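/- **Setting.** Let $X$ be a connected non-compact $C^\infty$ Riemannian manifold with Riemannian volume $m$, let $\mathbb R_+=(0,\infty)$ with Lebesgue measure $\lambda$, and let $q>0$ ($m\otimes\lambda$-a.e.) be a measurable function on $X\times\mathbb R_+$. Put $\tilde\sigma(dx,ds)=q(x,s)\,m(dx)\,\lambda(ds)$. Assume that $\tilde\sigma$ is infinite, that $\int_{K\times\mathbb R_+}\max\{1,s\}\,q\,dm\,d\lambda<\infty$ for every compact $K\subset X$, and that $\sqrt q$ belongs to the local Sobolev space $H_0^{1,2}(X\times\mathbb R_+)$, i.e. coincides on every $K\times\mathbb R_+$ ($K$ compact) with an element of the closure of $\mathfrak D$ (its elements of finite norm) in the norm $\|\varphi\|^2=\int(|\nabla^X\varphi|^2+s^2|\partial_s\varphi|^2+|\varphi|^2)\,dm\,d\lambda$. Here $\mathfrak D$ is the set of $C^\infty$ functions $\varphi$ on $X\times\mathbb R_+$, supported in $K\times\mathbb R_+$ for some compact $K$, bounded together with all derivatives, and with $|\partial_s^k\varphi(x,s)|\le C_{k,\varphi}\max\{1,s\}^{-k}$ for all $k$. Let $\Omega$ be the space of marked configurations: sets $\omega\subset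 X\times\mathbb R_+$ in which different points have different positions $x$, and whose positions form a locally finite subset of $X$. Write $\langle f,\omega\rangle=\sum_{(x,s)\in\omega}f(x,s)$, and let $\pi_{\tilde\sigma}$ be the marked Poisson measure on $\Omega$ with Lévy measure $\tilde\sigma$. The smooth cylinder functions are $F(\omega)=g(\langle\varphi_1,\omega\rangle,\dots,\langle\varphi_N,\omega\rangle)$ with $\varphi_j\in\mathfrak D$ and $g:\mathbb R^N\to\mathbb C$ smooth and bounded with all its derivatives; $\mathcal F$ is the set of these functions. Let $\mathfrak g=V_0(X)\times C_0^\infty(X)$ (compactly supported smooth vector fields and functions) with bracket $[(v_1,a_1),(v_2,a_2)]=([v_1,v_2],\nabla_{v_1}a_2-\nabla_{v_2}a_1)$. For $(v,a)\in\mathfrak g$ let $\psi^v_t$ be the flow of $v$ and $$(\nabla^\Omega_{(v,a)}F)(\omega)=\frac{d}{dt}F\big(\{(\psi_t^v(x),e^{ta(\psi_t^v(x))}s):(x,s)\in\omega\}\big)\Big|_{t=0}.$$ Let $B_{(v,a)}(\omega)=\langle\beta_{(v,a)},\omega\rangle$, where $\beta_{(v,a)}=\frac{\nabla_vq+a\,s\,\partial_sq}{q}+\operatorname{div}v+a$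 and the quotient means $2(\nabla_v\sqrt q+a\,s\,\partial_s\sqrt q)/\sqrt q$ with generalized derivatives. Define $$R(v,a)=\frac1i\nabla^\Omega_{(v,a)}+\frac1{2i}B_{(v,a)},\qquad J(v)=R(v,0),\qquad I(a)=R(0,a).$$ **Products.** Since $q$ is only Sobolev regular, $R(v,a)F$ with $F\in\mathcal F$ need not be a cylinder function, and products of the operators on $\mathcal F$ are taken by duality. For operators $A,B,C$ on $\mathcal F$, with $A,B$ symmetric, "$[A,B]=C$ on $\mathcal F$" means: for every $F\in\mathcal F$, $\langle BF,AG\rangle-\langle AF,BG\rangle=\langle CF,G\rangle$ in $L^2(\pi_{\tilde\sigma})$ for all $G\in\mathcal F$; and, whenever there are $U,V\in L^1(\pi_{\tilde\sigma})$ with $\int U\overline G\,d\pi_{\tilde\sigma}=\langle BF,AG\rangle$ and $\int V\overline G\,d\pi_{\tilde\sigma}=\langle AF,BG\rangle$ for all $G\in\mathcal F$ (that is, $U=ABF$ and $V=BAF$), one has $U-V=CF$ $\pi_{\tilde\sigma}$-a.e. **Proposition 3.4.** $\mathcal F\subset L^2(\pi_{\tilde\sigma})$. For each $(v,a)\in\mathfrak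 g$ and $F\in\mathcal F$, the derivative $\nabla^\Omega_{(v,a)}F$ exists everywhere on $\Omega$, $R(v,a)F\in L^2(\pi_{\tilde\sigma})$, $R(v,a)F$ depends up to null sets only on the class of $F$ in $L^2(\pi_{\tilde\sigma})$, and $R(v,a)$ is symmetric on $\mathcal F$. The map $(v,a)\mapsto R(v,a)$ is real linear on $\mathcal F$ ($\pi_{\tilde\sigma}$-a.e.). For all $(v_1,a_1),(v_2,a_2)\in\mathfrak g$, $([v_1,v_2],\nabla_{v_1}a_2-\nabla_{v_2}a_1)\in\mathfrak g$ and $$[R(v_1,a_1),R(v_2,a_2)]=-i\,R\big([v_1,v_2],\nabla_{v_1}a_2-\nabla_{v_2}a_1\big)\quad\text{on }\mathcal F,$$ so that the operators $iR(v,a)$ give a marked Poisson space representation of the Lie algebra $\mathfrak g$. If moreover $\beta_{(v_1,a_1)}$ and $\beta_{(v_2,a_2)}$ have versions that are $C^1$ on $X\times\mathbb R_+$ then, with these versions, for every $F\in\mathcal F$ the functions $R(v_2,a_2)F$ and $R(v_1,a_1)F$ are differentiable everywhere on $\Omega$ along $(v_1,a_1)$ and $(v_2,a_2)$ respectively, and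 the identity, with the products computed literally, holds $\pi_{\tilde\sigma}$-a.e. In particular, on $\mathcal F$, $$[J(v_1),J(v_2)]=-iJ([v_1,v_2]),\qquad[I(a_1),I(a_2)]=0,\qquad[J(v),I(a)]=-iI(\nabla_va).$$ -/

import Mathlib

open Set MeasureTheory Filter Topology
open scoped Manifold ContDiff ENNReal Bundle ComplexConjugate

noncomputable section

namespace MarkedPoisson

/-! ### Marked configurations with marks in `(0, ∞)`

Points of `X × (0, ∞)` are written as pairs `(x, s) : X × ℝ` with `0 < s`.  Functions on
`X × (0, ∞)` are functions on `X × ℝ` of which only the values at `s > 0` matter. -/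

section Configurations

variable {X : Type*} [TopologicalSpace X]

/-- `S ⊆ X × (0, ∞)` is a marked configuration: different points of `S` have different positions,
and the set of positions is locally finite. -/
def IsConfig (S : Set (X × ℝ)) : Prop :=
  (∀ p ∈ S, 0 < p.2) ∧ InjOn Prod.fst S ∧
    ∀ K : Set X, IsCompact K → {p ∈ S | p.1 ∈ K}.Finite

variable (X) in
/-- The marked configuration space. -/
def Config : Type _ := {S : Set (X × ℝ) // IsConfig S}

/-- The empty configuration. -/
def Config.empty : Config X :=
  ⟨∅, by simp [IsConfig]⟩

open Classical in
/-- A set of points regarded as a configuration (the empty one if it is not a configuration). -/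
def Config.ofSet (S : Set (X × ℝ)) : Config X :=
  if h : IsConfig S then ⟨S, h⟩ else Config.empty

/-- The restriction `γ ∩ (Λ × (0, ∞))`. -/
def Config.restrict (Λ : Set X) (γ : Config X) : Config X :=
  Config.ofSet {p ∈ γ.1 | p.1 ∈ Λ}

/-- The σ-algebra generated by the counting maps `γ ↦ #(γ ∩ B)`, where `B` is a Borel subset
of `K × (0, ∞)` for some compact `K`. -/
instance Config.measurableSpace [MeasurableSpace X] : MeasurableSpace (Config X) :=
  MeasurableSpace.generateFrom
    {A | ∃ (B : Set (X × ℝ)) (K : Set X) (k : ℕ), MeasurableSet B ∧ IsCompact K ∧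
      B ⊆ K ×ˢ Ioi (0 : ℝ) ∧ A = {γ : Config X | (γ.1 ∩ B).ncard = k}}

/-- `⟨f, γ⟩ = ∑_{(x, s) ∈ γ} f (x, s)`. -/
def pairing (f : X × ℝ → ℝ) (γ : Config X) : ℝ := ∑ᶠ p ∈ γ.1, f p

/-- The action `(x, s) ↦ (ψ x, θ (ψ x) s)` lifted to configurations. -/
def act (ψ : X → X) (θ : X → ℝ) (γ : Config X) : Config X :=
  Config.ofSet ((fun p : X × ℝ => (ψ p.1, θ (ψ p.1) * p.2)) '' γ.1)

/-- `μ` is the marked Poisson measure with Lévy measure `σ` on `X × (0, ∞)`: it is a probability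
measure, and for every relatively compact open `Λ` the image of `μ` under
`γ ↦ γ ∩ (Λ × (0, ∞))` is
`exp (-σ (Λ × (0, ∞))) ∑ₙ (1 / n!) σ^{⊗ n} ∘ ((z₁, …, zₙ) ↦ {z₁, …, zₙ})⁻¹`,
where `σ^{⊗ n}` lives on `(Λ × (0, ∞))ⁿ`. -/
structure IsMarkedPoisson [MeasurableSpace X] (σ : Measure (X × ℝ)) (μ : Measure (Config X)) :
    Prop where
  isProbability : IsProbabilityMeasure μ
  law : ∀ Λ : Set X, IsOpen Λ → IsCompact (closure Λ) →
    ∀ A : Set (Config X), MeasurableSet A →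
      μ {γ | γ.restrict Λ ∈ A} =
        ENNReal.ofReal (Real.exp (-(σ (Λ ×ˢ Ioi (0 : ℝ))).toReal)) *
          ∑' n : ℕ, ENNReal.ofReal (1 / (n.factorial : ℝ)) *
            (Measure.pi fun _ : Fin n => σ.restrict (Λ ×ˢ Ioi (0 : ℝ)))
              {z : Fin n → X × ℝ | Config.ofSet (range z) ∈ A}

end Configurations

/-! ### The Riemannian manifold -/

section Manifold

variable {n : ℕ} {X : Type*} [TopologicalSpace X] [ChartedSpace (EuclideanSpace ℝ (Fin n)) X]
  [IsManifold (𝓡 n) ∞ X]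

/-- The set `V₀(X)` of smooth compactly supported vector fields. -/
def IsField (v : (x : X) → TangentSpace (𝓡 n) x) : Prop :=
  ContMDiff (𝓡 n) (𝓡 n).tangent ∞
      (fun x => (⟨x, v x⟩ : TangentBundle (𝓡 n) X)) ∧
    IsCompact (closure {x | v x ≠ 0})

variable (n) in
/-- The set `C₀^∞(X)` of smooth compactly supported real functions. -/
def IsFun (a : X → ℝ) : Prop :=
  ContMDiff (𝓡 n) 𝓘(ℝ, ℝ) ∞ a ∧ HasCompactSupport a

/-- The derivative `∇_v f = df(v)` of a function along a vector field. -/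
def along (v : (x : X) → TangentSpace (𝓡 n) x) (f : X → ℝ) (x : X) : ℝ :=
  (mfderiv (𝓡 n) 𝓘(ℝ, ℝ) f x (v x) : ℝ)

open Classical in
/-- The flow `ψ_t(x)` of `v`: `d/dt ψ_t(x) = v(ψ_t(x))`, `ψ_0(x) = x`. -/
def flow (v : (x : X) → TangentSpace (𝓡 n) x) (t : ℝ) (x : X) : X :=
  if h : ∃ c : ℝ → X, c 0 = x ∧ IsMIntegralCurve c v then h.choose t else x

/-- The curve `t ↦ (ψ_t, θ_t) γ` with `ψ_t` the flow of `v` and `θ_t = exp (t a)`. -/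
def curve (v : (x : X) → TangentSpace (𝓡 n) x) (a : X → ℝ) (γ : Config X) (t : ℝ) : Config X :=
  act (flow v t) (fun x => Real.exp (t * a x)) γ

/-- The directional derivative `∇^Ω_{(v,a)} F (γ)`. -/
def dirDeriv (v : (x : X) → TangentSpace (𝓡 n) x) (a : X → ℝ) (F : Config X → ℂ)
    (γ : Config X) : ℂ :=
  deriv (fun t : ℝ => F (curve v a γ t)) 0

/-- `(1/i) ∇^Ω_{(v,a)} F + (1/(2i)) ⟨β, ·⟩ F`. -/
def opWith (β : X × ℝ → ℝ) (v : (x : X) → TangentSpace (𝓡 n) x) (a : X → ℝ)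
    (F : Config X → ℂ) (γ : Config X) : ℂ :=
  1 / Complex.I * dirDeriv v a F γ + 1 / (2 * Complex.I) * (pairing β γ : ℂ) * F γ

/-- The directional derivative on `X × (0, ∞)`:
`∇_{(v,a)} φ (x, s) = ∇_v φ (x, s) + s ∂_s φ (x, s) a (x)`. -/
def dirDerivXR (v : (x : X) → TangentSpace (𝓡 n) x) (a : X → ℝ) (φ : X × ℝ → ℝ)
    (p : X × ℝ) : ℝ :=
  along v (fun x => φ (x, p.2)) p.1 + p.2 * deriv (fun s => φ (p.1, s)) p.2 * a p.1

/-- `∇_{v₁} ⋯ ∇_{v_k} ∂_s^j φ` for a list `v₁, …, v_k` of vector fields. -/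
def iterDeriv (l : List ((x : X) → TangentSpace (𝓡 n) x)) (j : ℕ) (φ : X × ℝ → ℝ) :
    X × ℝ → ℝ :=
  l.foldr (fun v f p => along v (fun x => f (x, p.2)) p.1)
    (fun p => iteratedDeriv j (fun s => φ (p.1, s)) p.2)

variable (n) in
/-- The class `𝔇` of test functions: smooth on `X × (0, ∞)`, supported in `K × (0, ∞)` with `K`
compact, bounded with all derivatives, and
`|∂_s^j φ (x, s)| ≤ C_j (max {1, s})^{-j}` for all `j`. -/
structure IsTest (φ : X × ℝ → ℝ) : Prop where
  smooth : ContMDiffOn ((𝓡 n).prod 𝓘(ℝ, ℝ)) 𝓘(ℝ, ℝ) ∞ φ (univ ×ˢ Ioi (0 : ℝ))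
  support : ∃ K : Set X, IsCompact K ∧ ∀ x ∉ K, ∀ s : ℝ, 0 < s → φ (x, s) = 0
  bounded : ∀ l : List ((x : X) → TangentSpace (𝓡 n) x), (∀ v ∈ l, IsField v) → ∀ j : ℕ,
    ∃ C : ℝ, ∀ x : X, ∀ s : ℝ, 0 < s → |iterDeriv l j φ (x, s)| ≤ C
  decay : ∀ j : ℕ, ∃ C : ℝ, ∀ x : X, ∀ s : ℝ, 0 < s →
    |iteratedDeriv j (fun s => φ (x, s)) s| ≤ C * ((max 1 s) ^ j)⁻¹

variable (n) in
/-- The smooth cylinder functions `F(γ) = g(⟨φ₁, γ⟩, …, ⟨φ_N, γ⟩)`, `φ_j ∈ 𝔇`,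
`g ∈ C_b^∞(ℝ^N)`.  Complex values of `g` are allowed, since the operators act on complex
functions; real `g` give the real cylinder functions. -/
def IsCylinder (F : Config X → ℂ) : Prop :=
  ∃ (N : ℕ) (φ : Fin N → X × ℝ → ℝ) (g : (Fin N → ℝ) → ℂ),
    (∀ j, IsTest n (φ j)) ∧ ContDiff ℝ ∞ g ∧
    (∀ k : ℕ, ∃ C : ℝ, ∀ r, ‖iteratedFDeriv ℝ k g r‖ ≤ C) ∧
    ∀ γ, F γ = g fun j => pairing (φ j) γ

variable [Bundle.RiemannianBundle (fun x : X => TangentSpace (𝓡 n) x)]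

/-- The `i`-th coordinate vector field of the chart at `x₀`, at the point with coordinates `y`. -/
def coordVec (x₀ : X) (y : EuclideanSpace ℝ (Fin n)) (i : Fin n) :
    TangentSpace (𝓡 n) ((extChartAt (𝓡 n) x₀).symm y) :=
  mfderiv 𝓘(ℝ, EuclideanSpace ℝ (Fin n)) (𝓡 n) (extChartAt (𝓡 n) x₀).symm y
    (EuclideanSpace.single i (1 : ℝ))

/-- The density `√(det (g_ij))` of the Riemannian volume in the chart at `x₀`. -/
def volDensity (x₀ : X) (y : EuclideanSpace ℝ (Fin n)) : ℝ :=
  √(Matrix.det (Matrix.of fun i j : Fin n => inner ℝ (coordVec x₀ y i) (coordVec x₀ y j)))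

variable (n) in
/-- `m` is the Riemannian volume: in each chart it has the density `√(det (g_ij))` with respect to
Lebesgue measure. -/
def IsRiemannianVolume [MeasurableSpace X] (m : Measure X) : Prop :=
  ∀ (x₀ : X) (A : Set X), MeasurableSet A → A ⊆ (extChartAt (𝓡 n) x₀).source →
    m A = ∫⁻ y in extChartAt (𝓡 n) x₀ '' A, ENNReal.ofReal (volDensity x₀ y)

/-- The coordinates of the vector field `v` in the chart at `x₀`. -/
def coordField (x₀ : X) (v : (x : X) → TangentSpace (𝓡 n) x) (y : EuclideanSpace ℝ (Fin n)) :
    EuclideanSpace ℝ (Fin n) :=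
  mfderiv (𝓡 n) 𝓘(ℝ, EuclideanSpace ℝ (Fin n)) (extChartAt (𝓡 n) x₀)
    ((extChartAt (𝓡 n) x₀).symm y) (v ((extChartAt (𝓡 n) x₀).symm y))

/-- The Riemannian divergence: `div v = G^{-1} ∑_i ∂_i (G vⁱ)` with `G = √(det (g_ij))`, computed
at `x` in the chart at `x`. -/
def divergence (v : (x : X) → TangentSpace (𝓡 n) x) (x : X) : ℝ :=
  (volDensity x (extChartAt (𝓡 n) x x))⁻¹ *
    ∑ i : Fin n, fderiv ℝ (fun y => volDensity x y * coordField x v y i)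
      (extChartAt (𝓡 n) x x) (EuclideanSpace.single i (1 : ℝ))

/-! ### Sobolev functions and logarithmic derivatives -/

/-- The square `|∇^X φ|² + s² |∂_s φ|²` of the norm of the gradient on `X × (0, ∞)`; the norm of
`∇^X φ (x, s)` is the norm of the linear functional `d_x φ (x, s)` on the tangent space. -/
def gradSq (φ : X × ℝ → ℝ) (p : X × ℝ) : ℝ≥0∞ :=
  (⨆ (w : TangentSpace (𝓡 n) p.1) (_ : inner ℝ w w ≤ (1 : ℝ)),
      ENNReal.ofReal ((show ℝ from mfderiv (𝓡 n) 𝓘(ℝ, ℝ) (fun x => φ (x, p.2)) p.1 w) ^ 2)) +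
    ENNReal.ofReal (p.2 ^ 2 * deriv (fun s => φ (p.1, s)) p.2 ^ 2)

variable [MeasurableSpace X]

/-- The measure `m(dx) λ(ds)` on `X × (0, ∞)`. -/
def baseMeasure (m : Measure X) : Measure (X × ℝ) :=
  m.prod ((volume : Measure ℝ).restrict (Ioi 0))

/-- The Lévy measure `q(x, s) m(dx) λ(ds)`. -/
def levyMeasure (m : Measure X) (q : X × ℝ → ℝ) : Measure (X × ℝ) :=
  (baseMeasure m).withDensity fun p => ENNReal.ofReal (q p)

variable (n) in
/-- The Sobolev space `H^{1,2}(X × (0, ∞))`: the closure of `𝔇` (more precisely of its elements of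
finite norm) with respect to the norm
`‖φ‖² = ∫ (|∇^X φ|² + s² |∂_s φ|² + |φ|²) dm dλ`. -/
def IsSobolev (m : Measure X) (f : X × ℝ → ℝ) : Prop :=
  MemLp f 2 (baseMeasure m) ∧
  ∃ h : ℕ → X × ℝ → ℝ,
    (∀ k, IsTest n (h k) ∧ ∫⁻ p, gradSq (n := n) (h k) p ∂baseMeasure m < ⊤) ∧
    Tendsto (fun k => eLpNorm (fun p => h k p - f p) 2 (baseMeasure m)) atTop (𝓝 0) ∧
    Tendsto (fun kl : ℕ × ℕ =>
        ∫⁻ p, gradSq (n := n) (fun p => h kl.1 p - h kl.2 p) p ∂baseMeasure m)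
      atTop (𝓝 0)

variable (n) in
/-- The local Sobolev space `H_0^{1,2}(X × (0, ∞))`: functions that coincide on each
`K × (0, ∞)`, `K` compact, with a function in `H^{1,2}(X × (0, ∞))`. -/
def IsLocSobolev (m : Measure X) (f : X × ℝ → ℝ) : Prop :=
  ∀ K : Set X, IsCompact K → ∃ φ : X × ℝ → ℝ, IsSobolev n m φ ∧
    ∀ᵐ p ∂(baseMeasure m).restrict (K ×ˢ univ), f p = φ p

/-- `w` is the generalized derivative of `f` along `(v, a)`: on each `K × (0, ∞)`, `K` compact, it
is square integrable and is the `L²`-limit of `∇_{(v,a)} h_k` for some `h_k ∈ 𝔇` that converge to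
`f` there in `L²`.  Such a `w` is unique up to null sets. -/
def IsGenDeriv (m : Measure X) (v : (x : X) → TangentSpace (𝓡 n) x) (a : X → ℝ)
    (f w : X × ℝ → ℝ) : Prop :=
  ∀ K : Set X, IsCompact K →
    MemLp w 2 ((baseMeasure m).restrict (K ×ˢ univ)) ∧
    ∃ h : ℕ → X × ℝ → ℝ, (∀ k, IsTest n (h k)) ∧
      Tendsto (fun k => eLpNorm (fun p => h k p - f p) 2
        ((baseMeasure m).restrict (K ×ˢ univ))) atTop (𝓝 0) ∧
      Tendsto (fun k => eLpNorm (fun p => dirDerivXR v a (h k) p - w p) 2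
        ((baseMeasure m).restrict (K ×ˢ univ))) atTop (𝓝 0)

open Classical in
/-- A version of the generalized derivative of `f` along `(v, a)`. -/
def genDeriv (m : Measure X) (v : (x : X) → TangentSpace (𝓡 n) x) (a : X → ℝ)
    (f : X × ℝ → ℝ) : X × ℝ → ℝ :=
  if h : ∃ w, IsGenDeriv m v a f w then h.choose else 0

/-- The logarithmic derivative of the measure `q m(dx) λ(ds)` along `(v, a)`,
`β_{(v,a)} = (∇_v q) / q + div v + (s ∂_s q / q) a + a`.  Since only `√q` is assumed to be in the
local Sobolev space, `(∇_v q + a s ∂_s q) / q` is `2 (∇_{(v,a)} √q) / √q`.  It is defined up to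
null sets. -/
def logDeriv (m : Measure X) (q : X × ℝ → ℝ) (v : (x : X) → TangentSpace (𝓡 n) x) (a : X → ℝ)
    (p : X × ℝ) : ℝ :=
  2 * genDeriv m v a (fun p => √(q p)) p / √(q p) + divergence v p.1 + a p.1

/-! ### The operators -/

/-- The operator `R(v, a) = (1/i) ∇^Ω_{(v,a)} + (1/(2i)) B_{(v,a)}`, where
`B_{(v,a)}(γ) = ⟨β_{(v,a)}, γ⟩` is the logarithmic derivative of the marked Poisson measure. -/
def opR (m : Measure X) (q : X × ℝ → ℝ) (v : (x : X) → TangentSpace (𝓡 n) x) (a : X → ℝ) :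
    (Config X → ℂ) → Config X → ℂ :=
  opWith (logDeriv m q v a) v a

/-- `J(v) = (1/i) ∇^Ω_v + (1/(2i)) B_v`. -/
def opJ (m : Measure X) (q : X × ℝ → ℝ) (v : (x : X) → TangentSpace (𝓡 n) x) :
    (Config X → ℂ) → Config X → ℂ :=
  opR m q v 0

variable (n) in
/-- `I(a) = (1/i) ∇^Ω_a + (1/(2i)) B_a`. -/
def opI (m : Measure X) (q : X × ℝ → ℝ) (a : X → ℝ) : (Config X → ℂ) → Config X → ℂ :=
  opR (n := n) m q 0 a

end Manifold

/-- `[A, B] = C` on `D` in `L²(μ)`, for operators `A`, `B` that are symmetric on `D` and need not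
map `D` into `D`.  The products `A B F` and `B A F`, `F ∈ D`, are taken by duality:
`⟨A B F, G⟩ = ⟨B F, A G⟩` for `G ∈ D`.  The first clause is `[A, B] F = C F` as functionals on
`D`.  The second says that whenever the products `A B F` and `B A F` are (integrable) functions
`U` and `V`, then `U - V = C F` almost everywhere. -/
def CommutatorEq {Ω : Type*} [MeasurableSpace Ω] (μ : Measure Ω) (D : (Ω → ℂ) → Prop)
    (A B C : (Ω → ℂ) → Ω → ℂ) : Prop :=
  ∀ F, D F →
    (∀ G, D G →
      ∫ γ, B F γ * conj (A G γ) ∂μ - ∫ γ, A F γ * conj (B G γ) ∂μ = ∫ γ, C F γ * conj (G γ) ∂μ) ∧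
    ∀ U V : Ω → ℂ, Integrable U μ → Integrable V μ →
      (∀ G, D G → ∫ γ, U γ * conj (G γ) ∂μ = ∫ γ, B F γ * conj (A G γ) ∂μ) →
      (∀ G, D G → ∫ γ, V γ * conj (G γ) ∂μ = ∫ γ, A F γ * conj (B G γ) ∂μ) →
      (fun γ => U γ - V γ) =ᵐ[μ] C F

end MarkedPoisson

end

open Set MeasureTheory Filter Topology
open scoped Manifold ContDiff ENNReal Bundle ComplexConjugate
noncomputable section
namespace MarkedPoisson

set_option linter.unusedSectionVars false
set_option linter.unusedVariables false

/-! ### Vector fields and directional derivatives in coordinates -/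

section Coordinates

variable {n : ℕ} {X : Type*} [TopologicalSpace X] [ChartedSpace (EuclideanSpace ℝ (Fin n)) X]
  [IsManifold (𝓡 n) ∞ X]

/-! Everything rests on integration by parts. For one particle, with σ = q dm dλ, the formula is ∫
(∇_{(v,a)} ψ + β ψ) dσ = 0, where β is the logarithmic derivative along (v, a). Formally this is the
divergence theorem for the vector field (v, a s) on X × (0, ∞), whose divergence is div v + a,
applied to ψ q. Since only √q is a Sobolev function, the theorem is applied to ψ h_k² with test
functions h_k tending to √q, and the limit is taken (`GenLim.integral_eq_zero`). A cutoff in log s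
then removes the condition that ψ vanish for small and large marks
(`integral_dirDerivXR_add_of_cutoff`). The result is packaged in `exists_isWeakLogDeriv`.

Over a relatively compact open Λ the marked Poisson measure is a mixture of images of the powers
σ^{⊗k}, and a function of k points can be integrated by parts in each point separately. Summation
over the points gives ∫ (∇^Ω F + B F) dμ = 0 (`IsWeakLogDeriv.integral_cylDeriv_add_eq_zero`). For a
product F conj G this says that the formal adjoint of ∇^Ω is -∇^Ω - B, so (1/i)(∇^Ω + B/2) is
symmetric.

For the commutator, the fields (v_i, a_i s) have the Lie bracket ([v₁, v₂], s (∇_{v₁} a₂ - ∇_{v₂}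
a₁)), which gives the relation for derivatives of functions on X × (0, ∞) (`dirDerivXR_commutator`).
Symmetry of D²g lifts it to cylinder functions (`cylDeriv_commutator`). The product R₁ R₂ F would
contain a derivative of B₂, which may not exist. In ⟨R₂ F, R₁ G⟩ - ⟨R₁ F, R₂ G⟩ the B₁ B₂ terms
cancel, and what is left is a combination of five integrations by parts in which no β is
differentiated (`IsWeakLogDeriv.integral_opWith_commutator`). Four of them involve a cylinder
function of the ∇_{(v,a)} φ, whose own derivatives may grow like max {1, s}; the moment condition on
q is what makes these integrable.

Cylinder functions separate integrable functions, because they determine the σ-algebra of the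
configuration space (`ae_eq_zero_of_forall_integral_cylinder`). Thus the identity of forms becomes
an identity almost everywhere whenever the products are functions, and R(v, a) is well defined on
classes. If β₁ and β₂ have C¹ versions, then ∇₁ β₂ - ∇₂ β₁ satisfies the integration by parts
formula for the bracket and hence is its logarithmic derivative (`IsWeakLogDeriv.commutator_ae_eq`);
the products can then be multiplied out literally. -/

theorem contDiffOn_coordField {v : (x : X) → TangentSpace (𝓡 n) x}
    (hv : ContMDiff (𝓡 n) (𝓡 n).tangent ∞ (fun x => (⟨x, v x⟩ : TangentBundle (𝓡 n) X)))
    (x₀ : X) : ContDiffOn ℝ ∞ (coordField x₀ v) (extChartAt (𝓡 n) x₀).target := by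
  have h1 : ContMDiffOn (𝓡 n) 𝓘(ℝ, EuclideanSpace ℝ (Fin n)) ∞
      (fun x => (trivializationAt (EuclideanSpace ℝ (Fin n)) (TangentSpace (𝓡 n)) x₀ ⟨x, v x⟩).2)
      (chartAt (EuclideanSpace ℝ (Fin n)) x₀).source :=
    (Bundle.Trivialization.contMDiffOn_section_baseSet_iff _).1 hv.contMDiffOn
  rw [← contMDiffOn_iff_contDiffOn]
  have h2 := h1.comp (contMDiffOn_extChartAt_symm (I := 𝓡 n) (n := ∞) x₀) (fun y hy => by
    have := (extChartAt (𝓡 n) x₀).map_target hy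
    rwa [extChartAt_source] at this)
  refine h2.congr fun y hy => ?_
  have hs := (extChartAt (𝓡 n) x₀).map_target hy
  rw [extChartAt_source] at hs
  -- Over the chart domain the derivative of the chart is the trivialization of the tangent bundle,
  -- so the coordinates of `v` are the fibre component of a smooth section.
  have := TangentBundle.continuousLinearMapAt_trivializationAt (I := 𝓡 n) (𝕜 := ℝ) hs
  have e1 : (trivializationAt (EuclideanSpace ℝ (Fin n)) (TangentSpace (𝓡 n)) x₀).continuousLinearMapAt
      ℝ ((extChartAt (𝓡 n) x₀).symm y) (v ((extChartAt (𝓡 n) x₀).symm y)) =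
      (trivializationAt (EuclideanSpace ℝ (Fin n)) (TangentSpace (𝓡 n)) x₀
        ⟨_, v ((extChartAt (𝓡 n) x₀).symm y)⟩).2 := by
    rw [Bundle.Trivialization.continuousLinearMapAt_apply,
      Bundle.Trivialization.coe_linearMapAt_of_mem _ (by simpa using! hs)]
  exact (congrArg (fun L => L (v ((extChartAt (𝓡 n) x₀).symm y))) this).symm.trans e1

theorem coordField_extChartAt (v : (x : X) → TangentSpace (𝓡 n) x) {x₀ x : X}
    (hx : x ∈ (extChartAt (𝓡 n) x₀).source) :
    coordField x₀ v (extChartAt (𝓡 n) x₀ x) =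
      mfderiv (𝓡 n) 𝓘(ℝ, EuclideanSpace ℝ (Fin n)) (extChartAt (𝓡 n) x₀) x (v x) := by
  have : ∀ z, z = x → (mfderiv (𝓡 n) 𝓘(ℝ, EuclideanSpace ℝ (Fin n)) (extChartAt (𝓡 n) x₀) z (v z) :
      EuclideanSpace ℝ (Fin n)) =
      mfderiv (𝓡 n) 𝓘(ℝ, EuclideanSpace ℝ (Fin n)) (extChartAt (𝓡 n) x₀) x (v x) := by
    rintro z rfl; rfl
  exact this _ ((extChartAt (𝓡 n) x₀).left_inv hx)

theorem along_eq_fderiv (v : (x : X) → TangentSpace (𝓡 n) x) {f : X → ℝ} {x₀ x : X}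
    (hx : x ∈ (extChartAt (𝓡 n) x₀).source)
    (hf : DifferentiableAt ℝ (f ∘ (extChartAt (𝓡 n) x₀).symm) (extChartAt (𝓡 n) x₀ x)) :
    along v f x = fderiv ℝ (f ∘ (extChartAt (𝓡 n) x₀).symm) (extChartAt (𝓡 n) x₀ x)
      (coordField x₀ v (extChartAt (𝓡 n) x₀ x)) := by
  have h1 : MDifferentiableAt (𝓡 n) 𝓘(ℝ, EuclideanSpace ℝ (Fin n)) (extChartAt (𝓡 n) x₀) x :=
    mdifferentiableAt_extChartAt (by rwa [extChartAt_source] at hx)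
  have h2 : f =ᶠ[𝓝 x] (f ∘ (extChartAt (𝓡 n) x₀).symm) ∘ extChartAt (𝓡 n) x₀ := by
    filter_upwards [extChartAt_source_mem_nhds' (I := 𝓡 n) hx] with y hy
    rw [Function.comp_apply, Function.comp_apply, (extChartAt (𝓡 n) x₀).left_inv hy]
  have h3 := mfderiv_comp x hf.mdifferentiableAt h1
  rw [along, h2.mfderiv_eq, h3, mfderiv_eq_fderiv, coordField_extChartAt v hx]
  rfl

/-- The expression of a function on `X × ℝ` in the chart of `X` at `x₀`. -/
def locRep (x₀ : X) (φ : X × ℝ → ℝ) (p : EuclideanSpace ℝ (Fin n) × ℝ) : ℝ :=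
  φ ((extChartAt (𝓡 n) x₀).symm p.1, p.2)

variable (n) in
/-- `φ` is of class `C^k` on `X × (0, ∞)`. -/
abbrev Smooth (k : WithTop ℕ∞) (φ : X × ℝ → ℝ) : Prop :=
  ContMDiffOn ((𝓡 n).prod 𝓘(ℝ, ℝ)) 𝓘(ℝ, ℝ) k φ (univ ×ˢ Ioi (0 : ℝ))

theorem contDiffOn_locRep {k : WithTop ℕ∞} (hk : k ≤ (∞ : WithTop ℕ∞)) {φ : X × ℝ → ℝ} (hφ : Smooth n k φ)
    (x₀ : X) : ContDiffOn ℝ k (locRep x₀ φ) ((extChartAt (𝓡 n) x₀).target ×ˢ Ioi (0 : ℝ)) := by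
  rw [← contMDiffOn_iff_contDiffOn]
  refine ContMDiffOn.comp (t := univ ×ˢ Ioi (0 : ℝ)) (I' := (𝓡 n).prod 𝓘(ℝ, ℝ))
    (f := fun p : EuclideanSpace ℝ (Fin n) × ℝ => ((extChartAt (𝓡 n) x₀).symm p.1, p.2)) hφ ?_ ?_
  · refine ContMDiffOn.prodMk ?_ contDiff_snd.contMDiff.contMDiffOn
    exact ((contMDiffOn_extChartAt_symm (I := 𝓡 n) (n := ∞) x₀).of_le hk).comp
      contDiff_fst.contMDiff.contMDiffOn (fun p hp => hp.1)
  · intro p hp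
    exact ⟨mem_univ _, hp.2⟩

theorem contMDiffOn_comp_extChartAt {k : WithTop ℕ∞} (hk : k ≤ (∞ : WithTop ℕ∞))
    {x₀ : X} {h : EuclideanSpace ℝ (Fin n) × ℝ → ℝ}
    (hh : ContDiffOn ℝ k h ((extChartAt (𝓡 n) x₀).target ×ˢ Ioi (0 : ℝ))) :
    ContMDiffOn ((𝓡 n).prod 𝓘(ℝ, ℝ)) 𝓘(ℝ, ℝ) k (fun p : X × ℝ => h (extChartAt (𝓡 n) x₀ p.1, p.2))
      ((extChartAt (𝓡 n) x₀).source ×ˢ Ioi (0 : ℝ)) := by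
  refine hh.contMDiffOn.comp (f := fun p : X × ℝ => (extChartAt (𝓡 n) x₀ p.1, p.2)) ?_ ?_
  · refine ContMDiffOn.prodMk_space ?_ contMDiff_snd.contMDiffOn
    refine ((contMDiffOn_extChartAt (I := 𝓡 n) (n := ∞) (x := x₀)).of_le hk).comp
      contMDiff_fst.contMDiffOn (fun p hp => ?_)
    simpa [extChartAt_source] using hp.1
  · intro p hp
    exact ⟨(extChartAt (𝓡 n) x₀).map_source hp.1, hp.2⟩

theorem isOpen_target_prod (x₀ : X) :
    IsOpen ((extChartAt (𝓡 n) x₀).target ×ˢ Ioi (0 : ℝ)) :=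
  (isOpen_extChartAt_target x₀).prod isOpen_Ioi

theorem differentiableAt_locRep {φ : X × ℝ → ℝ} (hφ : Smooth n 1 φ) {x₀ x : X} {s : ℝ}
    (hx : x ∈ (extChartAt (𝓡 n) x₀).source) (hs : 0 < s) :
    DifferentiableAt ℝ (locRep x₀ φ) (extChartAt (𝓡 n) x₀ x, s) :=
  ((contDiffOn_locRep (k := 1) (by exact_mod_cast le_top) hφ x₀).differentiableOn one_ne_zero).differentiableAt
    ((isOpen_target_prod x₀).mem_nhds ⟨(extChartAt (𝓡 n) x₀).map_source hx, hs⟩)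

theorem along_slice {φ : X × ℝ → ℝ} (hφ : Smooth n 1 φ) (v : (x : X) → TangentSpace (𝓡 n) x)
    {x₀ x : X} {s : ℝ} (hx : x ∈ (extChartAt (𝓡 n) x₀).source) (hs : 0 < s) :
    along v (fun x => φ (x, s)) x = fderiv ℝ (locRep x₀ φ) (extChartAt (𝓡 n) x₀ x, s)
      (coordField x₀ v (extChartAt (𝓡 n) x₀ x), 0) := by
  have hd := (differentiableAt_locRep hφ hx hs).hasFDerivAt
  have h1 : HasFDerivAt ((fun x => φ (x, s)) ∘ (extChartAt (𝓡 n) x₀).symm)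
      ((fderiv ℝ (locRep x₀ φ) (extChartAt (𝓡 n) x₀ x, s)).comp
        (ContinuousLinearMap.inl ℝ (EuclideanSpace ℝ (Fin n)) ℝ)) (extChartAt (𝓡 n) x₀ x) :=
    hd.comp (f := fun y : EuclideanSpace ℝ (Fin n) => (y, s)) (extChartAt (𝓡 n) x₀ x)
      (hasFDerivAt_prodMk_left (extChartAt (𝓡 n) x₀ x) s)
  rw [along_eq_fderiv v hx h1.differentiableAt, h1.fderiv]
  simp

theorem hasDerivAt_slice {φ : X × ℝ → ℝ} (hφ : Smooth n 1 φ) {x₀ x : X} {s : ℝ}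
    (hx : x ∈ (extChartAt (𝓡 n) x₀).source) (hs : 0 < s) :
    HasDerivAt (fun s => φ (x, s))
      (fderiv ℝ (locRep x₀ φ) (extChartAt (𝓡 n) x₀ x, s) (0, 1)) s := by
  have hd := (differentiableAt_locRep hφ hx hs).hasFDerivAt
  have h1 := hd.comp_hasDerivAt (x := s) (f := fun s => (extChartAt (𝓡 n) x₀ x, s))
    ((hasDerivAt_const s (extChartAt (𝓡 n) x₀ x)).prodMk (hasDerivAt_id s))
  refine h1.congr_of_eventuallyEq (Eventually.of_forall fun t => ?_)
  simp only [Function.comp, locRep, (extChartAt (𝓡 n) x₀).left_inv hx]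

/-- The vector field `(v, a s)` on `X × ℝ` in coordinates. -/
def dirVec (x₀ : X) (v : (x : X) → TangentSpace (𝓡 n) x) (a : X → ℝ)
    (p : EuclideanSpace ℝ (Fin n) × ℝ) : EuclideanSpace ℝ (Fin n) × ℝ :=
  (coordField x₀ v p.1, a ((extChartAt (𝓡 n) x₀).symm p.1) * p.2)

/-- In a chart the two partial derivatives merge into one Fréchet derivative along the field
`dirVec` on an open set of ℝⁿ × ℝ. The sum, product and chain rules, the loss of one derivative and
the commutator are all read off from this form. -/
theorem dirDerivXR_eq_fderiv {φ : X × ℝ → ℝ} (hφ : Smooth n 1 φ)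
    (v : (x : X) → TangentSpace (𝓡 n) x) (a : X → ℝ)
    {x₀ x : X} {s : ℝ} (hx : x ∈ (extChartAt (𝓡 n) x₀).source) (hs : 0 < s) :
    dirDerivXR v a φ (x, s) = fderiv ℝ (locRep x₀ φ) (extChartAt (𝓡 n) x₀ x, s)
      (dirVec x₀ v a (extChartAt (𝓡 n) x₀ x, s)) := by
  have h3 : dirVec x₀ v a (extChartAt (𝓡 n) x₀ x, s) =
      (coordField x₀ v (extChartAt (𝓡 n) x₀ x), 0) + (s * a x) • ((0 : EuclideanSpace ℝ (Fin n)), (1:ℝ)) := by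
    ext <;> simp [dirVec, (extChartAt (𝓡 n) x₀).left_inv hx, -extChartAt, mul_comm]
  rw [dirDerivXR, along_slice hφ v hx hs, (hasDerivAt_slice hφ hx hs).deriv, h3, map_add, map_smul,
    smul_eq_mul]
  ring

theorem contDiffOn_comp_extChartAt_symm {a : X → ℝ} (ha : ContMDiff (𝓡 n) 𝓘(ℝ, ℝ) ∞ a) (x₀ : X) :
    ContDiffOn ℝ ∞ (a ∘ (extChartAt (𝓡 n) x₀).symm) (extChartAt (𝓡 n) x₀).target := by
  rw [← contMDiffOn_iff_contDiffOn]
  exact ha.comp_contMDiffOn (contMDiffOn_extChartAt_symm (I := 𝓡 n) (n := ∞) x₀)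

theorem contDiffOn_dirVec {v : (x : X) → TangentSpace (𝓡 n) x} {a : X → ℝ}
    (hv : ContMDiff (𝓡 n) (𝓡 n).tangent ∞ (fun x => (⟨x, v x⟩ : TangentBundle (𝓡 n) X)))
    (ha : ContMDiff (𝓡 n) 𝓘(ℝ, ℝ) ∞ a) (x₀ : X) :
    ContDiffOn ℝ ∞ (dirVec x₀ v a) ((extChartAt (𝓡 n) x₀).target ×ˢ Ioi (0 : ℝ)) := by
  refine ContDiffOn.prodMk ?_ (ContDiffOn.mul ?_ contDiff_snd.contDiffOn)
  · exact (contDiffOn_coordField hv x₀).comp contDiff_fst.contDiffOn fun p hp => hp.1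
  · exact (contDiffOn_comp_extChartAt_symm ha x₀).comp contDiff_fst.contDiffOn fun p hp => hp.1

theorem locRep_dirDerivXR {φ : X × ℝ → ℝ} (hφ : Smooth n 1 φ)
    (v : (x : X) → TangentSpace (𝓡 n) x) (a : X → ℝ) (x₀ : X) :
    EqOn (locRep x₀ (dirDerivXR v a φ))
      (fun p => fderiv ℝ (locRep x₀ φ) p (dirVec x₀ v a p))
      ((extChartAt (𝓡 n) x₀).target ×ˢ Ioi (0 : ℝ)) := by
  rintro ⟨y, s⟩ ⟨hy, hs⟩
  have := dirDerivXR_eq_fderiv hφ v a ((extChartAt (𝓡 n) x₀).map_target hy) hs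
  rwa [(extChartAt (𝓡 n) x₀).right_inv hy] at this

theorem Smooth.of_locRep {k : WithTop ℕ∞} (hk : k ≤ (∞ : WithTop ℕ∞)) {φ : X × ℝ → ℝ}
    (h : ∀ x₀ : X, ContDiffOn ℝ k (locRep x₀ φ) ((extChartAt (𝓡 n) x₀).target ×ˢ Ioi (0 : ℝ))) :
    Smooth n k φ := by
  rintro ⟨x₀, s⟩ ⟨-, hs⟩
  have h1 := contMDiffOn_comp_extChartAt hk (h x₀)
  have hx := mem_extChartAt_source (I := 𝓡 n) x₀
  have hn : (extChartAt (𝓡 n) x₀).source ×ˢ Ioi (0 : ℝ) ∈ 𝓝 (x₀, s) :=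
    ((isOpen_extChartAt_source x₀).prod isOpen_Ioi).mem_nhds ⟨hx, hs⟩
  refine ((h1.contMDiffAt hn).congr_of_eventuallyEq ?_).contMDiffWithinAt
  filter_upwards [hn] with p hp
  simp only [locRep, (extChartAt (𝓡 n) x₀).left_inv hp.1]

theorem Smooth.dirDerivXR {k m : WithTop ℕ∞} (hm : m ≤ (∞ : WithTop ℕ∞)) (hkm : k + 1 ≤ m) {φ : X × ℝ → ℝ}
    (hφ : Smooth n m φ) {v : (x : X) → TangentSpace (𝓡 n) x} {a : X → ℝ}
    (hv : ContMDiff (𝓡 n) (𝓡 n).tangent ∞ (fun x => (⟨x, v x⟩ : TangentBundle (𝓡 n) X)))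
    (ha : ContMDiff (𝓡 n) 𝓘(ℝ, ℝ) ∞ a) :
    Smooth n k (dirDerivXR v a φ) := by
  have hk : k ≤ (∞ : WithTop ℕ∞) := (le_self_add.trans hkm).trans hm
  refine Smooth.of_locRep hk fun x₀ => ?_
  refine ContDiffOn.congr ?_ (locRep_dirDerivXR (hφ.of_le (le_add_self.trans hkm)) v a x₀)
  exact ((contDiffOn_locRep hm hφ x₀).fderiv_of_isOpen (isOpen_target_prod x₀) hkm).clm_apply
    ((contDiffOn_dirVec hv ha x₀).of_le hk)

theorem dirDerivXR_comp {ι : Type*} [Fintype ι] {φ : ι → X × ℝ → ℝ} (hφ : ∀ j, Smooth n 1 (φ j))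
    (v : (x : X) → TangentSpace (𝓡 n) x) (a : X → ℝ) {g : (ι → ℝ) → ℝ} {p : X × ℝ}
    (hp : 0 < p.2) (hg : DifferentiableAt ℝ g (fun j => φ j p))
    (hgs : Smooth n 1 (fun p : X × ℝ => g fun j => φ j p)) :
    dirDerivXR v a (fun p => g fun j => φ j p) p =
      fderiv ℝ g (fun j => φ j p) (fun j => dirDerivXR v a (φ j) p) := by
  obtain ⟨x, s⟩ := p
  have hx := mem_extChartAt_source (I := 𝓡 n) x
  rw [dirDerivXR_eq_fderiv (n := n) hgs v a hx hp]
  have h1 : HasFDerivAt (fun (q : EuclideanSpace ℝ (Fin n) × ℝ) j => locRep x (φ j) q) _ (extChartAt (𝓡 n) x x, s) :=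
    hasFDerivAt_pi.2 fun j => (differentiableAt_locRep (hφ j) hx hp).hasFDerivAt
  have e : (fun j => locRep x (φ j) (extChartAt (𝓡 n) x x, s)) = fun j => φ j (x, s) := by
    ext j; simp only [locRep, (extChartAt (𝓡 n) x).left_inv hx]
  have h2 := (e.symm ▸ hg : DifferentiableAt ℝ g
    (fun j => locRep x (φ j) (extChartAt (𝓡 n) x x, s))).hasFDerivAt.comp _ h1
  have h3 : (locRep x fun p => g fun j => φ j p) = g ∘ fun (q : EuclideanSpace ℝ (Fin n) × ℝ) j => locRep x (φ j) q := rfl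
  rw [h3, h2.fderiv, e]
  simp only [ContinuousLinearMap.comp_apply]
  congr 1
  ext j
  simp [dirDerivXR_eq_fderiv (hφ j) v a hx hp]

theorem dirDerivXR_add {φ ψ : X × ℝ → ℝ} (hφ : Smooth n 1 φ) (hψ : Smooth n 1 ψ)
    (v : (x : X) → TangentSpace (𝓡 n) x) (a : X → ℝ) {p : X × ℝ} (hp : 0 < p.2) :
    dirDerivXR v a (fun p => φ p + ψ p) p = dirDerivXR v a φ p + dirDerivXR v a ψ p := by
  obtain ⟨x, s⟩ := p
  have hx := mem_extChartAt_source (I := 𝓡 n) x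
  rw [dirDerivXR_eq_fderiv (φ := fun p => φ p + ψ p) (hφ.add hψ) v a hx hp, dirDerivXR_eq_fderiv hφ v a hx hp,
    dirDerivXR_eq_fderiv hψ v a hx hp]
  have := fderiv_add (differentiableAt_locRep hφ hx hp) (differentiableAt_locRep hψ hx hp)
  exact congrArg (fun L => L (dirVec x v a (extChartAt (𝓡 n) x x, s))) this

theorem dirDerivXR_sub {φ ψ : X × ℝ → ℝ} (hφ : Smooth n 1 φ) (hψ : Smooth n 1 ψ)
    (v : (x : X) → TangentSpace (𝓡 n) x) (a : X → ℝ) {p : X × ℝ} (hp : 0 < p.2) :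
    dirDerivXR v a (fun p => φ p - ψ p) p = dirDerivXR v a φ p - dirDerivXR v a ψ p := by
  obtain ⟨x, s⟩ := p
  have hx := mem_extChartAt_source (I := 𝓡 n) x
  rw [dirDerivXR_eq_fderiv (φ := fun p => φ p - ψ p) (hφ.sub hψ) v a hx hp, dirDerivXR_eq_fderiv hφ v a hx hp,
    dirDerivXR_eq_fderiv hψ v a hx hp]
  have := fderiv_sub (differentiableAt_locRep hφ hx hp) (differentiableAt_locRep hψ hx hp)
  exact congrArg (fun L => L (dirVec x v a (extChartAt (𝓡 n) x x, s))) this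

theorem dirDerivXR_mul {φ ψ : X × ℝ → ℝ} (hφ : Smooth n 1 φ) (hψ : Smooth n 1 ψ)
    (v : (x : X) → TangentSpace (𝓡 n) x) (a : X → ℝ) {p : X × ℝ} (hp : 0 < p.2) :
    dirDerivXR v a (fun p => φ p * ψ p) p =
      dirDerivXR v a φ p * ψ p + φ p * dirDerivXR v a ψ p := by
  obtain ⟨x, s⟩ := p
  have hx := mem_extChartAt_source (I := 𝓡 n) x
  rw [dirDerivXR_eq_fderiv (φ := fun p => φ p * ψ p) (hφ.mul hψ) v a hx hp, dirDerivXR_eq_fderiv hφ v a hx hp,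
    dirDerivXR_eq_fderiv hψ v a hx hp]
  have := fderiv_mul (differentiableAt_locRep hφ hx hp) (differentiableAt_locRep hψ hx hp)
  refine (congrArg (fun L => L (dirVec x v a (extChartAt (𝓡 n) x x, s))) this).trans ?_
  have e : ∀ f : X × ℝ → ℝ, locRep x f (extChartAt (𝓡 n) x x, s) = f (x, s) := fun f => by
    simp only [locRep, (extChartAt (𝓡 n) x).left_inv hx]
  simp only [add_apply, smul_apply, smul_eq_mul, e]
  ring

theorem dirDerivXR_smul_add_smul (c₁ c₂ : ℝ) (v₁ v₂ : (x : X) → TangentSpace (𝓡 n) x)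
    (a₁ a₂ : X → ℝ) (φ : X × ℝ → ℝ) (p : X × ℝ) :
    dirDerivXR (fun x => c₁ • v₁ x + c₂ • v₂ x) (fun x => c₁ * a₁ x + c₂ * a₂ x) φ p =
      c₁ * dirDerivXR v₁ a₁ φ p + c₂ * dirDerivXR v₂ a₂ φ p := by
  have e : ∀ L : TangentSpace (𝓡 n) p.1 →L[ℝ] ℝ,
      L (c₁ • v₁ p.1 + c₂ • v₂ p.1) = c₁ * L (v₁ p.1) + c₂ * L (v₂ p.1) := fun L => by
    rw [map_add, map_smul, map_smul, smul_eq_mul, smul_eq_mul]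
  have e' := e (mfderiv (𝓡 n) 𝓘(ℝ, ℝ) (fun x => φ (x, p.2)) p.1)
  have e2 : along (fun x => c₁ • v₁ x + c₂ • v₂ x) (fun x => φ (x, p.2)) p.1 =
    c₁ * along v₁ (fun x => φ (x, p.2)) p.1 + c₂ * along v₂ (fun x => φ (x, p.2)) p.1 := e'
  rw [dirDerivXR, e2, dirDerivXR, dirDerivXR]
  ring

end Coordinates

/-! ### The Lie algebra of pairs `(v, a)` -/

section Bracket

theorem two_le_infty : (2 : WithTop ℕ∞) ≤ (∞ : WithTop ℕ∞) :=
  WithTop.coe_le_coe.2 (le_top : (2 : ℕ∞) ≤ ⊤)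

variable {n : ℕ} {X : Type*} [TopologicalSpace X] [ChartedSpace (EuclideanSpace ℝ (Fin n)) X]
  [IsManifold (𝓡 n) ∞ X]

/-- The Lie bracket on a manifold is defined by pulling the fields back along the inverse chart;
this identifies the pulled-back field with the coordinate expression used here. -/
theorem mpullbackWithin_extChartAt_symm (v : (x : X) → TangentSpace (𝓡 n) x) {x₀ : X}
    {y : EuclideanSpace ℝ (Fin n)} (hy : y ∈ (extChartAt (𝓡 n) x₀).target) :
    VectorField.mpullbackWithin 𝓘(ℝ, EuclideanSpace ℝ (Fin n)) (𝓡 n) (extChartAt (𝓡 n) x₀).symm v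
      (range (𝓡 n)) y = coordField x₀ v y := by
  have h1 := isInvertible_mfderivWithin_extChartAt_symm (I := 𝓡 n) hy
  have h2 := mfderiv_extChartAt_comp_mfderivWithin_extChartAt_symm (I := 𝓡 n) hy
  rw [VectorField.mpullbackWithin_apply]
  obtain ⟨w, hw⟩ := h1.surjective (v ((extChartAt (𝓡 n) x₀).symm y))
  have h3 : coordField x₀ v y = w := by
    have := congrArg (fun L => L w) h2
    rw [coordField, ← hw]
    exact this
  rw [← hw, h3]
  exact h1.inverse_apply_self w

/-- Stated only at the centre of the chart, because the bracket at `x` is defined through the chart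
at `x`. One point per chart suffices for a pointwise commutator. -/
theorem coordField_mlieBracket (v₁ v₂ : (x : X) → TangentSpace (𝓡 n) x) (x : X) :
    coordField x (VectorField.mlieBracket (𝓡 n) v₁ v₂) (extChartAt (𝓡 n) x x) =
      VectorField.lieBracket ℝ (coordField x v₁) (coordField x v₂) (extChartAt (𝓡 n) x x) := by
  have hx := mem_extChartAt_source (I := 𝓡 n) x
  rw [coordField_extChartAt _ hx, ← VectorField.mlieBracketWithin_univ,
    VectorField.mlieBracketWithin_apply]
  have h1 := isInvertible_mfderiv_extChartAt (I := 𝓡 n) hx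
  refine (h1.self_apply_inverse _).trans ?_
  have hr : ((extChartAt (𝓡 n) x).symm ⁻¹' univ ∩ range (𝓡 n) : Set (EuclideanSpace ℝ (Fin n))) =
    univ := by simp
  have hl : ∀ V W : EuclideanSpace ℝ (Fin n) → EuclideanSpace ℝ (Fin n),
      VectorField.lieBracketWithin ℝ V W ((extChartAt (𝓡 n) x).symm ⁻¹' univ ∩ range (𝓡 n))
        (extChartAt (𝓡 n) x x) = VectorField.lieBracket ℝ V W (extChartAt (𝓡 n) x x) := by
    intro V W
    rw [hr, VectorField.lieBracketWithin_univ]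
  refine (hl _ _).trans ?_
  have ht := extChartAt_target_mem_nhds (I := 𝓡 n) x
  exact Filter.EventuallyEq.lieBracket_vectorField_eq
    (Filter.mem_of_superset ht fun y hy => mpullbackWithin_extChartAt_symm v₁ hy)
    (Filter.mem_of_superset ht fun y hy => mpullbackWithin_extChartAt_symm v₂ hy)

theorem along_eq_fderiv_of_contMDiff (v : (x : X) → TangentSpace (𝓡 n) x) {a : X → ℝ}
    (ha : ContMDiff (𝓡 n) 𝓘(ℝ, ℝ) ∞ a) {x₀ x : X} (hx : x ∈ (extChartAt (𝓡 n) x₀).source) :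
    along v a x = fderiv ℝ (a ∘ (extChartAt (𝓡 n) x₀).symm) (extChartAt (𝓡 n) x₀ x)
      (coordField x₀ v (extChartAt (𝓡 n) x₀ x)) :=
  along_eq_fderiv v hx <| ((contDiffOn_comp_extChartAt_symm ha x₀).differentiableOn
    (by simp)).differentiableAt ((isOpen_extChartAt_target x₀).mem_nhds
      ((extChartAt (𝓡 n) x₀).map_source hx))

/-- In coordinates both iterated derivatives contain the second derivative of φ, and its symmetry
cancels it. The remaining first-order vector is the Lie bracket of the fields (v₁, a₁ s) and (v₂, a₂
s). -/
theorem dirDerivXR_commutator {φ : X × ℝ → ℝ} (hφ : Smooth n 2 φ)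
    {v₁ v₂ : (x : X) → TangentSpace (𝓡 n) x} {a₁ a₂ : X → ℝ}
    (hv₁ : ContMDiff (𝓡 n) (𝓡 n).tangent ∞ (fun x => (⟨x, v₁ x⟩ : TangentBundle (𝓡 n) X)))
    (ha₁ : ContMDiff (𝓡 n) 𝓘(ℝ, ℝ) ∞ a₁)
    (hv₂ : ContMDiff (𝓡 n) (𝓡 n).tangent ∞ (fun x => (⟨x, v₂ x⟩ : TangentBundle (𝓡 n) X)))
    (ha₂ : ContMDiff (𝓡 n) 𝓘(ℝ, ℝ) ∞ a₂) {p : X × ℝ} (hp : 0 < p.2) :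
    dirDerivXR v₁ a₁ (dirDerivXR v₂ a₂ φ) p - dirDerivXR v₂ a₂ (dirDerivXR v₁ a₁ φ) p =
      dirDerivXR (VectorField.mlieBracket (𝓡 n) v₁ v₂)
        (fun x => along v₁ a₂ x - along v₂ a₁ x) φ p := by
  obtain ⟨x, s⟩ := p
  replace hp : 0 < s := hp
  have h2 : (2 : WithTop ℕ∞) ≤ (∞ : WithTop ℕ∞) := two_le_infty
  have h12 : (1 : WithTop ℕ∞) + 1 ≤ 2 := by norm_num
  have hφ1 : Smooth n 1 φ := hφ.of_le (by norm_num)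
  have hx := mem_extChartAt_source (I := 𝓡 n) x
  set q : EuclideanSpace ℝ (Fin n) × ℝ := (extChartAt (𝓡 n) x x, s) with hq
  have hO := (isOpen_target_prod (n := n) x).mem_nhds
    (show q ∈ _ from ⟨(extChartAt (𝓡 n) x).map_source hx, hp⟩)
  have hT := (isOpen_extChartAt_target (I := 𝓡 n) x).mem_nhds ((extChartAt (𝓡 n) x).map_source hx)
  have hf : ContDiffAt ℝ 2 (locRep x φ) q := (contDiffOn_locRep h2 hφ x).contDiffAt hO
  have hsym : IsSymmSndFDerivAt ℝ (locRep x φ) q := hf.isSymmSndFDerivAt (by simp)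
  have hdf : DifferentiableAt ℝ (fderiv ℝ (locRep x φ)) q :=
    (hf.fderiv_right (m := 1) (by norm_num)).differentiableAt one_ne_zero
  -- This is D(Df · W) · U = D²f(U, W) + Df(DW · U) for U = (u, b s) and W = (w, c s); the last
  -- component is the derivative of c(x) s along U.
  have key : ∀ (u w : (x : X) → TangentSpace (𝓡 n) x) (b c : X → ℝ),
      ContMDiff (𝓡 n) (𝓡 n).tangent ∞ (fun x => (⟨x, u x⟩ : TangentBundle (𝓡 n) X)) →
      ContMDiff (𝓡 n) 𝓘(ℝ, ℝ) ∞ b →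
      ContMDiff (𝓡 n) (𝓡 n).tangent ∞ (fun x => (⟨x, w x⟩ : TangentBundle (𝓡 n) X)) →
      ContMDiff (𝓡 n) 𝓘(ℝ, ℝ) ∞ c →
      dirDerivXR u b (dirDerivXR w c φ) (x, s) =
        fderiv ℝ (fderiv ℝ (locRep x φ)) q (dirVec x u b q) (dirVec x w c q) +
        fderiv ℝ (locRep x φ) q
          (fderiv ℝ (coordField x w) q.1 (coordField x u q.1),
            along u c x * s + c x * (b x * s)) := by
    intro u w b c hu hb hw hc
    rw [dirDerivXR_eq_fderiv (hφ.dirDerivXR h2 h12 hw hc) u b hx hp,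
      ((locRep_dirDerivXR hφ1 w c x).eventuallyEq_of_mem hO).fderiv_eq]
    have hcf : DifferentiableAt ℝ (coordField x w) q.1 :=
      ((contDiffOn_coordField hw x).contDiffAt hT).differentiableAt (by simp)
    have hcc : DifferentiableAt ℝ (c ∘ (extChartAt (𝓡 n) x).symm) q.1 :=
      ((contDiffOn_comp_extChartAt_symm hc x).contDiffAt hT).differentiableAt (by simp)
    have hW1 : HasFDerivAt (fun p : EuclideanSpace ℝ (Fin n) × ℝ => coordField x w p.1) _ q :=
      hcf.hasFDerivAt.comp q hasFDerivAt_fst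
    have hW2 : HasFDerivAt (fun p : EuclideanSpace ℝ (Fin n) × ℝ =>
        (c ∘ (extChartAt (𝓡 n) x).symm) p.1 * p.2) _ q :=
      (hcc.hasFDerivAt.comp q hasFDerivAt_fst).mul hasFDerivAt_snd
    have hW : HasFDerivAt (dirVec x w c) _ q := hW1.prodMk hW2
    have := (hdf.hasFDerivAt.clm_apply hW).fderiv
    rw [this]
    have e1 : (extChartAt (𝓡 n) x).symm (extChartAt (𝓡 n) x x) = x :=
      (extChartAt (𝓡 n) x).left_inv hx
    rw [add_apply, ContinuousLinearMap.comp_apply, ContinuousLinearMap.flip_apply, add_comm]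
    congr 2
    refine Prod.ext rfl ?_
    simp only [ContinuousLinearMap.prod_apply, add_apply, smul_apply, smul_eq_mul,
      ContinuousLinearMap.comp_apply, ContinuousLinearMap.coe_fst', ContinuousLinearMap.coe_snd',
      dirVec, hq, Function.comp, e1, along_eq_fderiv_of_contMDiff u hc hx]
    ring
  rw [key v₁ v₂ a₁ a₂ hv₁ ha₁ hv₂ ha₂, key v₂ v₁ a₂ a₁ hv₂ ha₂ hv₁ ha₁,
    hsym.eq (dirVec x v₁ a₁ q) (dirVec x v₂ a₂ q), dirDerivXR_eq_fderiv hφ1 _ _ hx hp,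
    add_sub_add_left_eq_sub, ← map_sub]
  congr 1
  have e1 : (extChartAt (𝓡 n) x).symm (extChartAt (𝓡 n) x x) = x :=
    (extChartAt (𝓡 n) x).left_inv hx
  -- In the mark direction the terms a₁ a₂ s of the two orders cancel, and only the derivatives of
  -- the aᵢ survive.
  refine Prod.ext ?_ ?_
  · rw [Prod.fst_sub]
    simp only [dirVec]
    rw [coordField_mlieBracket]
    rfl
  · simp only [Prod.snd_sub, dirVec, e1]
    ring

theorem isField_zero : IsField (0 : (x : X) → TangentSpace (𝓡 n) x) := by
  refine ⟨?_, by simp⟩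
  exact Bundle.contMDiff_zeroSection ℝ (TangentSpace (𝓡 n) : X → Type _)

theorem isFun_zero : IsFun n (0 : X → ℝ) :=
  ⟨contMDiff_const, HasCompactSupport.zero⟩

/-- The bracket is local, so it vanishes wherever `v₁` vanishes on a neighbourhood; the support of
`v₁` alone therefore bounds its support. -/
theorem IsField.mlieBracket {v₁ v₂ : (x : X) → TangentSpace (𝓡 n) x}
    (h₁ : IsField v₁) (h₂ : IsField v₂) : IsField (VectorField.mlieBracket (𝓡 n) v₁ v₂) := by
  refine ⟨?_, h₁.2.of_isClosed_subset isClosed_closure (closure_minimal ?_ isClosed_closure)⟩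
  · have : IsManifold (𝓡 n) (minSmoothness ℝ 2) X := by
      rw [minSmoothness_of_isRCLikeNormedField]
      exact IsManifold.of_le (n := ∞) two_le_infty
    have : IsManifold (𝓡 n) (((⊤ : ℕ∞) : WithTop ℕ∞) + 1) X := by
      change IsManifold (𝓡 n) ∞ X; infer_instance
    exact ContDiff.mlieBracket_vectorField (m := ⊤) (n := ⊤) h₁.1 h₂.1 (by simp)
  · intro x hx
    by_contra hc
    have h0 : v₁ =ᶠ[𝓝 x] (0 : (x : X) → TangentSpace (𝓡 n) x) := by
      filter_upwards [isClosed_closure.isOpen_compl.mem_nhds hc] with y hy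
      by_contra h
      exact hy (subset_closure h)
    apply hx
    exact (Filter.EventuallyEq.mlieBracket_vectorField_eq h0 (EventuallyEq.refl _ v₂)).trans
      (congrFun VectorField.mlieBracket_zero_left x)

theorem along_zero (v : (x : X) → TangentSpace (𝓡 n) x) : along v (0 : X → ℝ) = 0 := by
  funext x
  have : mfderiv (𝓡 n) 𝓘(ℝ, ℝ) (fun _ : X => (0 : ℝ)) x = 0 := mfderiv_const
  exact congrArg (fun L => L (v x)) this

theorem zero_along (a : X → ℝ) : along (0 : (x : X) → TangentSpace (𝓡 n) x) a = 0 := by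
  funext x
  exact map_zero (mfderiv (𝓡 n) 𝓘(ℝ, ℝ) a x)

/-- `a` is regarded as a function on X × ℝ that ignores the mark, and the result for `dirDerivXR` is
evaluated at s = 1. -/
theorem contMDiff_along {v : (x : X) → TangentSpace (𝓡 n) x} {a : X → ℝ}
    (hv : ContMDiff (𝓡 n) (𝓡 n).tangent ∞ (fun x => (⟨x, v x⟩ : TangentBundle (𝓡 n) X)))
    (ha : ContMDiff (𝓡 n) 𝓘(ℝ, ℝ) ∞ a) : ContMDiff (𝓡 n) 𝓘(ℝ, ℝ) ∞ (along v a) := by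
  have h1 : Smooth n ∞ (fun p : X × ℝ => a p.1) := (ha.comp contMDiff_fst).contMDiffOn
  have h2 := h1.dirDerivXR (k := ∞) le_rfl le_rfl hv (contMDiff_const (c := (0 : ℝ)))
  have h3 : ContMDiffOn (𝓡 n) 𝓘(ℝ, ℝ) ∞ (fun x => dirDerivXR v (fun _ => 0)
      (fun p : X × ℝ => a p.1) (x, 1)) univ :=
    h2.comp (contMDiff_id.prodMk contMDiff_const).contMDiffOn fun x _ =>
      ⟨mem_univ _, show (0 : ℝ) < 1 from zero_lt_one⟩
  rw [contMDiffOn_univ] at h3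
  refine h3.congr fun x => ?_
  simp [dirDerivXR]

theorem along_of_notMem_tsupport (v : (x : X) → TangentSpace (𝓡 n) x) {a : X → ℝ} {x : X}
    (hx : x ∉ tsupport a) : along v a x = 0 := by
  have h0 : a =ᶠ[𝓝 x] fun _ => 0 := notMem_tsupport_iff_eventuallyEq.1 hx
  have : mfderiv (𝓡 n) 𝓘(ℝ, ℝ) a x = 0 := by
    rw [h0.mfderiv_eq]; exact mfderiv_const
  exact congrArg (fun L => L (v x)) this

theorem IsFun.along_sub_along [T2Space X] {v₁ v₂ : (x : X) → TangentSpace (𝓡 n) x} {a₁ a₂ : X → ℝ}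
    (hv₁ : IsField v₁) (ha₁ : IsFun n a₁) (hv₂ : IsField v₂) (ha₂ : IsFun n a₂) :
    IsFun n (fun x => along v₁ a₂ x - along v₂ a₁ x) := by
  refine ⟨(contMDiff_along hv₁.1 ha₂.1).sub (contMDiff_along hv₂.1 ha₁.1), ?_⟩
  refine HasCompactSupport.intro (ha₁.2.isCompact.union ha₂.2.isCompact) fun x hx => ?_
  rw [mem_union, not_or] at hx
  rw [along_of_notMem_tsupport _ hx.1, along_of_notMem_tsupport _ hx.2, sub_zero]

end Bracket

/-! ### Flows of compactly supported vector fields -/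

section Flow

variable {n : ℕ} {X : Type*} [TopologicalSpace X] [ChartedSpace (EuclideanSpace ℝ (Fin n)) X]
  [IsManifold (𝓡 n) ∞ X]

/-- Picard–Lindelöf in a chart, with continuous dependence on the initial point, yields one
existence time for a whole neighbourhood; this uniformity is what makes the flow global. -/
theorem exists_local_integralCurve {v : (x : X) → TangentSpace (𝓡 n) x}
    (hv : ContMDiff (𝓡 n) (𝓡 n).tangent ∞ (fun x => (⟨x, v x⟩ : TangentBundle (𝓡 n) X)))
    (x₀ : X) : ∃ U ∈ 𝓝 x₀, ∃ ε > (0 : ℝ), ∀ x ∈ U, ∃ c : ℝ → X, c 0 = x ∧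
      IsMIntegralCurveOn c v (Ioo (-ε) ε) := by
  set e := extChartAt (𝓡 n) x₀ with he
  have hx₀ := mem_extChartAt_source (I := 𝓡 n) x₀
  have hT := (isOpen_extChartAt_target (I := 𝓡 n) x₀).mem_nhds (e.map_source hx₀)
  have hw : ContDiffAt ℝ 1 (coordField x₀ v) (e x₀) :=
    ((contDiffOn_coordField hv x₀).contDiffAt hT).of_le (by exact_mod_cast le_top)
  obtain ⟨ε, hε, a, r, L, K, hr, hpl⟩ := IsPicardLindelof.of_contDiffAt_one hw
  obtain ⟨α, hα1, hα2⟩ :=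
    (hpl 0).exists_forall_mem_closedBall_eq_hasDerivWithinAt_continuousOn
  have hD : Metric.closedBall (e x₀) r ×ˢ Icc (0 - ε) (0 + ε) ∈ 𝓝 (e x₀, (0 : ℝ)) :=
    prod_mem_nhds (Metric.closedBall_mem_nhds _ hr) (Icc_mem_nhds (by linarith) (by linarith))
  have hc : ContinuousAt α (e x₀, 0) := hα2.continuousAt hD
  have h0 : α (e x₀, 0) = e x₀ := (hα1 _ (Metric.mem_closedBall_self r.2)).1
  have hpre : α ⁻¹' e.target ∈ 𝓝 (e x₀, (0 : ℝ)) := hc (by rw [h0]; exact hT)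
  -- Starting points and times are restricted so that the solution stays in the chart target, where
  -- `e.symm` carries it to an integral curve on the manifold.
  obtain ⟨V, hV, W, hW, hVW⟩ := mem_nhds_prod_iff.1 (Filter.inter_mem hD hpre)
  obtain ⟨δ, hδ, hδW⟩ := Metric.mem_nhds_iff.1 hW
  have hU : e.source ∩ e ⁻¹' V ∈ 𝓝 x₀ :=
    Filter.inter_mem (extChartAt_source_mem_nhds (I := 𝓡 n) x₀)
      ((continuousAt_extChartAt (I := 𝓡 n) x₀) hV)
  refine ⟨_, hU, δ, hδ, ?_⟩
  rintro x ⟨hxs, hxV⟩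
  have hmem : ∀ t ∈ Ioo (-δ) δ, (e x, t) ∈ (Metric.closedBall (e x₀) r ×ˢ Icc (0 - ε) (0 + ε)) ∩
      α ⁻¹' e.target := fun t ht => hVW ⟨hxV, hδW (by
        rw [Metric.mem_ball, Real.dist_eq, sub_zero]; exact abs_lt.2 ht)⟩
  have hx1 := hα1 _ (hmem 0 ⟨by linarith, hδ⟩).1.1
  refine ⟨fun t => e.symm (α (e x, t)), ?_, ?_⟩
  · change e.symm (α (e x, 0)) = x
    rw [hx1.1, e.left_inv hxs]
  · intro t ht
    have ht' := hmem t ht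
    have hda : HasDerivAt (fun t => α (e x, t)) (coordField x₀ v (α (e x, t))) t := by
      refine (hx1.2 t ht'.1.2).hasDerivAt ?_
      have : Ioo (-δ) δ ⊆ Icc (0 - ε) (0 + ε) := fun u hu => (hmem u hu).1.2
      exact Filter.mem_of_superset (Ioo_mem_nhds ht.1 ht.2) this
    have hz : α (e x, t) ∈ e.target := ht'.2
    have hs1 : HasMFDerivAt 𝓘(ℝ, EuclideanSpace ℝ (Fin n)) (𝓡 n) e.symm (α (e x, t))
        (mfderivWithin 𝓘(ℝ, EuclideanSpace ℝ (Fin n)) (𝓡 n) e.symm (range (𝓡 n)) (α (e x, t))) := by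
      have h1 := (mdifferentiableWithinAt_extChartAt_symm (I := 𝓡 n) hz).hasMFDerivWithinAt
      refine h1.hasMFDerivAt ?_
      simp
    have hs2 := hs1.comp t hda.hasFDerivAt.hasMFDerivAt
    refine HasMFDerivAt.hasMFDerivWithinAt ?_
    refine hs2.congr_mfderiv ?_
    have h2 := mfderivWithin_extChartAt_symm_comp_mfderiv_extChartAt (I := 𝓡 n) hz
    refine ContinuousLinearMap.ext_ring ?_
    refine Eq.trans (congrArg (mfderivWithin 𝓘(ℝ, EuclideanSpace ℝ (Fin n)) (𝓡 n) e.symm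
      (range (𝓡 n)) (α (e x, t)))
      (one_smul ℝ (coordField x₀ v (α (e x, t))) : (1 : ℝ) • coordField x₀ v (α (e x, t)) = _)) ?_
    refine Eq.trans ?_ (one_smul ℝ (v (e.symm (α (e x, t))))).symm
    exact congrArg (fun M => M (v (e.symm (α (e x, t))))) h2

variable [T2Space X] {v : (x : X) → TangentSpace (𝓡 n) x} {a : X → ℝ}

/-- By compactness finitely many neighbourhoods cover the support, so a single time δ serves all
starting points there; at a zero of `v` the constant curve serves. A uniform existence time extends
to all times. -/
theorem IsField.exists_integralCurve (hv : IsField v) (x : X) :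
    ∃ c : ℝ → X, c 0 = x ∧ IsMIntegralCurve c v := by
  choose U hU ε hε h using exists_local_integralCurve hv.1
  obtain ⟨t, -, ht⟩ := hv.2.elim_nhds_subcover U fun x _ => hU x
  obtain ⟨δ, hδ, hδt⟩ : ∃ δ > (0 : ℝ), ∀ x ∈ t, δ ≤ ε x := by
    clear ht
    classical
    induction t using Finset.induction_on with
    | empty => exact ⟨1, one_pos, by simp⟩
    | insert x s _ ih =>
      obtain ⟨δ, hδ, h⟩ := ih
      refine ⟨min δ (ε x), lt_min hδ (hε x), fun y hy => ?_⟩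
      rcases Finset.mem_insert.1 hy with rfl | hy
      · exact min_le_right _ _
      · exact (min_le_left _ _).trans (h y hy)
  refine exists_isMIntegralCurve_of_isMIntegralCurveOn (ε := δ)
    (hv.1.of_le (by exact_mod_cast le_top)) hδ (fun y => ?_) x
  by_cases hy : v y = 0
  · exact ⟨fun _ => y, rfl, (isMIntegralCurve_const hy).isMIntegralCurveOn _⟩
  · obtain ⟨z, hz, hyz⟩ := mem_iUnion₂.1 (ht (subset_closure hy))
    obtain ⟨c, hc0, hc⟩ := h z y hyz
    exact ⟨c, hc0, hc.mono (Ioo_subset_Ioo (neg_le_neg (hδt z hz)) (hδt z hz))⟩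

theorem IsField.flow_zero (hv : IsField v) (x : X) : flow v 0 x = x := by
  have h := hv.exists_integralCurve x
  rw [flow, dif_pos h]
  exact h.choose_spec.1

theorem IsField.isMIntegralCurve_flow (hv : IsField v) (x : X) :
    IsMIntegralCurve (fun t => flow v t x) v := by
  have h := hv.exists_integralCurve x
  have e : (fun t => flow v t x) = h.choose := by
    funext t; rw [flow, dif_pos h]
  rw [e]
  exact h.choose_spec.2

theorem IsField.integralCurve_unique (hv : IsField v) {c c' : ℝ → X} (hc : IsMIntegralCurve c v)
    (hc' : IsMIntegralCurve c' v) {t : ℝ} (h : c t = c' t) : c = c' :=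
  isMIntegralCurve_Ioo_eq_of_contMDiff_boundaryless (t₀ := t)
    (hv.1.of_le (by exact_mod_cast le_top)) hc hc' h

/-- Integral curves that meet at time `t` coincide, so they also have the same starting point. -/
theorem IsField.flow_injective (hv : IsField v) (t : ℝ) : Function.Injective (flow v t) := by
  intro x y h
  have := congrFun (hv.integralCurve_unique (hv.isMIntegralCurve_flow x)
    (hv.isMIntegralCurve_flow y) h) 0
  simpa [hv.flow_zero] using this

theorem IsField.flow_of_eq_zero (hv : IsField v) {x : X} (hx : v x = 0) (t : ℝ) :
    flow v t x = x :=
  congrFun (hv.integralCurve_unique (hv.isMIntegralCurve_flow x) (isMIntegralCurve_const hx)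
    (t := 0) (hv.flow_zero x)) t

/-- The curve (ψ_t(x), exp(t a(ψ_t(x))) s) has velocity (v(x), a(x) s) at t = 0, and the chain rule
is applied in the chart at `x`. -/
theorem IsField.hasDerivAt_flow (hv : IsField v) (ha : ContMDiff (𝓡 n) 𝓘(ℝ, ℝ) ∞ a)
    {φ : X × ℝ → ℝ} (hφ : Smooth n 1 φ) {x : X} {s : ℝ} (hs : 0 < s) :
    HasDerivAt (fun t => φ (flow v t x, Real.exp (t * a (flow v t x)) * s))
      (dirDerivXR v a φ (x, s)) 0 := by
  set e := extChartAt (𝓡 n) x with he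
  have hx := mem_extChartAt_source (I := 𝓡 n) x
  have hc := hv.isMIntegralCurve_flow x 0
  have hc0 := hv.flow_zero x
  have h1 : HasDerivAt (fun t => e (flow v t x)) (coordField x v (e x)) 0 := by
    have h2 : HasMFDerivAt (𝓡 n) 𝓘(ℝ, EuclideanSpace ℝ (Fin n)) e (flow v 0 x)
        (mfderiv (𝓡 n) 𝓘(ℝ, EuclideanSpace ℝ (Fin n)) e (flow v 0 x)) := by
      refine (mdifferentiableAt_extChartAt ?_).hasMFDerivAt
      rw [hc0, ← extChartAt_source (𝓡 n)]
      exact hx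
    have h4 : ∀ y, y = x → ((mfderiv (𝓡 n) 𝓘(ℝ, EuclideanSpace ℝ (Fin n)) e y) (v y) :
        EuclideanSpace ℝ (Fin n)) = coordField x v (e x) := by
      rintro y rfl
      exact (coordField_extChartAt v hx).symm
    have h3 : HasFDerivAt (fun t => e (flow v t x))
        (ContinuousLinearMap.smulRight (1 : ℝ →L[ℝ] ℝ) (coordField x v (e x))) 0 := by
      refine (h2.comp (f := fun t => flow v t x) 0 hc).hasFDerivAt.congr_fderiv ?_
      refine ContinuousLinearMap.ext_ring ?_
      refine Eq.trans ?_ (one_smul ℝ (coordField x v (e x))).symm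
      refine Eq.trans ?_ (h4 _ hc0)
      exact congrArg (mfderiv (𝓡 n) 𝓘(ℝ, EuclideanSpace ℝ (Fin n)) e (flow v 0 x))
        (one_smul ℝ (v (flow v 0 x)))
    exact h3.hasDerivAt.congr_deriv (one_smul ℝ (coordField x v (e x)))
  have hcont : ContinuousAt (fun t => flow v t x) 0 := hc.continuousAt
  have hsrc : ∀ᶠ t in 𝓝 (0 : ℝ), flow v t x ∈ e.source :=
    hcont (by
      change e.source ∈ 𝓝 (flow v 0 x)
      rw [hc0]; exact extChartAt_source_mem_nhds (I := 𝓡 n) x)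
  have hT := (isOpen_extChartAt_target (I := 𝓡 n) x).mem_nhds (e.map_source hx)
  have h5 : DifferentiableAt ℝ (fun t => a (flow v t x)) 0 := by
    have h6 : DifferentiableAt ℝ (a ∘ e.symm) (e (flow v 0 x)) := by
      rw [hc0]
      exact ((contDiffOn_comp_extChartAt_symm ha x).contDiffAt hT).differentiableAt (by simp)
    refine (h6.comp (0 : ℝ) h1.differentiableAt).congr_of_eventuallyEq ?_
    filter_upwards [hsrc] with t ht
    simp only [Function.comp, e.left_inv ht]
  -- The exponent is a product with the factor t, so the derivative of `a` along the flow is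
  -- multiplied by 0 at t = 0: only its existence matters.
  have h7 : HasDerivAt (fun t => Real.exp (t * a (flow v t x)) * s) (a x * s) 0 := by
    have := ((((hasDerivAt_id (0 : ℝ)).mul h5.hasDerivAt).exp).mul_const s)
    refine this.congr_deriv ?_
    simp [hc0]
  have h8 := h1.prodMk h7
  have h9 : HasFDerivAt (locRep x φ) (fderiv ℝ (locRep x φ) (e x, s))
      (e (flow v 0 x), Real.exp (0 * a (flow v 0 x)) * s) := by
    rw [hc0, zero_mul, Real.exp_zero, one_mul]
    exact (differentiableAt_locRep hφ hx hs).hasFDerivAt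
  have h10 := h9.comp_hasDerivAt (0 : ℝ) h8
  rw [dirDerivXR_eq_fderiv hφ v a hx hs]
  have e1 : e.symm (e x) = x := e.left_inv hx
  refine (h10.congr_deriv ?_).congr_of_eventuallyEq ?_
  · simp only [dirVec, ← he, e1]
  · filter_upwards [hsrc] with t ht
    simp only [Function.comp, locRep, ← he, e.left_inv ht]

end Flow

/-! ### Pairings and the action on configurations -/

section Pairing

variable {X : Type*} [TopologicalSpace X]

/-- `f` vanishes on `Kᶜ × (0, ∞)`. -/
def SuppIn (K : Set X) (f : X × ℝ → ℝ) : Prop := ∀ x ∉ K, ∀ s : ℝ, 0 < s → f (x, s) = 0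

theorem SuppIn.mono {K L : Set X} {f : X × ℝ → ℝ} (hf : SuppIn K f) (h : K ⊆ L) : SuppIn L f :=
  fun x hx => hf x fun hx' => hx (h hx')

theorem Config.finite_inter (γ : Config X) {K : Set X} (hK : IsCompact K) :
    {p ∈ γ.1 | p.1 ∈ K}.Finite := γ.2.2.2 K hK

/-- The points of a configuration with position in a compact set. -/
def Config.pts (γ : Config X) {K : Set X} (hK : IsCompact K) : Finset (X × ℝ) :=
  (γ.finite_inter hK).toFinset

theorem Config.mem_pts {γ : Config X} {K : Set X} {hK : IsCompact K} {p : X × ℝ} :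
    p ∈ γ.pts hK ↔ p ∈ γ.1 ∧ p.1 ∈ K := by simp [Config.pts]

theorem Config.pos (γ : Config X) {p : X × ℝ} (hp : p ∈ γ.1) : 0 < p.2 := γ.2.1 p hp

theorem pairing_eq_sum {f : X × ℝ → ℝ} {K : Set X} (hK : IsCompact K) (hf : SuppIn K f)
    (γ : Config X) : pairing f γ = ∑ p ∈ γ.pts hK, f p := by
  rw [pairing]
  refine finsum_mem_eq_sum_of_inter_support_eq _ ?_
  ext p
  simp only [mem_inter_iff, Function.mem_support, Finset.mem_coe, Config.mem_pts]
  constructor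
  · rintro ⟨h1, h2⟩
    exact ⟨⟨h1, by_contra fun h => h2 (hf p.1 h p.2 (γ.pos h1))⟩, h2⟩
  · rintro ⟨⟨h1, -⟩, h2⟩
    exact ⟨h1, h2⟩

theorem pairing_congr {f g : X × ℝ → ℝ} {γ : Config X} (h : ∀ p ∈ γ.1, f p = g p) :
    pairing f γ = pairing g γ := finsum_mem_congr rfl h

theorem Config.ofSet_val {S : Set (X × ℝ)} (h : IsConfig S) : (Config.ofSet S).1 = S :=
  congrArg Subtype.val (dif_pos h : Config.ofSet S = ⟨S, h⟩)

theorem pairing_add {f g : X × ℝ → ℝ} {K : Set X} (hK : IsCompact K) (hf : SuppIn K f)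
    (hg : SuppIn K g) (γ : Config X) :
    pairing (fun p => f p + g p) γ = pairing f γ + pairing g γ := by
  rw [pairing_eq_sum hK hf, pairing_eq_sum hK hg,
    pairing_eq_sum hK (fun x hx s hs => by simp [hf x hx s hs, hg x hx s hs]),
    Finset.sum_add_distrib]

theorem pairing_const_mul {f : X × ℝ → ℝ} {K : Set X} (hK : IsCompact K) (hf : SuppIn K f)
    (c : ℝ) (γ : Config X) : pairing (fun p => c * f p) γ = c * pairing f γ := by
  rw [pairing_eq_sum hK hf, pairing_eq_sum hK (fun x hx s hs => by simp [hf x hx s hs]),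
    Finset.mul_sum]

theorem pairing_sub {f g : X × ℝ → ℝ} {K : Set X} (hK : IsCompact K) (hf : SuppIn K f)
    (hg : SuppIn K g) (γ : Config X) :
    pairing (fun p => f p - g p) γ = pairing f γ - pairing g γ := by
  rw [pairing_eq_sum hK hf, pairing_eq_sum hK hg,
    pairing_eq_sum hK (fun x hx s hs => by simp [hf x hx s hs, hg x hx s hs]),
    Finset.sum_sub_distrib]

end Pairing

/-! ### The lifted flow and the differentiation of pairings along it -/

section Curve

variable {n : ℕ} {X : Type*} [TopologicalSpace X] [ChartedSpace (EuclideanSpace ℝ (Fin n)) X]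
  [IsManifold (𝓡 n) ∞ X] [T2Space X] {v : (x : X) → TangentSpace (𝓡 n) x} {a : X → ℝ}

/-- The image is again a configuration. Positions stay distinct because the flow is injective. They
stay locally finite because points off the support of `v` do not move, so whatever lands in K starts
in K or in the support. -/
theorem IsField.curve_val (hv : IsField v) (a : X → ℝ) (γ : Config X) (t : ℝ) :
    (curve v a γ t).1 = (fun p : X × ℝ => (flow v t p.1,
      Real.exp (t * a (flow v t p.1)) * p.2)) '' γ.1 := by
  refine Config.ofSet_val ⟨?_, ?_, fun K hK => ?_⟩
  · rintro _ ⟨p, hp, rfl⟩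
    exact mul_pos (Real.exp_pos _) (γ.pos hp)
  · rintro _ ⟨p, hp, rfl⟩ _ ⟨q, hq, rfl⟩ h
    have := γ.2.2.1 hp hq (hv.flow_injective t h)
    rw [this]
  · refine ((γ.finite_inter (hK.union hv.2)).image (fun p : X × ℝ =>
      (flow v t p.1, Real.exp (t * a (flow v t p.1)) * p.2))).subset ?_
    rintro _ ⟨⟨p, hp, rfl⟩, hpK⟩
    refine ⟨p, ⟨hp, ?_⟩, rfl⟩
    by_cases h : v p.1 = 0
    · left
      have h2 := hv.flow_of_eq_zero h t
      simp only [h2] at hpK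
      exact hpK
    · exact Or.inr (subset_closure h)

/-- The index set, the points over K and the support of `v`, does not depend on `t`. Differentiation
in `t` is therefore differentiation of a fixed finite sum. -/
theorem IsField.pairing_curve (hv : IsField v) (a : X → ℝ) {f : X × ℝ → ℝ} {K : Set X}
    (hK : IsCompact K) (hf : SuppIn K f) (γ : Config X) (t : ℝ) :
    pairing f (curve v a γ t) = ∑ p ∈ γ.pts (hK.union hv.2),
      f (flow v t p.1, Real.exp (t * a (flow v t p.1)) * p.2) := by
  rw [pairing, hv.curve_val, finsum_mem_image]
  · refine finsum_mem_eq_sum_of_inter_support_eq _ ?_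
    ext p
    simp only [mem_inter_iff, Function.mem_support, Finset.mem_coe, Config.mem_pts]
    constructor
    · rintro ⟨h1, h2⟩
      refine ⟨⟨h1, ?_⟩, h2⟩
      by_contra h
      rw [mem_union, not_or] at h
      have h0 : v p.1 = 0 := by
        by_contra h'
        exact h.2 (subset_closure h')
      apply h2
      rw [hv.flow_of_eq_zero h0]
      exact hf _ h.1 _ (mul_pos (Real.exp_pos _) (γ.pos h1))
    · rintro ⟨⟨h1, -⟩, h2⟩
      exact ⟨h1, h2⟩
  · intro p hp q hq h
    exact γ.2.2.1 hp hq (hv.flow_injective t (congrArg Prod.fst h))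

theorem SuppIn.dirDerivXR {K : Set X} (hK : IsCompact K) {f : X × ℝ → ℝ} (hf : SuppIn K f)
    (v : (x : X) → TangentSpace (𝓡 n) x) (a : X → ℝ) : SuppIn K (dirDerivXR v a f) := by
  intro x hx s hs
  have h1 : (fun x => f (x, s)) =ᶠ[𝓝 x] fun _ => 0 := by
    filter_upwards [hK.isClosed.isOpen_compl.mem_nhds hx] with y hy
    exact hf y hy s hs
  have h2 : (fun s => f (x, s)) =ᶠ[𝓝 s] fun _ => 0 := by
    filter_upwards [lt_mem_nhds hs] with r hr
    exact hf x hx r hr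
  have h3 : mfderiv (𝓡 n) 𝓘(ℝ, ℝ) (fun x => f (x, s)) x = 0 := by
    rw [h1.mfderiv_eq]; exact mfderiv_const
  have h4 : along v (fun x => f (x, s)) x = 0 := congrArg (fun L => L (v x)) h3
  change along v (fun x => f (x, s)) x + _ = 0
  rw [h4]
  simp [h2.deriv_eq]

theorem IsField.hasDerivAt_pairing_curve (hv : IsField v) (ha : ContMDiff (𝓡 n) 𝓘(ℝ, ℝ) ∞ a)
    {f : X × ℝ → ℝ} (hfs : Smooth n 1 f) {K : Set X} (hK : IsCompact K) (hf : SuppIn K f)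
    (γ : Config X) :
    HasDerivAt (fun t => pairing f (curve v a γ t)) (pairing (dirDerivXR v a f) γ) 0 := by
  have h1 := HasDerivAt.fun_sum (u := γ.pts (hK.union hv.2)) (x := (0 : ℝ)) fun p hp =>
    hv.hasDerivAt_flow ha hfs (x := p.1) (γ.pos (Config.mem_pts.1 hp).1)
  rw [pairing_eq_sum (hK.union hv.2) ((hf.dirDerivXR hK v a).mono subset_union_left)]
  simpa only [← hv.pairing_curve a hK hf γ] using h1

theorem IsField.pairing_curve_zero (hv : IsField v) (a : X → ℝ) {f : X × ℝ → ℝ} {K : Set X}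
    (hK : IsCompact K) (hf : SuppIn K f) (γ : Config X) :
    pairing f (curve v a γ 0) = pairing f γ := by
  rw [hv.pairing_curve a hK hf, pairing_eq_sum (hK.union hv.2) (hf.mono subset_union_left)]
  simp [hv.flow_zero]

end Curve

/-! ### Measurability on the configuration space and the law of the marked Poisson measure -/

section Law

variable {X : Type*} [TopologicalSpace X] [T2Space X] [SecondCountableTopology X]
  [LocallyCompactSpace X] [MeasurableSpace X] [BorelSpace X]

theorem Config.countable (γ : Config X) : γ.1.Countable := by
  have h : γ.1 = ⋃ k, {p ∈ γ.1 | p.1 ∈ compactCovering X k} := by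
    ext p
    simp only [mem_iUnion]
    constructor
    · intro hp
      obtain ⟨k, hk⟩ := mem_iUnion.1 ((iUnion_compactCovering X).symm ▸ mem_univ p.1)
      exact ⟨k, hp, hk⟩
    · rintro ⟨k, hp, -⟩
      exact hp
  rw [h]
  exact countable_iUnion fun k => (γ.finite_inter (isCompact_compactCovering X k)).countable

theorem Config.measurableSet (γ : Config X) : MeasurableSet γ.1 := γ.countable.measurableSet

/-- The counting measure of a configuration. -/
def countMeasure (γ : Config X) : Measure (X × ℝ) := Measure.count.restrict γ.1

theorem countMeasure_apply_of_subset (γ : Config X) {K : Set X} (hK : IsCompact K)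
    {B : Set (X × ℝ)} (hB : MeasurableSet B) (hBK : B ⊆ K ×ˢ univ) :
    countMeasure γ B = ((γ.1 ∩ B).ncard : ℝ≥0∞) := by
  have hf : (γ.1 ∩ B).Finite := (γ.finite_inter hK).subset fun p hp => ⟨hp.1, (hBK hp.2).1⟩
  rw [countMeasure, Measure.restrict_apply hB, inter_comm,
    Measure.count_apply (γ.measurableSet.inter hB), ← hf.cast_ncard_eq]
  rfl

/-- The σ-algebra is generated by counts over sets lying above a compact set; a general Borel set is
exhausted by these, and its count is their increasing limit. Measurability of pairings follows from
that of integrals against the counting measure. -/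
theorem measurable_countMeasure : Measurable (countMeasure : Config X → Measure (X × ℝ)) := by
  refine Measure.measurable_of_measurable_coe _ fun s hs => ?_
  have h : ∀ γ : Config X, countMeasure γ s =
      ⨆ k, countMeasure γ (s ∩ (compactCovering X k ×ˢ Ioi (0 : ℝ))) := by
    intro γ
    have h1 : countMeasure γ s = countMeasure γ (⋃ k, s ∩ (compactCovering X k ×ˢ Ioi (0 : ℝ))) := by
      refine measure_congr ?_
      have : ∀ᵐ p ∂countMeasure γ, p ∈ γ.1 := ae_restrict_mem γ.measurableSet
      filter_upwards [this] with p hp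
      obtain ⟨k, hk⟩ := mem_iUnion.1 ((iUnion_compactCovering X).symm ▸ mem_univ p.1)
      refine propext ⟨fun h => mem_iUnion.2 ⟨k, h, hk, γ.pos hp⟩, fun h => ?_⟩
      obtain ⟨k, hk⟩ := mem_iUnion.1 h
      exact hk.1
    rw [h1]
    refine Monotone.measure_iUnion fun i j hij => ?_
    exact inter_subset_inter_right _ (Set.prod_mono (compactCovering_subset X hij) le_rfl)
  simp_rw [h]
  refine Measurable.iSup fun k => ?_
  have hm : MeasurableSet (s ∩ (compactCovering X k ×ˢ Ioi (0 : ℝ))) :=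
    hs.inter ((isCompact_compactCovering X k).measurableSet.prod measurableSet_Ioi)
  simp_rw [fun γ : Config X => countMeasure_apply_of_subset γ (isCompact_compactCovering X k) hm
    (inter_subset_right.trans (Set.prod_mono le_rfl (subset_univ _)))]
  have : Measurable fun γ : Config X => (γ.1 ∩ (s ∩ (compactCovering X k ×ˢ Ioi (0 : ℝ)))).ncard := by
    refine measurable_to_countable' fun j => ?_
    exact MeasurableSpace.measurableSet_generateFrom
      ⟨_, _, j, hm, isCompact_compactCovering X k, inter_subset_right, rfl⟩
  exact (measurable_of_countable (fun j : ℕ => (j : ℝ≥0∞))).comp this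

/-- The pairing of a configuration with a `[0, ∞]`-valued function. -/
def lpair (f : X × ℝ → ℝ≥0∞) (γ : Config X) : ℝ≥0∞ := ∫⁻ p, f p ∂countMeasure γ

theorem measurable_lpair {f : X × ℝ → ℝ≥0∞} (hf : Measurable f) :
    Measurable (lpair f : Config X → ℝ≥0∞) :=
  (Measure.measurable_lintegral hf).comp measurable_countMeasure

theorem lpair_mono {f g : X × ℝ → ℝ≥0∞} {γ : Config X} (h : ∀ p ∈ γ.1, f p ≤ g p) :
    lpair f γ ≤ lpair g γ :=
  setLIntegral_mono' γ.measurableSet h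

theorem lintegral_count_restrict_finset (s : Finset (X × ℝ)) (f : X × ℝ → ℝ≥0∞) :
    ∫⁻ p in (s : Set (X × ℝ)), f p ∂Measure.count = ∑ p ∈ s, f p := by
  rw [lintegral_finset]
  simp

theorem lpair_eq_sum {f : X × ℝ → ℝ≥0∞} {K : Set X} (hK : IsCompact K)
    (hf : ∀ x ∉ K, ∀ s : ℝ, 0 < s → f (x, s) = 0) (γ : Config X) :
    lpair f γ = ∑ p ∈ γ.pts hK, f p := by
  rw [← lintegral_count_restrict_finset, lpair, countMeasure]
  have hsub : ((γ.pts hK : Finset (X × ℝ)) : Set (X × ℝ)) ⊆ γ.1 := fun p hp =>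
    (Config.mem_pts.1 (Finset.mem_coe.1 hp)).1
  rw [← inter_eq_self_of_subset_left hsub, ← setLIntegral_indicator (γ.pts hK).measurableSet]
  refine setLIntegral_congr_fun γ.measurableSet fun p hp => ?_
  by_cases h : p ∈ ((γ.pts hK : Finset (X × ℝ)) : Set (X × ℝ))
  · rw [indicator_of_mem h]
  · rw [indicator_of_notMem h]
    exact hf p.1 (fun h' => h (Finset.mem_coe.2 (Config.mem_pts.2 ⟨hp, h'⟩))) p.2 (γ.pos hp)

theorem lpair_ofReal {f : X × ℝ → ℝ} {K : Set X} (hK : IsCompact K) (hf : SuppIn K f)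
    (h0 : ∀ p, 0 < p.2 → 0 ≤ f p) (γ : Config X) :
    lpair (fun p => ENNReal.ofReal (f p)) γ = ENNReal.ofReal (pairing f γ) := by
  rw [lpair_eq_sum hK fun x hx s hs => by rw [hf x hx s hs, ENNReal.ofReal_zero],
    pairing_eq_sum hK hf, ENNReal.ofReal_sum_of_nonneg]
  exact fun p hp => h0 p (γ.pos (Config.mem_pts.1 hp).1)

/-- The positive and negative parts are integrated separately against the counting measure. Marks of
a configuration are positive, hence only the indicator of the half-space needs to be measurable. -/
theorem measurable_pairing {f : X × ℝ → ℝ} {K : Set X} (hK : IsCompact K) (hf : SuppIn K f)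
    (hm : Measurable ((univ ×ˢ Ioi (0 : ℝ)).indicator f)) : Measurable (pairing f : Config X → ℝ) := by
  set g := (univ ×ˢ Ioi (0 : ℝ)).indicator f with hg
  have hgf : ∀ p : X × ℝ, 0 < p.2 → g p = f p := fun p hp =>
    indicator_of_mem (s := univ ×ˢ Ioi (0 : ℝ)) ⟨mem_univ _, hp⟩ f
  have hgs : SuppIn K g := fun x hx s hs => by rw [hgf (x, s) hs, hf x hx s hs]
  have e : (pairing f : Config X → ℝ) = fun γ =>
      (lpair (fun p => ENNReal.ofReal (max (g p) 0)) γ).toReal -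
      (lpair (fun p => ENNReal.ofReal (max (-g p) 0)) γ).toReal := by
    funext γ
    have s1 : SuppIn K fun p => max (g p) 0 := fun x hx s hs => by simp [hgs x hx s hs]
    have s2 : SuppIn K fun p => max (-g p) 0 := fun x hx s hs => by simp [hgs x hx s hs]
    rw [lpair_ofReal hK s1 fun p _ => le_max_right _ _,
      lpair_ofReal hK s2 fun p _ => le_max_right _ _, pairing_eq_sum hK s1, pairing_eq_sum hK s2,
      pairing_eq_sum hK hf, ENNReal.toReal_ofReal (Finset.sum_nonneg fun p _ => le_max_right _ _),
      ENNReal.toReal_ofReal (Finset.sum_nonneg fun p _ => le_max_right _ _),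
      ← Finset.sum_sub_distrib]
    refine Finset.sum_congr rfl fun p hp => ?_
    rw [← hgf p (γ.pos (Config.mem_pts.1 hp).1)]
    rcases le_total 0 (g p) with h | h
    · rw [max_eq_left h, max_eq_right (neg_nonpos.2 h), sub_zero]
    · rw [max_eq_right h, max_eq_left (neg_nonneg.2 h), zero_sub, neg_neg]
  rw [e]
  exact ((measurable_lpair (hm.max measurable_const).ennreal_ofReal).ennreal_toReal).sub
    ((measurable_lpair (hm.neg.max measurable_const).ennreal_ofReal).ennreal_toReal)

theorem Config.restrict_val (Λ : Set X) (γ : Config X) :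
    (γ.restrict Λ).1 = {p ∈ γ.1 | p.1 ∈ Λ} :=
  Config.ofSet_val ⟨fun p hp => γ.pos hp.1, fun p hp q hq h => γ.2.2.1 hp.1 hq.1 h,
    fun K hK => (γ.finite_inter hK).subset fun p hp => ⟨hp.1.1, hp.2⟩⟩

theorem measurable_restrict {Λ : Set X} (hΛ : MeasurableSet Λ) :
    Measurable (Config.restrict Λ : Config X → Config X) := by
  refine measurable_generateFrom ?_
  rintro _ ⟨B, K, k, hB, hK, hBK, rfl⟩
  have : Config.restrict Λ ⁻¹' {γ : Config X | (γ.1 ∩ B).ncard = k} =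
      {γ : Config X | (γ.1 ∩ (B ∩ Λ ×ˢ univ)).ncard = k} := by
    ext γ
    simp only [mem_preimage, mem_ofPred_eq, Config.restrict_val]
    have : {p ∈ γ.1 | p.1 ∈ Λ} ∩ B = γ.1 ∩ (B ∩ Λ ×ˢ univ) := by
      ext p
      simp only [mem_inter_iff, mem_ofPred_eq, mem_prod, mem_univ, and_true]
      tauto
    rw [this]
  rw [this]
  exact MeasurableSpace.measurableSet_generateFrom ⟨_, K, k,
    hB.inter (hΛ.prod MeasurableSet.univ), hK, inter_subset_left.trans hBK, rfl⟩

theorem pairing_restrict {f : X × ℝ → ℝ} {Λ : Set X} (hf : SuppIn Λ f) (γ : Config X) :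
    pairing f (γ.restrict Λ) = pairing f γ := by
  rw [pairing, pairing, Config.restrict_val]
  refine finsum_mem_inter_support_eq' _ _ _ fun p hp => ?_
  refine ⟨fun h => h.1, fun h => ⟨h, ?_⟩⟩
  by_contra hn
  exact hp (hf p.1 hn p.2 (γ.pos h))

theorem lpair_restrict {f : X × ℝ → ℝ≥0∞} {Λ : Set X} (hΛ : MeasurableSet Λ)
    (hf : ∀ x ∉ Λ, ∀ s : ℝ, 0 < s → f (x, s) = 0) (γ : Config X) :
    lpair f (γ.restrict Λ) = lpair f γ := by
  have hm : MeasurableSet (Λ ×ˢ univ : Set (X × ℝ)) := hΛ.prod MeasurableSet.univ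
  rw [lpair, lpair, countMeasure, countMeasure, Config.restrict_val]
  have : {p ∈ γ.1 | p.1 ∈ Λ} = γ.1 ∩ Λ ×ˢ univ := by
    ext p; simp
  rw [this, inter_comm, ← setLIntegral_indicator hm]
  refine setLIntegral_congr_fun γ.measurableSet fun p hp => ?_
  by_cases h : p ∈ (Λ ×ˢ univ : Set (X × ℝ))
  · simp [h]
  · rw [indicator_of_notMem h]
    exact (hf p.1 (fun h' => h ⟨h', mem_univ _⟩) p.2 (γ.pos hp)).symm

/-- The tuples of points with positive marks and distinct positions. -/
def goodTuples (X : Type*) (k : ℕ) : Set (Fin k → X × ℝ) :=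
  {z | (∀ i, 0 < (z i).2) ∧ ∀ i j, i ≠ j → (z i).1 ≠ (z j).1}

theorem measurableSet_goodTuples (k : ℕ) : MeasurableSet (goodTuples X k) := by
  have : goodTuples X k = (⋂ i, {z | 0 < (z i).2}) ∩
      ⋂ (i) (j) (_ : i ≠ j), {z : Fin k → X × ℝ | (z i).1 = (z j).1}ᶜ := by
    ext z; simp [goodTuples]
  rw [this]
  refine MeasurableSet.inter (MeasurableSet.iInter fun i => ?_)
    (MeasurableSet.iInter fun i => MeasurableSet.iInter fun j => MeasurableSet.iInter fun _ =>
      (MeasurableSet.compl ?_))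
  · exact measurableSet_lt measurable_const (measurable_snd.comp (measurable_pi_apply i))
  · exact measurableSet_eq_fun (measurable_fst.comp (measurable_pi_apply i))
      (measurable_fst.comp (measurable_pi_apply j))

theorem ofSet_range_val {k : ℕ} {z : Fin k → X × ℝ} (hz : z ∈ goodTuples X k) :
    (Config.ofSet (range z)).1 = range z := by
  refine Config.ofSet_val ⟨?_, ?_, fun K _ => (finite_range z).subset fun p hp => hp.1⟩
  · rintro _ ⟨i, rfl⟩
    exact hz.1 i
  · rintro _ ⟨i, rfl⟩ _ ⟨j, rfl⟩ h
    by_contra hij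
    exact hz.2 i j (fun h' => hij (by rw [h'])) h

theorem goodTuples_injective {k : ℕ} {z : Fin k → X × ℝ} (hz : z ∈ goodTuples X k) :
    Function.Injective z := fun i j h => by
  by_contra hij
  exact hz.2 i j hij (by rw [h])

theorem pairing_ofSet_range {k : ℕ} {z : Fin k → X × ℝ} (hz : z ∈ goodTuples X k)
    (f : X × ℝ → ℝ) : pairing f (Config.ofSet (range z)) = ∑ i, f (z i) := by
  rw [pairing, ofSet_range_val hz, finsum_mem_range (goodTuples_injective hz),
    finsum_eq_sum_of_fintype]

theorem lpair_ofSet_range {k : ℕ} {z : Fin k → X × ℝ} (hz : z ∈ goodTuples X k)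
    (f : X × ℝ → ℝ≥0∞) : lpair f (Config.ofSet (range z)) = ∑ i, f (z i) := by
  classical
  have : range z = ((Finset.univ.image z : Finset (X × ℝ)) : Set (X × ℝ)) := by simp
  rw [lpair, countMeasure, ofSet_range_val hz, this, lintegral_count_restrict_finset,
    Finset.sum_image fun i _ j _ h => goodTuples_injective hz h]

open Classical in
/-- A measurable version of `z ↦ {z₁, …, z_k}`. -/
def tupleConfig (k : ℕ) (z : Fin k → X × ℝ) : Config X :=
  if z ∈ goodTuples X k then Config.ofSet (range z) else Config.empty

theorem measurable_tupleConfig (k : ℕ) : Measurable (tupleConfig k : (Fin k → X × ℝ) → Config X) := by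
  classical
  refine measurable_generateFrom ?_
  rintro _ ⟨B, K, j, hB, hK, hBK, rfl⟩
  have hcount : ∀ z ∈ goodTuples X k, ((Config.ofSet (range z)).1 ∩ B).ncard =
      ∑ i, B.indicator (fun _ => 1) (z i) := by
    intro z hz
    rw [ofSet_range_val hz]
    have : range z ∩ B = z '' ((Finset.univ.filter fun i => z i ∈ B : Finset (Fin k)) : Set (Fin k)) := by
      ext p
      simp only [mem_inter_iff, mem_range, mem_image, Finset.coe_filter, Finset.mem_univ, true_and,
        mem_ofPred_eq]
      constructor
      · rintro ⟨⟨i, rfl⟩, h⟩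
        exact ⟨i, h, rfl⟩
      · rintro ⟨i, h, rfl⟩
        exact ⟨⟨i, rfl⟩, h⟩
    rw [this, ncard_image_of_injective _ (goodTuples_injective hz), ncard_coe_finset,
      Finset.card_filter]
    rfl
  have : tupleConfig k ⁻¹' {γ : Config X | (γ.1 ∩ B).ncard = j} =
      (goodTuples X k ∩ {z | ∑ i, B.indicator (fun _ => 1) (z i) = j}) ∪
      ((goodTuples X k)ᶜ ∩ {_z | (∅ : Set (X × ℝ)).ncard = j}) := by
    ext z
    by_cases hz : z ∈ goodTuples X k
    · simp [tupleConfig, hz, hcount z hz]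
    · simp [tupleConfig, hz, Config.empty]
  rw [this]
  refine ((measurableSet_goodTuples k).inter ?_).union
    ((measurableSet_goodTuples k).compl.inter (MeasurableSet.const _))
  have hm : Measurable fun z : Fin k → X × ℝ => ∑ i, B.indicator (fun _ => (1 : ℕ)) (z i) :=
    Finset.measurable_sum _ fun i _ =>
      (measurable_const.indicator hB).comp (measurable_pi_apply i)
  exact hm (measurableSet_singleton j)

/-- The hypotheses on the Lévy measure. -/
structure IsLevy (σ : Measure (X × ℝ)) : Prop where
  finite : ∀ K : Set X, IsCompact K → σ (K ×ˢ univ) < ⊤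
  pos : ∀ᵐ p ∂σ, 0 < p.2
  noAtom : ∀ x : X, σ ({x} ×ˢ univ) = 0

variable {σ : Measure (X × ℝ)} {Λ : Set X}

theorem IsLevy.isFiniteMeasure (hσ : IsLevy σ) (hΛ : IsCompact (closure Λ)) :
    IsFiniteMeasure (σ.restrict (Λ ×ˢ Ioi (0 : ℝ))) := by
  refine ⟨?_⟩
  rw [Measure.restrict_apply_univ]
  exact (measure_mono (Set.prod_mono subset_closure (subset_univ _))).trans_lt (hσ.finite _ hΛ)

/-- Two distinct coordinates have the same position with probability zero: by Fubini the second may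
be frozen, and a fibre {x} × ℝ is a null set. -/
theorem IsLevy.ae_goodTuples (hσ : IsLevy σ) (hΛ : IsCompact (closure Λ)) (k : ℕ) :
    ∀ᵐ z ∂(Measure.pi fun _ : Fin k => σ.restrict (Λ ×ˢ Ioi (0 : ℝ))), z ∈ goodTuples X k := by
  have := hσ.isFiniteMeasure hΛ
  refine Filter.Eventually.and (ae_all_iff.2 fun i => ?_) (ae_all_iff.2 fun i => ae_all_iff.2
    fun j => ?_)
  · have h1 : ∀ᵐ p ∂(σ.restrict (Λ ×ˢ Ioi (0 : ℝ))), 0 < p.2 := ae_restrict_of_ae hσ.pos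
    exact (Measure.quasiMeasurePreserving_eval
      (μ := fun _ : Fin k => σ.restrict (Λ ×ˢ Ioi (0 : ℝ))) i).ae h1
  · by_cases hij : i = j
    · exact Eventually.of_forall fun _ h => absurd hij h
    · obtain ⟨l, rfl⟩ : ∃ l, k = l + 1 := Nat.exists_eq_succ_of_ne_zero fun h => by
        subst h; exact i.elim0
      obtain ⟨j', rfl⟩ := Fin.exists_succAbove_eq (fun h => hij h.symm : j ≠ i)
      have hp := measurePreserving_piFinSuccAbove
        (fun _ : Fin (l + 1) => σ.restrict (Λ ×ˢ Ioi (0 : ℝ))) i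
      have hae : ∀ᵐ w ∂((σ.restrict (Λ ×ˢ Ioi (0 : ℝ))).prod
          (Measure.pi fun _ : Fin l => σ.restrict (Λ ×ˢ Ioi (0 : ℝ)))),
          w.1.1 ≠ (w.2 j').1 := by
        have hmeas : MeasurableSet {w : (X × ℝ) × (Fin l → X × ℝ) | w.1.1 = (w.2 j').1} :=
          measurableSet_eq_fun (measurable_fst.comp measurable_fst)
            (measurable_fst.comp ((measurable_pi_apply j').comp measurable_snd))
        rw [ae_iff]
        simp only [ne_eq, not_not]
        rw [Measure.prod_apply_symm hmeas]
        refine lintegral_eq_zero_of_ae_eq_zero (Eventually.of_forall fun y => ?_)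
        refine measure_mono_null ?_ (Measure.absolutelyContinuous_of_le Measure.restrict_le_self
          (hσ.noAtom (y j').1))
        intro p hp
        exact ⟨hp, mem_univ _⟩
      have := hp.quasiMeasurePreserving.ae hae
      filter_upwards [this] with z hz _
      exact hz

theorem tupleConfig_of_mem {k : ℕ} {z : Fin k → X × ℝ} (hz : z ∈ goodTuples X k) :
    tupleConfig k z = Config.ofSet (range z) := if_pos hz

/-- The map z ↦ {z₁, …, z_k} may be replaced by its measurable version `tupleConfig`, since the two
agree on good tuples, that is almost everywhere. The law becomes a sum of image measures, against
which functions can be integrated. -/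
theorem IsLevy.map_restrict (hσ : IsLevy σ) {μ : Measure (Config X)} (hμ : IsMarkedPoisson σ μ)
    (hΛo : IsOpen Λ) (hΛ : IsCompact (closure Λ)) :
    μ.map (Config.restrict Λ) =
      ENNReal.ofReal (Real.exp (-(σ (Λ ×ˢ Ioi (0 : ℝ))).toReal)) •
        Measure.sum fun k : ℕ => ENNReal.ofReal (1 / (k.factorial : ℝ)) •
          (Measure.pi fun _ : Fin k => σ.restrict (Λ ×ˢ Ioi (0 : ℝ))).map (tupleConfig k) := by
  ext A hA
  rw [Measure.map_apply (measurable_restrict hΛo.measurableSet) hA]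
  refine (hμ.law Λ hΛo hΛ A hA).trans ?_
  rw [Measure.smul_apply, Measure.sum_apply _ hA, smul_eq_mul]
  congr 1
  refine tsum_congr fun k => ?_
  rw [Measure.smul_apply, smul_eq_mul, Measure.map_apply (measurable_tupleConfig k) hA]
  congr 1
  refine measure_congr ?_
  filter_upwards [hσ.ae_goodTuples hΛ k] with z hz
  change (Config.ofSet (range z) ∈ A) = (tupleConfig k z ∈ A)
  rw [tupleConfig_of_mem hz]

theorem IsLevy.lintegral_restrict (hσ : IsLevy σ) {μ : Measure (Config X)}
    (hμ : IsMarkedPoisson σ μ) (hΛo : IsOpen Λ) (hΛ : IsCompact (closure Λ))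
    {G : Config X → ℝ≥0∞} (hG : Measurable G) :
    ∫⁻ γ, G (γ.restrict Λ) ∂μ =
      ENNReal.ofReal (Real.exp (-(σ (Λ ×ˢ Ioi (0 : ℝ))).toReal)) *
        ∑' k : ℕ, ENNReal.ofReal (1 / (k.factorial : ℝ)) *
          ∫⁻ z, G (tupleConfig k z) ∂(Measure.pi fun _ : Fin k => σ.restrict (Λ ×ˢ Ioi (0 : ℝ))) := by
  rw [← lintegral_map hG (measurable_restrict hΛo.measurableSet), hσ.map_restrict hμ hΛo hΛ,
    lintegral_smul_measure, lintegral_sum_measure, smul_eq_mul]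
  congr 1
  refine tsum_congr fun k => ?_
  rw [lintegral_smul_measure, lintegral_map hG (measurable_tupleConfig k), smul_eq_mul]

/-- Reduces a vanishing integral over configurations to one for each fixed number of particles; it
is the bridge from one-particle integration by parts to the Poisson measure. -/
theorem IsLevy.integral_eq_zero (hσ : IsLevy σ) {μ : Measure (Config X)}
    (hμ : IsMarkedPoisson σ μ) (hΛo : IsOpen Λ) (hΛ : IsCompact (closure Λ))
    {G : Config X → ℝ} (hG : Measurable G) (hGΛ : ∀ γ : Config X, G (γ.restrict Λ) = G γ)
    (hGi : Integrable G μ)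
    (h : ∀ k, ∫ z, G (tupleConfig k z)
      ∂(Measure.pi fun _ : Fin k => σ.restrict (Λ ×ˢ Ioi (0 : ℝ))) = 0) : ∫ γ, G γ ∂μ = 0 := by
  have hr := measurable_restrict hΛo.measurableSet
  have h1 : ∫ γ, G γ ∂μ = ∫ γ, G γ ∂(μ.map (Config.restrict Λ)) := by
    rw [integral_map hr.aemeasurable hG.aestronglyMeasurable]
    simp_rw [hGΛ]
  have h2 : Integrable G (μ.map (Config.restrict Λ)) := by
    rw [integrable_map_measure hG.aestronglyMeasurable hr.aemeasurable]
    refine hGi.congr (Eventually.of_forall fun γ => (hGΛ γ).symm)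
  rw [h1]
  rw [hσ.map_restrict hμ hΛo hΛ] at h2 ⊢
  rw [integrable_smul_measure (by simp [Real.exp_pos]) (by simp)] at h2
  rw [integral_smul_measure, integral_sum_measure h2]
  have : ∀ k : ℕ, ∫ γ, G γ ∂(ENNReal.ofReal (1 / (k.factorial : ℝ)) •
      (Measure.pi fun _ : Fin k => σ.restrict (Λ ×ˢ Ioi (0 : ℝ))).map (tupleConfig k)) = 0 := by
    intro k
    rw [integral_smul_measure, integral_map (measurable_tupleConfig k).aemeasurable
      hG.aestronglyMeasurable, h k, smul_zero]
  simp_rw [this]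
  simp

end Law

/-! ### Moments of pairings -/

section Moments

variable {X : Type*} [TopologicalSpace X] [T2Space X] [SecondCountableTopology X]
  [LocallyCompactSpace X] [MeasurableSpace X] [BorelSpace X]
  {σ : Measure (X × ℝ)} {Λ : Set X}

/-- The i-th marginal of ν^{⊗k} is ν(univ)^{k-1} ν. Taking T ≥ 1 allows the cleaner exponent k. -/
theorem lintegral_pi_eval_le {α : Type*} [MeasurableSpace α] (ν : Measure α) [IsFiniteMeasure ν]
    {T : ℝ} (hT : 1 ≤ T) (hν : ν univ ≤ ENNReal.ofReal T) (k : ℕ) (i : Fin k) {f : α → ℝ≥0∞}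
    (hf : Measurable f) :
    ∫⁻ z, f (z i) ∂(Measure.pi fun _ : Fin k => ν) ≤ ENNReal.ofReal (T ^ k) * ∫⁻ p, f p ∂ν := by
  classical
  have h := lintegral_map (μ := Measure.pi fun _ : Fin k => ν) hf (measurable_pi_apply i)
  rw [← h]
  have e := Measure.pi_map_eval (μ := fun _ : Fin k => ν) i
  change Measure.map (fun z : Fin k → α => z i) _ = _ at e
  rw [e, lintegral_smul_measure, smul_eq_mul, Finset.prod_const,
    Finset.card_erase_of_mem (Finset.mem_univ i), Finset.card_univ, Fintype.card_fin]
  gcongr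
  calc ν univ ^ (k - 1) ≤ ENNReal.ofReal T ^ (k - 1) := by gcongr
    _ = ENNReal.ofReal (T ^ (k - 1)) := (ENNReal.ofReal_pow (by linarith) _).symm
    _ ≤ ENNReal.ofReal (T ^ k) := ENNReal.ofReal_le_ofReal (pow_le_pow_right₀ hT (Nat.sub_le _ _))

theorem succ_mul_self_le_four_pow (k : ℕ) : (1 + (k : ℝ)) * k ≤ 4 ^ k := by
  induction k with
  | zero => norm_num
  | succ k ih =>
    push_cast
    rw [pow_succ]
    rcases Nat.eq_zero_or_pos k with rfl | hk
    · norm_num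
    · have : (1 : ℝ) ≤ k := by exact_mod_cast hk
      nlinarith

/-- The weight 1 + N, with N the number of points over Λ, serves two purposes: it bounds squares of
pairings through Cauchy–Schwarz, and products of N with a pairing that need only be integrable. With
k particles the expectation is at most (1 + k) k T^k times the one-particle integral, and the factor
1/k! makes the series converge. -/
theorem IsLevy.exists_lintegral_le (hσ : IsLevy σ) {μ : Measure (Config X)}
    (hμ : IsMarkedPoisson σ μ) (hΛo : IsOpen Λ) (hΛ : IsCompact (closure Λ)) :
    ∃ C : ℝ≥0∞, C ≠ ⊤ ∧ ∀ f : X × ℝ → ℝ≥0∞, Measurable f →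
      (∀ x ∉ Λ, ∀ s : ℝ, 0 < s → f (x, s) = 0) →
      ∫⁻ γ, (1 + lpair ((Λ ×ˢ univ).indicator 1) γ) * lpair f γ ∂μ ≤
        C * ∫⁻ p in Λ ×ˢ Ioi (0 : ℝ), f p ∂σ := by
  have := hσ.isFiniteMeasure hΛ
  set ν := σ.restrict (Λ ×ˢ Ioi (0 : ℝ)) with hν
  obtain ⟨T, hT, hνT⟩ : ∃ T : ℝ, 1 ≤ T ∧ ν univ ≤ ENNReal.ofReal T :=
    ⟨max 1 (ν univ).toReal, le_max_left _ _, by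
      rw [← ENNReal.ofReal_toReal (measure_ne_top ν univ)]
      exact ENNReal.ofReal_le_ofReal (by
        rw [ENNReal.ofReal_toReal (measure_ne_top ν univ)]; exact le_max_right _ _)⟩
  have hsum : Summable fun k : ℕ => (4 * T) ^ k / (k.factorial : ℝ) :=
    Real.summable_pow_div_factorial _
  -- The constant comes from (1 + k) k T^k ≤ (4 T)^k.
  refine ⟨ENNReal.ofReal (Real.exp (-(σ (Λ ×ˢ Ioi (0 : ℝ))).toReal)) *
    ∑' k : ℕ, ENNReal.ofReal ((4 * T) ^ k / (k.factorial : ℝ)),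
    ENNReal.mul_ne_top ENNReal.ofReal_ne_top hsum.tsum_ofReal_ne_top, fun f hf hfΛ => ?_⟩
  have hi : Measurable ((Λ ×ˢ univ).indicator 1 : X × ℝ → ℝ≥0∞) :=
    measurable_one.indicator (hΛo.measurableSet.prod MeasurableSet.univ)
  have hG : Measurable fun γ : Config X =>
      (1 + lpair ((Λ ×ˢ univ).indicator 1) γ) * lpair f γ :=
    (measurable_const.add (measurable_lpair hi)).mul (measurable_lpair hf)
  have hGr : ∀ γ : Config X, (1 + lpair ((Λ ×ˢ univ).indicator 1) γ) * lpair f γ =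
      (1 + lpair ((Λ ×ˢ univ).indicator 1) (γ.restrict Λ)) * lpair f (γ.restrict Λ) := by
    intro γ
    rw [lpair_restrict hΛo.measurableSet hfΛ, lpair_restrict hΛo.measurableSet]
    intro x hx s _
    exact indicator_of_notMem (fun h => hx h.1) _
  rw [lintegral_congr hGr, hσ.lintegral_restrict hμ hΛo hΛ hG, mul_assoc]
  gcongr
  rw [← ENNReal.tsum_mul_right]
  refine ENNReal.tsum_le_tsum fun k => ?_
  have h1 : ∫⁻ z, (1 + lpair ((Λ ×ˢ univ).indicator 1) (tupleConfig k z)) *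
      lpair f (tupleConfig k z) ∂(Measure.pi fun _ : Fin k => ν) ≤
      ∫⁻ z, (1 + (k : ℝ≥0∞)) * ∑ i, f (z i) ∂(Measure.pi fun _ : Fin k => ν) := by
    refine lintegral_mono_ae ?_
    filter_upwards [hσ.ae_goodTuples hΛ k] with z hz
    rw [tupleConfig_of_mem hz, lpair_ofSet_range hz, lpair_ofSet_range hz]
    gcongr
    refine (Finset.sum_le_card_nsmul _ _ 1 fun i _ => ?_).trans (by simp)
    exact indicator_le_self' (fun _ _ => zero_le) _
  have h2 : ∫⁻ z, (1 + (k : ℝ≥0∞)) * ∑ i, f (z i) ∂(Measure.pi fun _ : Fin k => ν) ≤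
      (1 + (k : ℝ≥0∞)) * (k * (ENNReal.ofReal (T ^ k) * ∫⁻ p, f p ∂ν)) := by
    have hfi : ∀ i ∈ (Finset.univ : Finset (Fin k)), Measurable fun z : Fin k → X × ℝ => f (z i) :=
      fun i _ => hf.comp (measurable_pi_apply i)
    rw [lintegral_const_mul _ (Finset.measurable_sum _ hfi), lintegral_finsetSum _ hfi]
    gcongr
    refine (Finset.sum_le_card_nsmul _ _ _ fun i _ =>
      lintegral_pi_eval_le ν hT hνT k i hf).trans (by simp)
  refine (mul_le_mul_right (h1.trans h2) _).trans ?_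
  have h3 : (1 + (k : ℝ≥0∞)) * (k * (ENNReal.ofReal (T ^ k) * ∫⁻ p, f p ∂ν)) =
      ENNReal.ofReal ((1 + k) * k * T ^ k) * ∫⁻ p, f p ∂ν := by
    rw [ENNReal.ofReal_mul (by positivity), ENNReal.ofReal_mul (by positivity),
      ENNReal.ofReal_add (by positivity) (by positivity), ENNReal.ofReal_one,
      ENNReal.ofReal_natCast]
    ring
  rw [h3, ← mul_assoc, ← ENNReal.ofReal_mul (by positivity)]
  gcongr
  rw [div_mul_eq_mul_div, one_mul, mul_pow]
  gcongr
  exact succ_mul_self_le_four_pow k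

theorem exists_isOpen_superset_isCompact_closure {K : Set X} (hK : IsCompact K) :
    ∃ Λ : Set X, IsOpen Λ ∧ IsCompact (closure Λ) ∧ K ⊆ Λ := by
  obtain ⟨U, hU, hKU, hc⟩ := exists_isOpen_superset_and_isCompact_closure hK
  exact ⟨U, hU, hc, hKU⟩

/-- The expected number of points in a σ-null set is zero by the moment bound, first above each
compact set and then over a countable exhaustion. It follows that a pairing depends, almost surely,
only on the σ-class of the function. -/
theorem IsLevy.ae_forall_mem (hσ : IsLevy σ) {μ : Measure (Config X)}
    (hμ : IsMarkedPoisson σ μ) {P : X × ℝ → Prop} (hP : ∀ᵐ p ∂σ, P p) :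
    ∀ᵐ γ ∂μ, ∀ p ∈ γ.1, P p := by
  obtain ⟨N, hPN, hN, hN0⟩ := exists_measurable_superset_of_null (ae_iff.1 hP)
  have key : ∀ k, ∀ᵐ γ ∂μ, ∀ p ∈ γ.1, p.1 ∈ compactCovering X k → p ∉ N := by
    intro k
    obtain ⟨Λ, hΛo, hΛ, hkΛ⟩ :=
      exists_isOpen_superset_isCompact_closure (isCompact_compactCovering X k)
    obtain ⟨C, hC, h⟩ := hσ.exists_lintegral_le hμ hΛo hΛ
    have hm : MeasurableSet (N ∩ Λ ×ˢ univ) := hN.inter (hΛo.measurableSet.prod MeasurableSet.univ)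
    have h0 := h ((N ∩ Λ ×ˢ univ).indicator 1) (measurable_one.indicator hm)
      fun x hx s _ => indicator_of_notMem (fun h => hx h.2.1) _
    rw [lintegral_indicator_one hm, measure_mono_null inter_subset_left
      (Measure.absolutelyContinuous_of_le Measure.restrict_le_self hN0), mul_zero, nonpos_iff_eq_zero] at h0
    have h0 := (lintegral_eq_zero_iff ((measurable_const.add (measurable_lpair (measurable_one.indicator
        (hΛo.measurableSet.prod MeasurableSet.univ)))).mul
        (measurable_lpair (measurable_one.indicator hm)))).1 h0
    filter_upwards [h0] with γ hγ p hp hpk hpN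
    have h1 : lpair ((N ∩ Λ ×ˢ univ).indicator 1) γ = 0 :=
      (mul_eq_zero.1 hγ).resolve_left (by simp)
    rw [lpair, lintegral_indicator_one hm, countMeasure, Measure.restrict_apply hm,
      Measure.count_eq_zero_iff] at h1
    exact (h1 ▸ (⟨⟨hpN, hkΛ hpk, mem_univ _⟩, hp⟩ : p ∈ (N ∩ Λ ×ˢ univ) ∩ γ.1) : p ∈ (∅ : Set _))
  filter_upwards [ae_all_iff.2 key] with γ hγ p hp
  obtain ⟨k, hk⟩ := mem_iUnion.1 ((iUnion_compactCovering X).symm ▸ mem_univ p.1)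
  by_contra hn
  exact hγ k p hp hk (hPN hn)

theorem IsLevy.pairing_ae_eq (hσ : IsLevy σ) {μ : Measure (Config X)}
    (hμ : IsMarkedPoisson σ μ) {f g : X × ℝ → ℝ} (h : f =ᵐ[σ] g) :
    (pairing f : Config X → ℝ) =ᵐ[μ] pairing g := by
  filter_upwards [hσ.ae_forall_mem hμ h] with γ hγ
  exact finsum_mem_congr rfl hγ

theorem IsLevy.lintegral_lpair_lt_top (hσ : IsLevy σ) {μ : Measure (Config X)}
    (hμ : IsMarkedPoisson σ μ) {K : Set X} (hK : IsCompact K) {f : X × ℝ → ℝ≥0∞}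
    (hf : Measurable f) (hfK : ∀ x ∉ K, ∀ s : ℝ, 0 < s → f (x, s) = 0)
    (hfi : ∫⁻ p, f p ∂σ < ⊤) :
    ∫⁻ γ, (1 + lpair ((K ×ˢ univ).indicator 1) γ) * lpair f γ ∂μ < ⊤ := by
  obtain ⟨Λ, hΛo, hΛ, hkΛ⟩ := exists_isOpen_superset_isCompact_closure hK
  obtain ⟨C, hC, h⟩ := hσ.exists_lintegral_le hμ hΛo hΛ
  refine (lintegral_mono fun γ => ?_).trans_lt ((h f hf fun x hx => hfK x fun h => hx (hkΛ h)).trans_lt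
    (ENNReal.mul_lt_top hC.lt_top ((setLIntegral_le_lintegral _ _).trans_lt hfi)))
  refine mul_le_mul_left (add_le_add le_rfl (lpair_mono fun p _ => ?_)) _
  exact indicator_le_indicator_of_subset (Set.prod_mono hkΛ le_rfl) (fun _ => zero_le) _

variable {K : Set X} {f : X × ℝ → ℝ}

theorem pairing_indicator (f : X × ℝ → ℝ) (γ : Config X) :
    pairing ((univ ×ˢ Ioi (0 : ℝ)).indicator f) γ = pairing f γ :=
  finsum_mem_congr rfl fun p hp =>
    indicator_of_mem (s := univ ×ˢ Ioi (0 : ℝ)) ⟨mem_univ _, γ.pos hp⟩ f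

theorem lpair_indicator_one_eq (hK : IsCompact K) (γ : Config X) :
    lpair ((K ×ˢ univ).indicator 1) γ = ((γ.pts hK).card : ℝ≥0∞) := by
  rw [lpair_eq_sum hK fun x hx s _ => indicator_of_notMem (fun h => hx h.1) _,
    Finset.card_eq_sum_ones, Nat.cast_sum]
  refine Finset.sum_congr rfl fun p hp => ?_
  rw [indicator_of_mem (s := K ×ˢ univ) ⟨(Config.mem_pts.1 hp).2, mem_univ _⟩]
  simp

theorem lintegral_ofReal_abs_lt_top {α : Type*} [MeasurableSpace α] {ν : Measure α} {g : α → ℝ}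
    (hg : Integrable g ν) : ∫⁻ p, ENNReal.ofReal |g p| ∂ν < ⊤ := by
  have := hg.2
  rw [hasFiniteIntegral_iff_norm] at this
  exact this

/-- Cauchy–Schwarz: the square of a sum over N points is at most N times the sum of squares, which
is a quantity controlled by the weighted moment bound. -/
theorem IsLevy.memLp_pairing (hσ : IsLevy σ) {μ : Measure (Config X)}
    (hμ : IsMarkedPoisson σ μ) (hK : IsCompact K) (hf : SuppIn K f)
    (hm : Measurable ((univ ×ˢ Ioi (0 : ℝ)).indicator f)) (hi : Integrable (fun p => f p ^ 2) σ) :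
    MemLp (pairing f : Config X → ℝ) 2 μ := by
  have hmeas := measurable_pairing hK hf hm
  rw [memLp_two_iff_integrable_sq hmeas.aestronglyMeasurable]
  refine ⟨(hmeas.pow_const 2).aestronglyMeasurable, ?_⟩
  set g := (univ ×ˢ Ioi (0 : ℝ)).indicator f with hg
  have hgf : ∀ p : X × ℝ, 0 < p.2 → g p = f p := fun p hp =>
    indicator_of_mem (s := univ ×ˢ Ioi (0 : ℝ)) ⟨mem_univ _, hp⟩ f
  have hgs : SuppIn K g := fun x hx s hs => by rw [hgf (x, s) hs, hf x hx s hs]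
  have hgi : Integrable (fun p => g p ^ 2) σ :=
    hi.congr (hσ.pos.mono fun p hp => by simp only [hgf p hp])
  rw [hasFiniteIntegral_iff_norm]
  refine (lintegral_mono fun γ => ?_).trans_lt (hσ.lintegral_lpair_lt_top hμ hK
    (f := fun p => ENNReal.ofReal (|g p ^ 2|)) (by fun_prop)
    (fun x hx s hs => by simp [hgs x hx s hs]) (lintegral_ofReal_abs_lt_top hgi))
  refine le_trans ?_ (mul_le_mul_left (le_add_of_nonneg_left (zero_le)) _)
  have hs : SuppIn K fun p => |g p ^ 2| := fun x hx s hs => by simp [hgs x hx s hs]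
  rw [lpair_ofReal hK hs (fun p _ => abs_nonneg _), ← pairing_indicator f,
    lpair_indicator_one_eq hK, pairing_eq_sum hK hgs, pairing_eq_sum hK hs, Real.norm_eq_abs,
    ← ENNReal.ofReal_natCast, ← ENNReal.ofReal_mul (Nat.cast_nonneg _), abs_of_nonneg (sq_nonneg _)]
  refine ENNReal.ofReal_le_ofReal ?_
  simp_rw [abs_sq]
  exact sq_sum_le_card_mul_sum_sq

end Moments

/-! ### The density of the Riemannian volume -/

section Volume

variable {n : ℕ} {X : Type*} [TopologicalSpace X] [ChartedSpace (EuclideanSpace ℝ (Fin n)) X]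
  [IsManifold (𝓡 n) ∞ X] [Bundle.RiemannianBundle (fun x : X => TangentSpace (𝓡 n) x)]

theorem mfderiv_extChartAt_symm_injective (x₀ : X) {y : EuclideanSpace ℝ (Fin n)}
    (hy : y ∈ (extChartAt (𝓡 n) x₀).target) :
    Function.Injective (mfderiv 𝓘(ℝ, EuclideanSpace ℝ (Fin n)) (𝓡 n)
      (extChartAt (𝓡 n) x₀).symm y) := by
  have h := mfderiv_extChartAt_comp_mfderivWithin_extChartAt_symm (I := 𝓡 n) hy
  rw [(𝓡 n).range_eq_univ, mfderivWithin_univ] at h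
  exact Function.LeftInverse.injective fun w => congrArg (fun L => L w) h

theorem linearIndependent_coordVec (x₀ : X) {y : EuclideanSpace ℝ (Fin n)}
    (hy : y ∈ (extChartAt (𝓡 n) x₀).target) : LinearIndependent ℝ (coordVec x₀ y) := by
  have h1 : LinearIndependent ℝ fun i : Fin n => (EuclideanSpace.single i (1 : ℝ)) := by
    have := (EuclideanSpace.basisFun (Fin n) ℝ).toBasis.linearIndependent
    have e : (⇑(EuclideanSpace.basisFun (Fin n) ℝ).toBasis : Fin n → EuclideanSpace ℝ (Fin n)) =
        fun i => EuclideanSpace.single i (1 : ℝ) := by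
      funext i
      simp
    rwa [e] at this
  exact h1.map' (mfderiv 𝓘(ℝ, EuclideanSpace ℝ (Fin n)) (𝓡 n)
      (extChartAt (𝓡 n) x₀).symm y).toLinearMap
    (LinearMap.ker_eq_bot.2 (mfderiv_extChartAt_symm_injective x₀ hy))

theorem det_gram_pos {E : Type*} [NormedAddCommGroup E] [InnerProductSpace ℝ E] {c : Fin n → E}
    (hc : LinearIndependent ℝ c) :
    0 < Matrix.det (Matrix.of fun i j : Fin n => (inner ℝ (c i) (c j) : ℝ)) :=
  (Matrix.posDef_gram_of_linearIndependent (𝕜 := ℝ) hc).det_pos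

theorem det_gram_coordVec_pos (x₀ : X) {y : EuclideanSpace ℝ (Fin n)}
    (hy : y ∈ (extChartAt (𝓡 n) x₀).target) :
    0 < Matrix.det (Matrix.of fun i j : Fin n =>
      (inner ℝ (coordVec x₀ y i) (coordVec x₀ y j) : ℝ)) :=
  det_gram_pos (E := TangentSpace (𝓡 n) ((extChartAt (𝓡 n) x₀).symm y))
    (linearIndependent_coordVec x₀ hy)

theorem volDensity_pos (x₀ : X) {y : EuclideanSpace ℝ (Fin n)}
    (hy : y ∈ (extChartAt (𝓡 n) x₀).target) : 0 < volDensity x₀ y :=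
  Real.sqrt_pos.2 (det_gram_coordVec_pos x₀ hy)

/-- The coordinate field is the image of a constant field under the tangent map of the inverse
chart. -/
theorem contMDiffOn_coordVec (x₀ : X) (i : Fin n) :
    ContMDiffOn 𝓘(ℝ, EuclideanSpace ℝ (Fin n)) (𝓡 n).tangent ∞
      (fun y => (⟨(extChartAt (𝓡 n) x₀).symm y, coordVec x₀ y i⟩ : TangentBundle (𝓡 n) X))
      (extChartAt (𝓡 n) x₀).target := by
  have ho : IsOpen (extChartAt (𝓡 n) x₀).target := isOpen_extChartAt_target x₀
  have h1 := (contMDiffOn_extChartAt_symm (I := 𝓡 n) (n := ∞) x₀).contMDiffOn_tangentMapWithin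
    (m := ∞) (by exact_mod_cast le_top) ho.uniqueMDiffOn
  have h2 : ContMDiffOn 𝓘(ℝ, EuclideanSpace ℝ (Fin n)) 𝓘(ℝ, EuclideanSpace ℝ (Fin n)).tangent ∞
      (fun y => (⟨y, EuclideanSpace.single i (1 : ℝ)⟩ :
        TangentBundle 𝓘(ℝ, EuclideanSpace ℝ (Fin n)) (EuclideanSpace ℝ (Fin n))))
      (extChartAt (𝓡 n) x₀).target :=
    contMDiffOn_vectorSpace_iff_contDiffOn.2 contDiffOn_const
  refine (h1.comp h2 fun y hy => hy).congr fun y hy => ?_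
  have e := mfderivWithin_of_mem_nhds (I := 𝓘(ℝ, EuclideanSpace ℝ (Fin n))) (I' := 𝓡 n)
    (f := (extChartAt (𝓡 n) x₀).symm) (ho.mem_nhds hy)
  simp only [Function.comp_apply, tangentMapWithin, coordVec]
  rw [e]

variable [IsContMDiffRiemannianBundle (𝓡 n) ∞ (EuclideanSpace ℝ (Fin n))
      (fun x : X => TangentSpace (𝓡 n) x)]

/-- The Gram determinant is a polynomial in smooth inner products, and it is positive, so its square
root is smooth. -/
theorem contDiffOn_volDensity (x₀ : X) :
    ContDiffOn ℝ ∞ (volDensity x₀) (extChartAt (𝓡 n) x₀).target := by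
  have h : ∀ i j : Fin n, ContDiffOn ℝ ∞
      (fun y => (inner ℝ (coordVec x₀ y i) (coordVec x₀ y j) : ℝ)) (extChartAt (𝓡 n) x₀).target := by
    intro i j
    rw [← contMDiffOn_iff_contDiffOn]
    exact (contMDiffOn_coordVec x₀ i).inner_bundle (contMDiffOn_coordVec x₀ j)
  have hd : ContDiffOn ℝ ∞ (fun y => Matrix.det (Matrix.of fun i j : Fin n =>
      (inner ℝ (coordVec x₀ y i) (coordVec x₀ y j) : ℝ))) (extChartAt (𝓡 n) x₀).target := by
    simp only [Matrix.det_apply']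
    refine ContDiffOn.sum fun s _ => contDiffOn_const.mul (contDiffOn_prod fun i _ => h _ _)
  exact hd.sqrt fun y hy => (det_gram_coordVec_pos x₀ hy).ne'

variable [MeasurableSpace X] [BorelSpace X] {m : Measure X}

theorem image_extChartAt_inter (x₀ : X) (A : Set X) :
    extChartAt (𝓡 n) x₀ '' (A ∩ (extChartAt (𝓡 n) x₀).source) =
      (extChartAt (𝓡 n) x₀).symm ⁻¹' A ∩ (extChartAt (𝓡 n) x₀).target := by
  rw [inter_comm, (extChartAt (𝓡 n) x₀).image_source_inter_eq', inter_comm]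

/-- The Riemannian volume in the chart at `x₀`. -/
def chartMeasure (x₀ : X) : Measure (EuclideanSpace ℝ (Fin n)) :=
  (volume.restrict (extChartAt (𝓡 n) x₀).target).withDensity
    fun y => ENNReal.ofReal (volDensity x₀ y)

theorem aemeasurable_extChartAt_symm (x₀ : X) :
    AEMeasurable (extChartAt (𝓡 n) x₀).symm (chartMeasure x₀) :=
  ((continuousOn_extChartAt_symm x₀).aemeasurable
    (isOpen_extChartAt_target x₀).measurableSet).mono_ac (withDensity_absolutelyContinuous _ _)

theorem aemeasurable_volDensity (x₀ : X) :
    AEMeasurable (fun y => ENNReal.ofReal (volDensity x₀ y))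
      (volume.restrict (extChartAt (𝓡 n) x₀).target) :=
  ((contDiffOn_volDensity x₀).continuousOn.aemeasurable
    (isOpen_extChartAt_target x₀).measurableSet).ennreal_ofReal

theorem IsRiemannianVolume.restrict_source (hm : IsRiemannianVolume n m) (x₀ : X) :
    m.restrict (extChartAt (𝓡 n) x₀).source =
      (chartMeasure x₀).map (extChartAt (𝓡 n) x₀).symm := by
  ext A hA
  have hs : MeasurableSet (extChartAt (𝓡 n) x₀).source := (isOpen_extChartAt_source x₀).measurableSet
  have ht : MeasurableSet (extChartAt (𝓡 n) x₀).target := (isOpen_extChartAt_target x₀).measurableSet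
  rw [Measure.restrict_apply hA, hm x₀ _ (hA.inter hs) inter_subset_right,
    Measure.map_apply_of_aemeasurable (aemeasurable_extChartAt_symm x₀) hA, chartMeasure,
    withDensity_apply', Measure.restrict_restrict' ht, image_extChartAt_inter]

theorem IsRiemannianVolume.isLocallyFiniteMeasure [LocallyCompactSpace X] [T2Space X]
    (hm : IsRiemannianVolume n m) : IsLocallyFiniteMeasure m := by
  refine ⟨fun x => ?_⟩
  obtain ⟨K, hKx, hKs, hK⟩ := local_compact_nhds (extChartAt_source_mem_nhds (I := 𝓡 n) x)
  refine ⟨K, hKx, ?_⟩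
  rw [hm x K hK.measurableSet hKs]
  have hKc : IsCompact (extChartAt (𝓡 n) x '' K) :=
    hK.image_of_continuousOn ((continuousOn_extChartAt x).mono hKs)
  have hsub : extChartAt (𝓡 n) x '' K ⊆ (extChartAt (𝓡 n) x).target := by
    rintro _ ⟨z, hz, rfl⟩
    exact (extChartAt (𝓡 n) x).map_source (hKs hz)
  have hi : IntegrableOn (volDensity x) (extChartAt (𝓡 n) x '' K) :=
    ((contDiffOn_volDensity x).continuousOn.mono hsub).integrableOn_compact hKc
  exact hi.lintegral_lt_top

theorem IsRiemannianVolume.isOpenPosMeasure (hm : IsRiemannianVolume n m) : m.IsOpenPosMeasure := by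
  refine ⟨fun U hU ⟨x, hx⟩ h0 => ?_⟩
  have h1 : m (U ∩ (extChartAt (𝓡 n) x).source) = 0 := measure_mono_null inter_subset_left h0
  rw [hm x _ (hU.inter (isOpen_extChartAt_source x)).measurableSet inter_subset_right,
    image_extChartAt_inter, inter_comm] at h1
  have hVo : IsOpen ((extChartAt (𝓡 n) x).target ∩ (extChartAt (𝓡 n) x).symm ⁻¹' U) :=
    (continuousOn_extChartAt_symm x).isOpen_inter_preimage (isOpen_extChartAt_target x) hU
  have hsub : (extChartAt (𝓡 n) x).target ∩ (extChartAt (𝓡 n) x).symm ⁻¹' U ⊆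
    (extChartAt (𝓡 n) x).target := inter_subset_left
  have h2 := (setLIntegral_eq_zero_iff' hVo.measurableSet
    ((aemeasurable_volDensity x).mono_measure (Measure.restrict_mono hsub le_rfl))).1 h1
  have h3 : volume ((extChartAt (𝓡 n) x).target ∩ (extChartAt (𝓡 n) x).symm ⁻¹' U) = 0 := by
    refine measure_mono_null (fun y hy => ?_) (ae_iff.1 h2)
    simp only [Classical.not_imp, ENNReal.ofReal_eq_zero, not_le, Set.mem_ofPred_eq]
    exact ⟨hy, volDensity_pos x (hsub hy)⟩
  refine hVo.measure_ne_zero volume ⟨extChartAt (𝓡 n) x x, mem_extChartAt_target x, ?_⟩ h3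
  rw [mem_preimage, extChartAt_to_inv]
  exact hx

/-- In positive dimension a point has Lebesgue measure zero in a chart. In dimension zero points are
open, so a connected manifold is one point and compact, which is excluded. -/
theorem IsRiemannianVolume.measure_singleton [T1Space X] [ConnectedSpace X] [NoncompactSpace X]
    (hm : IsRiemannianVolume n m) (x : X) : m {x} = 0 := by
  rcases Nat.eq_zero_or_pos n with rfl | hn
  · exfalso
    have ho : IsOpen ({x} : Set X) := by
      have : (chartAt (EuclideanSpace ℝ (Fin 0)) x).source = {x} := by
        refine Subset.antisymm (fun z hz => ?_) (singleton_subset_iff.2 (mem_chart_source _ x))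
        exact (chartAt (EuclideanSpace ℝ (Fin 0)) x).injOn hz (mem_chart_source _ x)
          (Subsingleton.elim _ _)
      rw [← this]
      exact (chartAt (EuclideanSpace ℝ (Fin 0)) x).open_source
    have : ({x} : Set X) = univ := IsClopen.eq_univ ⟨isClosed_singleton, ho⟩ (singleton_nonempty x)
    exact noncompact_univ X (this ▸ isCompact_singleton)
  · have : Nonempty (Fin n) := ⟨⟨0, hn⟩⟩
    rw [hm x _ (measurableSet_singleton x) (singleton_subset_iff.2 (mem_extChartAt_source x)),
      image_singleton]
    exact setLIntegral_measure_zero _ _ (by simp)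

end Volume

/-! ### The divergence theorem -/

section Divergence

theorem contDiff_of_contDiffOn_of_eq_zero {E F : Type*} [NormedAddCommGroup E] [NormedSpace ℝ E]
    [NormedAddCommGroup F] [NormedSpace ℝ F] {k : WithTop ℕ∞} {f : E → F} {T K : Set E} (hT : IsOpen T)
    (hK : IsClosed K) (hKT : K ⊆ T) (hf : ContDiffOn ℝ k f T) (h0 : ∀ x ∉ K, f x = 0) :
    ContDiff ℝ k f := by
  rw [contDiff_iff_contDiffAt]
  intro x
  by_cases hx : x ∈ T
  · exact hf.contDiffAt (hT.mem_nhds hx)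
  · refine (contDiffAt_const (c := 0)).congr_of_eventuallyEq ?_
    filter_upwards [hK.isOpen_compl.mem_nhds fun h => hx (hKT h)] with y hy using h0 y hy

theorem continuous_of_continuousOn_of_eq_zero {E F : Type*} [TopologicalSpace E]
    [TopologicalSpace F] [Zero F] {f : E → F} {T K : Set E} (hT : IsOpen T)
    (hK : IsClosed K) (hKT : K ⊆ T) (hf : ContinuousOn f T) (h0 : ∀ x ∉ K, f x = 0) :
    Continuous f := by
  rw [continuous_iff_continuousAt]
  intro x
  by_cases hx : x ∈ T
  · exact hf.continuousAt (hT.mem_nhds hx)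
  · refine (continuousAt_const (y := 0)).congr_of_eventuallyEq ?_
    filter_upwards [hK.isOpen_compl.mem_nhds fun h => hx (hKT h)] with y hy using h0 y hy

theorem integral_fderiv_apply_eq_zero {E : Type*} [NormedAddCommGroup E] [NormedSpace ℝ E]
    [FiniteDimensional ℝ E] [MeasurableSpace E] [BorelSpace E] {ν : Measure E}
    [ν.IsAddHaarMeasure] {u : E → ℝ} (hu : ContDiff ℝ 1 u) (hc : HasCompactSupport u) (w : E) :
    ∫ y, fderiv ℝ u y w ∂ν = 0 := by
  have h1 : Integrable (fun y => fderiv ℝ u y w) ν :=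
    ((hu.continuous_fderiv one_ne_zero).clm_apply continuous_const).integrable_of_hasCompactSupport
      (hc.fderiv_apply ℝ w)
  have h2 : Integrable u ν := hu.continuous.integrable_of_hasCompactSupport hc
  have := integral_mul_fderiv_eq_neg_fderiv_mul_of_integrable (μ := ν) (f := fun _ : E => (1 : ℝ))
    (g := u) (v := w) (by simp) (by simpa using h1) (by simpa using h2)
    (fun _ _ => differentiableAt_const _) (fun x _ => hu.differentiable one_ne_zero x)
  simpa using this

/-- The integrand is Σ_i ∂_i (g W_i). Each g W_i, extended by zero outside T, is C¹ with compact
support in the whole space, and so its derivatives integrate to zero. -/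
theorem integral_fderiv_mul_add_mul_fderiv {E ι : Type*} [NormedAddCommGroup E] [NormedSpace ℝ E]
    [FiniteDimensional ℝ E] [MeasurableSpace E] [BorelSpace E] {ν : Measure E}
    [ν.IsAddHaarMeasure] [Fintype ι] {T K : Set E} (hT : IsOpen T) (hK : IsCompact K) (hKT : K ⊆ T)
    {g : E → ℝ} (hg : ContDiffOn ℝ 1 g T) (hgK : ∀ y ∈ T, y ∉ K → g y = 0)
    {W : ι → E → ℝ} (hW : ∀ i, ContDiffOn ℝ 1 (W i) T) (e : ι → E) :
    ∫ y in T, (fderiv ℝ g y (∑ i, W i y • e i) + g y * ∑ i, fderiv ℝ (W i) y (e i)) ∂ν = 0 := by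
  have hu : ∀ i, ContDiff ℝ 1 (T.indicator fun y => g y * W i y) := fun i => by
    refine contDiff_of_contDiffOn_of_eq_zero hT hK.isClosed hKT
      ((hg.mul (hW i)).congr fun y hy => indicator_of_mem hy _) fun y hy => ?_
    by_cases h : y ∈ T
    · rw [indicator_of_mem h, hgK y h hy, zero_mul]
    · exact indicator_of_notMem h _
  have hc : ∀ i, HasCompactSupport (T.indicator fun y => g y * W i y) := fun i => by
    refine HasCompactSupport.intro hK fun y hy => ?_
    by_cases h : y ∈ T
    · rw [indicator_of_mem h, hgK y h hy, zero_mul]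
    · exact indicator_of_notMem h _
  have h0 : ∀ i, ∀ y ∉ T, fderiv ℝ (T.indicator fun y => g y * W i y) y (e i) = 0 := by
    intro i y hy
    have : (T.indicator fun y => g y * W i y) =ᶠ[𝓝 y] fun _ => 0 := by
      filter_upwards [hK.isClosed.isOpen_compl.mem_nhds fun h => hy (hKT h)] with z hz
      by_cases h : z ∈ T
      · rw [indicator_of_mem h, hgK z h hz, zero_mul]
      · exact indicator_of_notMem h _
    rw [this.fderiv_eq]
    simp
  have h1 : ∀ i, ∫ y in T, fderiv ℝ (T.indicator fun y => g y * W i y) y (e i) ∂ν = 0 := fun i => by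
    rw [setIntegral_eq_integral_of_forall_compl_eq_zero (h0 i)]
    exact integral_fderiv_apply_eq_zero (hu i) (hc i) _
  have hi : ∀ i, Integrable (fun y => fderiv ℝ (T.indicator fun y => g y * W i y) y (e i))
      (ν.restrict T) := fun i =>
    ((((hu i).continuous_fderiv one_ne_zero).clm_apply
      continuous_const).integrable_of_hasCompactSupport ((hc i).fderiv_apply ℝ _)).restrict
  calc ∫ y in T, (fderiv ℝ g y (∑ i, W i y • e i) + g y * ∑ i, fderiv ℝ (W i) y (e i)) ∂ν
      = ∫ y in T, ∑ i, fderiv ℝ (T.indicator fun y => g y * W i y) y (e i) ∂ν := by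
        refine setIntegral_congr_fun hT.measurableSet fun y hy => ?_
        have hgd : DifferentiableAt ℝ g y :=
          (hg.contDiffAt (hT.mem_nhds hy)).differentiableAt one_ne_zero
        have e1 : ∀ i, fderiv ℝ (T.indicator fun y => g y * W i y) y (e i) =
            W i y * fderiv ℝ g y (e i) + g y * fderiv ℝ (W i) y (e i) := by
          intro i
          have hWd : DifferentiableAt ℝ (W i) y :=
            ((hW i).contDiffAt (hT.mem_nhds hy)).differentiableAt one_ne_zero
          have : (T.indicator fun y => g y * W i y) =ᶠ[𝓝 y] fun y => g y * W i y := by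
            filter_upwards [hT.mem_nhds hy] with z hz using indicator_of_mem hz _
          rw [this.fderiv_eq, fderiv_fun_mul hgd hWd]
          simp [add_comm]
        simp only [e1, Finset.sum_add_distrib, map_sum, map_smul, smul_eq_mul, Finset.mul_sum]
    _ = ∑ i, ∫ y in T, fderiv ℝ (T.indicator fun y => g y * W i y) y (e i) ∂ν :=
        integral_finsetSum _ fun i _ => hi i
    _ = 0 := Finset.sum_eq_zero fun i _ => h1 i

variable {n : ℕ} {X : Type*} [TopologicalSpace X] [ChartedSpace (EuclideanSpace ℝ (Fin n)) X]
  [IsManifold (𝓡 n) ∞ X]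

theorem continuous_along {v : (x : X) → TangentSpace (𝓡 n) x} {g : X → ℝ}
    (hv : ContMDiff (𝓡 n) (𝓡 n).tangent ∞ (fun x => (⟨x, v x⟩ : TangentBundle (𝓡 n) X)))
    (hg : ContMDiff (𝓡 n) 𝓘(ℝ, ℝ) 1 g) : Continuous (along v g) := by
  have h1 : Smooth n 1 (fun p : X × ℝ => g p.1) := (hg.comp contMDiff_fst).contMDiffOn
  have h2 := h1.dirDerivXR (k := 0) (m := 1) (by exact_mod_cast le_top) (by simp) hv
    (contMDiff_const (c := (0 : ℝ)))
  have h3 : ContinuousOn (fun x => dirDerivXR v (fun _ => 0) (fun p : X × ℝ => g p.1) (x, 1)) univ :=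
    h2.continuousOn.comp (by fun_prop) fun x _ => ⟨mem_univ _, show (0 : ℝ) < 1 from zero_lt_one⟩
  rw [continuousOn_univ] at h3
  refine h3.congr fun x => ?_
  simp [dirDerivXR]

theorem along_eq_zero_of_eventuallyEq (v : (x : X) → TangentSpace (𝓡 n) x) {g : X → ℝ} {x : X}
    (h : g =ᶠ[𝓝 x] fun _ => 0) : along v g x = 0 := by
  have : mfderiv (𝓡 n) 𝓘(ℝ, ℝ) g x = 0 := by
    rw [h.mfderiv_eq]; exact mfderiv_const
  exact congrArg (fun L => L (v x)) this

theorem along_add (v : (x : X) → TangentSpace (𝓡 n) x) {f g : X → ℝ} {x : X}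
    (hf : ContMDiff (𝓡 n) 𝓘(ℝ, ℝ) 1 f) (hg : ContMDiff (𝓡 n) 𝓘(ℝ, ℝ) 1 g) :
    along v (fun x => f x + g x) x = along v f x + along v g x :=
  congrArg (fun L => L (v x)) (mfderiv_add ((hf x).mdifferentiableAt one_ne_zero)
    ((hg x).mdifferentiableAt one_ne_zero))

variable [Bundle.RiemannianBundle (fun x : X => TangentSpace (𝓡 n) x)]

/-- The divergence of `v`, computed in the chart at `x₀`. -/
def chartDiv (x₀ : X) (v : (x : X) → TangentSpace (𝓡 n) x) (y : EuclideanSpace ℝ (Fin n)) : ℝ :=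
  (volDensity x₀ y)⁻¹ *
    ∑ i : Fin n, fderiv ℝ (fun y => volDensity x₀ y * coordField x₀ v y i) y
      (EuclideanSpace.single i (1 : ℝ))

variable [IsContMDiffRiemannianBundle (𝓡 n) ∞ (EuclideanSpace ℝ (Fin n))
      (fun x : X => TangentSpace (𝓡 n) x)]
  {v : (x : X) → TangentSpace (𝓡 n) x}

theorem contDiffOn_volDensity_mul_coordField (hv : IsField v) (x₀ : X) (i : Fin n) :
    ContDiffOn ℝ ∞ (fun y => volDensity x₀ y * coordField x₀ v y i)
      (extChartAt (𝓡 n) x₀).target := by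
  refine (contDiffOn_volDensity x₀).mul ?_
  exact ((EuclideanSpace.proj i : EuclideanSpace ℝ (Fin n) →L[ℝ] ℝ).contDiff).comp_contDiffOn
    (contDiffOn_coordField hv.1 x₀)

theorem continuousOn_chartDiv (hv : IsField v) (x₀ : X) :
    ContinuousOn (chartDiv x₀ v) (extChartAt (𝓡 n) x₀).target := by
  refine ((contDiffOn_volDensity x₀).continuousOn.inv₀ fun y hy => (volDensity_pos x₀ hy).ne').mul
    (continuousOn_finsetSum _ fun i _ => ?_)
  exact ((contDiffOn_volDensity_mul_coordField hv x₀ i).continuousOn_fderiv_of_isOpen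
    (isOpen_extChartAt_target x₀) (by exact_mod_cast le_top)).clm_apply continuousOn_const

theorem continuousOn_chartDiv_comp (hv : IsField v) (x₀ : X) :
    ContinuousOn (fun x => chartDiv x₀ v (extChartAt (𝓡 n) x₀ x)) (extChartAt (𝓡 n) x₀).source :=
  (continuousOn_chartDiv hv x₀).comp (continuousOn_extChartAt x₀)
    fun x hx => (extChartAt (𝓡 n) x₀).map_source hx

variable [T2Space X] [LocallyCompactSpace X] [SecondCountableTopology X]
  [MeasurableSpace X] [BorelSpace X] {m : Measure X}

theorem continuous_mul_chartDiv (hv : IsField v) (x₀ : X) {g : X → ℝ} (hg : Continuous g)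
    {K : Set X} (hK : IsCompact K) (hKs : K ⊆ (extChartAt (𝓡 n) x₀).source)
    (hgK : ∀ x ∉ K, g x = 0) :
    Continuous fun x => g x * chartDiv x₀ v (extChartAt (𝓡 n) x₀ x) :=
  continuous_of_continuousOn_of_eq_zero (isOpen_extChartAt_source x₀) hK.isClosed hKs
    (hg.continuousOn.mul (continuousOn_chartDiv_comp hv x₀)) fun x hx => by rw [hgK x hx, zero_mul]

/-- With G the volume density, (∇_v g + g div v) G = Σ_i ∂_i (g G vⁱ) in coordinates, and this has
integral zero. -/
theorem integral_along_add_mul_chartDiv (hm : IsRiemannianVolume n m) (hv : IsField v) (x₀ : X)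
    {g : X → ℝ} (hg : ContMDiff (𝓡 n) 𝓘(ℝ, ℝ) 1 g) {K : Set X} (hK : IsCompact K)
    (hKs : K ⊆ (extChartAt (𝓡 n) x₀).source) (hgK : ∀ x ∉ K, g x = 0) :
    ∫ x, (along v g x + g x * chartDiv x₀ v (extChartAt (𝓡 n) x₀ x)) ∂m = 0 := by
  have hcont : Continuous fun x => along v g x + g x * chartDiv x₀ v (extChartAt (𝓡 n) x₀ x) :=
    (continuous_along hv.1 hg).add (continuous_mul_chartDiv hv x₀ hg.continuous hK hKs hgK)
  have h0 : ∀ x ∉ (extChartAt (𝓡 n) x₀).source,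
      along v g x + g x * chartDiv x₀ v (extChartAt (𝓡 n) x₀ x) = 0 := by
    intro x hx
    rw [along_eq_zero_of_eventuallyEq, hgK x fun h => hx (hKs h), zero_mul, zero_add]
    filter_upwards [hK.isClosed.isOpen_compl.mem_nhds fun h => hx (hKs h)] with y hy using hgK y hy
  have ht := (isOpen_extChartAt_target (I := 𝓡 n) x₀)
  rw [← setIntegral_eq_integral_of_forall_compl_eq_zero h0, hm.restrict_source x₀,
    integral_map (aemeasurable_extChartAt_symm x₀) hcont.aestronglyMeasurable, chartMeasure,
    integral_withDensity_eq_integral_toReal_smul₀ (aemeasurable_volDensity x₀)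
      (Eventually.of_forall fun _ => ENNReal.ofReal_lt_top)]
  have hgc : ContDiffOn ℝ 1 (g ∘ (extChartAt (𝓡 n) x₀).symm) (extChartAt (𝓡 n) x₀).target := by
    rw [← contMDiffOn_iff_contDiffOn]
    exact hg.comp_contMDiffOn ((contMDiffOn_extChartAt_symm (I := 𝓡 n) (n := ∞) x₀).of_le
      (by exact_mod_cast le_top))
  have hKc : IsCompact (extChartAt (𝓡 n) x₀ '' K) :=
    hK.image_of_continuousOn ((continuousOn_extChartAt x₀).mono hKs)
  have hsub : extChartAt (𝓡 n) x₀ '' K ⊆ (extChartAt (𝓡 n) x₀).target := by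
    rintro _ ⟨z, hz, rfl⟩
    exact (extChartAt (𝓡 n) x₀).map_source (hKs hz)
  refine Eq.trans (setIntegral_congr_fun ht.measurableSet fun y hy => ?_)
    (integral_fderiv_mul_add_mul_fderiv (ν := volume) ht hKc hsub hgc (fun y hy hyK => ?_)
      (fun i => (contDiffOn_volDensity_mul_coordField hv x₀ i).of_le (by exact_mod_cast le_top))
      fun i => EuclideanSpace.single i (1 : ℝ))
  · have hs := (extChartAt (𝓡 n) x₀).map_target hy
    have hr := (extChartAt (𝓡 n) x₀).right_inv hy
    have e1 := along_eq_fderiv v (f := g) hs (by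
      rw [hr]
      exact (hgc.contDiffAt (ht.mem_nhds hy)).differentiableAt one_ne_zero)
    rw [hr] at e1
    have hpos := volDensity_pos x₀ hy
    have e2 : ∑ i, (volDensity x₀ y * coordField x₀ v y i) • EuclideanSpace.single i (1 : ℝ) =
        volDensity x₀ y • coordField x₀ v y := by
      ext j
      simp [Finset.sum_apply, Pi.single_apply]
    simp only [e1, hr, e2, map_smul, smul_eq_mul, ENNReal.toReal_ofReal hpos.le, chartDiv,
      Function.comp_apply]
    rw [mul_add, mul_left_comm, mul_inv_cancel_left₀ hpos.ne']
  · refine hgK _ fun h => hyK ⟨_, h, (extChartAt (𝓡 n) x₀).right_inv hy⟩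

/-- No change-of-variables computation is made: both expressions satisfy the same integral identity
against every smooth g supported in the overlap, so they agree almost everywhere there. They are
continuous and the volume charges open sets, so they agree everywhere. -/
theorem chartDiv_eq_chartDiv (hm : IsRiemannianVolume n m) (hv : IsField v) {x₀ x₁ x : X}
    (h₀ : x ∈ (extChartAt (𝓡 n) x₀).source) (h₁ : x ∈ (extChartAt (𝓡 n) x₁).source) :
    chartDiv x₀ v (extChartAt (𝓡 n) x₀ x) = chartDiv x₁ v (extChartAt (𝓡 n) x₁ x) := by
  have := hm.isLocallyFiniteMeasure
  have := hm.isOpenPosMeasure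
  set U := (extChartAt (𝓡 n) x₀).source ∩ (extChartAt (𝓡 n) x₁).source with hU
  have hUo : IsOpen U := (isOpen_extChartAt_source x₀).inter (isOpen_extChartAt_source x₁)
  have c₀ := (continuousOn_chartDiv_comp hv x₀).mono (inter_subset_left : U ⊆ _)
  have c₁ := (continuousOn_chartDiv_comp hv x₁).mono (inter_subset_right : U ⊆ _)
  have hae := hUo.ae_eq_zero_of_integral_contMDiff_smul_eq_zero (𝓡 n) (μ := m)
    (f := fun x => chartDiv x₀ v (extChartAt (𝓡 n) x₀ x) - chartDiv x₁ v (extChartAt (𝓡 n) x₁ x))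
    ((c₀.sub c₁).locallyIntegrableOn hUo.measurableSet) (fun g hg hgc hgU => by
      have hg1 : ContMDiff (𝓡 n) 𝓘(ℝ, ℝ) 1 g := hg.of_le (by exact_mod_cast le_top)
      have hgK : ∀ x ∉ tsupport g, g x = 0 := fun x hx => image_eq_zero_of_notMem_tsupport hx
      have k₀ := hgU.trans inter_subset_left
      have k₁ := hgU.trans inter_subset_right
      have i₀ := integral_along_add_mul_chartDiv hm hv x₀ hg1 hgc k₀ hgK
      have i₁ := integral_along_add_mul_chartDiv hm hv x₁ hg1 hgc k₁ hgK
      have j : Integrable (along v g) m := (continuous_along hv.1 hg1).integrable_of_hasCompactSupport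
        (HasCompactSupport.intro hgc fun x hx => along_of_notMem_tsupport _ hx)
      have j₀ : Integrable (fun x => g x * chartDiv x₀ v (extChartAt (𝓡 n) x₀ x)) m :=
        (continuous_mul_chartDiv hv x₀ hg.continuous hgc k₀ hgK).integrable_of_hasCompactSupport
          (HasCompactSupport.intro hgc fun x hx => by rw [hgK x hx, zero_mul])
      have j₁ : Integrable (fun x => g x * chartDiv x₁ v (extChartAt (𝓡 n) x₁ x)) m :=
        (continuous_mul_chartDiv hv x₁ hg.continuous hgc k₁ hgK).integrable_of_hasCompactSupport
          (HasCompactSupport.intro hgc fun x hx => by rw [hgK x hx, zero_mul])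
      rw [integral_add j j₀] at i₀
      rw [integral_add j j₁] at i₁
      simp only [smul_eq_mul, mul_sub]
      rw [integral_sub j₀ j₁]
      linarith)
  have h2 : (fun x => chartDiv x₀ v (extChartAt (𝓡 n) x₀ x)) =ᵐ[m.restrict U]
      fun x => chartDiv x₁ v (extChartAt (𝓡 n) x₁ x) := by
    rw [EventuallyEq, ae_restrict_iff' hUo.measurableSet]
    filter_upwards [hae] with x hx hxU using sub_eq_zero.1 (hx hxU)
  exact Measure.eqOn_open_of_ae_eq h2 hUo c₀ c₁ ⟨h₀, h₁⟩

theorem divergence_eq_chartDiv (hm : IsRiemannianVolume n m) (hv : IsField v) {x₀ x : X}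
    (h₀ : x ∈ (extChartAt (𝓡 n) x₀).source) :
    divergence v x = chartDiv x₀ v (extChartAt (𝓡 n) x₀ x) :=
  chartDiv_eq_chartDiv hm hv (mem_extChartAt_source x) h₀

theorem continuous_divergence (hm : IsRiemannianVolume n m) (hv : IsField v) :
    Continuous (divergence v) := by
  rw [continuous_iff_continuousAt]
  intro x
  refine ((continuousOn_chartDiv_comp hv x).continuousAt
    (extChartAt_source_mem_nhds (I := 𝓡 n) x)).congr ?_
  filter_upwards [extChartAt_source_mem_nhds (I := 𝓡 n) x] with z hz
  exact (divergence_eq_chartDiv hm hv hz).symm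

theorem divergence_eq_zero {x : X} (hx : x ∉ closure {x | v x ≠ 0}) : divergence v x = 0 := by
  have h : ∀ i, (fun y => volDensity x y * coordField x v y i) =ᶠ[𝓝 (extChartAt (𝓡 n) x x)]
      fun _ => 0 := by
    intro i
    have hc : ContinuousAt (extChartAt (𝓡 n) x).symm (extChartAt (𝓡 n) x x) :=
      continuousAt_extChartAt_symm x
    have hn : (closure {x | v x ≠ 0})ᶜ ∈ 𝓝 ((extChartAt (𝓡 n) x).symm (extChartAt (𝓡 n) x x)) := by
      rw [extChartAt_to_inv]
      exact isClosed_closure.isOpen_compl.mem_nhds hx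
    filter_upwards [hc hn] with y hy
    have h0 : v ((extChartAt (𝓡 n) x).symm y) = 0 := by
      by_contra h
      exact hy (subset_closure h)
    have : coordField x v y = 0 := by
      refine Eq.trans ?_ (map_zero (mfderiv (𝓡 n) 𝓘(ℝ, EuclideanSpace ℝ (Fin n)) (extChartAt (𝓡 n) x)
        ((extChartAt (𝓡 n) x).symm y)))
      exact congrArg _ h0
    rw [this]
    simp
  rw [divergence, Finset.sum_eq_zero, mul_zero]
  intro i _
  rw [(h i).fderiv_eq]
  simp

end Divergence

/-! ### The divergence theorem on the manifold -/

section GlobalDivergence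

variable {n : ℕ} {X : Type*} [TopologicalSpace X] [T2Space X] [SecondCountableTopology X]
  [LocallyCompactSpace X] [ChartedSpace (EuclideanSpace ℝ (Fin n)) X] [IsManifold (𝓡 n) ∞ X]

variable (n) in
theorem exists_cutoff {K : Set X} (hK : IsCompact K) :
    ∃ χ : X → ℝ, ContMDiff (𝓡 n) 𝓘(ℝ, ℝ) ∞ χ ∧ HasCompactSupport χ ∧
      (∀ x ∈ K, χ =ᶠ[𝓝 x] fun _ => 1) ∧ ∀ x, χ x ∈ Icc (0 : ℝ) 1 := by
  obtain ⟨Λ, hΛo, hKΛ, hΛ⟩ := exists_isOpen_superset_and_isCompact_closure hK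
  obtain ⟨f, h1, h0, hf⟩ := exists_contMDiffMap_one_nhds_of_subset_interior (𝓡 n) (n := (⊤ : ℕ∞))
    hK.isClosed (t := Λ) (by rwa [hΛo.interior_eq])
  refine ⟨f, f.contMDiff, HasCompactSupport.intro hΛ fun x hx => h0 x fun h => hx (subset_closure h),
    fun x hx => ?_, hf⟩
  rw [eventually_nhdsSet_iff_forall] at h1
  exact h1 x hx

variable [Bundle.RiemannianBundle (fun x : X => TangentSpace (𝓡 n) x)]
  [IsContMDiffRiemannianBundle (𝓡 n) ∞ (EuclideanSpace ℝ (Fin n))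
      (fun x : X => TangentSpace (𝓡 n) x)]
  {v : (x : X) → TangentSpace (𝓡 n) x} [MeasurableSpace X] [BorelSpace X] {m : Measure X}

theorem IsField.integrable_along (hm : IsRiemannianVolume n m) (hv : IsField v) {g : X → ℝ}
    (hg : ContMDiff (𝓡 n) 𝓘(ℝ, ℝ) 1 g) : Integrable (along v g) m := by
  have := hm.isLocallyFiniteMeasure
  refine (continuous_along hv.1 hg).integrable_of_hasCompactSupport
    (HasCompactSupport.intro hv.2 fun x hx => ?_)
  have h0 : v x = 0 := by
    by_contra h
    exact hx (subset_closure h)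
  rw [along, h0]
  exact map_zero (mfderiv (𝓡 n) 𝓘(ℝ, ℝ) g x)

theorem IsField.integrable_mul_divergence (hm : IsRiemannianVolume n m) (hv : IsField v) {g : X → ℝ}
    (hg : Continuous g) : Integrable (fun x => g x * divergence v x) m := by
  have := hm.isLocallyFiniteMeasure
  refine (hg.mul (continuous_divergence hm hv)).integrable_of_hasCompactSupport
    (HasCompactSupport.intro hv.2 fun x hx => ?_)
  exact (congrArg (g x * ·) (divergence_eq_zero hx)).trans (mul_zero _)

/-- A partition of unity subordinate to the charts splits g into finitely many pieces, each living
in one chart, where the chart-independent divergence can be computed. -/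
theorem integral_along_add_mul_divergence_of_compact (hm : IsRiemannianVolume n m) (hv : IsField v)
    {g : X → ℝ} (hg : ContMDiff (𝓡 n) 𝓘(ℝ, ℝ) 1 g) (hc : HasCompactSupport g) :
    ∫ x, (along v g x + g x * divergence v x) ∂m = 0 := by
  classical
  obtain ⟨ρ, hρ⟩ := SmoothPartitionOfUnity.exists_isSubordinate_chartAt_source (𝓡 n) X
  have hfin : {i | (Function.support (ρ i) ∩ tsupport g).Nonempty}.Finite :=
    ρ.locallyFinite.finite_nonempty_inter_compact hc
  have hsum : ∀ x, ∑ i ∈ hfin.toFinset, ρ i x * g x = g x := by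
    intro x
    by_cases hx : x ∈ tsupport g
    · rw [← Finset.sum_mul]
      have h1 := ρ.sum_eq_one (mem_univ x)
      rw [finsum_eq_sum_of_support_subset (s := hfin.toFinset)] at h1
      · rw [h1, one_mul]
      · intro i hi
        simp only [Finite.coe_toFinset, Set.mem_ofPred_eq]
        exact ⟨x, hi, hx⟩
    · rw [image_eq_zero_of_notMem_tsupport hx]
      simp
  have hρg : ∀ i, ContMDiff (𝓡 n) 𝓘(ℝ, ℝ) 1 fun x => ρ i x * g x := fun i =>
    ((ρ i).contMDiff.of_le (by exact_mod_cast le_top)).mul hg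
  -- Induction over the finite index set carries smoothness and the vanishing integral together, so
  -- that only additivity for two summands is needed.
  have key : ∀ S : Finset X, ContMDiff (𝓡 n) 𝓘(ℝ, ℝ) 1 (fun x => ∑ i ∈ S, ρ i x * g x) ∧
      ∫ x, (along v (fun x => ∑ i ∈ S, ρ i x * g x) x +
        (∑ i ∈ S, ρ i x * g x) * divergence v x) ∂m = 0 := by
    intro S
    induction S using Finset.induction_on with
    | empty =>
      simp only [Finset.sum_empty, zero_mul, add_zero]
      refine ⟨contMDiff_const, integral_eq_zero_of_ae (Eventually.of_forall fun x => ?_)⟩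
      exact along_eq_zero_of_eventuallyEq v EventuallyEq.rfl
    | insert i S hi ih =>
      simp only [Finset.sum_insert hi]
      refine ⟨(hρg i).add ih.1, ?_⟩
      have h1 : ∫ x, (along v (fun x => ρ i x * g x) x + (ρ i x * g x) * divergence v x) ∂m = 0 := by
        have hsub : tsupport (ρ i) ⊆ (extChartAt (𝓡 n) i).source := by
          rw [extChartAt_source]
          exact hρ i
        have h0 : ∀ x ∉ tsupport (ρ i) ∩ tsupport g, ρ i x * g x = 0 := by
          intro x hx
          rw [mem_inter_iff, not_and_or] at hx
          rcases hx with hx | hx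
          · rw [image_eq_zero_of_notMem_tsupport hx, zero_mul]
          · rw [image_eq_zero_of_notMem_tsupport hx, mul_zero]
        rw [← integral_along_add_mul_chartDiv hm hv i (hρg i)
          (hc.isCompact.inter_left (isClosed_tsupport (ρ i))) (inter_subset_left.trans hsub) h0]
        refine integral_congr_ae (Eventually.of_forall fun x => ?_)
        by_cases hx : x ∈ (extChartAt (𝓡 n) i).source
        · simp only [divergence_eq_chartDiv hm hv hx]
        · simp only [h0 x fun h => hx (hsub h.1), zero_mul]
      calc ∫ x, (along v (fun x => ρ i x * g x + ∑ j ∈ S, ρ j x * g x) x +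
            (ρ i x * g x + ∑ j ∈ S, ρ j x * g x) * divergence v x) ∂m
          = ∫ x, ((along v (fun x => ρ i x * g x) x + (ρ i x * g x) * divergence v x) +
            (along v (fun x => ∑ i ∈ S, ρ i x * g x) x +
              (∑ i ∈ S, ρ i x * g x) * divergence v x)) ∂m := by
            refine integral_congr_ae (Eventually.of_forall fun x => ?_)
            simp only [along_add v (hρg i) ih.1]
            ring
        _ = 0 := by
            refine (integral_add ((hv.integrable_along hm (hρg i)).add
              (hv.integrable_mul_divergence hm (hρg i).continuous))
              ((hv.integrable_along hm ih.1).add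
              (hv.integrable_mul_divergence hm ih.1.continuous))).trans ?_
            exact (congrArg₂ (· + ·) h1 ih.2).trans (add_zero 0)
  have := (key hfin.toFinset).2
  simp only [hsum] at this
  exact this

/-- The divergence theorem. -/
theorem integral_along_add_mul_divergence (hm : IsRiemannianVolume n m) (hv : IsField v)
    {g : X → ℝ} (hg : ContMDiff (𝓡 n) 𝓘(ℝ, ℝ) 1 g) :
    ∫ x, (along v g x + g x * divergence v x) ∂m = 0 := by
  -- Both terms of the integrand vanish off the support of `v`, so multiplying g by a cutoff equal
  -- to one near that support changes nothing and makes g compactly supported.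
  obtain ⟨χ, hχ, hχc, h1, -⟩ := exists_cutoff n hv.2
  have hχg : ContMDiff (𝓡 n) 𝓘(ℝ, ℝ) 1 fun x => χ x * g x :=
    (hχ.of_le (by exact_mod_cast le_top)).mul hg
  rw [← integral_along_add_mul_divergence_of_compact hm hv hχg hχc.mul_right]
  refine integral_congr_ae (Eventually.of_forall fun x => ?_)
  by_cases hx : x ∈ closure {x | v x ≠ 0}
  · have e : (fun x => χ x * g x) =ᶠ[𝓝 x] g := by
      filter_upwards [h1 x hx] with y hy
      rw [hy, one_mul]
    simp only [e.eq_of_nhds]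
    congr 1
    exact congrArg (fun L => L (v x)) (e.mfderiv_eq (I := 𝓡 n) (I' := 𝓘(ℝ, ℝ))).symm
  · have h0 : v x = 0 := by
      by_contra h
      exact hx (subset_closure h)
    simp only [divergence_eq_zero hx, mul_zero, along, h0]
    exact congrArg (· + (0 : ℝ)) ((map_zero (mfderiv (𝓡 n) 𝓘(ℝ, ℝ) g x)).trans
      (map_zero (mfderiv (𝓡 n) 𝓘(ℝ, ℝ) (fun x => χ x * g x) x)).symm)

end GlobalDivergence

/-! ### Integration by parts on `X × (0, ∞)` -/

section SingleParticle

variable {n : ℕ} {X : Type*} [TopologicalSpace X] [T2Space X] [SecondCountableTopology X]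
  [LocallyCompactSpace X] [ChartedSpace (EuclideanSpace ℝ (Fin n)) X] [IsManifold (𝓡 n) ∞ X]
  [MeasurableSpace X] [BorelSpace X]

/-- The union of the supports of `v` and `a`. -/
def fieldSupport (v : (x : X) → TangentSpace (𝓡 n) x) (a : X → ℝ) : Set X :=
  closure {x | v x ≠ 0} ∪ tsupport a

variable {v : (x : X) → TangentSpace (𝓡 n) x} {a : X → ℝ}

theorem isCompact_fieldSupport (hv : IsField v) (ha : IsFun n a) : IsCompact (fieldSupport v a) :=
  hv.2.union ha.2

theorem eq_zero_of_notMem_fieldSupport {x : X} (hx : x ∉ fieldSupport v a) : v x = 0 := by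
  by_contra h
  exact hx (Or.inl (subset_closure h))

theorem fun_eq_zero_of_notMem_fieldSupport {x : X} (hx : x ∉ fieldSupport v a) : a x = 0 :=
  image_eq_zero_of_notMem_tsupport fun h => hx (Or.inr h)

theorem dirDerivXR_eq_zero {x : X} (hx : x ∉ fieldSupport v a) (φ : X × ℝ → ℝ) (s : ℝ) :
    dirDerivXR v a φ (x, s) = 0 := by
  simp only [dirDerivXR, along, eq_zero_of_notMem_fieldSupport hx,
    fun_eq_zero_of_notMem_fieldSupport hx, mul_zero]
  exact (congrArg (· + (0 : ℝ)) (map_zero (mfderiv (𝓡 n) 𝓘(ℝ, ℝ) (fun x => φ (x, s)) x))).trans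
    (add_zero 0)

variable (n) in
theorem Smooth.comp_fst {g : X → ℝ} {k : WithTop ℕ∞} (hg : ContMDiff (𝓡 n) 𝓘(ℝ, ℝ) k g) :
    Smooth n k (fun p : X × ℝ => g p.1) := (hg.comp contMDiff_fst).contMDiffOn

theorem Smooth.slice_fst {ψ : X × ℝ → ℝ} {k : WithTop ℕ∞} (hψ : Smooth n k ψ) {s : ℝ} (hs : 0 < s) :
    ContMDiff (𝓡 n) 𝓘(ℝ, ℝ) k fun x => ψ (x, s) := by
  rw [← contMDiffOn_univ]
  exact hψ.comp (contMDiff_id.prodMk contMDiff_const).contMDiffOn fun x _ => ⟨mem_univ _, hs⟩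

theorem Smooth.slice_snd {ψ : X × ℝ → ℝ} {k : WithTop ℕ∞} (hψ : Smooth n k ψ) (x : X) :
    ContDiffOn ℝ k (fun s => ψ (x, s)) (Ioi (0 : ℝ)) := by
  rw [← contMDiffOn_iff_contDiffOn]
  exact hψ.comp (contMDiff_const.prodMk contMDiff_id).contMDiffOn fun s hs => ⟨mem_univ _, hs⟩

theorem ae_pos_baseMeasure (m : Measure X) [SFinite m] : ∀ᵐ p ∂baseMeasure m, 0 < p.2 := by
  have : ∀ᵐ s ∂((volume : Measure ℝ).restrict (Ioi 0)), 0 < s := ae_restrict_mem measurableSet_Ioi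
  exact Measure.quasiMeasurePreserving_snd.ae this

theorem measurableSet_half : MeasurableSet (univ ×ˢ Ioi (0 : ℝ) : Set (X × ℝ)) :=
  MeasurableSet.univ.prod measurableSet_Ioi

theorem measurable_indicator_half {f : X × ℝ → ℝ} (hf : ContinuousOn f (univ ×ˢ Ioi (0 : ℝ))) :
    Measurable ((univ ×ˢ Ioi (0 : ℝ)).indicator f) := by
  classical
  rw [← piecewise_eq_indicator]
  exact hf.measurable_piecewise continuousOn_const measurableSet_half

theorem indicator_half {f : X × ℝ → ℝ} {p : X × ℝ} (hp : 0 < p.2) :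
    (univ ×ˢ Ioi (0 : ℝ)).indicator f p = f p :=
  indicator_of_mem (s := univ ×ˢ Ioi (0 : ℝ)) ⟨mem_univ _, hp⟩ f

theorem aestronglyMeasurable_of_continuousOn {ν : Measure (X × ℝ)} (hν : ∀ᵐ p ∂ν, 0 < p.2)
    {f : X × ℝ → ℝ} (hf : ContinuousOn f (univ ×ˢ Ioi (0 : ℝ))) : AEStronglyMeasurable f ν :=
  ⟨_, (measurable_indicator_half hf).stronglyMeasurable, hν.mono fun _ hp => (indicator_half hp).symm⟩

theorem continuous_indicator_half {f : X × ℝ → ℝ} (hf : ContinuousOn f (univ ×ˢ Ioi (0 : ℝ)))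
    {r R : ℝ} (hr : 0 < r) (h0 : ∀ x s, 0 < s → s ∉ Icc r R → f (x, s) = 0) :
    Continuous ((univ ×ˢ Ioi (0 : ℝ)).indicator f) := by
  refine continuous_of_continuousOn_of_eq_zero (T := univ ×ˢ Ioi (0 : ℝ)) (K := univ ×ˢ Icc r R)
    (isOpen_univ.prod isOpen_Ioi) (isClosed_univ.prod isClosed_Icc)
    (Set.prod_mono le_rfl fun s hs => hr.trans_le hs.1)
    (hf.congr fun p hp => indicator_of_mem hp f) ?_
  rintro ⟨x, s⟩ hp
  by_cases hs : 0 < s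
  · rw [indicator_half (p := (x, s)) hs]
    exact h0 x s hs fun h => hp ⟨mem_univ _, h⟩
  · exact indicator_of_notMem (fun h => hs h.2) _

theorem hasCompactSupport_indicator_half {f : X × ℝ → ℝ} {K : Set X} (hK : IsCompact K)
    {r R : ℝ} (h0 : ∀ x s, 0 < s → s ∉ Icc r R → f (x, s) = 0) (hfK : SuppIn K f) :
    HasCompactSupport ((univ ×ˢ Ioi (0 : ℝ)).indicator f) := by
  refine HasCompactSupport.intro (hK.prod (isCompact_Icc (a := r) (b := R))) ?_
  rintro ⟨x, s⟩ hp
  by_cases hs : 0 < s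
  · rw [indicator_half (p := (x, s)) hs]
    by_cases hx : x ∈ K
    · exact h0 x s hs fun h => hp ⟨hx, h⟩
    · exact hfK x hx s hs
  · exact indicator_of_notMem (fun h => hs h.2) _

theorem integrable_baseMeasure_of_compact {m : Measure X} [IsLocallyFiniteMeasure m]
    {f : X × ℝ → ℝ} (hf : ContinuousOn f (univ ×ˢ Ioi (0 : ℝ))) {K : Set X} (hK : IsCompact K)
    {r R : ℝ} (hr : 0 < r) (h0 : ∀ x s, 0 < s → s ∉ Icc r R → f (x, s) = 0) (hfK : SuppIn K f) :
    Integrable f (baseMeasure m) := by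
  have : IsLocallyFiniteMeasure (baseMeasure m) := by unfold baseMeasure; infer_instance
  refine ((continuous_indicator_half hf hr h0).integrable_of_hasCompactSupport
    (hasCompactSupport_indicator_half hK h0 hfK)).congr ?_
  filter_upwards [ae_pos_baseMeasure m] with p hp using indicator_half hp

theorem dirDerivXR_eq_zero_of_slice {ψ : X × ℝ → ℝ} {r R : ℝ}
    (h0 : ∀ x s, 0 < s → s ∉ Icc r R → ψ (x, s) = 0) (v : (x : X) → TangentSpace (𝓡 n) x)
    (a : X → ℝ) (x : X) (s : ℝ) (hs : 0 < s) (hsr : s ∉ Icc r R) : dirDerivXR v a ψ (x, s) = 0 := by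
  have h1 : (fun s => ψ (x, s)) =ᶠ[𝓝 s] fun _ => 0 := by
    filter_upwards [isClosed_Icc.isOpen_compl.mem_nhds hsr, isOpen_Ioi.mem_nhds hs] with t ht ht0
      using h0 x t ht0 ht
  have h2 : (fun x => ψ (x, s)) = fun _ => 0 := funext fun x => h0 x s hs hsr
  simp only [dirDerivXR, h1.deriv_eq, h2, deriv_const, mul_zero, zero_mul, add_zero]
  exact along_eq_zero_of_eventuallyEq v EventuallyEq.rfl

/-- The integrand is the derivative of s u(s), which vanishes near 0 and near infinity. -/
theorem integral_Ioi_mul_deriv_add {u : ℝ → ℝ} (hu : ContDiffOn ℝ 1 u (Ioi 0)) {r R : ℝ} (hr : 0 < r)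
    (h0 : ∀ s, 0 < s → s ∉ Icc r R → u s = 0) : ∫ s in Ioi (0 : ℝ), (s * deriv u s + u s) = 0 := by
  set w := (Ioi (0 : ℝ)).indicator fun s => s * u s with hw
  have hwK : ∀ s ∉ Icc r R, w s = 0 := by
    intro s hs
    by_cases h : 0 < s
    · rw [hw, indicator_of_mem (mem_Ioi.2 h), h0 s h hs, mul_zero]
    · exact indicator_of_notMem h _
  have hwc : ContDiff ℝ 1 w :=
    contDiff_of_contDiffOn_of_eq_zero isOpen_Ioi isClosed_Icc
      (show Icc r R ⊆ Ioi 0 from fun s hs => hr.trans_le hs.1)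
      ((contDiffOn_id.mul hu).congr fun s hs => indicator_of_mem hs _) hwK
  have h1 := integral_fderiv_apply_eq_zero (ν := volume) hwc (HasCompactSupport.intro (isCompact_Icc (a := r) (b := R)) hwK) 1
  rw [← setIntegral_eq_integral_of_forall_compl_eq_zero (s := Ioi (0 : ℝ))] at h1
  · refine Eq.trans (setIntegral_congr_fun measurableSet_Ioi fun s hs => ?_) h1
    have e : w =ᶠ[𝓝 s] fun s => s * u s := by
      filter_upwards [isOpen_Ioi.mem_nhds (show s ∈ Ioi (0 : ℝ) from hs)] with t ht using
        indicator_of_mem ht _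
    have hd : DifferentiableAt ℝ u s :=
      (hu.contDiffAt (isOpen_Ioi.mem_nhds (show s ∈ Ioi (0 : ℝ) from hs))).differentiableAt one_ne_zero
    have := (hasDerivAt_id s).mul hd.hasDerivAt
    simp only [fderiv_apply_one_eq_deriv, e.deriv_eq]
    refine Eq.trans ?_ this.deriv.symm
    simp [add_comm]
  · intro s hs
    have e : w =ᶠ[𝓝 s] fun _ => 0 := by
      filter_upwards [(isClosed_Icc (a := r) (b := R)).isOpen_compl.mem_nhds fun h => hs (hr.trans_le h.1)] with t ht
        using hwK t ht
    rw [e.fderiv_eq]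
    simp

theorem continuousOn_dirDerivXR {ψ : X × ℝ → ℝ} (hψ : Smooth n 1 ψ) (hv : IsField v)
    (ha : IsFun n a) : ContinuousOn (dirDerivXR v a ψ) (univ ×ˢ Ioi (0 : ℝ)) :=
  (hψ.dirDerivXR (k := 0) (by exact_mod_cast le_top) (by simp) hv.1 ha.1).continuousOn

variable [Bundle.RiemannianBundle (fun x : X => TangentSpace (𝓡 n) x)]
  [IsContMDiffRiemannianBundle (𝓡 n) ∞ (EuclideanSpace ℝ (Fin n))
      (fun x : X => TangentSpace (𝓡 n) x)] {m : Measure X}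

theorem divergence_add_eq_zero {x : X} (hx : x ∉ fieldSupport v a) : divergence v x + a x = 0 := by
  rw [divergence_eq_zero fun h => hx (Or.inl h), fun_eq_zero_of_notMem_fieldSupport hx, add_zero]

theorem continuous_divergence_add (hm : IsRiemannianVolume n m) (hv : IsField v) (ha : IsFun n a) :
    Continuous fun x => divergence v x + a x := (continuous_divergence hm hv).add ha.1.continuous

/-- Fubini in the two orders: the horizontal part vanishes on each slice of fixed mark by the
divergence theorem, the vertical part on each fibre of fixed position. ψ needs no compact support in
x, since `v` and `a` have it. -/
theorem integral_dirDerivXR_add (hm : IsRiemannianVolume n m) (hv : IsField v) (ha : IsFun n a)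
    {ψ : X × ℝ → ℝ} (hψ : Smooth n 1 ψ) {r R : ℝ} (hr : 0 < r)
    (h0 : ∀ x s, 0 < s → s ∉ Icc r R → ψ (x, s) = 0) :
    ∫ p, (dirDerivXR v a ψ p + (divergence v p.1 + a p.1) * ψ p) ∂baseMeasure m = 0 := by
  have := hm.isLocallyFiniteMeasure
  have hK := isCompact_fieldSupport hv ha
  have hz : IsFun n (0 : X → ℝ) := isFun_zero
  have hzv : IsField (0 : (x : X) → TangentSpace (𝓡 n) x) := isField_zero
  have hψc := hψ.continuousOn
  -- The divergence of (v, a s) is shared out: div v belongs to the horizontal part, and the summand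
  -- a, which is ∂_s (a s), to the vertical one.
  have split : ∀ p : X × ℝ, dirDerivXR v a ψ p + (divergence v p.1 + a p.1) * ψ p =
      (along v (fun x => ψ (x, p.2)) p.1 + ψ p * divergence v p.1) +
        a p.1 * (p.2 * deriv (fun s => ψ (p.1, s)) p.2 + ψ p) := by
    intro p
    rw [dirDerivXR]
    ring
  have c1 : ContinuousOn (fun p : X × ℝ => along v (fun x => ψ (x, p.2)) p.1 + ψ p * divergence v p.1)
      (univ ×ˢ Ioi (0 : ℝ)) := by
    refine ContinuousOn.add ?_ (hψc.mul
      ((continuous_divergence hm hv).comp continuous_fst).continuousOn)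
    refine (continuousOn_dirDerivXR hψ hv hz).congr fun p _ => ?_
    simp [dirDerivXR]
  have c2 : ContinuousOn (fun p : X × ℝ => a p.1 * (p.2 * deriv (fun s => ψ (p.1, s)) p.2 + ψ p))
      (univ ×ˢ Ioi (0 : ℝ)) := by
    have : ContinuousOn (fun p : X × ℝ => dirDerivXR (0 : (x : X) → TangentSpace (𝓡 n) x) a ψ p +
        a p.1 * ψ p) (univ ×ˢ Ioi (0 : ℝ)) :=
      (continuousOn_dirDerivXR hψ hzv ha).add
        ((ha.1.continuous.comp continuous_fst).continuousOn.mul hψc)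
    refine this.congr fun p _ => ?_
    simp only [dirDerivXR, zero_along, Pi.zero_apply]
    ring
  have i1 : Integrable (fun p : X × ℝ => along v (fun x => ψ (x, p.2)) p.1 + ψ p * divergence v p.1)
      (baseMeasure m) := by
    refine integrable_baseMeasure_of_compact (R := R) c1 hK hr (fun x s hs hsr => ?_) fun x hx s hs => ?_
    · have h2 : (fun x => ψ (x, s)) = fun _ => 0 := funext fun x => h0 x s hs hsr
      simp only [h2, h0 x s hs hsr, zero_mul, add_zero]
      exact along_eq_zero_of_eventuallyEq v EventuallyEq.rfl
    · have e : divergence v x = 0 := divergence_eq_zero fun h => hx (Or.inl h)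
      simp only [e, mul_zero, along, eq_zero_of_notMem_fieldSupport hx]
      exact congrArg (· + (0 : ℝ)) (map_zero (mfderiv (𝓡 n) 𝓘(ℝ, ℝ) (fun x => ψ (x, s)) x)) |>.trans
        (add_zero 0)
  have i2 : Integrable (fun p : X × ℝ => a p.1 * (p.2 * deriv (fun s => ψ (p.1, s)) p.2 + ψ p))
      (baseMeasure m) := by
    refine integrable_baseMeasure_of_compact (R := R) c2 hK hr (fun x s hs hsr => ?_) fun x hx s hs => ?_
    · have h1 : (fun s => ψ (x, s)) =ᶠ[𝓝 s] fun _ => 0 := by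
        filter_upwards [isClosed_Icc.isOpen_compl.mem_nhds hsr, isOpen_Ioi.mem_nhds hs] with t ht ht0
          using h0 x t ht0 ht
      simp [h1.deriv_eq, h0 x s hs hsr]
    · simp [fun_eq_zero_of_notMem_fieldSupport hx]
  simp_rw [split]
  rw [integral_add i1 i2, baseMeasure, integral_prod_symm _ i1, integral_prod _ i2]
  have e1 : (∫ s in Ioi (0 : ℝ),
      (∫ x, (along v (fun x => ψ (x, s)) x + ψ (x, s) * divergence v x) ∂m)) = 0 := by
    refine setIntegral_eq_zero_of_forall_eq_zero fun s hs => ?_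
    exact integral_along_add_mul_divergence hm hv (hψ.slice_fst hs)
  have e2 : ∫ x, (∫ s in Ioi (0 : ℝ), a x * (s * deriv (fun s => ψ (x, s)) s + ψ (x, s))) ∂m = 0 := by
    refine integral_eq_zero_of_ae (Eventually.of_forall fun x => ?_)
    simp only [Pi.zero_apply]
    rw [integral_const_mul, integral_Ioi_mul_deriv_add (hψ.slice_snd x) hr fun s hs hsr => h0 x s hs hsr,
      mul_zero]
  exact (congrArg₂ (· + ·) e1 e2).trans (add_zero 0)

end SingleParticle

/-! ### Generalized derivatives -/

section L2

variable {α : Type*} [MeasurableSpace α] {ν : Measure α}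

theorem eventually_memLp_of_tendsto {u : α → ℝ} {U : ℕ → α → ℝ} (hu : MemLp u 2 ν)
    (hU : ∀ k, AEStronglyMeasurable (U k) ν)
    (tU : Tendsto (fun k => eLpNorm (fun x => U k x - u x) 2 ν) atTop (𝓝 0)) :
    ∀ᶠ k in atTop, MemLp (U k) 2 ν := by
  filter_upwards [tU.eventually (gt_mem_nhds ENNReal.zero_lt_top)] with k hk
  have h1 : MemLp (fun x => U k x - u x) 2 ν := ⟨(hU k).sub hu.1, hk⟩
  refine (h1.add hu).ae_eq (Eventually.of_forall fun x => ?_)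
  simp

theorem eLpNorm_mul_le_mul (f g : α → ℝ) (hf : AEStronglyMeasurable f ν)
    (hg : AEStronglyMeasurable g ν) :
    eLpNorm (fun x => f x * g x) 1 ν ≤ eLpNorm f 2 ν * eLpNorm g 2 ν := by
  have h := eLpNorm_le_eLpNorm_mul_eLpNorm_of_nnnorm (p := 2) (q := 2) (r := 1) hf hg
    (fun a b : ℝ => a * b) 1 (Eventually.of_forall fun x => by simp)
  simpa using h

/-- Products of L²-convergent sequences converge in L¹. Convergence of the norms of the differences
puts the approximants in L² only eventually, hence the first clause. -/
theorem tendsto_integral_mul_of_tendsto {u w : α → ℝ} {U W : ℕ → α → ℝ} (hu : MemLp u 2 ν)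
    (hw : MemLp w 2 ν) (hU : ∀ k, AEStronglyMeasurable (U k) ν)
    (hW : ∀ k, AEStronglyMeasurable (W k) ν)
    (tU : Tendsto (fun k => eLpNorm (fun x => U k x - u x) 2 ν) atTop (𝓝 0))
    (tW : Tendsto (fun k => eLpNorm (fun x => W k x - w x) 2 ν) atTop (𝓝 0)) :
    (∀ᶠ k in atTop, Integrable (fun x => U k x * W k x) ν) ∧
    Tendsto (fun k => ∫ x, U k x * W k x ∂ν) atTop (𝓝 (∫ x, u x * w x ∂ν)) := by
  have hI : ∀ᶠ k in atTop, Integrable (fun x => U k x * W k x) ν := by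
    filter_upwards [eventually_memLp_of_tendsto hu hU tU, eventually_memLp_of_tendsto hw hW tW]
      with k h1 h2 using h1.integrable_mul h2
  refine ⟨hI, tendsto_integral_of_L1' _ (hu.integrable_mul hw).1 hI ?_⟩
  have hb : ∀ k, eLpNorm ((fun x => U k x * W k x) - fun x => u x * w x) 1 ν ≤
      eLpNorm (fun x => U k x - u x) 2 ν * eLpNorm (fun x => W k x - w x) 2 ν +
        (eLpNorm (fun x => U k x - u x) 2 ν * eLpNorm w 2 ν +
        eLpNorm u 2 ν * eLpNorm (fun x => W k x - w x) 2 ν) := by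
    intro k
    have m1 : AEStronglyMeasurable (fun x => U k x - u x) ν := (hU k).sub hu.1
    have m2 : AEStronglyMeasurable (fun x => W k x - w x) ν := (hW k).sub hw.1
    have e : ((fun x => U k x * W k x) - fun x => u x * w x) =
        (fun x => (U k x - u x) * (W k x - w x)) +
          ((fun x => (U k x - u x) * w x) + fun x => u x * (W k x - w x)) := by
      funext x
      simp only [Pi.sub_apply, Pi.add_apply]
      ring
    rw [e]
    refine (eLpNorm_add_le (m1.mul m2) ((m1.mul hw.1).add (hu.1.mul m2)) le_rfl).trans
      (add_le_add (eLpNorm_mul_le_mul _ _ m1 m2) ?_)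
    exact (eLpNorm_add_le (m1.mul hw.1) (hu.1.mul m2) le_rfl).trans
      (add_le_add (eLpNorm_mul_le_mul _ _ m1 hw.1) (eLpNorm_mul_le_mul _ _ hu.1 m2))
  refine tendsto_of_tendsto_of_tendsto_of_le_of_le tendsto_const_nhds ?_ (fun _ => zero_le) hb
  have t1 := ENNReal.Tendsto.mul tU (Or.inr ENNReal.zero_ne_top) tW (Or.inr ENNReal.zero_ne_top)
  have t2 := ENNReal.Tendsto.mul_const (b := eLpNorm w 2 ν) tU (Or.inr hw.2.ne)
  have t3 := ENNReal.Tendsto.const_mul (a := eLpNorm u 2 ν) tW (Or.inr hu.2.ne)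
  simpa using t1.add (t2.add t3)

theorem tendsto_eLpNorm_mul_of_bounded {b u : α → ℝ} {U : ℕ → α → ℝ} {C : ℝ}
    (hb : ∀ᵐ x ∂ν, |b x| ≤ C)
    (tU : Tendsto (fun k => eLpNorm (fun x => U k x - u x) 2 ν) atTop (𝓝 0)) :
    Tendsto (fun k => eLpNorm (fun x => b x * U k x - b x * u x) 2 ν) atTop (𝓝 0) := by
  have h : ∀ k, eLpNorm (fun x => b x * U k x - b x * u x) 2 ν ≤
      ENNReal.ofReal C * eLpNorm (fun x => U k x - u x) 2 ν := fun k => by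
    refine eLpNorm_le_mul_eLpNorm_of_ae_le_mul ?_ 2
    filter_upwards [hb] with x hx
    rw [← mul_sub, norm_mul]
    exact mul_le_mul_of_nonneg_right hx (norm_nonneg _)
  refine tendsto_of_tendsto_of_tendsto_of_le_of_le tendsto_const_nhds ?_ (fun _ => zero_le) h
  simpa using ENNReal.Tendsto.const_mul (a := ENNReal.ofReal C) tU (Or.inr ENNReal.ofReal_ne_top)

theorem memLp_mul_of_bounded {b u : α → ℝ} {C : ℝ} (hbm : AEStronglyMeasurable b ν)
    (hb : ∀ᵐ x ∂ν, |b x| ≤ C) (hu : MemLp u 2 ν) : MemLp (fun x => b x * u x) 2 ν := by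
  refine hu.of_le_mul (c := C) (hbm.mul hu.1) ?_
  filter_upwards [hb] with x hx
  rw [norm_mul]
  exact mul_le_mul_of_nonneg_right hx (norm_nonneg _)

theorem eLpNorm_two_le_of_sq_le {u : α → ℝ} {G : α → ℝ≥0∞}
    (h : ∀ᵐ x ∂ν, ENNReal.ofReal (u x ^ 2) ≤ G x) :
    eLpNorm u 2 ν ≤ (∫⁻ x, G x ∂ν) ^ (1 / 2 : ℝ) := by
  rw [eLpNorm_eq_lintegral_rpow_enorm_toReal (by simp) (by simp)]
  simp only [ENNReal.toReal_ofNat]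
  refine ENNReal.rpow_le_rpow (lintegral_mono_ae ?_) (by norm_num)
  filter_upwards [h] with x hx
  refine le_trans (le_of_eq ?_) hx
  rw [Real.enorm_eq_ofReal_abs, ENNReal.ofReal_rpow_of_nonneg (abs_nonneg _) (by norm_num)]
  norm_num

theorem exists_limit_of_cauchy {U : ℕ → α → ℝ} (hU : ∀ k, MemLp (U k) 2 ν)
    (h : Tendsto (fun kl : ℕ × ℕ => eLpNorm (fun x => U kl.1 x - U kl.2 x) 2 ν) atTop (𝓝 0)) :
    ∃ w, MemLp w 2 ν ∧ Tendsto (fun k => eLpNorm (fun x => U k x - w x) 2 ν) atTop (𝓝 0) := by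
  have hc : CauchySeq fun k => (hU k).toLp (U k) := by
    rw [EMetric.cauchySeq_iff]
    intro ε hε
    have := h.eventually (gt_mem_nhds hε)
    rw [eventually_atTop_prod_self'] at this
    obtain ⟨N, hN⟩ := this
    refine ⟨N, fun k hk l hl => ?_⟩
    rw [Lp.edist_toLp_toLp]
    exact hN k hk l hl
  obtain ⟨w, hw⟩ := cauchySeq_tendsto_of_complete hc
  refine ⟨w, Lp.memLp w, ?_⟩
  rw [← Lp.toLp_coeFn w (Lp.memLp w), Lp.tendsto_Lp_iff_tendsto_eLpNorm''] at hw
  exact hw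

end L2

/-! ### Generalized derivatives above a compact set, and their uniqueness -/

section GenDeriv

variable {n : ℕ} {X : Type*} [TopologicalSpace X] [T2Space X] [SecondCountableTopology X]
  [LocallyCompactSpace X] [ChartedSpace (EuclideanSpace ℝ (Fin n)) X] [IsManifold (𝓡 n) ∞ X]
  [MeasurableSpace X] [BorelSpace X]
  {v : (x : X) → TangentSpace (𝓡 n) x} {a : X → ℝ} {m : Measure X} {f w : X × ℝ → ℝ} {K : Set X}

/-- `w` is the generalized derivative of `f` along `(v, a)` on `K × (0, ∞)`. -/
def GenLim (m : Measure X) (v : (x : X) → TangentSpace (𝓡 n) x) (a : X → ℝ)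
    (f : X × ℝ → ℝ) (K : Set X) (w : X × ℝ → ℝ) : Prop :=
  MemLp w 2 ((baseMeasure m).restrict (K ×ˢ univ)) ∧
    ∃ h : ℕ → X × ℝ → ℝ, (∀ k, IsTest n (h k)) ∧
      Tendsto (fun k => eLpNorm (fun p => h k p - f p) 2
        ((baseMeasure m).restrict (K ×ˢ univ))) atTop (𝓝 0) ∧
      Tendsto (fun k => eLpNorm (fun p => dirDerivXR v a (h k) p - w p) 2
        ((baseMeasure m).restrict (K ×ˢ univ))) atTop (𝓝 0)

theorem GenLim.mono {L : Set X} (h : GenLim m v a f K w) (hLK : L ⊆ K) : GenLim m v a f L w := by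
  obtain ⟨hw, h, h1, h2, h3⟩ := h
  have hle : (baseMeasure m).restrict (L ×ˢ univ) ≤ (baseMeasure m).restrict (K ×ˢ univ) :=
    Measure.restrict_mono (Set.prod_mono hLK le_rfl) le_rfl
  exact ⟨hw.mono_measure hle, h, h1,
    tendsto_of_tendsto_of_tendsto_of_le_of_le tendsto_const_nhds h2 (fun _ => zero_le)
      fun _ => eLpNorm_mono_measure _ hle,
    tendsto_of_tendsto_of_tendsto_of_le_of_le tendsto_const_nhds h3 (fun _ => zero_le)
      fun _ => eLpNorm_mono_measure _ hle⟩

theorem GenLim.congr {w' : X × ℝ → ℝ} (h : GenLim m v a f K w)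
    (hw : w =ᵐ[(baseMeasure m).restrict (K ×ˢ univ)] w') : GenLim m v a f K w' := by
  obtain ⟨h0, h, h1, h2, h3⟩ := h
  refine ⟨(memLp_congr_ae hw).1 h0, h, h1, h2, h3.congr fun k => eLpNorm_congr_ae ?_⟩
  filter_upwards [hw] with p hp
  rw [hp]

theorem IsTest.smooth_one {φ : X × ℝ → ℝ} (h : IsTest n φ) : Smooth n 1 φ :=
  h.smooth.of_le (by exact_mod_cast le_top)

theorem ae_pos_restrict [SFinite m] (K : Set X) :
    ∀ᵐ p ∂(baseMeasure m).restrict (K ×ˢ univ), 0 < p.2 :=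
  ae_restrict_of_ae (ae_pos_baseMeasure m)

theorem ae_mem_restrict (hK : IsCompact K) :
    ∀ᵐ p ∂(baseMeasure m).restrict (K ×ˢ univ), p.1 ∈ K := by
  filter_upwards [ae_restrict_mem (hK.measurableSet.prod MeasurableSet.univ)] with p hp using hp.1

theorem exists_bound_of_compact {g : X × ℝ → ℝ} (hg : ContinuousOn g (univ ×ˢ Ioi (0 : ℝ)))
    (hK : IsCompact K) {r R : ℝ} (hr : 0 < r) (h0 : ∀ x s, 0 < s → s ∉ Icc r R → g (x, s) = 0) :
    ∃ C : ℝ, ∀ p : X × ℝ, p.1 ∈ K → 0 < p.2 → |g p| ≤ C := by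
  obtain ⟨C, hC⟩ := (hK.prod (isCompact_Icc (a := r) (b := R))).exists_bound_of_continuousOn
    (hg.mono (Set.prod_mono (subset_univ K) fun s hs => hr.trans_le hs.1))
  refine ⟨max C 0, fun p hp hs => ?_⟩
  by_cases h : p.2 ∈ Icc r R
  · exact (hC p ⟨hp, h⟩).trans (le_max_left _ _)
  · rw [show g p = 0 from h0 p.1 p.2 hs h, abs_zero]
    exact le_max_right _ _

/-- Derivatives of the approximating functions vanish identically off the supports of `v` and `a`,
and the L²-limit inherits this. -/
theorem GenLim.ae_eq_zero [SFinite m] (h : GenLim m v a f K w) :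
    ∀ᵐ p ∂(baseMeasure m).restrict (K ×ˢ univ), p.1 ∉ fieldSupport v a → w p = 0 := by
  obtain ⟨hw, h, h1, h2, h3⟩ := h
  set ν := (baseMeasure m).restrict (K ×ˢ univ)
  have hmeas : MeasurableSet ((fieldSupport v a)ᶜ ×ˢ univ : Set (X × ℝ)) :=
    ((isClosed_closure.union (isClosed_tsupport a)).measurableSet.compl).prod MeasurableSet.univ
  have hle : ∀ k, eLpNorm (((fieldSupport v a)ᶜ ×ˢ univ).indicator w) 2 ν ≤
      eLpNorm (fun p => dirDerivXR v a (h k) p - w p) 2 ν := fun k => by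
    refine eLpNorm_mono fun p => ?_
    by_cases hp : p ∈ ((fieldSupport v a)ᶜ ×ˢ univ : Set (X × ℝ))
    · rw [indicator_of_mem hp, show dirDerivXR v a (h k) p = 0 from
        dirDerivXR_eq_zero hp.1 (h k) p.2, zero_sub, norm_neg]
    · rw [indicator_of_notMem hp, norm_zero]
      exact norm_nonneg _
  have h0 : eLpNorm (((fieldSupport v a)ᶜ ×ˢ univ).indicator w) 2 ν = 0 :=
    le_antisymm (ge_of_tendsto' h3 hle) zero_le
  rw [eLpNorm_eq_zero_iff (hw.1.indicator hmeas) (by simp)] at h0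
  filter_upwards [h0] with p hp hpx
  rwa [indicator_of_mem (s := (fieldSupport v a)ᶜ ×ˢ univ) ⟨hpx, mem_univ _⟩] at hp

variable (n) in
theorem ae_eq_zero_of_forall_integral_mul_eq_zero {ν : Measure (X × ℝ)} {F : X × ℝ → ℝ}
    (hF : LocallyIntegrableOn F (univ ×ˢ Ioi (0 : ℝ)) ν)
    (h : ∀ χ : X × ℝ → ℝ, ContMDiff ((𝓡 n).prod 𝓘(ℝ, ℝ)) 𝓘(ℝ, ℝ) ∞ χ → HasCompactSupport χ →
      tsupport χ ⊆ univ ×ˢ Ioi (0 : ℝ) → ∫ p, χ p * F p ∂ν = 0) :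
    ∀ᵐ p ∂ν, 0 < p.2 → F p = 0 := by
  have := (isOpen_univ.prod isOpen_Ioi : IsOpen (univ ×ˢ Ioi (0 : ℝ) : Set (X × ℝ))).ae_eq_zero_of_integral_contMDiff_smul_eq_zero
    ((𝓡 n).prod 𝓘(ℝ, ℝ)) (μ := ν) hF h
  filter_upwards [this] with p hp h0 using hp ⟨mem_univ _, h0⟩

theorem exists_Icc_of_tsupport {χ : X × ℝ → ℝ} (hc : HasCompactSupport χ)
    (hχ : tsupport χ ⊆ univ ×ˢ Ioi (0 : ℝ)) :
    ∃ r R : ℝ, 0 < r ∧ ∀ x s, s ∉ Icc r R → χ (x, s) = 0 := by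
  have hS : IsCompact (Prod.snd '' tsupport χ) := hc.isCompact.image continuous_snd
  rcases (Prod.snd '' tsupport χ).eq_empty_or_nonempty with he | hne
  · refine ⟨1, 1, one_pos, fun x s _ => image_eq_zero_of_notMem_tsupport fun h => ?_⟩
    exact (he ▸ (⟨(x, s), h, rfl⟩ : s ∈ Prod.snd '' tsupport χ) : s ∈ (∅ : Set ℝ))
  · obtain ⟨r, ⟨p, hp, rfl⟩, hr⟩ := hS.exists_isLeast hne
    obtain ⟨R, -, hR⟩ := hS.exists_isGreatest hne
    refine ⟨p.2, R, (hχ hp).2, fun x s hs => image_eq_zero_of_notMem_tsupport fun h => hs ?_⟩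
    exact ⟨hr ⟨_, h, rfl⟩, hR ⟨_, h, rfl⟩⟩

variable [Bundle.RiemannianBundle (fun x : X => TangentSpace (𝓡 n) x)]
  [IsContMDiffRiemannianBundle (𝓡 n) ∞ (EuclideanSpace ℝ (Fin n))
      (fun x : X => TangentSpace (𝓡 n) x)]

/-- The smooth formula is applied to ψ h_k² with h_k → f and ∇ h_k → w in L². Squaring is the point:
for f = √q the limit is integration by parts against the density q, though q itself was never
differentiated. -/
theorem GenLim.integral_eq_zero (hm : IsRiemannianVolume n m) (hv : IsField v) (ha : IsFun n a)
    (h : GenLim m v a f K w) (hK : IsCompact K) (hKs : fieldSupport v a ⊆ K)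
    (hf : MemLp f 2 ((baseMeasure m).restrict (K ×ˢ univ)))
    {ψ : X × ℝ → ℝ} (hψ : Smooth n 1 ψ) {r R : ℝ} (hr : 0 < r)
    (h0 : ∀ x s, 0 < s → s ∉ Icc r R → ψ (x, s) = 0) :
    Integrable (fun p => (dirDerivXR v a ψ p + (divergence v p.1 + a p.1) * ψ p) * f p * f p)
        ((baseMeasure m).restrict (K ×ˢ univ)) ∧
    Integrable (fun p => 2 * ψ p * f p * w p) ((baseMeasure m).restrict (K ×ˢ univ)) ∧
    ∫ p in K ×ˢ univ, (dirDerivXR v a ψ p + (divergence v p.1 + a p.1) * ψ p) * f p * f p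
        ∂baseMeasure m +
      ∫ p in K ×ˢ univ, 2 * ψ p * f p * w p ∂baseMeasure m = 0 := by
  have := hm.isLocallyFiniteMeasure
  obtain ⟨hw, h, h1, h2, h3⟩ := h
  have hpos := ae_pos_restrict (m := m) K
  have hmem := ae_mem_restrict (m := m) hK
  have hb0 : ∀ x s, 0 < s → s ∉ Icc r R →
      dirDerivXR v a ψ (x, s) + (divergence v x + a x) * ψ (x, s) = 0 := fun x s hs hsr => by
    rw [dirDerivXR_eq_zero_of_slice h0 v a x s hs hsr, h0 x s hs hsr, mul_zero, add_zero]
  have hbc : ContinuousOn (fun p => dirDerivXR v a ψ p + (divergence v p.1 + a p.1) * ψ p)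
      (univ ×ˢ Ioi (0 : ℝ)) :=
    (continuousOn_dirDerivXR hψ hv ha).add
      (((continuous_divergence_add hm hv ha).comp continuous_fst).continuousOn.mul hψ.continuousOn)
  obtain ⟨C₁, hC₁⟩ := exists_bound_of_compact hbc hK hr hb0
  obtain ⟨C₂, hC₂⟩ := exists_bound_of_compact (g := fun p => 2 * ψ p)
    (continuousOn_const.mul hψ.continuousOn) hK hr fun x s hs hsr => by rw [h0 x s hs hsr, mul_zero]
  have hc : ∀ k, ContinuousOn (h k) (univ ×ˢ Ioi (0 : ℝ)) := fun k => (h1 k).smooth.continuousOn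
  have hd : ∀ k, ContinuousOn (dirDerivXR v a (h k)) (univ ×ˢ Ioi (0 : ℝ)) := fun k =>
    continuousOn_dirDerivXR (h1 k).smooth_one hv ha
  have mh := fun k => aestronglyMeasurable_of_continuousOn hpos (hc k)
  have md := fun k => aestronglyMeasurable_of_continuousOn hpos (hd k)
  have mb := aestronglyMeasurable_of_continuousOn hpos hbc
  have mψ := aestronglyMeasurable_of_continuousOn hpos
    (f := fun p => 2 * ψ p) (continuousOn_const.mul hψ.continuousOn)
  have bb : ∀ᵐ p ∂(baseMeasure m).restrict (K ×ˢ univ),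
      |dirDerivXR v a ψ p + (divergence v p.1 + a p.1) * ψ p| ≤ C₁ := by
    filter_upwards [hpos, hmem] with p hp hpK using hC₁ p hpK hp
  have bψ : ∀ᵐ p ∂(baseMeasure m).restrict (K ×ˢ univ), |2 * ψ p| ≤ C₂ := by
    filter_upwards [hpos, hmem] with p hp hpK using hC₂ p hpK hp
  have T1 := tendsto_integral_mul_of_tendsto (memLp_mul_of_bounded mb bb hf) hf
    (fun k => mb.mul (mh k)) mh (tendsto_eLpNorm_mul_of_bounded bb h2) h2
  have T2 := tendsto_integral_mul_of_tendsto (memLp_mul_of_bounded mψ bψ hf) hw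
    (fun k => mψ.mul (mh k)) md (tendsto_eLpNorm_mul_of_bounded bψ h2) h3
  refine ⟨(memLp_mul_of_bounded mb bb hf).integrable_mul hf,
    (memLp_mul_of_bounded mψ bψ hf).integrable_mul hw, ?_⟩
  refine tendsto_nhds_unique (T1.2.add T2.2) (Tendsto.congr' ?_ tendsto_const_nhds)
  filter_upwards [T1.1, T2.1] with k i1 i2
  -- The product rule turns ∇(ψ h_k²) into h_k² ∇ψ + 2 ψ h_k ∇h_k, the two integrands whose limits
  -- are known.
  have hs : Smooth n 1 (fun p => ψ p * (h k p * h k p)) :=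
    hψ.mul ((h1 k).smooth_one.mul (h1 k).smooth_one)
  have hz := integral_dirDerivXR_add hm hv ha hs hr fun x s hs hsr => by
    rw [h0 x s hs hsr, zero_mul]
  rw [← setIntegral_eq_integral_of_forall_compl_eq_zero (s := K ×ˢ univ)] at hz
  · rw [← hz]
    refine Eq.trans ?_ (integral_add i1 i2)
    refine integral_congr_ae ?_
    filter_upwards [hpos] with p hp
    rw [dirDerivXR_mul hψ (φ := ψ) (ψ := fun p => h k p * h k p)
      ((h1 k).smooth_one.mul (h1 k).smooth_one) v a hp,
      dirDerivXR_mul (h1 k).smooth_one (h1 k).smooth_one v a hp]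
    simp only [Pi.mul_apply]
    ring
  · rintro ⟨x, s⟩ hp
    have hx : x ∉ fieldSupport v a := fun hx => hp ⟨hKs hx, mem_univ _⟩
    rw [dirDerivXR_eq_zero hx, show divergence v x + a x = 0 from divergence_add_eq_zero hx,
      zero_mul, add_zero]

/-- The preceding identity determines the integral of χ f w for every compactly supported smooth χ,
hence f w, and then w because f does not vanish. Uniqueness is thus obtained exactly for the
functions needed, such as √q. -/
theorem GenLim.unique (hm : IsRiemannianVolume n m) (hv : IsField v) (ha : IsFun n a)
    {w' : X × ℝ → ℝ} (h : GenLim m v a f K w) (h' : GenLim m v a f K w') (hK : IsCompact K)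
    (hKs : fieldSupport v a ⊆ K)
    (hf : MemLp f 2 ((baseMeasure m).restrict (K ×ˢ univ)))
    (hf0 : ∀ᵐ p ∂(baseMeasure m).restrict (K ×ˢ univ), f p ≠ 0) :
    w =ᵐ[(baseMeasure m).restrict (K ×ˢ univ)] w' := by
  have := hm.isLocallyFiniteMeasure
  have hpos := ae_pos_restrict (m := m) K
  have i1 := hf.integrable_mul h.1
  have i2 := hf.integrable_mul h'.1
  have key := ae_eq_zero_of_forall_integral_mul_eq_zero n
    ((i1.sub i2).locallyIntegrable.locallyIntegrableOn _) fun χ hχ hχc hχs => by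
    obtain ⟨r, R, hr, h0⟩ := exists_Icc_of_tsupport hχc hχs
    have hχ1 : Smooth n 1 χ := (hχ.of_le (by exact_mod_cast le_top)).contMDiffOn
    have e1 := (h.integral_eq_zero hm hv ha hK hKs hf hχ1 hr fun x s _ => h0 x s).2.2
    have e2 := (h'.integral_eq_zero hm hv ha hK hKs hf hχ1 hr fun x s _ => h0 x s).2.2
    obtain ⟨C, hC⟩ := exists_bound_of_compact hχ.continuous.continuousOn hK hr fun x s _ => h0 x s
    have bχ : ∀ᵐ p ∂(baseMeasure m).restrict (K ×ˢ univ), |χ p| ≤ C := by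
      filter_upwards [hpos, ae_mem_restrict hK] with p hp hpK using hC p hpK hp
    have j1 : Integrable (fun p => χ p * (f p * w p)) ((baseMeasure m).restrict (K ×ˢ univ)) :=
      i1.bdd_mul (c := C) hχ.continuous.aestronglyMeasurable bχ
    have j2 : Integrable (fun p => χ p * (f p * w' p)) ((baseMeasure m).restrict (K ×ˢ univ)) :=
      i2.bdd_mul (c := C) hχ.continuous.aestronglyMeasurable bχ
    have s1 : ∫ p in K ×ˢ univ, 2 * χ p * f p * w p ∂baseMeasure m =
        2 * ∫ p in K ×ˢ univ, χ p * (f p * w p) ∂baseMeasure m := by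
      rw [← integral_const_mul]
      refine integral_congr_ae (Eventually.of_forall fun p => ?_)
      simp only
      ring
    have s2 : ∫ p in K ×ˢ univ, 2 * χ p * f p * w' p ∂baseMeasure m =
        2 * ∫ p in K ×ˢ univ, χ p * (f p * w' p) ∂baseMeasure m := by
      rw [← integral_const_mul]
      refine integral_congr_ae (Eventually.of_forall fun p => ?_)
      simp only
      ring
    have s3 : ∫ p in K ×ˢ univ, χ p * (f * w - f * w') p ∂baseMeasure m =
        ∫ p in K ×ˢ univ, χ p * (f p * w p) ∂baseMeasure m -
        ∫ p in K ×ˢ univ, χ p * (f p * w' p) ∂baseMeasure m := by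
      rw [← integral_sub j1 j2]
      refine integral_congr_ae (Eventually.of_forall fun p => ?_)
      simp only [Pi.sub_apply, Pi.mul_apply]
      ring
    rw [s1] at e1
    rw [s2] at e2
    rw [s3]
    linarith
  filter_upwards [key, hpos, hf0] with p hp hp0 hfp
  have := hp hp0
  simp only [Pi.sub_apply, Pi.mul_apply, ← mul_sub] at this
  exact sub_eq_zero.1 ((mul_eq_zero.1 this).resolve_left hfp)

end GenDeriv

/-! ### Existence of generalized derivatives of local Sobolev functions -/

section Existence

variable {n : ℕ} {X : Type*} [TopologicalSpace X] [T2Space X] [SecondCountableTopology X]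
  [LocallyCompactSpace X] [ChartedSpace (EuclideanSpace ℝ (Fin n)) X] [IsManifold (𝓡 n) ∞ X]
  [MeasurableSpace X] [BorelSpace X]
  {v : (x : X) → TangentSpace (𝓡 n) x} {a : X → ℝ} {m : Measure X}
  [Bundle.RiemannianBundle (fun x : X => TangentSpace (𝓡 n) x)]
  [IsContMDiffRiemannianBundle (𝓡 n) ∞ (EuclideanSpace ℝ (Fin n))
      (fun x : X => TangentSpace (𝓡 n) x)]

theorem IsField.exists_inner_le (hv : IsField v) :
    ∃ M : ℝ, 0 < M ∧ ∀ x, (inner ℝ (v x) (v x) : ℝ) ≤ M ^ 2 := by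
  have hc : ContMDiff (𝓡 n) 𝓘(ℝ, ℝ) ∞ fun x => (inner ℝ (v x) (v x) : ℝ) :=
    hv.1.inner_bundle hv.1
  have hs : HasCompactSupport fun x => (inner ℝ (v x) (v x) : ℝ) := by
    refine HasCompactSupport.intro hv.2 fun x hx => ?_
    have h0 : v x = 0 := by
      by_contra h
      exact hx (subset_closure h)
    rw [h0, inner_zero_left]
  obtain ⟨C, hC⟩ := hs.exists_bound_of_continuous hc.continuous
  refine ⟨max C 1, lt_max_of_lt_right one_pos, fun x => ?_⟩
  have h1 := (le_abs_self _).trans (hC x)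
  have h2 : (1 : ℝ) ≤ max C 1 := le_max_right _ _
  nlinarith [le_max_left C 1]

theorem IsFun.exists_bound (ha : IsFun n a) : ∃ A : ℝ, ∀ x, |a x| ≤ A :=
  ha.2.exists_bound_of_continuous ha.1.continuous

theorem sq_mul_add_le (M y : ℝ) {z B : ℝ} (h : z ^ 2 ≤ B) :
    (M * y + z) ^ 2 ≤ 2 * M ^ 2 * y ^ 2 + 2 * B := by
  nlinarith [sq_nonneg (M * y - z)]

/-- The horizontal gradient is a supremum over vectors of norm at most one. It is tested on v / M,
with M a bound for the norm of `v`; the vertical part is bounded through the maximum of |a|. -/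
theorem exists_sq_dirDerivXR_le (hv : IsField v) (ha : IsFun n a) :
    ∃ C : ℝ≥0∞, C ≠ ⊤ ∧ ∀ (h : X × ℝ → ℝ) (p : X × ℝ),
      ENNReal.ofReal (dirDerivXR v a h p ^ 2) ≤ C * gradSq (n := n) h p := by
  obtain ⟨M, hM, hvM⟩ := hv.exists_inner_le
  obtain ⟨A, hA⟩ := ha.exists_bound
  refine ⟨ENNReal.ofReal (2 * M ^ 2) + ENNReal.ofReal (2 * A ^ 2),
    ENNReal.add_ne_top.2 ⟨ENNReal.ofReal_ne_top, ENNReal.ofReal_ne_top⟩, fun h p => ?_⟩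
  set L := mfderiv (𝓡 n) 𝓘(ℝ, ℝ) (fun x => h (x, p.2)) p.1 with hL
  set D := deriv (fun s => h (p.1, s)) p.2 with hD
  have e1 : along v (fun x => h (x, p.2)) p.1 = M * (show ℝ from L (M⁻¹ • v p.1)) := by
    have h1 : (show ℝ from L (M⁻¹ • v p.1)) = M⁻¹ * (show ℝ from L (v p.1)) := L.map_smul M⁻¹ (v p.1)
    rw [h1, mul_inv_cancel_left₀ hM.ne']
    rfl
  have hle : (inner ℝ (M⁻¹ • v p.1) (M⁻¹ • v p.1) : ℝ) ≤ 1 := by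
    rw [real_inner_smul_left, real_inner_smul_right, ← mul_assoc, ← sq, inv_pow]
    rw [inv_mul_le_iff₀ (by positivity), mul_one]
    exact hvM p.1
  have h1 : ENNReal.ofReal ((show ℝ from L (M⁻¹ • v p.1)) ^ 2) ≤
      ⨆ (w : TangentSpace (𝓡 n) p.1) (_ : inner ℝ w w ≤ (1 : ℝ)),
        ENNReal.ofReal ((show ℝ from L w) ^ 2) :=
    le_iSup₂_of_le (f := fun (w : TangentSpace (𝓡 n) p.1) (_ : inner ℝ w w ≤ (1 : ℝ)) =>
      ENNReal.ofReal ((show ℝ from L w) ^ 2)) (M⁻¹ • v p.1) hle le_rfl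
  have h2 : dirDerivXR v a h p ^ 2 ≤ 2 * M ^ 2 * (show ℝ from L (M⁻¹ • v p.1)) ^ 2 +
      2 * A ^ 2 * (p.2 ^ 2 * D ^ 2) := by
    have hab : a p.1 ^ 2 ≤ A ^ 2 := by
      rw [← sq_abs]
      exact pow_le_pow_left₀ (abs_nonneg _) (hA p.1) 2
    rw [dirDerivXR, e1]
    have h3 : (p.2 * D * a p.1) ^ 2 ≤ A ^ 2 * (p.2 ^ 2 * D ^ 2) := by
      have : (p.2 * D * a p.1) ^ 2 = a p.1 ^ 2 * (p.2 ^ 2 * D ^ 2) := by ring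
      rw [this]
      exact mul_le_mul_of_nonneg_right hab (by positivity)
    refine (sq_mul_add_le M (show ℝ from L (M⁻¹ • v p.1)) h3).trans (le_of_eq ?_)
    rw [mul_assoc 2 (A ^ 2)]
  calc ENNReal.ofReal (dirDerivXR v a h p ^ 2)
      ≤ ENNReal.ofReal (2 * M ^ 2) * ENNReal.ofReal ((show ℝ from L (M⁻¹ • v p.1)) ^ 2) +
        ENNReal.ofReal (2 * A ^ 2) * ENNReal.ofReal (p.2 ^ 2 * D ^ 2) := by
        rw [← ENNReal.ofReal_mul (by positivity), ← ENNReal.ofReal_mul (by positivity),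
          ← ENNReal.ofReal_add (by positivity) (by positivity)]
        exact ENNReal.ofReal_le_ofReal h2
    _ ≤ (ENNReal.ofReal (2 * M ^ 2) + ENNReal.ofReal (2 * A ^ 2)) * gradSq (n := n) h p := by
        rw [add_mul]
        refine add_le_add ?_ ?_
        · gcongr
          exact h1.trans le_self_add
        · gcongr
          exact le_add_self

/-- The gradient norm dominates ∇_{(v,a)}, so a sequence that is Cauchy in the Sobolev norm has
directional derivatives that are Cauchy in L², and completeness supplies the limit. -/
theorem IsLocSobolev.exists_genLim (hm : IsRiemannianVolume n m) (hv : IsField v) (ha : IsFun n a)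
    {f : X × ℝ → ℝ} (hf : IsLocSobolev n m f) {K : Set X} (hK : IsCompact K) :
    ∃ w, GenLim m v a f K w := by
  have := hm.isLocallyFiniteMeasure
  obtain ⟨φ, ⟨hφ, h, h1, h2, h3⟩, hfφ⟩ := hf K hK
  obtain ⟨C, hC, hCle⟩ := exists_sq_dirDerivXR_le hv ha
  have hpos := ae_pos_baseMeasure m
  have hd : ∀ k, MemLp (dirDerivXR v a (h k)) 2 (baseMeasure m) := fun k => by
    refine ⟨aestronglyMeasurable_of_continuousOn hpos
      (continuousOn_dirDerivXR (h1 k).1.smooth_one hv ha), ?_⟩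
    refine (eLpNorm_two_le_of_sq_le (Eventually.of_forall fun p => hCle (h k) p)).trans_lt ?_
    rw [lintegral_const_mul' _ _ hC]
    exact ENNReal.rpow_lt_top_of_nonneg (by norm_num) (ENNReal.mul_ne_top hC (h1 k).2.ne)
  obtain ⟨w, hw, hlim⟩ := exists_limit_of_cauchy hd (by
    have hb : ∀ kl : ℕ × ℕ, eLpNorm (fun p => dirDerivXR v a (h kl.1) p - dirDerivXR v a (h kl.2) p) 2
        (baseMeasure m) ≤ (C * ∫⁻ p, gradSq (n := n) (fun p => h kl.1 p - h kl.2 p) p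
          ∂baseMeasure m) ^ (1 / 2 : ℝ) := by
      intro kl
      rw [← lintegral_const_mul' _ _ hC]
      refine eLpNorm_two_le_of_sq_le ?_
      filter_upwards [hpos] with p hp
      rw [← dirDerivXR_sub (h1 _).1.smooth_one (h1 _).1.smooth_one v a hp]
      exact hCle _ p
    refine tendsto_of_tendsto_of_tendsto_of_le_of_le tendsto_const_nhds ?_ (fun _ => zero_le) hb
    have t1 := ENNReal.Tendsto.const_mul (a := C) h3 (Or.inr hC)
    rw [mul_zero] at t1
    have t2 := (ENNReal.continuous_rpow_const (y := (1 / 2 : ℝ))).tendsto 0 |>.comp t1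
    rw [ENNReal.zero_rpow_of_pos (by norm_num)] at t2
    exact t2)
  have hle : (baseMeasure m).restrict (K ×ˢ univ) ≤ baseMeasure m := Measure.restrict_le_self
  refine ⟨w, hw.mono_measure hle, h, fun k => (h1 k).1, ?_, ?_⟩
  · have : ∀ k, eLpNorm (fun p => h k p - f p) 2 ((baseMeasure m).restrict (K ×ˢ univ)) =
        eLpNorm (fun p => h k p - φ p) 2 ((baseMeasure m).restrict (K ×ˢ univ)) := fun k => by
      refine eLpNorm_congr_ae ?_
      filter_upwards [hfφ] with p hp
      rw [hp]
    simp_rw [this]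
    exact tendsto_of_tendsto_of_tendsto_of_le_of_le tendsto_const_nhds h2 (fun _ => zero_le)
      fun _ => eLpNorm_mono_measure _ hle
  · exact tendsto_of_tendsto_of_tendsto_of_le_of_le tendsto_const_nhds hlim (fun _ => zero_le)
      fun _ => eLpNorm_mono_measure _ hle

/-- One function must serve all compact sets K at once. The limit above the supports of `v` and `a`
is extended by zero; for given K, the limit above the union of K with these supports agrees with it
there by uniqueness and vanishes elsewhere. -/
theorem IsLocSobolev.exists_isGenDeriv (hm : IsRiemannianVolume n m) (hv : IsField v)
    (ha : IsFun n a) {f : X × ℝ → ℝ} (hf : IsLocSobolev n m f)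
    (hf2 : ∀ K : Set X, IsCompact K → MemLp f 2 ((baseMeasure m).restrict (K ×ˢ univ)))
    (hf0 : ∀ᵐ p ∂baseMeasure m, f p ≠ 0) : ∃ w, IsGenDeriv m v a f w := by
  have := hm.isLocallyFiniteMeasure
  have hK₀ := isCompact_fieldSupport hv ha
  obtain ⟨w₀, hw₀⟩ := hf.exists_genLim hm hv ha hK₀
  refine ⟨(fieldSupport v a ×ˢ univ).indicator w₀, fun K hK => ?_⟩
  have hKK : IsCompact (K ∪ fieldSupport v a) := hK.union hK₀
  obtain ⟨w₁, hw₁⟩ := hf.exists_genLim hm hv ha hKK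
  refine GenLim.mono (K := K ∪ fieldSupport v a) ?_ subset_union_left
  refine hw₁.congr ?_
  have h0 := hw₁.ae_eq_zero
  have h1 := (hw₁.mono subset_union_right).unique hm hv ha hw₀ hK₀ le_rfl (hf2 _ hK₀)
    (ae_restrict_of_ae hf0)
  rw [EventuallyEq, ae_restrict_iff' (hK₀.measurableSet.prod MeasurableSet.univ)] at h1
  filter_upwards [h0, ae_restrict_of_ae h1] with p hp0 hp1
  by_cases hp : p.1 ∈ fieldSupport v a
  · rw [indicator_of_mem (s := fieldSupport v a ×ˢ univ) ⟨hp, mem_univ _⟩, hp1 ⟨hp, mem_univ _⟩]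
  · rw [indicator_of_notMem (s := fieldSupport v a ×ˢ univ) fun h => hp h.1, hp0 hp]

theorem genDeriv_spec {f w : X × ℝ → ℝ} (h : IsGenDeriv m v a f w) :
    IsGenDeriv m v a f (genDeriv m v a f) := by
  have h' : ∃ w, IsGenDeriv m v a f w := ⟨w, h⟩
  rw [genDeriv, dif_pos h']
  exact h'.choose_spec

end Existence

/-! ### The logarithmic derivative of the Lévy measure -/

section LogDeriv

variable {n : ℕ} {X : Type*} [TopologicalSpace X] [T2Space X] [SecondCountableTopology X]
  [LocallyCompactSpace X] [ChartedSpace (EuclideanSpace ℝ (Fin n)) X] [IsManifold (𝓡 n) ∞ X]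
  [MeasurableSpace X] [BorelSpace X]

/-- The hypotheses on the density `q`. -/
structure IsWeight (m : Measure X) (q : X × ℝ → ℝ) : Prop where
  measurable : Measurable q
  pos : ∀ᵐ p ∂baseMeasure m, 0 < q p
  lintegral_lt_top : ∀ K : Set X, IsCompact K →
    ∫⁻ p in K ×ˢ univ, ENNReal.ofReal (max 1 p.2 * q p) ∂baseMeasure m < ⊤

/-- `β` is a version of the logarithmic derivative of `σ` along `(v, a)`, vanishing outside the
supports of `v` and `a`. -/
structure IsWeakLogDeriv (σ : Measure (X × ℝ)) (v : (x : X) → TangentSpace (𝓡 n) x) (a : X → ℝ)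
    (β : X × ℝ → ℝ) : Prop where
  measurable : Measurable β
  supp : SuppIn (fieldSupport v a) β
  memLp : MemLp β 2 σ
  integrable : Integrable β σ
  ibp : ∀ ψ : X × ℝ → ℝ, Smooth n 1 ψ → (∃ C, ∀ p : X × ℝ, 0 < p.2 → |ψ p| ≤ C) →
    (∃ C, ∀ p : X × ℝ, 0 < p.2 → |dirDerivXR v a ψ p| ≤ C * max 1 p.2) →
    Integrable (dirDerivXR v a ψ) σ ∧ ∫ p, (dirDerivXR v a ψ p + β p * ψ p) ∂σ = 0

variable {v : (x : X) → TangentSpace (𝓡 n) x} {a : X → ℝ} {m : Measure X} {q : X × ℝ → ℝ}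

theorem IsWeight.memLp_sqrt (hq : IsWeight m q) {K : Set X} (hK : IsCompact K) :
    MemLp (fun p => √(q p)) 2 ((baseMeasure m).restrict (K ×ˢ univ)) := by
  have hmeas : Measurable fun p => √(q p) := hq.measurable.sqrt
  rw [memLp_two_iff_integrable_sq hmeas.aestronglyMeasurable]
  refine ⟨(hmeas.pow_const 2).aestronglyMeasurable, ?_⟩
  rw [hasFiniteIntegral_iff_norm]
  refine (lintegral_mono_ae ?_).trans_lt (hq.lintegral_lt_top K hK)
  filter_upwards [ae_restrict_of_ae hq.pos] with p hp
  refine ENNReal.ofReal_le_ofReal ?_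
  rw [Real.sq_sqrt hp.le, Real.norm_of_nonneg hp.le]
  exact le_mul_of_one_le_left hp.le (le_max_left _ _)

theorem IsWeight.sqrt_ne_zero (hq : IsWeight m q) : ∀ᵐ p ∂baseMeasure m, √(q p) ≠ 0 :=
  hq.pos.mono fun _ hp => (Real.sqrt_pos.2 hp).ne'

theorem levyMeasure_ac : levyMeasure m q ≪ baseMeasure m := withDensity_absolutelyContinuous _ _

theorem IsWeight.baseMeasure_ac (hq : IsWeight m q) : baseMeasure m ≪ levyMeasure m q :=
  withDensity_absolutelyContinuous' hq.measurable.ennreal_ofReal.aemeasurable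
    (hq.pos.mono fun _ hp => (ENNReal.ofReal_pos.2 hp).ne')

theorem IsWeight.integral_levyMeasure (hq : IsWeight m q) (F : X × ℝ → ℝ) :
    ∫ p, F p ∂levyMeasure m q = ∫ p, q p * F p ∂baseMeasure m := by
  rw [levyMeasure, integral_withDensity_eq_integral_toReal_smul hq.measurable.ennreal_ofReal
    (Eventually.of_forall fun _ => ENNReal.ofReal_lt_top)]
  refine integral_congr_ae ?_
  filter_upwards [hq.pos] with p hp
  rw [ENNReal.toReal_ofReal hp.le, smul_eq_mul]

theorem IsWeight.lintegral_max_lt_top (hq : IsWeight m q) {K : Set X} (hK : IsCompact K) :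
    ∫⁻ p in K ×ˢ univ, ENNReal.ofReal (max 1 p.2) ∂levyMeasure m q < ⊤ := by
  have hs : MeasurableSet (K ×ˢ univ : Set (X × ℝ)) := hK.measurableSet.prod MeasurableSet.univ
  rw [levyMeasure, restrict_withDensity hs, lintegral_withDensity_eq_lintegral_mul _
    hq.measurable.ennreal_ofReal (by fun_prop)]
  refine lt_of_le_of_lt (le_of_eq (lintegral_congr fun p => ?_)) (hq.lintegral_lt_top K hK)
  rw [Pi.mul_apply, ENNReal.ofReal_mul (zero_le_one.trans (le_max_left _ _)), mul_comm]

theorem IsWeight.isLevy (hq : IsWeight m q) [SFinite m] (hm0 : ∀ x, m {x} = 0) :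
    IsLevy (levyMeasure m q) := by
  refine ⟨fun K hK => ?_, levyMeasure_ac.ae_le (ae_pos_baseMeasure m), fun x => levyMeasure_ac ?_⟩
  · refine lt_of_le_of_lt ?_ (hq.lintegral_max_lt_top hK)
    rw [← setLIntegral_one]
    refine lintegral_mono fun p => ?_
    rw [← ENNReal.ofReal_one]
    exact ENNReal.ofReal_le_ofReal (le_max_left _ _)
  · rw [baseMeasure, Measure.prod_prod, hm0, zero_mul]

theorem IsWeight.integrable_indicator_max (hq : IsWeight m q) {K : Set X} (hK : IsCompact K) :
    Integrable ((K ×ˢ univ).indicator fun p : X × ℝ => max 1 p.2) (levyMeasure m q) := by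
  rw [integrable_indicator_iff (hK.measurableSet.prod MeasurableSet.univ)]
  refine ⟨by fun_prop, ?_⟩
  rw [hasFiniteIntegral_iff_norm]
  refine lt_of_le_of_lt (le_of_eq (lintegral_congr fun p => ?_)) (hq.lintegral_max_lt_top hK)
  rw [Real.norm_of_nonneg (zero_le_one.trans (le_max_left _ _))]

variable [Bundle.RiemannianBundle (fun x : X => TangentSpace (𝓡 n) x)]
  [IsContMDiffRiemannianBundle (𝓡 n) ∞ (EuclideanSpace ℝ (Fin n))
      (fun x : X => TangentSpace (𝓡 n) x)]

/-- Integration by parts for functions vanishing for small and large marks extends to all bounded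
functions of controlled growth of the derivative. -/
theorem integral_dirDerivXR_add_of_cutoff (hv : IsField v) (ha : IsFun n a) (hq : IsWeight m q)
    [SFinite m] {β : X × ℝ → ℝ} (hβ : Integrable β (levyMeasure m q))
    (h : ∀ ψ : X × ℝ → ℝ, Smooth n 1 ψ →
      (∃ r R : ℝ, 0 < r ∧ ∀ x s, 0 < s → s ∉ Icc r R → ψ (x, s) = 0) →
      ∫ p, (dirDerivXR v a ψ p + β p * ψ p) ∂levyMeasure m q = 0)
    {ψ : X × ℝ → ℝ} (hψ : Smooth n 1 ψ) {C D : ℝ} (hC : ∀ p : X × ℝ, 0 < p.2 → |ψ p| ≤ C)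
    (hD : ∀ p : X × ℝ, 0 < p.2 → |dirDerivXR v a ψ p| ≤ D * max 1 p.2) :
    Integrable (dirDerivXR v a ψ) (levyMeasure m q) ∧
      ∫ p, (dirDerivXR v a ψ p + β p * ψ p) ∂levyMeasure m q = 0 := by
  have hK := isCompact_fieldSupport hv ha
  obtain ⟨A, hA⟩ := ha.exists_bound
  have hpos : ∀ᵐ p ∂levyMeasure m q, 0 < p.2 := levyMeasure_ac.ae_le (ae_pos_baseMeasure m)
  have hG := hq.integrable_indicator_max hK
  set G : X × ℝ → ℝ := (fieldSupport v a ×ˢ univ).indicator fun p => max 1 p.2 with hGdef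
  have hDG : ∀ p : X × ℝ, 0 < p.2 → |dirDerivXR v a ψ p| ≤ |D| * G p := by
    intro p hp
    by_cases hx : p.1 ∈ fieldSupport v a
    · rw [hGdef, indicator_of_mem (s := fieldSupport v a ×ˢ univ) ⟨hx, mem_univ _⟩]
      exact (hD p hp).trans (mul_le_mul_of_nonneg_right (le_abs_self D)
        (zero_le_one.trans (le_max_left _ _)))
    · rw [hGdef, indicator_of_notMem (s := fieldSupport v a ×ˢ univ) fun h => hx h.1,
        show dirDerivXR v a ψ p = 0 from dirDerivXR_eq_zero hx ψ p.2]
      simp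
  have md : AEStronglyMeasurable (dirDerivXR v a ψ) (levyMeasure m q) :=
    aestronglyMeasurable_of_continuousOn hpos (continuousOn_dirDerivXR hψ hv ha)
  refine ⟨(hG.const_mul |D|).mono' md (hpos.mono fun p hp => hDG p hp), ?_⟩
  let B : ContDiffBump (0 : ℝ) := ⟨1, 2, one_pos, one_lt_two⟩
  have hBs : ContDiff ℝ ∞ B := B.contDiff
  obtain ⟨E, hE⟩ := (B.hasCompactSupport.deriv).exists_bound_of_continuous
    (hBs.continuous_deriv (by exact_mod_cast le_top))
  have hE0 : 0 ≤ E := (norm_nonneg _).trans (hE 0)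
  -- The cutoff is a bump in log s / (k + 1) because s ∂_s is differentiation in log s: |s ∂_s ρ_k|
  -- ≤ E / (k + 1) uniformly in s, so the error term ψ a s ∂_s ρ_k is bounded and tends to zero.
  set ρ : ℕ → ℝ → ℝ := fun k s => B (Real.log s / (k + 1)) with hρ
  have hk : ∀ k : ℕ, (0 : ℝ) < k + 1 := fun k => by positivity
  have hρs : ∀ k, ContDiffOn ℝ 1 (ρ k) (Ioi 0) := fun k =>
    (hBs.of_le (by exact_mod_cast le_top)).comp_contDiffOn
      ((Real.contDiffOn_log.mono fun s hs => (ne_of_gt hs : s ≠ 0)).div_const _)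
  have hρS : ∀ k, Smooth n 1 (fun p : X × ℝ => ρ k p.2) := fun k =>
    (hρs k).contMDiffOn.comp contMDiff_snd.contMDiffOn fun p hp => hp.2
  have hρ1 : ∀ k s, |ρ k s| ≤ 1 := fun k s => by
    rw [abs_of_nonneg B.nonneg]
    exact B.le_one
  have hρd : ∀ k (p : X × ℝ), 0 < p.2 → |dirDerivXR v a (fun p => ρ k p.2) p| ≤ E / (k + 1) * |a p.1| := by
    intro k p hp
    have h1 : HasDerivAt (ρ k) (deriv B (Real.log p.2 / (k + 1)) * (p.2⁻¹ / (k + 1))) p.2 :=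
      ((hBs.differentiable (by simp)) _).hasDerivAt.comp p.2
        ((Real.hasDerivAt_log hp.ne').div_const _)
    have h2 : along v (fun _ : X => ρ k p.2) p.1 = 0 :=
      congrArg (fun L => L (v p.1)) (mfderiv_const (I := 𝓡 n) (I' := 𝓘(ℝ, ℝ)) (c := ρ k p.2) (x := p.1))
    have h3 : dirDerivXR v a (fun p => ρ k p.2) p =
        deriv B (Real.log p.2 / (k + 1)) / (k + 1) * a p.1 := by
      rw [dirDerivXR, h2, zero_add, show deriv (fun s => ρ k s) p.2 = _ from h1.deriv]
      have := hk k
      field_simp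
    rw [h3, abs_mul, abs_div, abs_of_pos (hk k)]
    gcongr
    exact hE _
  have hz : ∀ k : ℕ, ∫ p, (dirDerivXR v a (fun p => ψ p * ρ k p.2) p + β p * (ψ p * ρ k p.2))
      ∂levyMeasure m q = 0 := by
    intro k
    -- The bump has outer radius 2, so ρ_k vanishes once |log s| ≥ 2 (k + 1).
    refine h _ (hψ.mul (hρS k)) ⟨Real.exp (-(2 * (k + 1))), Real.exp (2 * (k + 1)), Real.exp_pos _,
      fun x s hs hsr => ?_⟩
    have : ρ k s = 0 := by
      refine B.zero_of_le_dist ?_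
      rw [Real.dist_eq, sub_zero, abs_div, abs_of_pos (hk k), le_div_iff₀ (hk k)]
      by_contra hlt
      rw [not_le] at hlt
      have h1 := abs_lt.1 hlt
      change -(2 * ((k : ℝ) + 1)) < Real.log s ∧ Real.log s < 2 * (k + 1) at h1
      exact hsr ⟨((Real.lt_log_iff_exp_lt hs).1 h1.1).le, ((Real.log_lt_iff_lt_exp hs).1 h1.2).le⟩
    simp only [this, mul_zero]
  have hmul : ∀ k (p : X × ℝ), 0 < p.2 → dirDerivXR v a (fun p => ψ p * ρ k p.2) p =
      dirDerivXR v a ψ p * ρ k p.2 + ψ p * dirDerivXR v a (fun p => ρ k p.2) p := fun k p hp =>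
    dirDerivXR_mul hψ (hρS k) v a hp
  -- The function G, equal to max {1, s} above the supports of `v` and `a`, is σ-integrable and
  -- dominates both ∇ψ and the error term; the zero-order term is dominated by |β|.
  have hlim := tendsto_integral_of_dominated_convergence (μ := levyMeasure m q)
    (F := fun (k : ℕ) p => dirDerivXR v a (fun p => ψ p * ρ k p.2) p + β p * (ψ p * ρ k p.2))
    (f := fun p => dirDerivXR v a ψ p + β p * ψ p)
    (fun p => (|D| * G p + |C| * (E * (|A| * G p))) + |C| * |β p|) (fun k => ?_) ?_ (fun k => ?_) ?_
  · simp only [hz] at hlim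
    exact tendsto_nhds_unique hlim tendsto_const_nhds
  · refine AEStronglyMeasurable.add (aestronglyMeasurable_of_continuousOn hpos
      (continuousOn_dirDerivXR (hψ.mul (hρS k)) hv ha)) (hβ.1.mul
      (aestronglyMeasurable_of_continuousOn hpos (hψ.mul (hρS k)).continuousOn))
  · exact ((hG.const_mul _).add (((hG.const_mul _).const_mul _).const_mul _)).add
      (hβ.abs.const_mul _)
  · filter_upwards [hpos] with p hp
    have hCp : |ψ p| ≤ |C| := (hC p hp).trans (le_abs_self C)
    have h1 : |a p.1| ≤ |A| * G p := by
      by_cases hx : p.1 ∈ fieldSupport v a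
      · rw [hGdef, indicator_of_mem (s := fieldSupport v a ×ˢ univ) ⟨hx, mem_univ _⟩]
        exact ((hA p.1).trans (le_abs_self A)).trans (le_mul_of_one_le_right (abs_nonneg _)
          (le_max_left _ _))
      · rw [hGdef, indicator_of_notMem (s := fieldSupport v a ×ˢ univ) fun h => hx h.1,
          fun_eq_zero_of_notMem_fieldSupport hx]
        simp
    have h2 : |dirDerivXR v a (fun p => ρ k p.2) p| ≤ E * (|A| * G p) := by
      refine (hρd k p hp).trans (mul_le_mul ?_ h1 (abs_nonneg _) hE0)
      exact div_le_self hE0 (by linarith [(Nat.cast_nonneg k : (0 : ℝ) ≤ k)])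
    rw [Real.norm_eq_abs, hmul k p hp]
    refine (abs_add_le _ _).trans (add_le_add ((abs_add_le _ _).trans (add_le_add ?_ ?_)) ?_)
    · rw [abs_mul]
      exact (mul_le_of_le_one_right (abs_nonneg _) (hρ1 k _)).trans (hDG p hp)
    · rw [abs_mul]
      exact mul_le_mul hCp h2 (abs_nonneg _) (abs_nonneg _)
    · rw [abs_mul, abs_mul, mul_comm]
      exact mul_le_mul_of_nonneg_right ((mul_le_of_le_one_right (abs_nonneg _) (hρ1 k _)).trans hCp)
        (abs_nonneg _)
  · filter_upwards [hpos] with p hp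
    have t0 : Tendsto (fun k : ℕ => ((k : ℝ) + 1)⁻¹) atTop (𝓝 0) :=
      (tendsto_atTop_add_const_right _ _ tendsto_natCast_atTop_atTop).inv_tendsto_atTop
    have t1 : Tendsto (fun k : ℕ => ρ k p.2) atTop (𝓝 1) := by
      have h1 : Tendsto (fun k : ℕ => Real.log p.2 / ((k : ℝ) + 1)) atTop (𝓝 0) := by
        simpa [div_eq_mul_inv] using t0.const_mul (Real.log p.2)
      have h2 : B (0 : ℝ) = 1 := B.one_of_mem_closedBall (by simp [B])
      rw [← h2]
      exact (hBs.continuous.tendsto 0).comp h1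
    have t2 : Tendsto (fun k : ℕ => dirDerivXR v a (fun p : X × ℝ => ρ k p.2) p) atTop (𝓝 0) := by
      refine squeeze_zero_norm (fun k => hρd k p hp) ?_
      have := (t0.const_mul E).mul_const |a p.1|
      simpa [div_eq_mul_inv] using this
    have t3 := ((t1.const_mul (dirDerivXR v a ψ p)).add (t2.const_mul (ψ p))).add
      ((t1.const_mul (ψ p)).const_mul (β p))
    simp only [mul_one, mul_zero, add_zero] at t3
    refine t3.congr fun k => ?_
    rw [hmul k p hp]

/-- `logDeriv` involves an arbitrary choice and is determined only up to null sets. The β built here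
from 2 w / √q + div v + a is Borel measurable and vanishes identically off the supports of `v` and
`a`, so its pairing with every configuration is a finite sum. -/
theorem exists_isWeakLogDeriv (hm : IsRiemannianVolume n m) (hv : IsField v) (ha : IsFun n a)
    (hq : IsWeight m q) (hsob : IsLocSobolev n m (fun p => √(q p))) :
    ∃ β, IsWeakLogDeriv (levyMeasure m q) v a β ∧ β =ᵐ[levyMeasure m q] logDeriv m q v a := by
  have := hm.isLocallyFiniteMeasure
  have hK := isCompact_fieldSupport hv ha
  obtain ⟨w₀, hw₀⟩ := hsob.exists_isGenDeriv hm hv ha (fun K hK => hq.memLp_sqrt hK) hq.sqrt_ne_zero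
  have hw : ∀ K, IsCompact K → GenLim m v a (fun p => √(q p)) K
    (genDeriv m v a fun p => √(q p)) := genDeriv_spec hw₀
  set w := genDeriv m v a fun p => √(q p) with hwdef
  have hpos := ae_pos_baseMeasure m
  have hms : MeasurableSet (fieldSupport v a ×ˢ univ : Set (X × ℝ)) :=
    hK.measurableSet.prod MeasurableSet.univ
  -- A measurable representative of the generalized derivative above the supports of `v` and `a`.
  obtain ⟨w', hw'm, hww'⟩ := (hw _ hK).1.1
  rw [EventuallyEq, ae_restrict_iff' hms] at hww'
  have hdiv := continuous_divergence_add hm hv ha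
  -- The vanishing of w is known above each compact set; a countable exhaustion makes it global.
  have hw0 : ∀ᵐ p ∂baseMeasure m, p.1 ∉ fieldSupport v a → w p = 0 := by
    have : ∀ j, ∀ᵐ p ∂baseMeasure m, p ∈ (compactCovering X j ×ˢ univ : Set (X × ℝ)) →
        p.1 ∉ fieldSupport v a → w p = 0 := fun j => by
      have := (hw _ (isCompact_compactCovering X j)).ae_eq_zero
      rwa [ae_restrict_iff' ((isCompact_compactCovering X j).measurableSet.prod
        MeasurableSet.univ)] at this
    filter_upwards [ae_all_iff.2 this] with p hp
    obtain ⟨j, hj⟩ := mem_iUnion.1 ((iUnion_compactCovering X).symm ▸ mem_univ p.1)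
    exact hp j ⟨hj, mem_univ _⟩
  set β : X × ℝ → ℝ := (fieldSupport v a ×ˢ univ).indicator fun p =>
    2 * w' p / √(q p) + (divergence v p.1 + a p.1) with hβ
  have hβm : Measurable β := by
    refine Measurable.indicator ?_ hms
    exact ((measurable_const.mul hw'm.measurable).div hq.measurable.sqrt).add
      (hdiv.measurable.comp measurable_fst)
  have hβlog : β =ᵐ[levyMeasure m q] logDeriv m q v a := by
    refine levyMeasure_ac.ae_le ?_
    filter_upwards [hw0, hww'] with p h0 h1
    by_cases hp : p.1 ∈ fieldSupport v a
    · have hp' : p ∈ (fieldSupport v a ×ˢ univ : Set (X × ℝ)) := ⟨hp, mem_univ _⟩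
      rw [hβ, indicator_of_mem hp', ← h1 hp', logDeriv, ← hwdef, add_assoc]
    · rw [hβ, indicator_of_notMem (s := fieldSupport v a ×ˢ univ) (fun h => hp h.1), logDeriv,
        ← hwdef, h0 hp, mul_zero, zero_div, zero_add,
        show divergence v p.1 + a p.1 = 0 from divergence_add_eq_zero hp]
  have hqK : IntegrableOn (fun p => √(q p) ^ 2) (fieldSupport v a ×ˢ univ) (baseMeasure m) :=
    (hq.memLp_sqrt hK).integrable_sq
  obtain ⟨A, hA⟩ : ∃ A : ℝ, ∀ x, |divergence v x + a x| ≤ A := by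
    refine HasCompactSupport.exists_bound_of_continuous ?_ hdiv
    exact HasCompactSupport.intro hK fun x hx => divergence_add_eq_zero hx
  -- q β² = (2 w + √q (div v + a))² ≤ 8 w² + 2 A² q, and both w and √q are square integrable above
  -- the supports of `v` and `a`.
  have hmem : MemLp β 2 (levyMeasure m q) := by
    rw [memLp_two_iff_integrable_sq hβm.aestronglyMeasurable]
    refine ⟨(hβm.pow_const 2).aestronglyMeasurable, ?_⟩
    rw [hasFiniteIntegral_iff_norm, levyMeasure, lintegral_withDensity_eq_lintegral_mul _
      hq.measurable.ennreal_ofReal (by fun_prop)]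
    have i1 : IntegrableOn (fun p => w p ^ 2) (fieldSupport v a ×ˢ univ) (baseMeasure m) :=
      (hw _ hK).1.integrable_sq
    have i2 := ((integrable_indicator_iff hms).2
      ((Integrable.const_mul i1 8).add (Integrable.const_mul hqK (2 * A ^ 2)))).2
    rw [hasFiniteIntegral_iff_norm] at i2
    refine (lintegral_mono_ae ?_).trans_lt i2
    filter_upwards [hq.pos, hww'] with p hp h1
    rw [Pi.mul_apply, ← ENNReal.ofReal_mul hp.le]
    refine ENNReal.ofReal_le_ofReal ?_
    by_cases hpK : p ∈ (fieldSupport v a ×ˢ univ : Set (X × ℝ))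
    · rw [hβ, indicator_of_mem hpK, indicator_of_mem hpK, ← h1 hpK]
      refine le_trans ?_ (le_abs_self _)
      have hs := Real.sqrt_pos.2 hp
      have hs2 := Real.sq_sqrt hp.le
      have hAp : (divergence v p.1 + a p.1) ^ 2 ≤ A ^ 2 := by
        rw [← sq_abs]
        exact pow_le_pow_left₀ (abs_nonneg _) (hA p.1) 2
      rw [Real.norm_of_nonneg (sq_nonneg _)]
      simp only [Pi.add_apply]
      have e1 : q p * (2 * w p / √(q p) + (divergence v p.1 + a p.1)) ^ 2 =
          (2 * w p + √(q p) * (divergence v p.1 + a p.1)) ^ 2 := by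
        conv_lhs => rw [← hs2]
        field_simp
        rw [Real.sqrt_sq hs.le]
      rw [e1]
      have e2 : (√(q p) * (divergence v p.1 + a p.1)) ^ 2 ≤ A ^ 2 * √(q p) ^ 2 := by
        rw [mul_pow, mul_comm]
        exact mul_le_mul_of_nonneg_right hAp (sq_nonneg _)
      nlinarith [sq_nonneg (2 * w p - √(q p) * (divergence v p.1 + a p.1))]
    · rw [hβ, indicator_of_notMem hpK, indicator_of_notMem hpK]
      simp
  have hint : Integrable β (levyMeasure m q) := by
    have hfin : IsFiniteMeasure ((levyMeasure m q).restrict (fieldSupport v a ×ˢ univ)) := by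
      refine ⟨?_⟩
      rw [Measure.restrict_apply_univ]
      refine lt_of_le_of_lt ?_ (hq.lintegral_max_lt_top hK)
      rw [← setLIntegral_one]
      refine lintegral_mono fun p => ?_
      rw [← ENNReal.ofReal_one]
      exact ENNReal.ofReal_le_ofReal (le_max_left _ _)
    have h1 : IntegrableOn β (fieldSupport v a ×ˢ univ) (levyMeasure m q) :=
      (hmem.mono_measure Measure.restrict_le_self).integrable one_le_two
    have h2 := h1.integrable_indicator hms
    refine h2.congr (Eventually.of_forall fun p => ?_)
    rw [hβ, indicator_indicator, inter_self]
  have hcut : ∀ ψ : X × ℝ → ℝ, Smooth n 1 ψ →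
      (∃ r R : ℝ, 0 < r ∧ ∀ x s, 0 < s → s ∉ Icc r R → ψ (x, s) = 0) →
      ∫ p, (dirDerivXR v a ψ p + β p * ψ p) ∂levyMeasure m q = 0 := by
    rintro ψ hψ ⟨r, R, hr, h0⟩
    -- For f = √q the two integrands add up to q (∇ψ + β ψ), since 2 ψ √q w = q ψ (2 w / √q).
    obtain ⟨j1, j2, hz⟩ := (hw _ hK).integral_eq_zero hm hv ha hK le_rfl (hq.memLp_sqrt hK) hψ hr h0
    rw [← integral_add j1 j2] at hz
    rw [hq.integral_levyMeasure, ← setIntegral_eq_integral_of_forall_compl_eq_zero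
      (s := fieldSupport v a ×ˢ univ), ← hz]
    · refine setIntegral_congr_ae hms ?_
      filter_upwards [hq.pos, hww'] with p hp h1 hpK
      rw [hβ, indicator_of_mem hpK, ← h1 hpK]
      have hs := Real.sqrt_pos.2 hp
      have hs2 := Real.sq_sqrt hp.le
      conv_lhs => rw [← hs2]
      field_simp
      rw [Real.sqrt_sq hs.le]
      ring
    · intro p hp
      have hx : p.1 ∉ fieldSupport v a := fun hx => hp ⟨hx, mem_univ _⟩
      rw [hβ, indicator_of_notMem hp, show dirDerivXR v a ψ p = 0 from dirDerivXR_eq_zero hx ψ p.2]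
      simp
  refine ⟨β, ⟨hβm, fun x hx s _ => indicator_of_notMem (fun h => hx h.1) _, hmem, hint,
    fun ψ hψ ⟨C, hC⟩ ⟨D, hD⟩ => integral_dirDerivXR_add_of_cutoff hv ha hq hint hcut hψ hC hD⟩, hβlog⟩

end LogDeriv

/-! ### Integration by parts on the configuration space -/

section ConfigIBP

variable {n : ℕ} {X : Type*} [TopologicalSpace X] [ChartedSpace (EuclideanSpace ℝ (Fin n)) X]
  [IsManifold (𝓡 n) ∞ X]

/-- A function on `X × (0, ∞)` to which integration by parts along `(v, a)` applies. -/
structure IsAdm (K : Set X) (v : (x : X) → TangentSpace (𝓡 n) x) (a : X → ℝ) (φ : X × ℝ → ℝ) :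
    Prop where
  smooth : Smooth n 1 φ
  supp : SuppIn K φ
  bounded : ∃ C, ∀ p : X × ℝ, 0 < p.2 → |φ p| ≤ C
  deriv_le : ∃ C, ∀ p : X × ℝ, 0 < p.2 → |dirDerivXR v a φ p| ≤ C * max 1 p.2

variable {ι : Type*} [Fintype ι] {E : Type*} [NormedAddCommGroup E] [NormedSpace ℝ E]

/-- The cylinder function `g (⟨φ_j, γ⟩)_j`. -/
def cylVal (g : (ι → ℝ) → E) (φ : ι → X × ℝ → ℝ) (γ : Config X) : E :=
  g fun j => pairing (φ j) γ

/-- The derivative of the cylinder function `g (⟨φ_j, γ⟩)_j` along `(v, a)`. -/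
def cylDeriv (v : (x : X) → TangentSpace (𝓡 n) x) (a : X → ℝ) (g : (ι → ℝ) → E)
    (φ : ι → X × ℝ → ℝ) (γ : Config X) : E :=
  fderiv ℝ g (fun j => pairing (φ j) γ) fun j => pairing (dirDerivXR v a (φ j)) γ

variable {v : (x : X) → TangentSpace (𝓡 n) x} {a : X → ℝ} {K : Set X} {φ : ι → X × ℝ → ℝ}

theorem hasDerivAt_cylVal [T2Space X] (hv : IsField v) (ha : ContMDiff (𝓡 n) 𝓘(ℝ, ℝ) ∞ a)
    {g : (ι → ℝ) → E} (hg : Differentiable ℝ g) (hK : IsCompact K)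
    (hφ : ∀ j, Smooth n 1 (φ j)) (hφK : ∀ j, SuppIn K (φ j)) (γ : Config X) :
    HasDerivAt (fun t => cylVal g φ (curve v a γ t)) (cylDeriv v a g φ γ) 0 := by
  have h1 : HasDerivAt (fun t => fun j => pairing (φ j) (curve v a γ t))
      (fun j => pairing (dirDerivXR v a (φ j)) γ) 0 :=
    hasDerivAt_pi.2 fun j => hv.hasDerivAt_pairing_curve ha (hφ j) hK (hφK j) γ
  have h0 : (fun j => pairing (φ j) (curve v a γ 0)) = fun j => pairing (φ j) γ :=
    funext fun j => hv.pairing_curve_zero a hK (hφK j) γ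
  have h2 := (hg fun j => pairing (φ j) (curve v a γ 0)).hasFDerivAt.comp_hasDerivAt (0 : ℝ) h1
  rw [h0] at h2
  exact h2

variable [T2Space X] [SecondCountableTopology X] [LocallyCompactSpace X]
  [MeasurableSpace X] [BorelSpace X] {σ : Measure (X × ℝ)}

/-- With k particles the arguments of g are bounded by k M, so the linear growth of g and its
derivative contributes only a constant, and the rest depends on the single particle i. -/
theorem integrable_pi_term {ν : Measure (X × ℝ)} [IsFiniteMeasure ν]
    {g : (ι → ℝ) → ℝ} (hg : ContDiff ℝ 1 g) {C M D : ℝ} (hC : ∀ r, |g r| ≤ C * (1 + ‖r‖))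
    (hD : ∀ r, ‖fderiv ℝ g r‖ ≤ C * (1 + ‖r‖)) (hC0 : 0 ≤ C) (hM0 : 0 ≤ M) (hD0 : 0 ≤ D)
    {Φ Ψ : ι → X × ℝ → ℝ} {β : X × ℝ → ℝ} (hΦm : ∀ j, Measurable (Φ j))
    (hΨm : ∀ j, Measurable (Ψ j)) (hβm : Measurable β) (hΦ : ∀ j p, |Φ j p| ≤ M)
    (hΨ : ∀ j p, |Ψ j p| ≤ D * max 1 p.2) (hmax : Integrable (fun p : X × ℝ => max 1 p.2) ν)
    (hβ : Integrable β ν) (k : ℕ) (i : Fin k) :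
    Integrable (fun z : Fin k → X × ℝ =>
      fderiv ℝ g (fun j => ∑ l, Φ j (z l)) (fun j => Ψ j (z i)) +
        β (z i) * g (fun j => ∑ l, Φ j (z l))) (Measure.pi fun _ : Fin k => ν) := by
  have m1 : Measurable fun z : Fin k → X × ℝ => fun j => ∑ l, Φ j (z l) :=
    measurable_pi_lambda _ fun j => Finset.measurable_sum _ fun l _ =>
      (hΦm j).comp (measurable_pi_apply l)
  have m2 : Measurable fun z : Fin k → X × ℝ => fun j => Ψ j (z i) :=
    measurable_pi_lambda _ fun j => (hΨm j).comp (measurable_pi_apply i)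
  have c1 : Continuous fun p : (ι → ℝ) × (ι → ℝ) => fderiv ℝ g p.1 p.2 :=
    ((hg.continuous_fderiv one_ne_zero).comp continuous_fst).clm_apply continuous_snd
  have hn : ∀ z : Fin k → X × ℝ, ‖fun j => ∑ l, Φ j (z l)‖ ≤ k * M := fun z =>
    (pi_norm_le_iff_of_nonneg (by positivity)).2 fun j => by
      refine (Finset.abs_sum_le_sum_abs _ _).trans ((Finset.sum_le_sum fun l _ =>
        hΦ j (z l)).trans ?_)
      simp
  have hi : Integrable (fun z : Fin k → X × ℝ => C * (1 + k * M) * (D * max 1 (z i).2 + |β (z i)|))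
      (Measure.pi fun _ : Fin k => ν) :=
    ((integrable_comp_eval (μ := fun _ : Fin k => ν) (i := i) hmax |>.const_mul D).add
      (integrable_comp_eval (μ := fun _ : Fin k => ν) (i := i) hβ.abs)).const_mul _
  refine hi.mono' (((c1.measurable.comp (m1.prodMk m2)).add
    ((hβm.comp (measurable_pi_apply i)).mul
      (hg.continuous.measurable.comp m1))).aestronglyMeasurable) (Eventually.of_forall fun z => ?_)
  have hz : C * (1 + ‖fun j => ∑ l, Φ j (z l)‖) ≤ C * (1 + k * M) := by
    gcongr
    exact hn z
  have hΨz : ‖fun j => Ψ j (z i)‖ ≤ D * max 1 (z i).2 :=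
    (pi_norm_le_iff_of_nonneg (mul_nonneg hD0 (zero_le_one.trans (le_max_left _ _)))).2
      fun j => hΨ j (z i)
  rw [mul_add]
  refine (norm_add_le _ _).trans (add_le_add ?_ ?_)
  · exact (ContinuousLinearMap.le_opNorm _ _).trans (mul_le_mul ((hD _).trans hz) hΨz
      (norm_nonneg _) (by positivity))
  · rw [norm_mul, mul_comm]
    exact mul_le_mul_of_nonneg_right ((hC _).trans hz) (norm_nonneg _)

theorem Smooth.comp_contDiff {k : WithTop ℕ∞} {g : (ι → ℝ) → ℝ} (hg : ContDiff ℝ k g)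
    (hφ : ∀ j, Smooth n k (φ j)) : Smooth n k fun p => g fun j => φ j p :=
  hg.contMDiff.comp_contMDiffOn (contMDiffOn_pi_space.2 hφ)

/-- Integration by parts in one of the particles. -/
theorem IsWeakLogDeriv.integral_comp_eq_zero {β : X × ℝ → ℝ} (hβ : IsWeakLogDeriv σ v a β)
    {g : (ι → ℝ) → ℝ} (hg : ContDiff ℝ 1 g) {C M D : ℝ} (hC : ∀ r, |g r| ≤ C * (1 + ‖r‖))
    (hD : ∀ r, ‖fderiv ℝ g r‖ ≤ C * (1 + ‖r‖)) (hC0 : 0 ≤ C) (hM0 : 0 ≤ M) (hD0 : 0 ≤ D)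
    (hφ : ∀ j, Smooth n 1 (φ j)) (hΦ : ∀ j (p : X × ℝ), 0 < p.2 → |φ j p| ≤ M)
    (hΨ : ∀ j (p : X × ℝ), 0 < p.2 → |dirDerivXR v a (φ j) p| ≤ D * max 1 p.2) (c : ι → ℝ)
    (hpos : ∀ᵐ p ∂σ, 0 < p.2) :
    ∫ p, (fderiv ℝ g (fun j => φ j p + c j) (fun j => dirDerivXR v a (φ j) p) +
        β p * g (fun j => φ j p + c j)) ∂σ = 0 := by
  have hgc : ContDiff ℝ 1 fun r : ι → ℝ => g (r + c) := hg.comp (contDiff_id.add contDiff_const)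
  have hψ : Smooth n 1 fun p => g ((fun j => φ j p) + c) := Smooth.comp_contDiff (g := fun r : ι → ℝ => g (r + c)) hgc hφ
  have hd : ∀ p : X × ℝ, 0 < p.2 → dirDerivXR v a (fun p => g ((fun j => φ j p) + c)) p =
      fderiv ℝ g (fun j => φ j p + c j) (fun j => dirDerivXR v a (φ j) p) := fun p hp => by
    have h1 := dirDerivXR_comp (g := fun r : ι → ℝ => g (r + c)) hφ v a hp
      (hgc.differentiable one_ne_zero _) hψ
    rw [fderiv_comp_add_right] at h1
    exact h1
  have hn : ∀ p : X × ℝ, 0 < p.2 → ‖fun j => φ j p + c j‖ ≤ M + ‖c‖ := fun p hp =>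
    (norm_add_le (fun j => φ j p) c).trans (add_le_add
      ((pi_norm_le_iff_of_nonneg hM0).2 fun j => hΦ j p hp) le_rfl)
  have hz : ∀ p : X × ℝ, 0 < p.2 → C * (1 + ‖fun j => φ j p + c j‖) ≤ C * (1 + (M + ‖c‖)) :=
    fun p hp => by gcongr; exact hn p hp
  refine (integral_congr_ae ?_).trans (hβ.ibp (fun p => g ((fun j => φ j p) + c)) hψ
    ⟨C * (1 + (M + ‖c‖)), fun p hp => (hC _).trans (hz p hp)⟩
    ⟨C * (1 + (M + ‖c‖)) * D, fun p hp => ?_⟩).2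
  · filter_upwards [hpos] with p hp
    rw [hd p hp]
    rfl
  · rw [hd p hp, mul_assoc]
    refine (ContinuousLinearMap.le_opNorm _ _).trans (mul_le_mul ((hD _).trans (hz p hp)) ?_
      (norm_nonneg _) (by positivity))
    exact (pi_norm_le_iff_of_nonneg (mul_nonneg hD0 (zero_le_one.trans (le_max_left _ _)))).2
      fun j => hΨ j p hp

/-- Fubini with the i-th particle integrated first and all others frozen. -/
theorem integral_pi_succ_eq_zero {ν : Measure (X × ℝ)} [IsFiniteMeasure ν] {k : ℕ} (i : Fin (k + 1))
    {T : (X × ℝ) → (Fin (k + 1) → X × ℝ) → ℝ}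
    (hT : Integrable (fun z => T (z i) z) (Measure.pi fun _ : Fin (k + 1) => ν))
    (h : ∀ w : Fin k → X × ℝ, ∫ p, T p (i.insertNth (α := fun _ => X × ℝ) p w) ∂ν = 0) :
    ∫ z, T (z i) z ∂(Measure.pi fun _ : Fin (k + 1) => ν) = 0 := by
  have hmp := measurePreserving_piFinSuccAbove (fun _ : Fin (k + 1) => ν) i
  have hmp' := hmp.symm
  have e : ∀ p : (X × ℝ) × (Fin k → X × ℝ),
      (MeasurableEquiv.piFinSuccAbove (fun _ : Fin (k + 1) => X × ℝ) i).symm p =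
        i.insertNth (α := fun _ => X × ℝ) p.1 p.2 := fun _ => rfl
  rw [← hmp'.integral_comp' (fun z => T (z i) z)]
  refine (integral_prod_symm _
    ((hmp'.integrable_comp_emb (MeasurableEquiv.measurableEmbedding _)).2 hT)).trans ?_
  refine integral_eq_zero_of_ae (Eventually.of_forall fun w => ?_)
  refine (integral_congr_ae (Eventually.of_forall fun p => ?_)).trans (h w)
  simp only [Function.comp_apply, e, Fin.insertNth_apply_same]

variable {μ : Measure (Config X)}

theorem measurable_cylArg (hK : IsCompact K) (hφ : ∀ j, ContinuousOn (φ j) (univ ×ˢ Ioi (0 : ℝ)))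
    (hφK : ∀ j, SuppIn K (φ j)) : Measurable fun (γ : Config X) j => pairing (φ j) γ :=
  measurable_pi_lambda _ fun j => measurable_pairing hK (hφK j) (measurable_indicator_half (hφ j))

theorem IsLevy.memLp_pairing_of_bounded (hσ : IsLevy σ) (hμ : IsMarkedPoisson σ μ)
    (hK : IsCompact K) {f : X × ℝ → ℝ} (hf : ContinuousOn f (univ ×ˢ Ioi (0 : ℝ)))
    (hfK : SuppIn K f) (hb : ∃ M, ∀ p : X × ℝ, 0 < p.2 → |f p| ≤ M) :
    MemLp (pairing f : Config X → ℝ) 2 μ := by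
  obtain ⟨M, hM⟩ := hb
  refine hσ.memLp_pairing hμ hK hfK (measurable_indicator_half hf) ?_
  have hms : MeasurableSet (K ×ˢ univ : Set (X × ℝ)) := hK.measurableSet.prod MeasurableSet.univ
  have hi : Integrable ((K ×ˢ univ).indicator fun _ : X × ℝ => M ^ 2) σ := by
    rw [integrable_indicator_iff hms]
    exact integrableOn_const (hσ.finite K hK).ne
  refine hi.mono' ((aestronglyMeasurable_of_continuousOn hσ.pos hf).pow 2) ?_
  filter_upwards [hσ.pos] with p hp
  rw [Real.norm_of_nonneg (sq_nonneg _)]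
  by_cases hx : p.1 ∈ K
  · rw [indicator_of_mem (s := K ×ˢ univ) ⟨hx, mem_univ _⟩, ← sq_abs]
    exact pow_le_pow_left₀ (abs_nonneg _) (hM p hp) 2
  · rw [indicator_of_notMem (s := K ×ˢ univ) fun h => hx h.1, hfK p.1 hx p.2 hp]
    simp

theorem memLp_mul_one_add_sum_abs {α : Type*} [MeasurableSpace α] {ν : Measure α}
    [IsFiniteMeasure ν] {f : ι → α → ℝ} (h : ∀ j, MemLp (f j) 2 ν) (C : ℝ) :
    MemLp (fun x => C * (1 + ∑ j, |f j x|)) 2 ν := by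
  have h1 : MemLp (fun x => ∑ j, |f j x|) 2 ν := memLp_finsetSum _ fun j _ => (h j).abs
  have h2 : MemLp (fun _ : α => (1 : ℝ)) 2 ν := memLp_const 1
  exact (h2.add h1).const_mul C

theorem IsLevy.memLp_cylVal (hσ : IsLevy σ) (hμ : IsMarkedPoisson σ μ) (hK : IsCompact K)
    {g : (ι → ℝ) → ℝ} (hg : Continuous g) {C : ℝ} (hC : ∀ r, |g r| ≤ C * (1 + ‖r‖))
    (hφ : ∀ j, ContinuousOn (φ j) (univ ×ˢ Ioi (0 : ℝ))) (hφK : ∀ j, SuppIn K (φ j))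
    (hb : ∀ j, ∃ M, ∀ p : X × ℝ, 0 < p.2 → |φ j p| ≤ M) :
    MemLp (cylVal g φ : Config X → ℝ) 2 μ := by
  have := hμ.isProbability
  have hC0 : 0 ≤ C := by
    have := (abs_nonneg _).trans (hC 0)
    rwa [norm_zero, add_zero, mul_one] at this
  have h1 : ∀ j, MemLp (fun γ : Config X => pairing (φ j) γ) 2 μ := fun j =>
    hσ.memLp_pairing_of_bounded hμ hK (hφ j) (hφK j) (hb j)
  have h3 := memLp_mul_one_add_sum_abs h1 C
  have hm : Measurable (cylVal g φ : Config X → ℝ) :=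
    hg.measurable.comp (measurable_cylArg hK hφ hφK)
  refine h3.mono' hm.aestronglyMeasurable (Eventually.of_forall fun γ => (hC _).trans ?_)
  refine mul_le_mul_of_nonneg_left (add_le_add le_rfl ?_) hC0
  exact (pi_norm_le_iff_of_nonneg (Finset.sum_nonneg fun _ _ => abs_nonneg _)).2 fun j =>
    Finset.single_le_sum (f := fun j => |pairing (φ j) γ|) (fun _ _ => abs_nonneg _)
      (Finset.mem_univ j)

theorem pairing_abs_le {f h : X × ℝ → ℝ} (hK : IsCompact K) (hf : SuppIn K f) (hh : SuppIn K h)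
    (hfh : ∀ p : X × ℝ, 0 < p.2 → |f p| ≤ h p) (γ : Config X) : |pairing f γ| ≤ pairing h γ := by
  rw [pairing_eq_sum hK hf, pairing_eq_sum hK hh]
  exact (Finset.abs_sum_le_sum_abs _ _).trans
    (Finset.sum_le_sum fun p hp => hfh p (γ.pos (Config.mem_pts.1 hp).1))

/-- The derivative of φ may grow like max {1, s}, of which only the first moment is finite, so its
pairing need not be square integrable. The factor from Dg, however, is at most linear in the number
N of points, and products of 1 + N with a pairing are covered by the weighted moment bound. -/
theorem IsLevy.integrable_cylDeriv (hσ : IsLevy σ) (hμ : IsMarkedPoisson σ μ) (hK : IsCompact K)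
    (hmax : Integrable ((K ×ˢ univ).indicator fun p : X × ℝ => max 1 p.2) σ)
    (hv : IsField v) (ha : IsFun n a)
    {g : (ι → ℝ) → ℝ} (hg : ContDiff ℝ 1 g) {C M D : ℝ}
    (hD : ∀ r, ‖fderiv ℝ g r‖ ≤ C * (1 + ‖r‖)) (hC0 : 0 ≤ C) (hM0 : 0 ≤ M) (hD0 : 0 ≤ D)
    (hφ : ∀ j, Smooth n 1 (φ j)) (hφK : ∀ j, SuppIn K (φ j))
    (hΦ : ∀ j (p : X × ℝ), 0 < p.2 → |φ j p| ≤ M)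
    (hΨ : ∀ j (p : X × ℝ), 0 < p.2 → |dirDerivXR v a (φ j) p| ≤ D * max 1 p.2) :
    Measurable (cylDeriv v a g φ : Config X → ℝ) ∧ Integrable (cylDeriv v a g φ : Config X → ℝ) μ := by
  have hΨK : ∀ j, SuppIn K (dirDerivXR v a (φ j)) := fun j => (hφK j).dirDerivXR hK v a
  have c1 : Continuous fun p : (ι → ℝ) × (ι → ℝ) => fderiv ℝ g p.1 p.2 :=
    ((hg.continuous_fderiv one_ne_zero).comp continuous_fst).clm_apply continuous_snd
  have hm : Measurable (cylDeriv v a g φ : Config X → ℝ) := c1.measurable.comp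
    ((measurable_cylArg hK (fun j => (hφ j).continuousOn) hφK).prodMk
      (measurable_cylArg hK (fun j => continuousOn_dirDerivXR (hφ j) hv ha) hΨK))
  refine ⟨hm, hm.aestronglyMeasurable, ?_⟩
  have hms : MeasurableSet (K ×ˢ univ : Set (X × ℝ)) := hK.measurableSet.prod MeasurableSet.univ
  set P : X × ℝ → ℝ := (K ×ˢ univ).indicator fun p => max 1 p.2 with hP
  have hP0 : ∀ p, 0 ≤ P p := fun p => indicator_nonneg (fun p _ =>
    zero_le_one.trans (le_max_left _ _)) p
  have hPK : SuppIn K P := fun x hx s _ => indicator_of_notMem (fun h => hx h.1) _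
  set Q : X × ℝ → ℝ := (K ×ˢ univ).indicator fun _ => M with hQ
  have hQK : SuppIn K Q := fun x hx s _ => indicator_of_notMem (fun h => hx h.1) _
  rw [hasFiniteIntegral_iff_norm]
  refine lt_of_le_of_lt (lintegral_mono fun γ => ?_) (hσ.lintegral_lpair_lt_top hμ hK
    (f := fun p => ENNReal.ofReal (C * (1 + M) * (D * P p))) ?_ ?_ ?_)
  · have hS : SuppIn K fun p => C * (1 + M) * (D * P p) := fun x hx s hs => by
      simp only [hPK x hx s hs, mul_zero]
    rw [lpair_ofReal hK hS (fun p _ => by have := hP0 p; positivity), lpair_indicator_one_eq hK,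
      ← ENNReal.ofReal_natCast, ← ENNReal.ofReal_one, ← ENNReal.ofReal_add zero_le_one
      (Nat.cast_nonneg _), ← ENNReal.ofReal_mul (by positivity)]
    refine ENNReal.ofReal_le_ofReal ?_
    have e1 : pairing (fun p => C * (1 + M) * (D * P p)) γ = C * (1 + M) * (D * pairing P γ) := by
      rw [pairing_const_mul hK (fun x hx s hs => by simp only [hPK x hx s hs, mul_zero]),
        pairing_const_mul hK hPK]
    have hPγ : 0 ≤ pairing P γ := by
      rw [pairing_eq_sum hK hPK]
      exact Finset.sum_nonneg fun p _ => hP0 p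
    have n1 : ‖fun j => pairing (φ j) γ‖ ≤ M * (γ.pts hK).card :=
      (pi_norm_le_iff_of_nonneg (by positivity)).2 fun j => by
        rw [Real.norm_eq_abs, pairing_eq_sum hK (hφK j), mul_comm, ← nsmul_eq_mul]
        exact (Finset.abs_sum_le_sum_abs _ _).trans (Finset.sum_le_card_nsmul _ _ _ fun p hp =>
          hΦ j p (γ.pos (Config.mem_pts.1 hp).1))
    have n2 : ‖fun j => pairing (dirDerivXR v a (φ j)) γ‖ ≤ D * pairing P γ :=
      (pi_norm_le_iff_of_nonneg (by positivity)).2 fun j => by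
        rw [← pairing_const_mul hK hPK]
        refine pairing_abs_le hK (hΨK j) (fun x hx s hs => by simp only [hPK x hx s hs, mul_zero])
          (fun p hp => ?_) γ
        by_cases hx : p.1 ∈ K
        · rw [hP, indicator_of_mem (s := K ×ˢ univ) ⟨hx, mem_univ _⟩]
          exact hΨ j p hp
        · rw [show dirDerivXR v a (φ j) p = 0 from hΨK j p.1 hx p.2 hp, abs_zero]
          exact mul_nonneg hD0 (hP0 p)
    rw [e1]
    refine (ContinuousLinearMap.le_opNorm _ _).trans ((mul_le_mul (hD _) n2 (norm_nonneg _)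
      (by positivity)).trans ?_)
    have hN : (0 : ℝ) ≤ (γ.pts hK).card := Nat.cast_nonneg _
    have : 1 + ‖fun j => pairing (φ j) γ‖ ≤ (1 + (γ.pts hK).card) * (1 + M) := by nlinarith
    calc C * (1 + ‖fun j => pairing (φ j) γ‖) * (D * pairing P γ)
        ≤ C * ((1 + (γ.pts hK).card) * (1 + M)) * (D * pairing P γ) := by gcongr
      _ = _ := by ring
  · exact ((((by fun_prop : Measurable fun p : X × ℝ => max 1 p.2).indicator hms).const_mul
      D).const_mul _).ennreal_ofReal
  · intro x hx s hs
    simp only [hPK x hx s hs, mul_zero, ENNReal.ofReal_zero]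
  · have := lintegral_ofReal_abs_lt_top ((hmax.const_mul D).const_mul (C * (1 + M)))
    refine lt_of_le_of_lt (lintegral_mono fun p => ENNReal.ofReal_le_ofReal (le_abs_self _)) this

theorem IsWeakLogDeriv.memLp_pairing {β : X × ℝ → ℝ} (hβ : IsWeakLogDeriv σ v a β)
    (hσ : IsLevy σ) (hμ : IsMarkedPoisson σ μ) (hv : IsField v) (ha : IsFun n a) :
    MemLp (pairing β : Config X → ℝ) 2 μ :=
  hσ.memLp_pairing hμ (isCompact_fieldSupport hv ha) hβ.supp
    (hβ.measurable.indicator measurableSet_half) hβ.memLp.integrable_sq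

/-- Integration by parts on the configuration space. -/
theorem IsWeakLogDeriv.integral_cylDeriv_add_eq_zero {β : X × ℝ → ℝ} (hβ : IsWeakLogDeriv σ v a β)
    (hσ : IsLevy σ) (hμ : IsMarkedPoisson σ μ)
    (hmax : ∀ K : Set X, IsCompact K →
      Integrable ((K ×ˢ univ).indicator fun p : X × ℝ => max 1 p.2) σ)
    (hv : IsField v) (ha : IsFun n a) (hK : IsCompact K) (hφ : ∀ j, IsAdm K v a (φ j))
    {g : (ι → ℝ) → ℝ} (hg : ContDiff ℝ 1 g) {C : ℝ}
    (hC : ∀ r, |g r| ≤ C * (1 + ‖r‖)) (hD : ∀ r, ‖fderiv ℝ g r‖ ≤ C * (1 + ‖r‖)) :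
    Integrable (cylDeriv v a g φ : Config X → ℝ) μ ∧
    Integrable (fun γ => pairing β γ * cylVal g φ γ) μ ∧
    ∫ γ, (cylDeriv v a g φ γ + pairing β γ * cylVal g φ γ) ∂μ = 0 := by
  have hC0 : 0 ≤ C := by
    have := (abs_nonneg _).trans (hC 0)
    rwa [norm_zero, add_zero, mul_one] at this
  choose M₀ hM₀ using fun j => (hφ j).bounded
  choose D₀ hD₀ using fun j => (hφ j).deriv_le
  obtain ⟨M, hM⟩ : ∃ M : ℝ, M = ∑ j, |M₀ j| := ⟨_, rfl⟩
  obtain ⟨D, hDD⟩ : ∃ D : ℝ, D = ∑ j, |D₀ j| := ⟨_, rfl⟩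
  have hM0 : 0 ≤ M := hM ▸ Finset.sum_nonneg fun _ _ => abs_nonneg _
  have hD0 : 0 ≤ D := hDD ▸ Finset.sum_nonneg fun _ _ => abs_nonneg _
  have hΦ : ∀ j (p : X × ℝ), 0 < p.2 → |φ j p| ≤ M := fun j p hp =>
    ((hM₀ j p hp).trans (le_abs_self _)).trans (hM ▸ Finset.single_le_sum
      (f := fun j => |M₀ j|) (fun _ _ => abs_nonneg _) (Finset.mem_univ j))
  have hΨ : ∀ j (p : X × ℝ), 0 < p.2 → |dirDerivXR v a (φ j) p| ≤ D * max 1 p.2 := fun j p hp =>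
    (hD₀ j p hp).trans (mul_le_mul_of_nonneg_right ((le_abs_self _).trans
      (hDD ▸ Finset.single_le_sum (f := fun j => |D₀ j|) (fun _ _ => abs_nonneg _)
        (Finset.mem_univ j))) (zero_le_one.trans (le_max_left _ _)))
  have hφs := fun j => (hφ j).smooth
  have hφK := fun j => (hφ j).supp
  obtain ⟨hdm, hdi⟩ := hσ.integrable_cylDeriv hμ hK (hmax K hK) hv ha hg hD hC0 hM0 hD0 hφs hφK hΦ hΨ
  have hcv : MemLp (cylVal g φ : Config X → ℝ) 2 μ := hσ.memLp_cylVal hμ hK hg.continuous hC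
    (fun j => (hφs j).continuousOn) hφK fun j => ⟨M, hΦ j⟩
  have hcm : Measurable (cylVal g φ : Config X → ℝ) := hg.continuous.measurable.comp
    (measurable_cylArg hK (fun j => (hφs j).continuousOn) hφK)
  have hβm : Measurable (pairing β : Config X → ℝ) := measurable_pairing
    (isCompact_fieldSupport hv ha) hβ.supp (hβ.measurable.indicator measurableSet_half)
  have hbi : Integrable (fun γ => pairing β γ * cylVal g φ γ) μ :=
    (hβ.memLp_pairing hσ hμ hv ha).integrable_mul hcv
  refine ⟨hdi, hbi, ?_⟩
  -- Λ contains the supports of all the φ_j and of β, so the integrand depends only on the points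
  -- above Λ.
  obtain ⟨Λ, hΛo, hΛ, hKΛ⟩ := exists_isOpen_superset_isCompact_closure
    (hK.union (isCompact_fieldSupport hv ha))
  have hKΛ' : K ⊆ Λ := subset_union_left.trans hKΛ
  have hFΛ : fieldSupport v a ⊆ Λ := subset_union_right.trans hKΛ
  have hφΛ := fun j => (hφK j).mono hKΛ'
  have hψΛ := fun j => ((hφK j).dirDerivXR hK v a).mono hKΛ'
  have hβΛ := hβ.supp.mono hFΛ
  have := hσ.isFiniteMeasure hΛ
  set ν := σ.restrict (Λ ×ˢ Ioi (0 : ℝ)) with hν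
  have hsub : (Λ ×ˢ Ioi (0 : ℝ) : Set (X × ℝ)) ⊆ closure Λ ×ˢ univ :=
    Set.prod_mono subset_closure (subset_univ _)
  have hmaxν : Integrable (fun p : X × ℝ => max 1 p.2) ν := by
    have h1 := hmax _ hΛ
    rw [integrable_indicator_iff (hΛ.measurableSet.prod MeasurableSet.univ)] at h1
    exact IntegrableOn.mono_set h1 hsub
  have hβν : Integrable β ν := hβ.integrable.mono_measure Measure.restrict_le_self
  -- Values at nonpositive marks are arbitrary; extension by zero there yields measurability and
  -- bounds on all of X × ℝ.
  set Φ : ι → X × ℝ → ℝ := fun j => (univ ×ˢ Ioi (0 : ℝ)).indicator (φ j) with hΦdef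
  set Ψ : ι → X × ℝ → ℝ := fun j => (univ ×ˢ Ioi (0 : ℝ)).indicator (dirDerivXR v a (φ j)) with hΨdef
  have eΦ : ∀ j (p : X × ℝ), 0 < p.2 → Φ j p = φ j p := fun j p hp => indicator_half hp
  have eΨ : ∀ j (p : X × ℝ), 0 < p.2 → Ψ j p = dirDerivXR v a (φ j) p := fun j p hp =>
    indicator_half hp
  have hΦm : ∀ j, Measurable (Φ j) := fun j => measurable_indicator_half (hφs j).continuousOn
  have hΨm : ∀ j, Measurable (Ψ j) := fun j =>
    measurable_indicator_half (continuousOn_dirDerivXR (hφs j) hv ha)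
  have hΦb : ∀ j p, |Φ j p| ≤ M := fun j p => by
    by_cases hp : 0 < p.2
    · rw [eΦ j p hp]
      exact hΦ j p hp
    · rw [hΦdef]
      simp only
      rw [indicator_of_notMem fun h => hp h.2, abs_zero]
      exact hM0
  have hΨb : ∀ j p, |Ψ j p| ≤ D * max 1 p.2 := fun j p => by
    by_cases hp : 0 < p.2
    · rw [eΨ j p hp]
      exact hΨ j p hp
    · rw [hΨdef]
      simp only
      rw [indicator_of_notMem fun h => hp h.2, abs_zero]
      exact mul_nonneg hD0 (zero_le_one.trans (le_max_left _ _))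
  refine hσ.integral_eq_zero hμ hΛo hΛ (hdm.add (hβm.mul hcm)) (fun γ => ?_) (hdi.add hbi) fun k => ?_
  · simp only [cylDeriv, cylVal, pairing_restrict (hφΛ _), pairing_restrict (hψΛ _), pairing_restrict hβΛ]
  rw [← hν]
  have hT := integrable_pi_term hg hC hD hC0 hM0 hD0 hΦm hΨm hβ.measurable hΦb hΨb hmaxν hβν k
  -- The derivative is linear in the direction, and both the direction and the pairing with β are
  -- sums over particles, so the integrand splits into one term per particle.
  have hG : (fun z => (cylDeriv v a g φ + pairing β * cylVal g φ : Config X → ℝ) (tupleConfig k z))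
      =ᵐ[Measure.pi fun _ : Fin k => ν] fun z => ∑ i,
      (fderiv ℝ g (fun j => ∑ l, Φ j (z l)) (fun j => Ψ j (z i)) +
        β (z i) * g (fun j => ∑ l, Φ j (z l))) := by
    filter_upwards [hσ.ae_goodTuples hΛ k] with z hz
    have h1 : (fun j => ∑ l, Φ j (z l)) = fun j => ∑ l, φ j (z l) :=
      funext fun j => Finset.sum_congr rfl fun l _ => eΦ j _ (hz.1 l)
    have h2 : (fun j => ∑ i, dirDerivXR v a (φ j) (z i)) = ∑ i, fun j => Ψ j (z i) := by
      funext j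
      rw [Finset.sum_apply]
      exact Finset.sum_congr rfl fun l _ => (eΨ j _ (hz.1 l)).symm
    simp only [Pi.add_apply, Pi.mul_apply, cylDeriv, cylVal, tupleConfig_of_mem hz,
      pairing_ofSet_range hz]
    rw [h2, map_sum, Finset.sum_mul, ← Finset.sum_add_distrib, h1]
  refine (integral_congr_ae hG).trans ?_
  rw [integral_finsetSum _ fun i _ => hT i]
  refine Finset.sum_eq_zero fun i _ => ?_
  obtain _ | k := k
  · exact i.elim0
  refine integral_pi_succ_eq_zero i (T := fun p z =>
    fderiv ℝ g (fun j => ∑ l, Φ j (z l)) (fun j => Ψ j p) + β p * g (fun j => ∑ l, Φ j (z l)))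
    (hT i) fun w => ?_
  -- The frozen particles enter only through the constants c_j = Σ_l φ_j(w_l), a translation of the
  -- argument of g.
  have h0 := hβ.integral_comp_eq_zero hg hC hD hC0 hM0 hD0 hφs hΦ hΨ (fun j => ∑ l, Φ j (w l)) hσ.pos
  -- The one-particle formula is over all of σ; off Λ both ∇φ_j and β vanish, so it restricts to Λ.
  rw [← h0, ← setIntegral_eq_integral_of_ae_compl_eq_zero (μ := σ) (s := Λ ×ˢ Ioi (0 : ℝ)), ← hν]
  · refine integral_congr_ae ?_
    filter_upwards [ae_restrict_of_ae hσ.pos] with p hp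
    simp only [Fin.sum_univ_succAbove _ i, Fin.insertNth_apply_same, Fin.insertNth_apply_succAbove,
      eΦ _ p hp, eΨ _ p hp]
  · filter_upwards [hσ.pos] with p hp hpΛ
    have hx : p.1 ∉ Λ := fun hx => hpΛ ⟨hx, hp⟩
    have e1 : (fun j => dirDerivXR v a (φ j) p) = 0 := funext fun j => hψΛ j p.1 hx p.2 hp
    rw [e1, map_zero, show β p = 0 from hβΛ p.1 hx p.2 hp, zero_mul, add_zero]

end ConfigIBP

/-! ### Uniqueness of the logarithmic derivative -/

section Uniqueness

variable {n : ℕ} {X : Type*} [TopologicalSpace X] [ChartedSpace (EuclideanSpace ℝ (Fin n)) X]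
  [IsManifold (𝓡 n) ∞ X]

variable (n) in
/-- `ψ` is of class `C^k` on `X × (0, ∞)` and has compact support there. -/
structure LocSmooth (k : WithTop ℕ∞) (ψ : X × ℝ → ℝ) : Prop where
  smooth : Smooth n k ψ
  supp : ∃ K, IsCompact K ∧ SuppIn K ψ
  slice : ∃ r R : ℝ, 0 < r ∧ ∀ x s, 0 < s → s ∉ Icc r R → ψ (x, s) = 0

variable {v v₁ v₂ : (x : X) → TangentSpace (𝓡 n) x} {a a₁ a₂ : X → ℝ} {ψ : X × ℝ → ℝ}
  {k l : WithTop ℕ∞}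

theorem LocSmooth.of_le (h : LocSmooth n k ψ) (hl : l ≤ k) : LocSmooth n l ψ :=
  ⟨ContMDiffOn.of_le h.smooth hl, h.supp, h.slice⟩

theorem LocSmooth.mul_left {b : X × ℝ → ℝ} (h : LocSmooth n k ψ) (hb : Smooth n k b) :
    LocSmooth n k fun p => b p * ψ p := by
  obtain ⟨K, hK, hψK⟩ := h.supp
  obtain ⟨r, R, hr, h0⟩ := h.slice
  exact ⟨ContMDiffOn.mul hb h.smooth, ⟨K, hK, fun x hx s hs => by simp only [hψK x hx s hs, mul_zero]⟩,
    ⟨r, R, hr, fun x s hs h => by simp only [h0 x s hs h, mul_zero]⟩⟩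

theorem LocSmooth.exists_bound (h : LocSmooth n k ψ) :
    ∃ C, ∀ p : X × ℝ, 0 < p.2 → |ψ p| ≤ C := by
  obtain ⟨K, hK, hψK⟩ := h.supp
  obtain ⟨r, R, hr, h0⟩ := h.slice
  obtain ⟨C, hC⟩ := (hK.prod (isCompact_Icc (a := r) (b := R))).exists_bound_of_continuousOn
    (h.smooth.continuousOn.mono (Set.prod_mono (subset_univ K) fun s hs => hr.trans_le hs.1))
  refine ⟨max C 0, fun p hs => ?_⟩
  by_cases hp : p ∈ K ×ˢ Icc r R
  · exact (hC p hp).trans (le_max_left _ _)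
  · have : ψ p = 0 := by
      by_cases hx : p.1 ∈ K
      · exact h0 p.1 p.2 hs fun h => hp ⟨hx, h⟩
      · exact hψK p.1 hx p.2 hs
    rw [this, abs_zero]
    exact le_max_right _ _

variable [T2Space X] [SecondCountableTopology X] [LocallyCompactSpace X]
  [MeasurableSpace X] [BorelSpace X] {σ : Measure (X × ℝ)}

theorem LocSmooth.dirDerivXR (h : LocSmooth n k ψ) (hk : k ≤ (∞ : WithTop ℕ∞)) (hl : l + 1 ≤ k)
    (hv : ContMDiff (𝓡 n) (𝓡 n).tangent ∞ (fun x => (⟨x, v x⟩ : TangentBundle (𝓡 n) X)))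
    (ha : ContMDiff (𝓡 n) 𝓘(ℝ, ℝ) ∞ a) : LocSmooth n l (dirDerivXR v a ψ) := by
  obtain ⟨K, hK, hψK⟩ := h.supp
  obtain ⟨r, R, hr, h0⟩ := h.slice
  exact ⟨h.smooth.dirDerivXR hk hl hv ha, ⟨K, hK, hψK.dirDerivXR hK v a⟩,
    ⟨r, R, hr, dirDerivXR_eq_zero_of_slice h0 v a⟩⟩

theorem IsLevy.integrable_of_bounded (hσ : IsLevy σ) {f : X × ℝ → ℝ}
    (hf : ContinuousOn f (univ ×ˢ Ioi (0 : ℝ))) {K : Set X} (hK : IsCompact K) (hfK : SuppIn K f)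
    (hb : ∃ C, ∀ p : X × ℝ, 0 < p.2 → |f p| ≤ C) : Integrable f σ := by
  obtain ⟨C, hC⟩ := hb
  have hms : MeasurableSet (K ×ˢ univ : Set (X × ℝ)) := hK.measurableSet.prod MeasurableSet.univ
  have hi : Integrable ((K ×ˢ univ).indicator fun _ : X × ℝ => C) σ := by
    rw [integrable_indicator_iff hms]
    exact integrableOn_const (hσ.finite K hK).ne
  refine hi.mono' (aestronglyMeasurable_of_continuousOn hσ.pos hf) ?_
  filter_upwards [hσ.pos] with p hp
  by_cases hx : p.1 ∈ K
  · rw [indicator_of_mem (s := K ×ˢ univ) ⟨hx, mem_univ _⟩]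
    exact hC p hp
  · rw [indicator_of_notMem (s := K ×ˢ univ) fun h => hx h.1, show f p = 0 from hfK p.1 hx p.2 hp,
      norm_zero]

theorem LocSmooth.integrable (h : LocSmooth n k ψ) (hσ : IsLevy σ) : Integrable ψ σ := by
  obtain ⟨K, hK, hψK⟩ := h.supp
  exact hσ.integrable_of_bounded h.smooth.continuousOn hK hψK h.exists_bound

theorem locSmooth_of_contMDiff {χ : X × ℝ → ℝ}
    (hχ : ContMDiff ((𝓡 n).prod 𝓘(ℝ, ℝ)) 𝓘(ℝ, ℝ) ∞ χ) (hc : HasCompactSupport χ)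
    (hs : tsupport χ ⊆ univ ×ˢ Ioi (0 : ℝ)) : LocSmooth n ∞ χ := by
  obtain ⟨r, R, hr, h0⟩ := exists_Icc_of_tsupport hc hs
  refine ⟨hχ.contMDiffOn, ⟨Prod.fst '' tsupport χ, hc.isCompact.image continuous_fst, ?_⟩,
    ⟨r, R, hr, fun x s _ => h0 x s⟩⟩
  exact fun x hx s _ => image_eq_zero_of_notMem_tsupport fun h => hx ⟨_, h, rfl⟩

theorem IsWeakLogDeriv.integral_locSmooth {β : X × ℝ → ℝ} (hβ : IsWeakLogDeriv σ v a β)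
    (hσ : IsLevy σ) (hv : IsField v) (ha : IsFun n a) (hψ : LocSmooth n 1 ψ) :
    Integrable (fun p => β p * ψ p) σ ∧
      ∫ p, dirDerivXR v a ψ p ∂σ + ∫ p, β p * ψ p ∂σ = 0 := by
  have hd : LocSmooth n 0 (MarkedPoisson.dirDerivXR v a ψ) :=
    hψ.dirDerivXR (by exact_mod_cast le_top) (by simp) hv.1 ha.1
  obtain ⟨C, hC⟩ := hψ.exists_bound
  obtain ⟨D, hD⟩ := hd.exists_bound
  have h1 : Integrable (fun p => β p * ψ p) σ := by
    refine hβ.integrable.mul_bdd (c := C) (aestronglyMeasurable_of_continuousOn hσ.pos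
      hψ.smooth.continuousOn) (hσ.pos.mono fun p hp => hC p hp)
  refine ⟨h1, ?_⟩
  rw [← integral_add (hd.integrable hσ) h1]
  refine (hβ.ibp ψ hψ.smooth ⟨C, hC⟩ ⟨|D|, fun p hp => ((hD p hp).trans (le_abs_self D)).trans ?_⟩).2
  exact le_mul_of_one_le_right (abs_nonneg _) (le_max_left _ _)

/-- Integration by parts against compactly supported smooth functions alone already determines the
logarithmic derivative. Linearity and the bracket relation for β are consequences of this
uniqueness. -/
theorem IsWeakLogDeriv.ae_eq_of_forall {β b : X × ℝ → ℝ} (hβ : IsWeakLogDeriv σ v a β)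
    (hσ : IsLevy σ) (hv : IsField v) (ha : IsFun n a)
    (hb : LocallyIntegrableOn b (univ ×ˢ Ioi (0 : ℝ)) σ)
    (h : ∀ χ, LocSmooth n ∞ χ → Integrable (fun p => b p * χ p) σ ∧
      ∫ p, dirDerivXR v a χ p ∂σ + ∫ p, b p * χ p ∂σ = 0) : b =ᵐ[σ] β := by
  have key := ae_eq_zero_of_forall_integral_mul_eq_zero n
    (hb.sub (hβ.integrable.locallyIntegrable.locallyIntegrableOn _)) fun χ hχ hχc hχs => by
      have hl := locSmooth_of_contMDiff hχ hχc hχs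
      have h1 := h χ hl
      have h2 := hβ.integral_locSmooth hσ hv ha (hl.of_le (by exact_mod_cast le_top))
      have e : ∀ p, χ p * (b - β) p = b p * χ p - β p * χ p := fun p => by
        rw [Pi.sub_apply]
        ring
      simp only [e]
      rw [integral_sub h1.1 h2.1]
      linarith [h1.2, h2.2]
  filter_upwards [key, hσ.pos] with p hp h0
  exact sub_eq_zero.1 (hp h0)

theorem IsField.smul_add_smul (hv₁ : IsField v₁) (hv₂ : IsField v₂) (c₁ c₂ : ℝ) :
    IsField fun x => c₁ • v₁ x + c₂ • v₂ x := by
  refine ⟨(hv₁.1.const_smul_section (a := c₁)).add_section (hv₂.1.const_smul_section (a := c₂)), ?_⟩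
  refine (hv₁.2.union hv₂.2).of_isClosed_subset isClosed_closure ?_
  rw [← closure_union]
  refine closure_mono fun x hx => ?_
  by_contra h
  simp only [mem_union, mem_ofPred_eq, not_or, not_not] at h
  refine hx ?_
  change c₁ • v₁ x + c₂ • v₂ x = 0
  rw [h.1, h.2, smul_zero, smul_zero, add_zero]

theorem IsFun.mul_add_mul (ha₁ : IsFun n a₁) (ha₂ : IsFun n a₂) (c₁ c₂ : ℝ) :
    IsFun n fun x => c₁ * a₁ x + c₂ * a₂ x :=
  ⟨(contMDiff_const.mul ha₁.1).add (contMDiff_const.mul ha₂.1),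
    (ha₁.2.mul_left (f := fun _ => c₁)).add (ha₂.2.mul_left (f := fun _ => c₂))⟩

/-- The directional derivative is linear in (v, a), so the linear combination satisfies the
integration by parts formula that characterizes β. -/
theorem IsWeakLogDeriv.ae_eq_smul_add_smul {β β₁ β₂ : X × ℝ → ℝ} {c₁ c₂ : ℝ}
    (hβ : IsWeakLogDeriv σ (fun x => c₁ • v₁ x + c₂ • v₂ x) (fun x => c₁ * a₁ x + c₂ * a₂ x) β)
    (hβ₁ : IsWeakLogDeriv σ v₁ a₁ β₁) (hβ₂ : IsWeakLogDeriv σ v₂ a₂ β₂)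
    (hσ : IsLevy σ) (hv₁ : IsField v₁) (ha₁ : IsFun n a₁) (hv₂ : IsField v₂) (ha₂ : IsFun n a₂) :
    (fun p => c₁ * β₁ p + c₂ * β₂ p) =ᵐ[σ] β := by
  refine hβ.ae_eq_of_forall hσ (hv₁.smul_add_smul hv₂ c₁ c₂) (ha₁.mul_add_mul ha₂ c₁ c₂)
    (((hβ₁.integrable.const_mul c₁).add (hβ₂.integrable.const_mul c₂)).locallyIntegrable.locallyIntegrableOn
      _) fun χ hχ => ?_
  have h1 : LocSmooth n 1 χ := hχ.of_le (by exact_mod_cast le_top)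
  obtain ⟨i₁, e₁⟩ := hβ₁.integral_locSmooth hσ hv₁ ha₁ h1
  obtain ⟨i₂, e₂⟩ := hβ₂.integral_locSmooth hσ hv₂ ha₂ h1
  have j₁ := (hχ.dirDerivXR (l := 0) le_rfl (by simp) hv₁.1 ha₁.1).integrable hσ
  have j₂ := (hχ.dirDerivXR (l := 0) le_rfl (by simp) hv₂.1 ha₂.1).integrable hσ
  have e : ∀ p, (c₁ * β₁ p + c₂ * β₂ p) * χ p = c₁ * (β₁ p * χ p) + c₂ * (β₂ p * χ p) :=
    fun p => by ring
  simp only [e, dirDerivXR_smul_add_smul]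
  refine ⟨(i₁.const_mul c₁).add (i₂.const_mul c₂), ?_⟩
  rw [integral_add (i₁.const_mul c₁) (i₂.const_mul c₂), integral_add (j₁.const_mul c₁)
    (j₂.const_mul c₂), integral_const_mul, integral_const_mul, integral_const_mul, integral_const_mul]
  linear_combination c₁ * e₁ + c₂ * e₂

theorem IsLevy.isLocallyFiniteMeasure (hσ : IsLevy σ) : IsLocallyFiniteMeasure σ := by
  refine ⟨fun p => ?_⟩
  obtain ⟨K, hK, hp⟩ := exists_compact_mem_nhds p.1
  exact ⟨K ×ˢ univ, prod_mem_nhds hp univ_mem, hσ.finite K hK⟩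

/-- A continuous version that vanishes almost everywhere on an open set vanishes there everywhere.
This makes its pairing a finite sum for every configuration, as is needed for differentiability
everywhere and not merely almost surely. -/
theorem IsWeakLogDeriv.suppIn_of_continuousOn {β b : X × ℝ → ℝ} (hβ : IsWeakLogDeriv σ v a β)
    (hb : ContinuousOn b (univ ×ˢ Ioi (0 : ℝ))) (hbβ : b =ᵐ[σ] β)
    (hop : ∀ U : Set (X × ℝ), IsOpen U → U ⊆ univ ×ˢ Ioi (0 : ℝ) → σ U = 0 → U = ∅) :
    SuppIn (fieldSupport v a) b := by
  intro x hx s hs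
  by_contra hne
  have hc : IsClosed (fieldSupport v a) := isClosed_closure.union (isClosed_tsupport a)
  have hho : IsOpen (univ ×ˢ Ioi (0 : ℝ) : Set (X × ℝ)) := isOpen_univ.prod isOpen_Ioi
  have hUo : IsOpen (((univ ×ˢ Ioi (0 : ℝ)) ∩ b ⁻¹' {0}ᶜ) ∩ (fieldSupport v a)ᶜ ×ˢ univ) :=
    (hb.isOpen_inter_preimage hho isOpen_compl_singleton).inter (hc.isOpen_compl.prod isOpen_univ)
  have h0 := hop _ hUo (fun p hp => hp.1.1) (measure_mono_null (fun p hp => ?_) (ae_iff.1 hbβ))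
  · exact (h0 ▸ ⟨⟨⟨mem_univ _, hs⟩, hne⟩, hx, mem_univ _⟩ : (x, s) ∈ (∅ : Set (X × ℝ)))
  · intro h
    exact hp.1.2 (h.trans (hβ.supp p.1 hp.2.1 p.2 hp.1.1.2))

/-- By `dirDerivXR_commutator` the integral of ∇_{[1,2]} χ is that of ∇₁∇₂χ - ∇₂∇₁χ. Integration by
parts against ∇₂χ and ∇₁χ replaces it by that of β₂ ∇₁χ - β₁ ∇₂χ; integration by parts against b₂ χ
and b₁ χ moves the remaining derivatives onto b₂ and b₁. The outcome is the formula defining the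
logarithmic derivative of the bracket. -/
theorem IsWeakLogDeriv.commutator_ae_eq {β₁ β₂ β b₁ b₂ : X × ℝ → ℝ}
    (hβ₁ : IsWeakLogDeriv σ v₁ a₁ β₁) (hβ₂ : IsWeakLogDeriv σ v₂ a₂ β₂)
    (hβ : IsWeakLogDeriv σ (VectorField.mlieBracket (𝓡 n) v₁ v₂)
      (fun x => along v₁ a₂ x - along v₂ a₁ x) β)
    (hσ : IsLevy σ) (hv₁ : IsField v₁) (ha₁ : IsFun n a₁) (hv₂ : IsField v₂) (ha₂ : IsFun n a₂)
    (h₁ : b₁ =ᵐ[σ] β₁) (h₂ : b₂ =ᵐ[σ] β₂) (hb₁ : Smooth n 1 b₁) (hb₂ : Smooth n 1 b₂) :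
    (fun p => dirDerivXR v₁ a₁ b₂ p - dirDerivXR v₂ a₂ b₁ p) =ᵐ[σ] β := by
  have := hσ.isLocallyFiniteMeasure
  have c₁ := continuousOn_dirDerivXR hb₂ hv₁ ha₁
  have c₂ := continuousOn_dirDerivXR hb₁ hv₂ ha₂
  refine hβ.ae_eq_of_forall hσ (hv₁.mlieBracket hv₂) (IsFun.along_sub_along hv₁ ha₁ hv₂ ha₂)
    ((c₁.sub c₂).locallyIntegrableOn measurableSet_half) fun χ hχ => ?_
  have hχ1 : LocSmooth n 1 χ := hχ.of_le (by exact_mod_cast le_top)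
  have hχ2 : Smooth n 2 χ := ContMDiffOn.of_le hχ.smooth two_le_infty
  have l₁ : LocSmooth n 1 (dirDerivXR v₁ a₁ χ) :=
    hχ.dirDerivXR le_rfl (one_add_one_eq_two.le.trans two_le_infty) hv₁.1 ha₁.1
  have l₂ : LocSmooth n 1 (dirDerivXR v₂ a₂ χ) :=
    hχ.dirDerivXR le_rfl (one_add_one_eq_two.le.trans two_le_infty) hv₂.1 ha₂.1
  have one_le : (1 : WithTop ℕ∞) ≤ (∞ : WithTop ℕ∞) := by exact_mod_cast le_top
  have d₁₂ := (l₂.dirDerivXR (l := 0) one_le (zero_add 1).le hv₁.1 ha₁.1).integrable hσ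
  have d₂₁ := (l₁.dirDerivXR (l := 0) one_le (zero_add 1).le hv₂.1 ha₂.1).integrable hσ
  have i1 := (hβ₁.integral_locSmooth hσ hv₁ ha₁ l₂).2
  have i2 := (hβ₂.integral_locSmooth hσ hv₂ ha₂ l₁).2
  have m₂ := hχ1.mul_left hb₂
  have m₁ := hχ1.mul_left hb₁
  have i3 := (hβ₁.integral_locSmooth hσ hv₁ ha₁ m₂).2
  have i4 := (hβ₂.integral_locSmooth hσ hv₂ ha₂ m₁).2
  have z : ∀ {f : X × ℝ → ℝ}, Smooth n 0 f → ∀ {ψ}, LocSmooth n 0 ψ → Integrable (fun p => f p * ψ p) σ :=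
    fun hf _ hψ => (hψ.mul_left hf).integrable hσ
  have s₁ : Smooth n 0 (dirDerivXR v₁ a₁ b₂) := hb₂.dirDerivXR one_le (by simp) hv₁.1 ha₁.1
  have s₂ : Smooth n 0 (dirDerivXR v₂ a₂ b₁) := hb₁.dirDerivXR one_le (by simp) hv₂.1 ha₂.1
  have hb₁0 : Smooth n 0 b₁ := ContMDiffOn.of_le hb₁ zero_le_one
  have hb₂0 : Smooth n 0 b₂ := ContMDiffOn.of_le hb₂ zero_le_one
  have hχ0 := hχ.of_le (l := 0) (by simp)
  have e3 : ∫ p, dirDerivXR v₁ a₁ (fun p => b₂ p * χ p) p ∂σ =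
      ∫ p, dirDerivXR v₁ a₁ b₂ p * χ p ∂σ + ∫ p, b₂ p * dirDerivXR v₁ a₁ χ p ∂σ := by
    rw [← integral_add (z s₁ hχ0) (z hb₂0 (l₁.of_le zero_le_one))]
    exact integral_congr_ae (hσ.pos.mono fun p hp => dirDerivXR_mul hb₂ hχ1.smooth _ _ hp)
  have e4 : ∫ p, dirDerivXR v₂ a₂ (fun p => b₁ p * χ p) p ∂σ =
      ∫ p, dirDerivXR v₂ a₂ b₁ p * χ p ∂σ + ∫ p, b₁ p * dirDerivXR v₂ a₂ χ p ∂σ := by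
    rw [← integral_add (z s₂ hχ0) (z hb₁0 (l₂.of_le zero_le_one))]
    exact integral_congr_ae (hσ.pos.mono fun p hp => dirDerivXR_mul hb₁ hχ1.smooth _ _ hp)
  have e5 : ∫ p, dirDerivXR (VectorField.mlieBracket (𝓡 n) v₁ v₂)
      (fun x => along v₁ a₂ x - along v₂ a₁ x) χ p ∂σ =
      ∫ p, dirDerivXR v₁ a₁ (dirDerivXR v₂ a₂ χ) p ∂σ -
        ∫ p, dirDerivXR v₂ a₂ (dirDerivXR v₁ a₁ χ) p ∂σ := by
    rw [← integral_sub d₁₂ d₂₁]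
    exact integral_congr_ae (hσ.pos.mono fun p hp =>
      (dirDerivXR_commutator hχ2 hv₁.1 ha₁.1 hv₂.1 ha₂.1 hp).symm)
  have f1 : ∫ p, β₁ p * dirDerivXR v₂ a₂ χ p ∂σ = ∫ p, b₁ p * dirDerivXR v₂ a₂ χ p ∂σ :=
    integral_congr_ae (h₁.mono fun p hp => by simp only [hp])
  have f2 : ∫ p, β₂ p * dirDerivXR v₁ a₁ χ p ∂σ = ∫ p, b₂ p * dirDerivXR v₁ a₁ χ p ∂σ :=
    integral_congr_ae (h₂.mono fun p hp => by simp only [hp])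
  -- The zero-order terms β₁ β₂ χ of the last two integrations by parts are equal and cancel in the
  -- difference.
  have f3 : ∫ p, β₁ p * (b₂ p * χ p) ∂σ = ∫ p, β₂ p * (b₁ p * χ p) ∂σ := by
    refine integral_congr_ae ?_
    filter_upwards [h₁, h₂] with p hp₁ hp₂
    rw [hp₁, hp₂]
    ring
  have e : ∀ p, (dirDerivXR v₁ a₁ b₂ p - dirDerivXR v₂ a₂ b₁ p) * χ p =
      dirDerivXR v₁ a₁ b₂ p * χ p - dirDerivXR v₂ a₂ b₁ p * χ p := fun p => sub_mul _ _ _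
  simp only [e]
  refine ⟨(z s₁ hχ0).sub (z s₂ hχ0), ?_⟩
  rw [integral_sub (z s₁ hχ0) (z s₂ hχ0)]
  linarith

end Uniqueness

/-! ### Test functions -/

section Tests

variable {n : ℕ} {X : Type*} [TopologicalSpace X] [ChartedSpace (EuclideanSpace ℝ (Fin n)) X]
  [IsManifold (𝓡 n) ∞ X] [T2Space X] [SecondCountableTopology X] [LocallyCompactSpace X]
  [MeasurableSpace X] [BorelSpace X]
  {v v₁ v₂ : (x : X) → TangentSpace (𝓡 n) x} {a a₁ a₂ : X → ℝ} {φ ψ : X × ℝ → ℝ}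

theorem dirDerivXR_zero_one (φ : X × ℝ → ℝ) (p : X × ℝ) :
    dirDerivXR (0 : (x : X) → TangentSpace (𝓡 n) x) 1 φ p = p.2 * deriv (fun s => φ (p.1, s)) p.2 := by
  rw [dirDerivXR, zero_along, Pi.zero_apply, zero_add, Pi.one_apply, mul_one]

theorem dirDerivXR_zero_right (v : (x : X) → TangentSpace (𝓡 n) x) (φ : X × ℝ → ℝ) (p : X × ℝ) :
    dirDerivXR v 0 φ p = along v (fun x => φ (x, p.2)) p.1 := by
  rw [dirDerivXR, Pi.zero_apply, mul_zero, add_zero]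

/-- Splits the derivative into the horizontal ∇_v and the Euler operator s ∂_s, written as the
direction (0, 1). The constant 1 lacks compact support, but the rules for derivatives do not need
it. -/
theorem dirDerivXR_eq_add (v : (x : X) → TangentSpace (𝓡 n) x) (a : X → ℝ) (φ : X × ℝ → ℝ)
    (p : X × ℝ) : dirDerivXR v a φ p = dirDerivXR v 0 φ p + a p.1 *
      dirDerivXR (0 : (x : X) → TangentSpace (𝓡 n) x) 1 φ p := by
  rw [dirDerivXR_zero_one, dirDerivXR_zero_right, dirDerivXR, mul_comm (a p.1)]

/-- The general commutator with both components of the bracket zero, since ∇_v of the constant 1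
vanishes. -/
theorem dirDerivXR_zero_one_comm (hφ : Smooth n 2 φ) (hv : IsField v) {p : X × ℝ} (hp : 0 < p.2) :
    dirDerivXR (0 : (x : X) → TangentSpace (𝓡 n) x) 1 (dirDerivXR v 0 φ) p =
      dirDerivXR v 0 (dirDerivXR (0 : (x : X) → TangentSpace (𝓡 n) x) 1 φ) p := by
  have h := dirDerivXR_commutator (a₁ := (1 : X → ℝ)) hφ (isField_zero (n := n) (X := X)).1
    contMDiff_const hv.1
    (isFun_zero (n := n) (X := X)).1 hp
  have e1 : VectorField.mlieBracket (𝓡 n) (0 : (x : X) → TangentSpace (𝓡 n) x) v = 0 :=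
    VectorField.mlieBracket_zero_left
  have e2 : along v (1 : X → ℝ) = 0 := funext fun x =>
    congrArg (fun L => L (v x)) (mfderiv_const (I := 𝓡 n) (I' := 𝓘(ℝ, ℝ)) (c := (1 : ℝ)) (x := x))
  rw [e1, e2] at h
  simp only [zero_along, Pi.zero_apply, sub_zero] at h
  rw [sub_eq_zero.1 (h.trans ?_)]
  rw [dirDerivXR, zero_along]
  simp

/-- The derivative of `φ` in the second variable. -/
def derivSnd (φ : X × ℝ → ℝ) (p : X × ℝ) : ℝ := deriv (fun s => φ (p.1, s)) p.2

theorem smooth_inv_snd {k : WithTop ℕ∞} : Smooth n k (fun p : X × ℝ => p.2⁻¹) := by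
  have h : ContDiffOn ℝ k (fun s : ℝ => s⁻¹) (Ioi 0) :=
    contDiffOn_id.inv fun s hs => (ne_of_gt hs : s ≠ 0)
  exact h.contMDiffOn.comp contMDiff_snd.contMDiffOn fun p hp => hp.2

theorem smooth_snd {k : WithTop ℕ∞} : Smooth n k (fun p : X × ℝ => p.2) :=
  contMDiff_snd.contMDiffOn

theorem LocSmooth.congr {k : WithTop ℕ∞} (h : LocSmooth n k φ) (he : ∀ p : X × ℝ, 0 < p.2 → ψ p = φ p) :
    LocSmooth n k ψ := by
  obtain ⟨K, hK, hφK⟩ := h.supp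
  obtain ⟨r, R, hr, h0⟩ := h.slice
  exact ⟨ContMDiffOn.congr h.smooth fun p hp => he p hp.2,
    ⟨K, hK, fun x hx s hs => (he (x, s) hs).trans (hφK x hx s hs)⟩,
    ⟨r, R, hr, fun x s hs h => (he (x, s) hs).trans (h0 x s hs h)⟩⟩

/-- ∂_s is recovered from the Euler operator s ∂_s by multiplication with 1/s, which is smooth for
positive marks. -/
theorem locSmooth_derivSnd (h : LocSmooth n ∞ φ) : LocSmooth n ∞ (derivSnd φ) := by
  have h1 : LocSmooth n ∞ (MarkedPoisson.dirDerivXR (0 : (x : X) → TangentSpace (𝓡 n) x) 1 φ) :=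
    h.dirDerivXR le_rfl le_rfl (isField_zero (n := n) (X := X)).1 contMDiff_const
  refine (h1.mul_left smooth_inv_snd).congr fun p hp => ?_
  rw [dirDerivXR_zero_one, inv_mul_cancel_left₀ hp.ne']
  rfl

theorem locSmooth_iteratedDeriv (h : LocSmooth n ∞ φ) (j : ℕ) :
    LocSmooth n ∞ (fun p => iteratedDeriv j (fun s => φ (p.1, s)) p.2) := by
  induction j with
  | zero => simpa only [iteratedDeriv_zero] using h
  | succ j ih =>
    simp only [iteratedDeriv_succ]
    exact locSmooth_derivSnd ih

theorem locSmooth_iterDeriv (h : LocSmooth n ∞ φ) (j : ℕ)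
    (l : List ((x : X) → TangentSpace (𝓡 n) x)) (hl : ∀ v ∈ l, IsField v) :
    LocSmooth n ∞ (iterDeriv l j φ) := by
  induction l with
  | nil => exact locSmooth_iteratedDeriv h j
  | cons v l ih =>
    have h1 := (ih fun w hw => hl w (List.mem_cons_of_mem _ hw)).dirDerivXR (l := (∞ : WithTop ℕ∞)) le_rfl
      le_rfl (hl v List.mem_cons_self).1 (isFun_zero (n := n) (X := X)).1
    exact h1.congr fun p _ => (dirDerivXR_zero_right v _ p).symm

theorem LocSmooth.isTest (h : LocSmooth n ∞ φ) : IsTest n φ := by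
  refine ⟨h.smooth, h.supp, fun l hl j => ?_, fun j => ?_⟩
  · obtain ⟨C, hC⟩ := (locSmooth_iterDeriv h j l hl).exists_bound
    exact ⟨C, fun x s hs => hC (x, s) hs⟩
  · obtain ⟨C, hC⟩ := (locSmooth_iteratedDeriv h j).exists_bound
    obtain ⟨r, R, hr, h0⟩ := (locSmooth_iteratedDeriv h j).slice
    -- The derivative is bounded by C and vanishes for s > R, so max {1, s}^j never exceeds max {1,
    -- R}^j where it matters.
    refine ⟨|C| * max 1 R ^ j, fun x s hs => ?_⟩
    have hm : (0 : ℝ) < max 1 s := zero_lt_one.trans_le (le_max_left _ _)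
    have hm' : (0 : ℝ) < max 1 R := zero_lt_one.trans_le (le_max_left _ _)
    rw [← div_eq_mul_inv, le_div_iff₀ (pow_pos hm j)]
    by_cases hsr : s ∈ Icc r R
    · exact mul_le_mul ((hC (x, s) hs).trans (le_abs_self C))
        (pow_le_pow_left₀ hm.le (max_le_max le_rfl hsr.2) j) (pow_pos hm j).le (abs_nonneg _)
    · rw [show iteratedDeriv j (fun s => φ (x, s)) s = 0 from h0 x s hs hsr, abs_zero, zero_mul]
      positivity

theorem IsTest.exists_bound (h : IsTest n φ) : ∃ C, ∀ p : X × ℝ, 0 < p.2 → |φ p| ≤ C := by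
  obtain ⟨C, hC⟩ := h.bounded [] (by simp) 0
  exact ⟨C, fun p hp => by simpa [iterDeriv] using hC p.1 p.2 hp⟩

theorem IsTest.exists_bound_along (h : IsTest n φ) (hv : IsField v) :
    ∃ C, ∀ p : X × ℝ, 0 < p.2 → |dirDerivXR v 0 φ p| ≤ C := by
  obtain ⟨C, hC⟩ := h.bounded [v] (by simpa using hv) 0
  exact ⟨C, fun p hp => by simpa [iterDeriv, dirDerivXR_zero_right] using hC p.1 p.2 hp⟩

/-- Decay of order one is exactly what keeps s ∂_s φ bounded. -/
theorem IsTest.exists_bound_snd (h : IsTest n φ) : ∃ C, ∀ p : X × ℝ, 0 < p.2 →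
    |dirDerivXR (0 : (x : X) → TangentSpace (𝓡 n) x) 1 φ p| ≤ C := by
  obtain ⟨C, hC⟩ := h.decay 1
  refine ⟨C, fun p hp => ?_⟩
  have h1 := hC p.1 p.2 hp
  have hm : (0 : ℝ) < max 1 p.2 := zero_lt_one.trans_le (le_max_left _ _)
  rw [iteratedDeriv_one, pow_one, ← div_eq_mul_inv, le_div_iff₀ hm] at h1
  rw [dirDerivXR_zero_one, abs_mul, abs_of_pos hp, mul_comm]
  exact (mul_le_mul_of_nonneg_left (le_max_right 1 p.2) (abs_nonneg _)).trans h1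

variable [Bundle.RiemannianBundle (fun x : X => TangentSpace (𝓡 n) x)]
  [IsContMDiffRiemannianBundle (𝓡 n) ∞ (EuclideanSpace ℝ (Fin n))
      (fun x : X => TangentSpace (𝓡 n) x)]

theorem IsTest.exists_bound_dirDerivXR (h : IsTest n φ) (hv : IsField v) (ha : IsFun n a) :
    ∃ C, ∀ p : X × ℝ, 0 < p.2 → |dirDerivXR v a φ p| ≤ C := by
  obtain ⟨C, hC⟩ := h.exists_bound_along hv
  obtain ⟨D, hD⟩ := h.exists_bound_snd
  obtain ⟨A, hA⟩ := ha.exists_bound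
  refine ⟨C + A * D, fun p hp => ?_⟩
  rw [dirDerivXR_eq_add]
  refine (abs_add_le _ _).trans (add_le_add (hC p hp) ?_)
  rw [abs_mul]
  exact mul_le_mul (hA _) (hD p hp) (abs_nonneg _) ((abs_nonneg _).trans (hA p.1))

theorem Smooth.derivSnd {k l : WithTop ℕ∞} (hφ : Smooth n k φ) (hk : k ≤ (∞ : WithTop ℕ∞))
    (hl : l + 1 ≤ k) : Smooth n l (derivSnd φ) := by
  have h1 : Smooth n l (MarkedPoisson.dirDerivXR (0 : (x : X) → TangentSpace (𝓡 n) x) 1 φ) :=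
    hφ.dirDerivXR hk hl (isField_zero (n := n) (X := X)).1 contMDiff_const
  refine ContMDiffOn.congr (ContMDiffOn.mul (smooth_inv_snd (n := n) (X := X)) h1) fun p hp => ?_
  rw [Pi.mul_apply, dirDerivXR_zero_one, inv_mul_cancel_left₀ (ne_of_gt hp.2)]
  rfl

theorem dirDerivXR_zero_one_eq (φ : X × ℝ → ℝ) :
    dirDerivXR (0 : (x : X) → TangentSpace (𝓡 n) x) 1 φ = fun p => p.2 * derivSnd φ p :=
  funext fun p => dirDerivXR_zero_one φ p

/-- The class 𝔇 bounds the mixed derivative ∇_v ∂_s φ by a constant, without decay in s, so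
multiplication by s costs linear growth. This is the source of the factor max {1, s}. -/
theorem IsTest.exists_bound_along_snd (h : IsTest n φ) (hv : IsField v) :
    ∃ C, ∀ p : X × ℝ, 0 < p.2 → |dirDerivXR v 0
      (dirDerivXR (0 : (x : X) → TangentSpace (𝓡 n) x) 1 φ) p| ≤ C * max 1 p.2 := by
  obtain ⟨C, hC⟩ := h.bounded [v] (by simpa using hv) 1
  refine ⟨|C|, fun p hp => ?_⟩
  have h2 : Smooth n 2 φ := ContMDiffOn.of_le h.smooth two_le_infty
  have h1 : Smooth n 1 (derivSnd φ) := h2.derivSnd two_le_infty one_add_one_eq_two.le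
  rw [dirDerivXR_zero_one_eq, dirDerivXR_mul smooth_snd h1 v 0 hp, dirDerivXR_zero_right,
    dirDerivXR_zero_right]
  have e : along v (fun _ : X => p.2) p.1 = 0 :=
    congrArg (fun L => L (v p.1)) (mfderiv_const (I := 𝓡 n) (I' := 𝓘(ℝ, ℝ)) (c := p.2) (x := p.1))
  rw [e, zero_mul, zero_add, abs_mul, abs_of_pos hp, mul_comm]
  have h3 := hC p.1 p.2 hp
  simp only [iterDeriv, List.foldr, iteratedDeriv_one] at h3
  exact mul_le_mul (h3.trans (le_abs_self C)) (le_max_right _ _) hp.le (abs_nonneg _)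

/-- (s ∂_s)² = s ∂_s + s² ∂_s², and both terms are bounded by the decay of orders one and two. -/
theorem IsTest.exists_bound_snd_snd (h : IsTest n φ) :
    ∃ C, ∀ p : X × ℝ, 0 < p.2 → |dirDerivXR (0 : (x : X) → TangentSpace (𝓡 n) x) 1
      (dirDerivXR (0 : (x : X) → TangentSpace (𝓡 n) x) 1 φ) p| ≤ C := by
  obtain ⟨C, hC⟩ := h.exists_bound_snd
  obtain ⟨D, hD⟩ := h.decay 2
  refine ⟨C + D, fun p hp => ?_⟩
  have h2 : Smooth n 2 φ := ContMDiffOn.of_le h.smooth two_le_infty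
  have h1 : Smooth n 1 (derivSnd φ) := h2.derivSnd two_le_infty one_add_one_eq_two.le
  have h3 := hC p hp
  have h4 := hD p.1 p.2 hp
  have hm : (0 : ℝ) < max 1 p.2 := zero_lt_one.trans_le (le_max_left _ _)
  rw [← div_eq_mul_inv, le_div_iff₀ (pow_pos hm 2), iteratedDeriv_succ, iteratedDeriv_one] at h4
  rw [dirDerivXR_zero_one_eq φ, dirDerivXR_mul smooth_snd h1 _ _ hp, dirDerivXR_zero_one,
    dirDerivXR_zero_one, deriv_id'', mul_one]
  rw [dirDerivXR_zero_one] at h3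
  refine (abs_add_le _ _).trans (add_le_add h3 ?_)
  rw [← mul_assoc, ← sq, abs_mul, abs_of_nonneg (sq_nonneg p.2), mul_comm]
  exact (mul_le_mul_of_nonneg_left (pow_le_pow_left₀ hp.le (le_max_right 1 p.2) 2)
    (abs_nonneg _)).trans h4

/-- The second derivative expands into ∇∇φ, (∇_{v₁} a₂) s ∂_s φ, the mixed terms a ∇(s ∂_s φ), and
a₁ a₂ (s ∂_s)² φ. Only the mixed terms force the factor max {1, s}. -/
theorem IsTest.exists_bound_dirDerivXR_dirDerivXR (h : IsTest n φ) (hv₁ : IsField v₁)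
    (ha₁ : IsFun n a₁) (hv₂ : IsField v₂) (ha₂ : IsFun n a₂) :
    ∃ C, ∀ p : X × ℝ, 0 < p.2 →
      |dirDerivXR v₁ a₁ (dirDerivXR v₂ a₂ φ) p| ≤ C * max 1 p.2 := by
  have hz := isField_zero (n := n) (X := X)
  have hz' := isFun_zero (n := n) (X := X)
  have h2 : Smooth n 2 φ := ContMDiffOn.of_le h.smooth two_le_infty
  obtain ⟨C₁, hC₁⟩ := h.bounded [v₁, v₂] (by simpa using ⟨hv₁, hv₂⟩) 0
  obtain ⟨C₂, hC₂⟩ := h.exists_bound_snd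
  obtain ⟨C₃, hC₃⟩ := h.exists_bound_along_snd hv₁
  obtain ⟨C₄, hC₄⟩ := h.exists_bound_along_snd hv₂
  obtain ⟨C₅, hC₅⟩ := h.exists_bound_snd_snd
  obtain ⟨A₁, hA₁⟩ := ha₁.exists_bound
  obtain ⟨A₂, hA₂⟩ := ha₂.exists_bound
  -- A bound for ∇_{v₁} a₂, taken from the bracket of (v₁, 0) and (0, a₂).
  obtain ⟨A₃, hA₃⟩ := (IsFun.along_sub_along hv₁ hz' hz ha₂).exists_bound
  simp only [zero_along, Pi.zero_apply, sub_zero] at hA₃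
  have s₂ : Smooth n 1 (dirDerivXR v₂ 0 φ) := h2.dirDerivXR two_le_infty one_add_one_eq_two.le
    hv₂.1 hz'.1
  have sE : Smooth n 1 (dirDerivXR (0 : (x : X) → TangentSpace (𝓡 n) x) 1 φ) :=
    h2.dirDerivXR two_le_infty one_add_one_eq_two.le hz.1 contMDiff_const
  have sa : Smooth n 1 fun p : X × ℝ => a₂ p.1 :=
    Smooth.comp_fst n (ha₂.1.of_le (by exact_mod_cast le_top))
  have sm : Smooth n 1 fun p : X × ℝ => a₂ p.1 *
      dirDerivXR (0 : (x : X) → TangentSpace (𝓡 n) x) 1 φ p := ContMDiffOn.mul sa sE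
  refine ⟨|C₁| + |A₃| * |C₂| + |A₂| * |C₃| + |A₁| * (|C₄| + |A₂| * |C₅|), fun p hp => ?_⟩
  have e₂ : dirDerivXR v₂ a₂ φ = fun p => dirDerivXR v₂ 0 φ p + a₂ p.1 *
      dirDerivXR (0 : (x : X) → TangentSpace (𝓡 n) x) 1 φ p := funext fun p => dirDerivXR_eq_add _ _ _ p
  have e : dirDerivXR v₁ a₁ (dirDerivXR v₂ a₂ φ) p = dirDerivXR v₁ 0 (dirDerivXR v₂ 0 φ) p +
      along v₁ a₂ p.1 * dirDerivXR (0 : (x : X) → TangentSpace (𝓡 n) x) 1 φ p +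
      a₂ p.1 * dirDerivXR v₁ 0 (dirDerivXR (0 : (x : X) → TangentSpace (𝓡 n) x) 1 φ) p +
      a₁ p.1 * (dirDerivXR v₂ 0 (dirDerivXR (0 : (x : X) → TangentSpace (𝓡 n) x) 1 φ) p +
        a₂ p.1 * dirDerivXR (0 : (x : X) → TangentSpace (𝓡 n) x) 1
          (dirDerivXR (0 : (x : X) → TangentSpace (𝓡 n) x) 1 φ) p) := by
    rw [dirDerivXR_eq_add v₁ a₁, e₂, dirDerivXR_add s₂ sm _ _ hp, dirDerivXR_add s₂ sm _ _ hp,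
      dirDerivXR_mul sa sE _ _ hp, dirDerivXR_mul sa sE _ _ hp, dirDerivXR_zero_one_comm h2 hv₂ hp,
      dirDerivXR_zero_right v₁ (fun p => a₂ p.1), dirDerivXR_zero_one (fun p => a₂ p.1)]
    simp only [deriv_const, mul_zero, zero_mul, zero_add]
    ring
  have hm : (1 : ℝ) ≤ max 1 p.2 := le_max_left _ _
  have b1 : |dirDerivXR v₁ 0 (dirDerivXR v₂ 0 φ) p| ≤ |C₁| * max 1 p.2 := by
    have := hC₁ p.1 p.2 hp
    simp only [iterDeriv, List.foldr, iteratedDeriv_zero] at this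
    rw [dirDerivXR_zero_right]
    simp only [dirDerivXR_zero_right]
    exact (this.trans (le_abs_self _)).trans (le_mul_of_one_le_right (abs_nonneg _) hm)
  have b2 : |along v₁ a₂ p.1 * dirDerivXR (0 : (x : X) → TangentSpace (𝓡 n) x) 1 φ p| ≤
      |A₃| * |C₂| * max 1 p.2 := by
    rw [abs_mul]
    exact (mul_le_mul ((hA₃ _).trans (le_abs_self _)) ((hC₂ p hp).trans (le_abs_self _))
      (abs_nonneg _) (abs_nonneg _)).trans (le_mul_of_one_le_right (by positivity) hm)
  have b3 : |a₂ p.1 * dirDerivXR v₁ 0 (dirDerivXR (0 : (x : X) → TangentSpace (𝓡 n) x) 1 φ) p| ≤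
      |A₂| * |C₃| * max 1 p.2 := by
    rw [abs_mul, mul_assoc]
    exact mul_le_mul ((hA₂ _).trans (le_abs_self _)) ((hC₃ p hp).trans
      (mul_le_mul_of_nonneg_right (le_abs_self _) (by positivity))) (abs_nonneg _) (abs_nonneg _)
  have b5 : |a₂ p.1 * dirDerivXR (0 : (x : X) → TangentSpace (𝓡 n) x) 1
      (dirDerivXR (0 : (x : X) → TangentSpace (𝓡 n) x) 1 φ) p| ≤ |A₂| * |C₅| * max 1 p.2 := by
    rw [abs_mul]
    exact (mul_le_mul ((hA₂ _).trans (le_abs_self _)) ((hC₅ p hp).trans (le_abs_self _))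
      (abs_nonneg _) (abs_nonneg _)).trans (le_mul_of_one_le_right (by positivity) hm)
  have b4 : |dirDerivXR v₂ 0 (dirDerivXR (0 : (x : X) → TangentSpace (𝓡 n) x) 1 φ) p| ≤
      |C₄| * max 1 p.2 :=
    (hC₄ p hp).trans (mul_le_mul_of_nonneg_right (le_abs_self _) (by positivity))
  rw [e, add_mul, add_mul, add_mul]
  refine (abs_add_le _ _).trans (add_le_add ((abs_add_le _ _).trans (add_le_add
    ((abs_add_le _ _).trans (add_le_add b1 b2)) b3)) ?_)
  rw [abs_mul, mul_assoc, add_mul]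
  exact mul_le_mul ((hA₁ _).trans (le_abs_self _)) ((abs_add_le _ _).trans (add_le_add b4 b5))
    (abs_nonneg _) (abs_nonneg _)

theorem IsTest.isAdm (h : IsTest n φ) {K : Set X} (hK : SuppIn K φ) (hv : IsField v)
    (ha : IsFun n a) : IsAdm K v a φ := by
  obtain ⟨C, hC⟩ := h.exists_bound_dirDerivXR hv ha
  exact ⟨h.smooth_one, hK, h.exists_bound, ⟨|C|, fun p hp => ((hC p hp).trans (le_abs_self C)).trans
    (le_mul_of_one_le_right (abs_nonneg _) (le_max_left _ _))⟩⟩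

theorem IsTest.isAdm_dirDerivXR (h : IsTest n φ) {K : Set X} (hKc : IsCompact K) (hK : SuppIn K φ)
    (hv₁ : IsField v₁) (ha₁ : IsFun n a₁) (hv₂ : IsField v₂) (ha₂ : IsFun n a₂) :
    IsAdm K v₁ a₁ (dirDerivXR v₂ a₂ φ) :=
  ⟨Smooth.dirDerivXR (m := 2) two_le_infty (hφ := ContMDiffOn.of_le h.smooth two_le_infty)
    (hkm := one_add_one_eq_two.le) (hv := hv₂.1) (ha := ha₂.1), hK.dirDerivXR hKc v₂ a₂, h.exists_bound_dirDerivXR hv₂ ha₂,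
    h.exists_bound_dirDerivXR_dirDerivXR hv₁ ha₁ hv₂ ha₂⟩

end Tests

/-! ### Cylinder functions separate integrable functions -/

section Separation

/-- The open set, a locally compact space in its own right, is exhausted by compact sets, and the
k-th function equals one on the k-th of them. -/
theorem exists_seq_contMDiff {E H M : Type*} [NormedAddCommGroup E] [NormedSpace ℝ E]
    [FiniteDimensional ℝ E] [TopologicalSpace H] (I : ModelWithCorners ℝ E H) [TopologicalSpace M]
    [ChartedSpace H M] [IsManifold I ∞ M] [T2Space M] [SecondCountableTopology M]
    [LocallyCompactSpace M] {U : Set M} (hU : IsOpen U) :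
    ∃ χ : ℕ → M → ℝ, (∀ k, ContMDiff I 𝓘(ℝ, ℝ) ∞ (χ k)) ∧ (∀ k, HasCompactSupport (χ k)) ∧
      (∀ k, tsupport (χ k) ⊆ U) ∧ (∀ k x, χ k x ∈ Icc (0 : ℝ) 1) ∧
      ∀ x, Tendsto (fun k => χ k x) atTop (𝓝 (U.indicator 1 x)) := by
  have : LocallyCompactSpace U := hU.locallyCompactSpace
  have hK : ∀ k, IsCompact (((↑) : U → M) '' compactCovering U k) := fun k =>
    (isCompact_compactCovering U k).image continuous_subtype_val
  have hKU : ∀ k, ((↑) : U → M) '' compactCovering U k ⊆ U := fun k => by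
    rintro _ ⟨x, -, rfl⟩
    exact x.2
  have key : ∀ k, ∃ χ : M → ℝ, ContMDiff I 𝓘(ℝ, ℝ) ∞ χ ∧ HasCompactSupport χ ∧ tsupport χ ⊆ U ∧
      (∀ x, χ x ∈ Icc (0 : ℝ) 1) ∧ ∀ x ∈ ((↑) : U → M) '' compactCovering U k, χ x = 1 := by
    intro k
    obtain ⟨L, hL, hKL, hLU⟩ := exists_compact_between (hK k) hU (hKU k)
    obtain ⟨f, f0, f1, hf⟩ := exists_contMDiffMap_zero_one_of_isClosed I (n := (⊤ : ℕ∞))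
      isOpen_interior.isClosed_compl (hK k).isClosed
      (disjoint_compl_left_iff_subset.2 hKL)
    have hs : tsupport f ⊆ L := by
      refine closure_minimal (fun x hx => interior_subset ?_) hL.isClosed
      by_contra h
      exact hx (f0 h)
    exact ⟨f, f.contMDiff, hL.of_isClosed_subset (isClosed_tsupport f) hs, hs.trans hLU, hf,
      fun x hx => f1 hx⟩
  choose χ h1 h2 h3 h4 h5 using key
  refine ⟨χ, h1, h2, h3, h4, fun x => ?_⟩
  by_cases hx : x ∈ U
  · rw [indicator_of_mem hx]
    obtain ⟨k, hk⟩ := mem_iUnion.1 ((iUnion_compactCovering U).symm ▸ mem_univ (⟨x, hx⟩ : U))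
    refine tendsto_const_nhds.congr' ?_
    filter_upwards [eventually_ge_atTop k] with j hj
    exact (h5 j x ⟨⟨x, hx⟩, compactCovering_subset U hj hk, rfl⟩).symm
  · rw [indicator_of_notMem hx]
    refine tendsto_const_nhds.congr fun k => ?_
    exact (image_eq_zero_of_notMem_tsupport fun h => hx (h3 k h)).symm

variable {n : ℕ} {X : Type*} [TopologicalSpace X] [ChartedSpace (EuclideanSpace ℝ (Fin n)) X]
  [IsManifold (𝓡 n) ∞ X] [T2Space X] [SecondCountableTopology X] [LocallyCompactSpace X]
  [MeasurableSpace X] [BorelSpace X]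

theorem isCylinder_comp {ι : Type*} [Fintype ι] {φ : ι → X × ℝ → ℝ} (hφ : ∀ j, IsTest n (φ j))
    {g : (ι → ℝ) → ℂ} (hg : ContDiff ℝ ∞ g) (hgc : HasCompactSupport g) :
    IsCylinder n fun γ => g fun j => pairing (φ j) γ := by
  let e := Fintype.equivFin ι
  let L : (Fin (Fintype.card ι) → ℝ) ≃L[ℝ] (ι → ℝ) := ContinuousLinearEquiv.piCongrLeft ℝ (fun _ => ℝ) e.symm
  have hL : ContDiff ℝ ∞ (g ∘ L) := hg.comp L.contDiff
  have hLc : HasCompactSupport (g ∘ L) := hgc.comp_homeomorph L.toHomeomorph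
  refine ⟨Fintype.card ι, fun j => φ (e.symm j), g ∘ L, fun j => hφ _, hL, fun k => ?_, fun γ => ?_⟩
  · exact (hLc.iteratedFDeriv k).exists_bound_of_continuous
      (hL.continuous_iteratedFDeriv (by exact_mod_cast le_top))
  · refine congrArg g (funext fun j => ?_)
    obtain ⟨i, rfl⟩ := e.symm.surjective j
    exact (Equiv.piCongrLeft_apply_apply (fun _ => ℝ) e.symm (fun j => pairing (φ (e.symm j)) γ) i).symm

/-- Smooth functions converging to the indicator of an open set show that counts over open sets are
measurable. Open sets form a π-system generating the Borel sets, so finite measures determined on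
them carry this over to counts over Borel sets. -/
theorem measurable_of_pairing {Ω : Type*} [MeasurableSpace Ω] {c : Ω → Config X}
    (h : ∀ χ, LocSmooth n ∞ χ → Measurable fun w => pairing χ (c w)) : Measurable c := by
  refine measurable_generateFrom ?_
  rintro _ ⟨B, K, k, hB, hK, hBK, rfl⟩
  obtain ⟨Λ, hΛo, hΛ, hKΛ⟩ := exists_isOpen_superset_isCompact_closure hK
  have hBs : B ⊆ Λ ×ˢ Ioi (0 : ℝ) := hBK.trans (Set.prod_mono hKΛ le_rfl)
  have hΛm : MeasurableSet (Λ ×ˢ Ioi (0 : ℝ) : Set (X × ℝ)) := hΛo.measurableSet.prod measurableSet_Ioi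
  have happ : ∀ (γ : Config X) (A : Set (X × ℝ)), MeasurableSet A →
      (countMeasure γ).restrict (Λ ×ˢ Ioi (0 : ℝ)) A =
        ((γ.1 ∩ (A ∩ Λ ×ˢ Ioi (0 : ℝ))).ncard : ℝ≥0∞) := fun γ A hA => by
    rw [Measure.restrict_apply hA]
    exact countMeasure_apply_of_subset γ hΛ (hA.inter hΛm)
      (inter_subset_right.trans (Set.prod_mono subset_closure (subset_univ _)))
  have hfin : ∀ w, IsFiniteMeasure ((countMeasure (c w)).restrict (Λ ×ˢ Ioi (0 : ℝ))) := fun w =>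
    ⟨by rw [happ _ _ MeasurableSet.univ]; exact ENNReal.natCast_lt_top _⟩
  have hopen : ∀ A : Set (X × ℝ), IsOpen A →
      Measurable fun w => (countMeasure (c w)).restrict (Λ ×ˢ Ioi (0 : ℝ)) A := by
    -- Cutting down to Λ × (0, ∞) makes the counting measures finite, as the π-system argument
    -- requires.
    intro A hA
    have hUo : IsOpen (A ∩ Λ ×ˢ Ioi (0 : ℝ)) := hA.inter (hΛo.prod isOpen_Ioi)
    obtain ⟨χ, h1, h2, h3, h4, h5⟩ := exists_seq_contMDiff ((𝓡 n).prod 𝓘(ℝ, ℝ)) hUo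
    have hχΛ : ∀ k, SuppIn (closure Λ) (χ k) := fun k x hx s hs =>
      image_eq_zero_of_notMem_tsupport fun h => hx (subset_closure (h3 k h).2.1)
    have hm : ∀ k, Measurable fun w => pairing (χ k) (c w) := fun k => h _
      (locSmooth_of_contMDiff (h1 k) (h2 k) fun p hp => ⟨mem_univ _, (h3 k hp).2.2⟩)
    have hlim : Measurable fun w => ((((c w).1 ∩ (A ∩ Λ ×ˢ Ioi (0 : ℝ))).ncard : ℕ) : ℝ) := by
      refine measurable_of_tendsto_metrizable hm (tendsto_pi_nhds.2 fun w => ?_)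
      have e1 : ∀ k, pairing (χ k) (c w) = ∑ p ∈ (c w).pts hΛ, χ k p := fun k =>
        pairing_eq_sum hΛ (hχΛ k) _
      have e2 : ((((c w).1 ∩ (A ∩ Λ ×ˢ Ioi (0 : ℝ))).ncard : ℕ) : ℝ) =
          ∑ p ∈ (c w).pts hΛ, (A ∩ Λ ×ˢ Ioi (0 : ℝ)).indicator 1 p := by
        classical
        rw [Finset.sum_indicator_eq_sum_filter]
        simp only [Pi.one_apply, Finset.sum_const, nsmul_eq_mul, mul_one]
        rw [← Set.ncard_coe_finset]
        congr 2
        ext p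
        simp only [Finset.coe_filter, mem_inter_iff, Config.mem_pts, mem_ofPred_eq]
        exact ⟨fun hp => ⟨⟨hp.1, subset_closure hp.2.2.1⟩, hp.2⟩, fun hp => ⟨hp.1.1, hp.2⟩⟩
      simp only [e1, e2]
      exact tendsto_finsetSum _ fun p _ => h5 p
    have : Measurable fun w => ENNReal.ofReal
        ((((c w).1 ∩ (A ∩ Λ ×ˢ Ioi (0 : ℝ))).ncard : ℕ) : ℝ) := hlim.ennreal_ofReal
    simpa only [ENNReal.ofReal_natCast, happ _ _ hA.measurableSet] using this
  have hmeas : Measurable fun w => (countMeasure (c w)).restrict (Λ ×ˢ Ioi (0 : ℝ)) :=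
    Measurable.measure_of_isPiSystem (S := {A | IsOpen A}) (BorelSpace.measurable_eq)
      isPiSystem_isOpen (fun A hA => hopen A hA) (hopen _ isOpen_univ)
  have hB' : Measurable fun w => (((c w).1 ∩ B).ncard : ℝ≥0∞) := by
    have := (Measure.measurable_coe hB).comp hmeas
    have e0 : (fun w => (((c w).1 ∩ B).ncard : ℝ≥0∞)) =
        (fun ν : Measure (X × ℝ) => ν B) ∘ fun w =>
          (countMeasure (c w)).restrict (Λ ×ˢ Ioi (0 : ℝ)) := funext fun w => by
      simp only [Function.comp_apply, happ _ _ hB, inter_eq_self_of_subset_left hBs]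
    rw [e0]
    exact this
  have e : c ⁻¹' {γ : Config X | (γ.1 ∩ B).ncard = k} =
      (fun w => (((c w).1 ∩ B).ncard : ℝ≥0∞)) ⁻¹' {(k : ℝ≥0∞)} := by
    ext w
    simp only [mem_preimage, mem_ofPred_eq, mem_singleton_iff, Nat.cast_inj]
  rw [e]
  exact hB' (measurableSet_singleton _)

variable (n X) in
/-- The sets `{γ | (⟨χ_j, γ⟩)_j ∈ O}` with `O` open and `χ_j` smooth with compact support. -/
def cylinderSets : Set (Set (Config X)) :=
  {A | ∃ (k : ℕ) (χ : Fin k → X × ℝ → ℝ) (O : Set (Fin k → ℝ)), (∀ j, LocSmooth n ∞ (χ j)) ∧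
    IsOpen O ∧ A = {γ | (fun j => pairing (χ j) γ) ∈ O}}

theorem isPiSystem_cylinderSets : IsPiSystem (cylinderSets n X) := by
  rintro _ ⟨k, χ, O, hχ, hO, rfl⟩ _ ⟨l, η, Q, hη, hQ, rfl⟩ -
  refine ⟨k + l, Fin.append χ η, {r | (fun j => r (Fin.castAdd l j)) ∈ O ∧
    (fun j => r (Fin.natAdd k j)) ∈ Q}, fun j => ?_, ?_, ?_⟩
  · refine Fin.addCases (fun i => ?_) (fun i => ?_) j
    · rw [Fin.append_left]
      exact hχ i
    · rw [Fin.append_right]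
      exact hη i
  · exact (hO.preimage (by fun_prop)).inter (hQ.preimage (by fun_prop))
  · ext γ
    simp only [mem_inter_iff, mem_ofPred_eq, Fin.append_left, Fin.append_right]

theorem LocSmooth.measurable_pairing {χ : X × ℝ → ℝ} {k : WithTop ℕ∞} (h : LocSmooth n k χ) :
    Measurable (pairing χ : Config X → ℝ) := by
  obtain ⟨K, hK, hχK⟩ := h.supp
  exact MarkedPoisson.measurable_pairing hK hχK (measurable_indicator_half h.smooth.continuousOn)

-- The nontrivial inclusion is `measurable_of_pairing` for the identity map, whose source carries
-- the σ-algebra generated by the cylinder sets.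
variable (n) in
theorem generateFrom_cylinderSets :
    (Config.measurableSpace : MeasurableSpace (Config X)) =
      MeasurableSpace.generateFrom (cylinderSets n X) := by
  refine le_antisymm ?_ (MeasurableSpace.generateFrom_le ?_)
  · have h : @Measurable _ _ (MeasurableSpace.generateFrom (cylinderSets n X)) _
        (id : Config X → Config X) := by
      refine @measurable_of_pairing n X _ _ _ _ _ _ _ _ (Config X)
        (MeasurableSpace.generateFrom (cylinderSets n X)) id fun χ hχ => ?_
      refine @measurable_of_isOpen _ _ _ _ _ (MeasurableSpace.generateFrom (cylinderSets n X)) _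
        fun O hO => MeasurableSpace.measurableSet_generateFrom ?_
      exact ⟨1, fun _ => χ, {r | r 0 ∈ O}, fun _ => hχ, hO.preimage (continuous_apply 0), rfl⟩
    intro A hA
    exact h hA
  · rintro _ ⟨k, χ, O, hχ, hO, rfl⟩
    exact (measurable_pi_lambda _ fun j => (hχ j).measurable_pairing) hO.measurableSet

variable {μ : Measure (Config X)}

/-- Smooth cylinder functions separate the integrable functions. -/
theorem ae_eq_zero_of_forall_integral_cylinder {W : Config X → ℂ} (hW : Integrable W μ)
    (h : ∀ G, IsCylinder n G → ∫ γ, W γ * conj (G γ) ∂μ = 0) : W =ᵐ[μ] 0 := by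
  have hbasic : ∀ A ∈ cylinderSets n X, ∫ γ in A, W γ ∂μ = 0 := by
    rintro _ ⟨k, χ, O, hχ, hO, rfl⟩
    have hm : Measurable fun (γ : Config X) j => pairing (χ j) γ :=
      measurable_pi_lambda _ fun j => (hχ j).measurable_pairing
    -- The indicator of O is a bounded pointwise limit of smooth compactly supported functions, each
    -- of which gives an admissible cylinder function; dominated convergence does the rest.
    obtain ⟨g, h1, h2, h3, h4, h5⟩ := exists_seq_contMDiff 𝓘(ℝ, Fin k → ℝ) hO
    have h0 : ∀ l, ∫ γ, W γ * (g l (fun j => pairing (χ j) γ) : ℂ) ∂μ = 0 := fun l => by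
      have hc : IsCylinder n fun γ : Config X => ((g l fun j => pairing (χ j) γ : ℝ) : ℂ) :=
        isCylinder_comp (g := fun r => ((g l r : ℝ) : ℂ)) (fun j => (hχ j).isTest)
          (Complex.ofRealCLM.contDiff.comp (h1 l).contDiff)
          ((h2 l).comp_left (g := fun r : ℝ => (r : ℂ)) Complex.ofReal_zero)
      simpa only [Complex.conj_ofReal] using h _ hc
    have hlim := tendsto_integral_of_dominated_convergence (μ := μ)
      (F := fun l γ => W γ * (g l (fun j => pairing (χ j) γ) : ℂ))
      (f := fun γ => {γ : Config X | (fun j => pairing (χ j) γ) ∈ O}.indicator W γ)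
      (fun γ => ‖W γ‖) (fun l => hW.1.mul (Complex.measurable_ofReal.comp
        ((h1 l).continuous.measurable.comp hm)).aestronglyMeasurable) hW.norm
      (fun l => Eventually.of_forall fun γ => ?_) (Eventually.of_forall fun γ => ?_)
    · simp only [h0] at hlim
      refine (integral_indicator (hm hO.measurableSet)).symm.trans ?_
      exact (tendsto_nhds_unique tendsto_const_nhds hlim).symm
    · rw [norm_mul, Complex.norm_real, Real.norm_of_nonneg (h4 l _).1]
      exact mul_le_of_le_one_right (norm_nonneg _) (h4 l _).2
    · have := ((Complex.continuous_ofReal.tendsto _).comp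
        (h5 fun j => pairing (χ j) γ)).const_mul (W γ)
      have e : {γ : Config X | (fun j => pairing (χ j) γ) ∈ O}.indicator W γ =
          W γ * ((O.indicator 1 fun j => pairing (χ j) γ : ℝ) : ℂ) := by
        by_cases hγ : (fun j => pairing (χ j) γ) ∈ O
        · have hγ' : γ ∈ {γ : Config X | (fun j => pairing (χ j) γ) ∈ O} := hγ
          rw [indicator_of_mem hγ, indicator_of_mem hγ']
          simp
        · have hγ' : γ ∉ {γ : Config X | (fun j => pairing (χ j) γ) ∈ O} := hγ
          rw [indicator_of_notMem hγ, indicator_of_notMem hγ']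
          simp
      rw [e]
      exact this
  have huniv : ∫ γ, W γ ∂μ = 0 := by
    rw [← setIntegral_univ]
    -- With no functions at all the cylinder set is the whole space; this is needed for complements
    -- in the π-λ argument.
    refine hbasic _ ⟨0, Fin.elim0, univ, fun j => j.elim0, isOpen_univ, ?_⟩
    simp
  refine hW.ae_eq_zero_of_forall_setIntegral_eq_zero fun A hA _ => ?_
  refine MeasurableSpace.induction_on_inter (C := fun A _ => ∫ γ in A, W γ ∂μ = 0)
    (generateFrom_cylinderSets (X := X) n) isPiSystem_cylinderSets (by simp) hbasic
    (fun A hA ih => ?_) (fun f hd hm ih => ?_) A hA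
  · have := integral_add_compl hA hW
    rwa [ih, zero_add, huniv] at this
  · rw [integral_iUnion hm hd hW.integrableOn]
    simp only [ih, tsum_zero]

end Separation

/-! ### Calculus of cylinder functions -/

section CylinderCalculus

variable {n : ℕ} {X : Type*} [TopologicalSpace X] [ChartedSpace (EuclideanSpace ℝ (Fin n)) X]
  [IsManifold (𝓡 n) ∞ X]
  {v v₁ v₂ : (x : X) → TangentSpace (𝓡 n) x} {a a₁ a₂ : X → ℝ} {K : Set X}
  {ι κ : Type*} [Fintype ι] [Fintype κ] {E : Type*} [NormedAddCommGroup E] [NormedSpace ℝ E]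

/-- `r ↦ (r_j)_j` for the left indices. -/
def leftProj (ι κ : Type*) : (ι ⊕ κ → ℝ) →L[ℝ] (ι → ℝ) :=
  ContinuousLinearMap.pi fun j => ContinuousLinearMap.proj (Sum.inl j)

/-- `r ↦ (r_j)_j` for the right indices. -/
def rightProj (ι κ : Type*) : (ι ⊕ κ → ℝ) →L[ℝ] (κ → ℝ) :=
  ContinuousLinearMap.pi fun j => ContinuousLinearMap.proj (Sum.inr j)

theorem norm_leftProj_le (r : ι ⊕ κ → ℝ) : ‖leftProj ι κ r‖ ≤ ‖r‖ :=
  (pi_norm_le_iff_of_nonneg (norm_nonneg _)).2 fun j => norm_le_pi_norm r (Sum.inl j)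

theorem norm_rightProj_le (r : ι ⊕ κ → ℝ) : ‖rightProj ι κ r‖ ≤ ‖r‖ :=
  (pi_norm_le_iff_of_nonneg (norm_nonneg _)).2 fun j => norm_le_pi_norm r (Sum.inr j)

/-- The function `(r, d) ↦ Dg(r) d`. -/
def derivFun (g : (ι → ℝ) → E) (r : ι ⊕ ι → ℝ) : E :=
  fderiv ℝ g (leftProj ι ι r) (rightProj ι ι r)

/-- The functions `φ_j` together with their derivatives along `(v, a)`. -/
def withDeriv (v : (x : X) → TangentSpace (𝓡 n) x) (a : X → ℝ) (φ : ι → X × ℝ → ℝ) :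
    ι ⊕ ι → X × ℝ → ℝ := Sum.elim φ fun j => dirDerivXR v a (φ j)

theorem cylVal_derivFun (g : (ι → ℝ) → E) (φ : ι → X × ℝ → ℝ) :
    cylVal (derivFun g) (withDeriv v a φ) = cylDeriv v a g φ := rfl

/-- `g` is of class `C²` and bounded together with its derivatives up to order two. -/
structure IsBdd (g : (ι → ℝ) → E) (C : ℝ) : Prop where
  contDiff : ContDiff ℝ 2 g
  norm_le : ∀ r, ‖g r‖ ≤ C
  norm_fderiv_le : ∀ r, ‖fderiv ℝ g r‖ ≤ C
  norm_fderiv_fderiv_le : ∀ r, ‖fderiv ℝ (fderiv ℝ g) r‖ ≤ C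

/-- `g` is of class `C¹` and has at most linear growth together with its derivative. -/
structure IsLin (g : (ι → ℝ) → E) (C : ℝ) : Prop where
  contDiff : ContDiff ℝ 1 g
  norm_le : ∀ r, ‖g r‖ ≤ C * (1 + ‖r‖)
  norm_fderiv_le : ∀ r, ‖fderiv ℝ g r‖ ≤ C * (1 + ‖r‖)

theorem IsBdd.nonneg {g : (ι → ℝ) → E} {C : ℝ} (h : IsBdd g C) : 0 ≤ C :=
  (norm_nonneg _).trans (h.norm_le 0)

theorem IsLin.nonneg {g : (ι → ℝ) → E} {C : ℝ} (h : IsLin g C) : 0 ≤ C := by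
  have := (norm_nonneg _).trans (h.norm_le 0)
  rwa [norm_zero, add_zero, mul_one] at this

theorem IsBdd.isLin {g : (ι → ℝ) → E} {C : ℝ} (h : IsBdd g C) : IsLin g C :=
  ⟨h.contDiff.of_le one_le_two, fun r => (h.norm_le r).trans (le_mul_of_one_le_right h.nonneg
    (le_add_of_nonneg_right (norm_nonneg r))), fun r => (h.norm_fderiv_le r).trans
    (le_mul_of_one_le_right h.nonneg (le_add_of_nonneg_right (norm_nonneg r)))⟩

theorem hasFDerivAt_derivFun {g : (ι → ℝ) → E} (hg : ContDiff ℝ 2 g) (r : ι ⊕ ι → ℝ) :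
    HasFDerivAt (derivFun g)
      ((fderiv ℝ g (leftProj ι ι r)).comp (rightProj ι ι) +
        ((fderiv ℝ (fderiv ℝ g) (leftProj ι ι r)).comp (leftProj ι ι)).flip (rightProj ι ι r)) r := by
  have h1 : HasFDerivAt (fderiv ℝ g) (fderiv ℝ (fderiv ℝ g) (leftProj ι ι r)) (leftProj ι ι r) :=
    ((hg.fderiv_right (m := 1) one_add_one_eq_two.le).differentiable one_ne_zero _).hasFDerivAt
  exact (h1.comp r (leftProj ι ι).hasFDerivAt).clm_apply (rightProj ι ι).hasFDerivAt

theorem cylDeriv_derivFun {g : (ι → ℝ) → E} (hg : ContDiff ℝ 2 g) (φ : ι → X × ℝ → ℝ)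
    (γ : Config X) :
    cylDeriv v₁ a₁ (derivFun g) (withDeriv v₂ a₂ φ) γ =
      fderiv ℝ g (fun j => pairing (φ j) γ)
        (fun j => pairing (dirDerivXR v₁ a₁ (dirDerivXR v₂ a₂ (φ j))) γ) +
      fderiv ℝ (fderiv ℝ g) (fun j => pairing (φ j) γ) (fun j => pairing (dirDerivXR v₁ a₁ (φ j)) γ)
        (fun j => pairing (dirDerivXR v₂ a₂ (φ j)) γ) := by
  rw [cylDeriv, (hasFDerivAt_derivFun hg _).fderiv]
  rfl

/-- The derivative of a cylinder function is again a cylinder function, of the φ_j and ∇φ_j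
together. Its outer function is linear in the new variables, hence no longer bounded; this is why
integration by parts is developed for linear growth. -/
theorem IsBdd.isLin_derivFun {g : (ι → ℝ) → E} {C : ℝ} (h : IsBdd g C) : IsLin (derivFun g) C := by
  have hC := h.nonneg
  have h1 : ContDiff ℝ 1 (fderiv ℝ g) := h.contDiff.fderiv_right one_add_one_eq_two.le
  refine ⟨(h1.comp (leftProj ι ι).contDiff).clm_apply (rightProj ι ι).contDiff, fun r => ?_,
    fun r => ?_⟩
  · refine (ContinuousLinearMap.le_opNorm _ _).trans (mul_le_mul (h.norm_fderiv_le _)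
      ((norm_rightProj_le r).trans ?_) (norm_nonneg _) hC)
    linarith
  · rw [(hasFDerivAt_derivFun h.contDiff r).fderiv]
    refine ContinuousLinearMap.opNorm_le_bound _ (by positivity) fun d => ?_
    have e1 : ‖fderiv ℝ g (leftProj ι ι r) (rightProj ι ι d)‖ ≤ C * ‖d‖ :=
      (ContinuousLinearMap.le_opNorm _ _).trans (mul_le_mul (h.norm_fderiv_le _)
        (norm_rightProj_le d) (norm_nonneg _) hC)
    have e2 : ‖fderiv ℝ (fderiv ℝ g) (leftProj ι ι r) (leftProj ι ι d) (rightProj ι ι r)‖ ≤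
        C * ‖d‖ * ‖r‖ :=
      (ContinuousLinearMap.le_opNorm _ _).trans (mul_le_mul
        ((ContinuousLinearMap.le_opNorm _ _).trans (mul_le_mul (h.norm_fderiv_fderiv_le _)
          (norm_leftProj_le d) (norm_nonneg _) hC)) (norm_rightProj_le r) (norm_nonneg _)
        (by positivity))
    refine (norm_add_le _ _).trans ((add_le_add e1 e2).trans (le_of_eq ?_))
    ring

variable [T2Space X]

/-- The terms with D²g are symmetric in the two directions and cancel; the terms with Dg contain the
second derivatives of the φ_j, to which the one-particle commutator applies point by point. -/
theorem cylDeriv_commutator {g : (ι → ℝ) → E} (hg : ContDiff ℝ 2 g) {φ : ι → X × ℝ → ℝ}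
    (hφ : ∀ j, Smooth n 2 (φ j)) (hK : IsCompact K) (hφK : ∀ j, SuppIn K (φ j))
    (hv₁ : IsField v₁) (ha₁ : IsFun n a₁) (hv₂ : IsField v₂) (ha₂ : IsFun n a₂) (γ : Config X) :
    cylDeriv v₁ a₁ (derivFun g) (withDeriv v₂ a₂ φ) γ -
      cylDeriv v₂ a₂ (derivFun g) (withDeriv v₁ a₁ φ) γ =
      cylDeriv (VectorField.mlieBracket (𝓡 n) v₁ v₂)
        (fun x => along v₁ a₂ x - along v₂ a₁ x) g φ γ := by
  have hs : fderiv ℝ (fderiv ℝ g) (fun j => pairing (φ j) γ)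
        (fun j => pairing (dirDerivXR v₁ a₁ (φ j)) γ) (fun j => pairing (dirDerivXR v₂ a₂ (φ j)) γ) =
      fderiv ℝ (fderiv ℝ g) (fun j => pairing (φ j) γ)
        (fun j => pairing (dirDerivXR v₂ a₂ (φ j)) γ) (fun j => pairing (dirDerivXR v₁ a₁ (φ j)) γ) :=
    second_derivative_symmetric (fun y => (hg.differentiable two_ne_zero y).hasFDerivAt)
      ((hg.fderiv_right (m := 1) one_add_one_eq_two.le).differentiable one_ne_zero _).hasFDerivAt _ _
  rw [cylDeriv_derivFun hg, cylDeriv_derivFun hg, hs, add_sub_add_right_eq_sub, ← map_sub, cylDeriv]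
  congr 1
  funext j
  rw [Pi.sub_apply, ← pairing_sub hK (((hφK j).dirDerivXR hK v₂ a₂).dirDerivXR hK v₁ a₁)
    (((hφK j).dirDerivXR hK v₁ a₁).dirDerivXR hK v₂ a₂)]
  exact pairing_congr fun p hp => dirDerivXR_commutator (hφ j) hv₁.1 ha₁.1 hv₂.1 ha₂.1 (γ.pos hp)

theorem cylVal_curve_zero (hv : IsField v) (g : (ι → ℝ) → E) {φ : ι → X × ℝ → ℝ}
    (hK : IsCompact K) (hφK : ∀ j, SuppIn K (φ j)) (γ : Config X) :
    cylVal g φ (curve v a γ 0) = cylVal g φ γ :=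
  congrArg g (funext fun j => hv.pairing_curve_zero a hK (hφK j) γ)

end CylinderCalculus

/-! ### Integration by parts for complex cylinder functions -/

section ComplexIBP

variable {n : ℕ} {X : Type*} [TopologicalSpace X] [ChartedSpace (EuclideanSpace ℝ (Fin n)) X]
  [IsManifold (𝓡 n) ∞ X] [T2Space X] [SecondCountableTopology X] [LocallyCompactSpace X]
  [MeasurableSpace X] [BorelSpace X]
  {v : (x : X) → TangentSpace (𝓡 n) x} {a : X → ℝ} {K : Set X}
  {ι κ : Type*} [Fintype ι] [Fintype κ] {σ : Measure (X × ℝ)} {μ : Measure (Config X)}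

theorem IsLin.comp_clm {g : (ι → ℝ) → ℂ} {C : ℝ} (h : IsLin g C) (L : ℂ →L[ℝ] ℝ) (hL : ‖L‖ ≤ 1) :
    IsLin (fun r => L (g r)) C := by
  have hd : ∀ r, fderiv ℝ (fun r => L (g r)) r = L.comp (fderiv ℝ g r) := fun r =>
    (L.hasFDerivAt.comp r (h.contDiff.differentiable one_ne_zero r).hasFDerivAt).fderiv
  refine ⟨L.contDiff.comp h.contDiff, fun r => ?_, fun r => ?_⟩
  · exact ((L.le_opNorm _).trans (mul_le_of_le_one_left (norm_nonneg _) hL)).trans (h.norm_le r)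
  · rw [hd]
    exact ((ContinuousLinearMap.opNorm_comp_le _ _).trans
      (mul_le_of_le_one_left (norm_nonneg _) hL)).trans (h.norm_fderiv_le r)

theorem cylDeriv_comp_clm {g : (ι → ℝ) → ℂ} {C : ℝ} (h : IsLin g C) (L : ℂ →L[ℝ] ℝ)
    (φ : ι → X × ℝ → ℝ) (γ : Config X) :
    cylDeriv v a (fun r => L (g r)) φ γ = L (cylDeriv v a g φ γ) := by
  have hd : ∀ r, fderiv ℝ (fun r => L (g r)) r = L.comp (fderiv ℝ g r) := fun r =>
    (L.hasFDerivAt.comp r (h.contDiff.differentiable one_ne_zero r).hasFDerivAt).fderiv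
  rw [cylDeriv, hd]
  rfl

/-- Integration by parts for complex cylinder functions. -/
theorem IsWeakLogDeriv.integral_cylDeriv_add_eq_zero_complex {β : X × ℝ → ℝ}
    (hβ : IsWeakLogDeriv σ v a β) (hσ : IsLevy σ) (hμ : IsMarkedPoisson σ μ)
    (hmax : ∀ K : Set X, IsCompact K →
      Integrable ((K ×ˢ univ).indicator fun p : X × ℝ => max 1 p.2) σ)
    (hv : IsField v) (ha : IsFun n a) (hK : IsCompact K) {φ : ι → X × ℝ → ℝ}
    (hφ : ∀ j, IsAdm K v a (φ j)) {g : (ι → ℝ) → ℂ} {C : ℝ} (hg : IsLin g C) :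
    Integrable (fun γ => cylDeriv v a g φ γ + (pairing β γ : ℂ) * cylVal g φ γ) μ ∧
    ∫ γ, (cylDeriv v a g φ γ + (pairing β γ : ℂ) * cylVal g φ γ) ∂μ = 0 := by
  -- β is real, so a real-linear functional of the integrand is the real integrand of the composed
  -- function; the real and imaginary parts are the two cases used.
  have key : ∀ L : ℂ →L[ℝ] ℝ, ‖L‖ ≤ 1 →
      Integrable (fun γ => L (cylDeriv v a g φ γ + (pairing β γ : ℂ) * cylVal g φ γ)) μ ∧
      ∫ γ, L (cylDeriv v a g φ γ + (pairing β γ : ℂ) * cylVal g φ γ) ∂μ = 0 := by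
    intro L hL
    have hl := hg.comp_clm L hL
    obtain ⟨i1, i2, i3⟩ := hβ.integral_cylDeriv_add_eq_zero hσ hμ hmax hv ha hK hφ hl.contDiff
      hl.norm_le hl.norm_fderiv_le
    have e : ∀ γ, L (cylDeriv v a g φ γ + (pairing β γ : ℂ) * cylVal g φ γ) =
        cylDeriv v a (fun r => L (g r)) φ γ + pairing β γ * cylVal (fun r => L (g r)) φ γ := by
      intro γ
      rw [map_add, cylDeriv_comp_clm hg, ← Complex.real_smul, map_smul, smul_eq_mul]
      rfl
    simp only [e]
    exact ⟨i1.add i2, i3⟩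
  obtain ⟨r1, r2⟩ := key Complex.reCLM Complex.reCLM_norm.le
  obtain ⟨s1, s2⟩ := key Complex.imCLM Complex.imCLM_norm.le
  set f : Config X → ℂ := fun γ => cylDeriv v a g φ γ + (pairing β γ : ℂ) * cylVal g φ γ with hf
  have e : ∀ γ, f γ = ((f γ).re : ℂ) + ((f γ).im : ℂ) * Complex.I := fun γ =>
    (Complex.re_add_im _).symm
  have hi : Integrable f μ := by
    rw [funext e]
    exact r1.ofReal.add (s1.ofReal.mul_const _)
  refine ⟨hi, Complex.ext ?_ ?_⟩
  · exact (Complex.reCLM.integral_comp_comm hi).symm.trans r2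
  · exact (Complex.imCLM.integral_comp_comm hi).symm.trans s2

end ComplexIBP

/-! ### Integration by parts for products of cylinder functions -/

section Product

variable {n : ℕ} {X : Type*} [TopologicalSpace X] [ChartedSpace (EuclideanSpace ℝ (Fin n)) X]
  [IsManifold (𝓡 n) ∞ X]
  {v : (x : X) → TangentSpace (𝓡 n) x} {a : X → ℝ} {K : Set X}
  {ι κ : Type*} [Fintype ι] [Fintype κ]

/-- The function `(r, s) ↦ g(r) conj k(s)`. -/
def mulConjFun (g : (ι → ℝ) → ℂ) (k : (κ → ℝ) → ℂ) (r : ι ⊕ κ → ℝ) : ℂ :=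
  g (leftProj ι κ r) * conj (k (rightProj ι κ r))

theorem cylVal_mulConjFun (g : (ι → ℝ) → ℂ) (k : (κ → ℝ) → ℂ) (φ : ι → X × ℝ → ℝ)
    (η : κ → X × ℝ → ℝ) (γ : Config X) :
    cylVal (mulConjFun g k) (Sum.elim φ η) γ = cylVal g φ γ * conj (cylVal k η γ) := rfl

theorem hasFDerivAt_mulConjFun {g : (ι → ℝ) → ℂ} {k : (κ → ℝ) → ℂ} (hg : Differentiable ℝ g)
    (hk : Differentiable ℝ k) (r : ι ⊕ κ → ℝ) :
    HasFDerivAt (mulConjFun g k)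
      (g (leftProj ι κ r) • ((Complex.conjCLE : ℂ →L[ℝ] ℂ).comp
          ((fderiv ℝ k (rightProj ι κ r)).comp (rightProj ι κ))) +
        conj (k (rightProj ι κ r)) • (fderiv ℝ g (leftProj ι κ r)).comp (leftProj ι κ)) r := by
  have h1 := (hg (leftProj ι κ r)).hasFDerivAt.comp r (leftProj ι κ).hasFDerivAt
  have h2 := (Complex.conjCLE : ℂ →L[ℝ] ℂ).hasFDerivAt.comp r
    ((hk (rightProj ι κ r)).hasFDerivAt.comp r (rightProj ι κ).hasFDerivAt)
  exact h1.mul h2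

theorem cylDeriv_mulConjFun {g : (ι → ℝ) → ℂ} {k : (κ → ℝ) → ℂ} (hg : Differentiable ℝ g)
    (hk : Differentiable ℝ k) (φ : ι → X × ℝ → ℝ) (η : κ → X × ℝ → ℝ) (γ : Config X) :
    cylDeriv v a (mulConjFun g k) (Sum.elim φ η) γ =
      cylDeriv v a g φ γ * conj (cylVal k η γ) + cylVal g φ γ * conj (cylDeriv v a k η γ) := by
  rw [cylDeriv, (hasFDerivAt_mulConjFun hg hk _).fderiv, add_comm, mul_comm (cylDeriv v a g φ γ)]
  rfl

/-- Linear growth is kept because one factor is bounded with its derivative; the 2 accounts for the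
two terms of the product rule. -/
theorem IsLin.mulConjFun {g : (ι → ℝ) → ℂ} {k : (κ → ℝ) → ℂ} {C D : ℝ} (hg : IsLin g C)
    (hk : IsBdd k D) : IsLin (mulConjFun g k) (2 * (C * D)) := by
  have hC := hg.nonneg
  have hD := hk.nonneg
  have hl : ∀ r : ι ⊕ κ → ℝ, C * (1 + ‖leftProj ι κ r‖) ≤ C * (1 + ‖r‖) := fun r => by
    gcongr
    exact norm_leftProj_le r
  have hk1 : ContDiff ℝ 1 k := hk.contDiff.of_le one_le_two
  refine ⟨(hg.contDiff.comp (leftProj ι κ).contDiff).mul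
    ((Complex.conjCLE : ℂ →L[ℝ] ℂ).contDiff.comp (hk1.comp (rightProj ι κ).contDiff)), fun r => ?_,
    fun r => ?_⟩
  · rw [MarkedPoisson.mulConjFun, norm_mul, RCLike.norm_conj]
    have := mul_le_mul ((hg.norm_le _).trans (hl r)) (hk.norm_le (rightProj ι κ r)) (norm_nonneg _)
      (by positivity)
    refine this.trans ?_
    have : 0 ≤ C * D * (1 + ‖r‖) := by positivity
    linarith
  · rw [(hasFDerivAt_mulConjFun (hg.contDiff.differentiable one_ne_zero)
      (hk1.differentiable one_ne_zero) r).fderiv]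
    refine ContinuousLinearMap.opNorm_le_bound _ (by positivity) fun d => ?_
    have e1 : ‖g (leftProj ι κ r) * conj (fderiv ℝ k (rightProj ι κ r) (rightProj ι κ d))‖ ≤
        C * (1 + ‖r‖) * (D * ‖d‖) := by
      rw [norm_mul, RCLike.norm_conj]
      exact mul_le_mul ((hg.norm_le _).trans (hl r)) ((ContinuousLinearMap.le_opNorm _ _).trans
        (mul_le_mul (hk.norm_fderiv_le _) (norm_rightProj_le d) (norm_nonneg _) hD)) (norm_nonneg _)
        (by positivity)
    have e2 : ‖conj (k (rightProj ι κ r)) * fderiv ℝ g (leftProj ι κ r) (leftProj ι κ d)‖ ≤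
        D * (C * (1 + ‖r‖) * ‖d‖) := by
      rw [norm_mul, RCLike.norm_conj]
      exact mul_le_mul (hk.norm_le _) ((ContinuousLinearMap.le_opNorm _ _).trans
        (mul_le_mul ((hg.norm_fderiv_le _).trans (hl r)) (norm_leftProj_le d) (norm_nonneg _)
          (by positivity))) (norm_nonneg _) hD
    refine (norm_add_le _ _).trans ((add_le_add e1 e2).trans (le_of_eq ?_))
    ring

variable [T2Space X] [SecondCountableTopology X] [LocallyCompactSpace X]
  [MeasurableSpace X] [BorelSpace X] {σ : Measure (X × ℝ)} {μ : Measure (Config X)}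

/-- Integration by parts for products of cylinder functions. -/
theorem IsWeakLogDeriv.integral_mul_conj {β : X × ℝ → ℝ}
    (hβ : IsWeakLogDeriv σ v a β) (hσ : IsLevy σ) (hμ : IsMarkedPoisson σ μ)
    (hmax : ∀ K : Set X, IsCompact K →
      Integrable ((K ×ˢ univ).indicator fun p : X × ℝ => max 1 p.2) σ)
    (hv : IsField v) (ha : IsFun n a) (hK : IsCompact K) {φ : ι → X × ℝ → ℝ} {η : κ → X × ℝ → ℝ}
    (hφ : ∀ j, IsAdm K v a (φ j)) (hη : ∀ j, IsAdm K v a (η j))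
    {g : (ι → ℝ) → ℂ} {k : (κ → ℝ) → ℂ} {C D : ℝ} (hg : IsLin g C) (hk : IsBdd k D) :
    Integrable (fun γ => cylDeriv v a g φ γ * conj (cylVal k η γ) +
      cylVal g φ γ * conj (cylDeriv v a k η γ) +
      (pairing β γ : ℂ) * (cylVal g φ γ * conj (cylVal k η γ))) μ ∧
    ∫ γ, (cylDeriv v a g φ γ * conj (cylVal k η γ) +
      cylVal g φ γ * conj (cylDeriv v a k η γ) +
      (pairing β γ : ℂ) * (cylVal g φ γ * conj (cylVal k η γ))) ∂μ = 0 := by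
  have h := hβ.integral_cylDeriv_add_eq_zero_complex hσ hμ hmax hv ha hK
    (φ := Sum.elim φ η) (fun j => by cases j with
      | inl i => exact hφ i
      | inr i => exact hη i) (hg.mulConjFun hk)
  simpa only [cylDeriv_mulConjFun (hg.contDiff.differentiable one_ne_zero)
    (hk.contDiff.differentiable two_ne_zero), cylVal_mulConjFun] using h

theorem IsAdm.withDeriv {v₁ v₂ : (x : X) → TangentSpace (𝓡 n) x} {a₁ a₂ : X → ℝ}
    {φ : ι → X × ℝ → ℝ} (h₁ : ∀ j, IsAdm K v₁ a₁ (φ j))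
    (h₂ : ∀ j, IsAdm K v₁ a₁ (dirDerivXR v₂ a₂ (φ j))) (j : ι ⊕ ι) :
    IsAdm K v₁ a₁ (withDeriv v₂ a₂ φ j) := by
  cases j with
  | inl i => exact h₁ i
  | inr i => exact h₂ i

theorem measurable_cylVal {E : Type*} [NormedAddCommGroup E] [NormedSpace ℝ E] [MeasurableSpace E]
    [BorelSpace E] {g : (ι → ℝ) → E} (hg : Continuous g) (hK : IsCompact K) {φ : ι → X × ℝ → ℝ}
    (hφ : ∀ j, ContinuousOn (φ j) (univ ×ˢ Ioi (0 : ℝ))) (hφK : ∀ j, SuppIn K (φ j)) :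
    Measurable (cylVal g φ : Config X → E) :=
  hg.measurable.comp (measurable_cylArg hK hφ hφK)

theorem memLp_cylVal_of_isBdd [IsFiniteMeasure μ] {g : (ι → ℝ) → ℂ} {C : ℝ} (hg : IsBdd g C)
    (hK : IsCompact K) {φ : ι → X × ℝ → ℝ}
    (hφ : ∀ j, ContinuousOn (φ j) (univ ×ˢ Ioi (0 : ℝ))) (hφK : ∀ j, SuppIn K (φ j)) (p : ℝ≥0∞) :
    MemLp (cylVal g φ : Config X → ℂ) p μ :=
  MemLp.of_bound (measurable_cylVal hg.contDiff.continuous hK hφ hφK).aestronglyMeasurable C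
    (Eventually.of_forall fun _ => hg.norm_le _)

theorem IsLevy.memLp_cylVal_of_isLin (hσ : IsLevy σ) (hμ : IsMarkedPoisson σ μ) {g : (ι → ℝ) → ℂ}
    {C : ℝ} (hg : IsLin g C) (hK : IsCompact K) {φ : ι → X × ℝ → ℝ}
    (hφ : ∀ j, ContinuousOn (φ j) (univ ×ˢ Ioi (0 : ℝ))) (hφK : ∀ j, SuppIn K (φ j))
    (hb : ∀ j, ∃ M, ∀ p : X × ℝ, 0 < p.2 → |φ j p| ≤ M) :
    MemLp (cylVal g φ : Config X → ℂ) 2 μ := by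
  have := hμ.isProbability
  have h1 := hσ.memLp_cylVal hμ hK (g := fun r => C * (1 + ‖r‖)) (by fun_prop)
    (fun r => (abs_of_nonneg (mul_nonneg hg.nonneg
      (add_nonneg zero_le_one (norm_nonneg r)))).le) hφ hφK hb
  exact h1.mono' (measurable_cylVal hg.contDiff.continuous hK hφ hφK).aestronglyMeasurable
    (Eventually.of_forall fun _ => hg.norm_le _)

end Product

/-! ### The operators on cylinder functions -/

theorem norm_fderiv_eq_norm_iteratedFDeriv {E F : Type*} [NormedAddCommGroup E] [NormedSpace ℝ E]
    [NormedAddCommGroup F] [NormedSpace ℝ F] (g : E → F) (r : E) :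
    ‖fderiv ℝ g r‖ = ‖iteratedFDeriv ℝ 1 g r‖ := by
  rw [← norm_iteratedFDeriv_zero (𝕜 := ℝ) (f := fderiv ℝ g), norm_iteratedFDeriv_fderiv]

theorem norm_fderiv_fderiv_eq_norm_iteratedFDeriv {E F : Type*} [NormedAddCommGroup E]
    [NormedSpace ℝ E] [NormedAddCommGroup F] [NormedSpace ℝ F] (g : E → F) (r : E) :
    ‖fderiv ℝ (fderiv ℝ g) r‖ = ‖iteratedFDeriv ℝ 2 g r‖ := by
  rw [norm_fderiv_eq_norm_iteratedFDeriv, norm_iteratedFDeriv_fderiv]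

section Operators

variable {n : ℕ} {X : Type*} [TopologicalSpace X] [ChartedSpace (EuclideanSpace ℝ (Fin n)) X]
  [IsManifold (𝓡 n) ∞ X]
  {v v₁ v₂ : (x : X) → TangentSpace (𝓡 n) x} {a a₁ a₂ : X → ℝ} {K : Set X}
  {F G : Config X → ℂ}

theorem opWith_eq (β : X × ℝ → ℝ) (v : (x : X) → TangentSpace (𝓡 n) x) (a : X → ℝ)
    (F : Config X → ℂ) (γ : Config X) :
    opWith β v a F γ = -Complex.I * (dirDeriv v a F γ + 1 / 2 * ((pairing β γ : ℂ) * F γ)) := by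
  rw [opWith, one_div, one_div, mul_inv, Complex.inv_I]
  ring

/-- Extracts what the calculus uses: bounds on derivatives of order up to two, and one compact set
supporting all the test functions. -/
theorem IsCylinder.exists_rep (hF : IsCylinder n F) :
    ∃ (N : ℕ) (φ : Fin N → X × ℝ → ℝ) (g : (Fin N → ℝ) → ℂ) (C : ℝ) (K : Set X),
      (∀ j, IsTest n (φ j)) ∧ IsBdd g C ∧ IsCompact K ∧ (∀ j, SuppIn K (φ j)) ∧ F = cylVal g φ := by
  obtain ⟨N, φ, g, hφ, hg, hb, hFg⟩ := hF
  choose C hC using hb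
  choose L hL hLφ using fun j => (hφ j).support
  refine ⟨N, φ, g, max (C 0) (max (C 1) (C 2)), ⋃ j, L j, hφ,
    ⟨hg.of_le two_le_infty, fun r => ?_, fun r => ?_, fun r => ?_⟩,
    isCompact_iUnion hL, fun j x hx => hLφ j x fun h => hx (mem_iUnion.2 ⟨j, h⟩), funext hFg⟩
  · rw [← norm_iteratedFDeriv_zero (𝕜 := ℝ)]
    exact (hC 0 r).trans (le_max_left _ _)
  · exact (norm_fderiv_eq_norm_iteratedFDeriv g r).le.trans
      ((hC 1 r).trans ((le_max_left _ _).trans (le_max_right _ _)))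
  · exact (norm_fderiv_fderiv_eq_norm_iteratedFDeriv g r).le.trans
      ((hC 2 r).trans ((le_max_right _ _).trans (le_max_right _ _)))

variable [T2Space X] {ι κ : Type*} [Fintype ι] [Fintype κ]

theorem dirDeriv_cylVal (hv : IsField v) (ha : IsFun n a) {g : (ι → ℝ) → ℂ}
    (hg : Differentiable ℝ g) (hK : IsCompact K) {φ : ι → X × ℝ → ℝ}
    (hφ : ∀ j, Smooth n 1 (φ j)) (hφK : ∀ j, SuppIn K (φ j)) :
    dirDeriv v a (cylVal g φ) = cylDeriv v a g φ :=
  funext fun γ => (hasDerivAt_cylVal hv ha.1 hg hK hφ hφK γ).deriv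

theorem opWith_congr {β β' : X × ℝ → ℝ} {γ : Config X} (h : pairing β γ = pairing β' γ) :
    opWith β v a F γ = opWith β' v a F γ := by
  rw [opWith, opWith, h]

variable [SecondCountableTopology X] [LocallyCompactSpace X]
  [MeasurableSpace X] [BorelSpace X] {σ : Measure (X × ℝ)} {μ : Measure (Config X)}

theorem IsLevy.opWith_ae_eq (hσ : IsLevy σ) (hμ : IsMarkedPoisson σ μ) {β β' : X × ℝ → ℝ}
    (h : β =ᵐ[σ] β') (v : (x : X) → TangentSpace (𝓡 n) x) (a : X → ℝ) (F : Config X → ℂ) :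
    opWith β v a F =ᵐ[μ] opWith β' v a F :=
  (hσ.pairing_ae_eq hμ h).mono fun _ hγ => opWith_congr hγ

theorem IsCylinder.memLp (hF : IsCylinder n F) [IsFiniteMeasure μ] (p : ℝ≥0∞) : MemLp F p μ := by
  obtain ⟨N, φ, g, C, K, hφ, hg, hK, hφK, rfl⟩ := hF.exists_rep
  exact memLp_cylVal_of_isBdd hg hK (fun j => (hφ j).smooth.continuousOn) hφK p

theorem IsCylinder.exists_norm_le (hF : IsCylinder n F) : ∃ C, ∀ γ, ‖F γ‖ ≤ C := by
  obtain ⟨N, φ, g, C, K, hφ, hg, hK, hφK, rfl⟩ := hF.exists_rep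
  exact ⟨C, fun γ => hg.norm_le _⟩

theorem IsCylinder.differentiableAt (hF : IsCylinder n F) (hv : IsField v) (ha : IsFun n a)
    (γ : Config X) : DifferentiableAt ℝ (fun t : ℝ => F (curve v a γ t)) 0 := by
  obtain ⟨N, φ, g, C, K, hφ, hg, hK, hφK, rfl⟩ := hF.exists_rep
  exact (hasDerivAt_cylVal hv ha.1 (hg.contDiff.differentiable two_ne_zero) hK
    (fun j => (hφ j).smooth_one) hφK γ).differentiableAt

variable [Bundle.RiemannianBundle (fun x : X => TangentSpace (𝓡 n) x)]
  [IsContMDiffRiemannianBundle (𝓡 n) ∞ (EuclideanSpace ℝ (Fin n))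
      (fun x : X => TangentSpace (𝓡 n) x)]

theorem IsCylinder.memLp_dirDeriv (hF : IsCylinder n F) (hσ : IsLevy σ) (hμ : IsMarkedPoisson σ μ)
    (hv : IsField v) (ha : IsFun n a) : MemLp (dirDeriv v a F) 2 μ := by
  obtain ⟨N, φ, g, C, K, hφ, hg, hK, hφK, rfl⟩ := hF.exists_rep
  rw [dirDeriv_cylVal hv ha (hg.contDiff.differentiable two_ne_zero) hK
    (fun j => (hφ j).smooth_one) hφK, ← cylVal_derivFun]
  refine hσ.memLp_cylVal_of_isLin hμ hg.isLin_derivFun hK ?_ ?_ ?_ <;> rintro (j | j)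
  · exact (hφ j).smooth.continuousOn
  · exact continuousOn_dirDerivXR (hφ j).smooth_one hv ha
  · exact hφK j
  · exact (hφK j).dirDerivXR hK v a
  · exact (hφ j).exists_bound
  · exact (hφ j).exists_bound_dirDerivXR hv ha

theorem IsCylinder.memLp_opWith (hF : IsCylinder n F) (hσ : IsLevy σ) (hμ : IsMarkedPoisson σ μ)
    (hv : IsField v) (ha : IsFun n a) {β : X × ℝ → ℝ} (hβ : IsWeakLogDeriv σ v a β) :
    MemLp (opWith β v a F) 2 μ := by
  have := hμ.isProbability
  obtain ⟨C, hC⟩ := hF.exists_norm_le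
  have h1 := hF.memLp_dirDeriv hσ hμ hv ha
  have h2 : MemLp (fun γ => (pairing β γ : ℂ) * F γ) 2 μ := by
    have hb := hβ.memLp_pairing hσ hμ hv ha
    refine (hb.norm.const_mul C).mono' (hb.ofReal.1.mul (hF.memLp (μ := μ) 2).1)
      (Eventually.of_forall fun γ => ?_)
    rw [norm_mul, Complex.norm_real, mul_comm]
    exact mul_le_mul_of_nonneg_right (hC γ) (norm_nonneg _)
  have h3 := (h1.add (h2.const_mul (1 / 2))).const_mul (-Complex.I)
  exact (memLp_congr_ae (Eventually.of_forall fun γ => opWith_eq β v a F γ)).2 h3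

theorem integrable_mul_conj {f g : Config X → ℂ} (hf : MemLp f 2 μ) (hg : MemLp g 2 μ) :
    Integrable (fun γ => f γ * conj (g γ)) μ :=
  hf.integrable_mul (hg.star)

/-- The operators are symmetric on cylinder functions. -/
theorem IsWeakLogDeriv.integral_opWith_mul_conj {β : X × ℝ → ℝ} (hβ : IsWeakLogDeriv σ v a β)
    (hσ : IsLevy σ) (hμ : IsMarkedPoisson σ μ)
    (hmax : ∀ K : Set X, IsCompact K →
      Integrable ((K ×ˢ univ).indicator fun p : X × ℝ => max 1 p.2) σ)
    (hv : IsField v) (ha : IsFun n a) (hF : IsCylinder n F) (hG : IsCylinder n G) :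
    ∫ γ, opWith β v a F γ * conj (G γ) ∂μ = ∫ γ, F γ * conj (opWith β v a G γ) ∂μ := by
  have := hμ.isProbability
  have i1 := integrable_mul_conj (hF.memLp_opWith hσ hμ hv ha hβ) (hG.memLp 2)
  have i2 := integrable_mul_conj (hF.memLp 2) (hG.memLp_opWith hσ hμ hv ha hβ)
  rw [← sub_eq_zero, ← integral_sub i1 i2]
  obtain ⟨N, φ, g, C, K, hφ, hg, hK, hφK, rfl⟩ := hF.exists_rep
  obtain ⟨M, η, k, D, L, hη, hk, hL, hηL, rfl⟩ := hG.exists_rep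
  have h := (hβ.integral_mul_conj hσ hμ hmax hv ha (hK.union hL)
    (fun j => (hφ j).isAdm ((hφK j).mono subset_union_left) hv ha)
    (fun j => (hη j).isAdm ((hηL j).mono subset_union_right) hv ha) hg.isLin hk).2
  -- RF conj G - F conj(RG) = -i (∇F conj G + F conj(∇G) + B F conj G): the half of B in each
  -- operator adds up to the whole B of the formula.
  rw [← mul_zero (-Complex.I), ← h, ← integral_const_mul]
  refine integral_congr_ae (Eventually.of_forall fun γ => ?_)
  have e1 := congrFun (dirDeriv_cylVal hv ha (hg.contDiff.differentiable two_ne_zero) hK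
    (fun j => (hφ j).smooth_one) hφK) γ
  have e2 := congrFun (dirDeriv_cylVal hv ha (hk.contDiff.differentiable two_ne_zero) hL
    (fun j => (hη j).smooth_one) hηL) γ
  simp only [opWith_eq, e1, e2, map_add, map_mul, map_neg, Complex.conj_I, Complex.conj_ofReal,
    map_div₀, map_one, map_ofNat]
  ring

end Operators

/-! ### The commutation relations -/

section Commutator

/-- The bookkeeping for the weak commutator: P - Q - R is a combination of five functions of
integral zero, two of them conjugated. -/
theorem integral_sub_eq_of_forall {α : Type*} [MeasurableSpace α] {ν : Measure α}
    {P Q R f₁ f₂ f₃ f₄ f₅ : α → ℂ} (hP : Integrable P ν) (hQ : Integrable Q ν)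
    (hR : Integrable R ν) (h₁ : Integrable f₁ ν ∧ ∫ x, f₁ x ∂ν = 0)
    (h₂ : Integrable f₂ ν ∧ ∫ x, f₂ x ∂ν = 0) (h₃ : Integrable f₃ ν ∧ ∫ x, f₃ x ∂ν = 0)
    (h₄ : Integrable f₄ ν ∧ ∫ x, f₄ x ∂ν = 0) (h₅ : Integrable f₅ ν ∧ ∫ x, f₅ x ∂ν = 0)
    (h : ∀ x, P x - Q x - R x =
      1 / 2 * ((f₁ x + conj (f₂ x)) - (f₃ x + conj (f₄ x)) + f₅ x)) :
    ∫ x, P x ∂ν - ∫ x, Q x ∂ν = ∫ x, R x ∂ν := by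
  have c₂ : Integrable (fun x => conj (f₂ x)) ν :=
    Complex.conjCLE.toContinuousLinearMap.integrable_comp h₂.1
  have c₄ : Integrable (fun x => conj (f₄ x)) ν :=
    Complex.conjCLE.toContinuousLinearMap.integrable_comp h₄.1
  have z₂ : ∫ x, conj (f₂ x) ∂ν = 0 := by rw [integral_conj, h₂.2, map_zero]
  have z₄ : ∫ x, conj (f₄ x) ∂ν = 0 := by rw [integral_conj, h₄.2, map_zero]
  have e₁ : (fun x => P x - Q x - R x) = fun x =>
      1 / 2 * ((f₁ x + conj (f₂ x)) - (f₃ x + conj (f₄ x)) + f₅ x) := funext h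
  have e₂ : ∫ x, (f₁ x + conj (f₂ x)) - (f₃ x + conj (f₄ x)) + f₅ x ∂ν = 0 := by
    refine (integral_add ((h₁.1.add c₂).sub (h₃.1.add c₄)) h₅.1).trans ?_
    rw [h₅.2, add_zero]
    refine (integral_sub (h₁.1.add c₂) (h₃.1.add c₄)).trans ?_
    rw [integral_add' h₁.1 c₂, integral_add' h₃.1 c₄, h₁.2, h₃.2, z₂, z₄, add_zero, sub_zero]
  rw [← sub_eq_zero, ← integral_sub hP hQ,
    ← integral_sub (f := fun x => P x - Q x) (hP.sub hQ) hR, e₁, integral_const_mul, e₂, mul_zero]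

theorem CommutatorEq.congr {Ω : Type*} [MeasurableSpace Ω] {ν : Measure Ω} {D : (Ω → ℂ) → Prop}
    {A B C A' B' C' : (Ω → ℂ) → Ω → ℂ} (h : CommutatorEq ν D A B C)
    (hA : ∀ F, D F → A F =ᵐ[ν] A' F) (hB : ∀ F, D F → B F =ᵐ[ν] B' F)
    (hC : ∀ F, D F → C F =ᵐ[ν] C' F) : CommutatorEq ν D A' B' C' := by
  have key : ∀ {P Q P' Q' : Ω → ℂ}, P =ᵐ[ν] P' → Q =ᵐ[ν] Q' →
      ∫ x, P x * conj (Q x) ∂ν = ∫ x, P' x * conj (Q' x) ∂ν := fun hP hQ =>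
    integral_congr_ae (by filter_upwards [hP, hQ] with x h₁ h₂; rw [h₁, h₂])
  intro F hF
  refine ⟨fun G hG => ?_, fun U V hU hV hUG hVG => ?_⟩
  · rw [← key (hB F hF) (hA G hG), ← key (hA F hF) (hB G hG),
      ← key (hC F hF) (Filter.EventuallyEq.refl _ G)]
    exact (h F hF).1 G hG
  · refine ((h F hF).2 U V hU hV (fun G hG => ?_) fun G hG => ?_).trans (hC F hF)
    · rw [key (hB F hF) (hA G hG)]
      exact hUG G hG
    · rw [key (hA F hF) (hB G hG)]
      exact hVG G hG

variable {n : ℕ} {X : Type*} [TopologicalSpace X] [ChartedSpace (EuclideanSpace ℝ (Fin n)) X]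
  [IsManifold (𝓡 n) ∞ X] [T2Space X] [SecondCountableTopology X] [LocallyCompactSpace X]
  [MeasurableSpace X] [BorelSpace X]
  [Bundle.RiemannianBundle (fun x : X => TangentSpace (𝓡 n) x)]
  [IsContMDiffRiemannianBundle (𝓡 n) ∞ (EuclideanSpace ℝ (Fin n))
      (fun x : X => TangentSpace (𝓡 n) x)]
  {v v₁ v₂ : (x : X) → TangentSpace (𝓡 n) x} {a a₁ a₂ : X → ℝ}
  {F G : Config X → ℂ} {σ : Measure (X × ℝ)} {μ : Measure (Config X)}
  {β β₁ β₂ : X × ℝ → ℝ}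

/-- The terms with B₁ B₂ agree in both products. Integration by parts is used along field 1 for ∇₂F
conj G and for ∇₂G conj F, along field 2 for ∇₁G conj F and for ∇₁F conj G, and along the bracket
for F conj G. The second derivatives then appear only as commutators of F and of G, which the
cylinder calculus evaluates. -/
theorem IsWeakLogDeriv.integral_opWith_commutator (hβ₁ : IsWeakLogDeriv σ v₁ a₁ β₁)
    (hβ₂ : IsWeakLogDeriv σ v₂ a₂ β₂)
    (hβ : IsWeakLogDeriv σ (VectorField.mlieBracket (𝓡 n) v₁ v₂)
      (fun x => along v₁ a₂ x - along v₂ a₁ x) β)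
    (hσ : IsLevy σ) (hμ : IsMarkedPoisson σ μ)
    (hmax : ∀ K : Set X, IsCompact K →
      Integrable ((K ×ˢ univ).indicator fun p : X × ℝ => max 1 p.2) σ)
    (hv₁ : IsField v₁) (ha₁ : IsFun n a₁) (hv₂ : IsField v₂) (ha₂ : IsFun n a₂)
    (hF : IsCylinder n F) (hG : IsCylinder n G) :
    ∫ γ, opWith β₂ v₂ a₂ F γ * conj (opWith β₁ v₁ a₁ G γ) ∂μ -
      ∫ γ, opWith β₁ v₁ a₁ F γ * conj (opWith β₂ v₂ a₂ G γ) ∂μ =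
    ∫ γ, (-Complex.I * opWith β (VectorField.mlieBracket (𝓡 n) v₁ v₂)
      (fun x => along v₁ a₂ x - along v₂ a₁ x) F γ) * conj (G γ) ∂μ := by
  have := hμ.isProbability
  have hv := hv₁.mlieBracket hv₂
  have ha := IsFun.along_sub_along hv₁ ha₁ hv₂ ha₂
  have j₁ := integrable_mul_conj (hF.memLp_opWith hσ hμ hv₂ ha₂ hβ₂)
    (hG.memLp_opWith hσ hμ hv₁ ha₁ hβ₁)
  have j₂ := integrable_mul_conj (hF.memLp_opWith hσ hμ hv₁ ha₁ hβ₁)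
    (hG.memLp_opWith hσ hμ hv₂ ha₂ hβ₂)
  have j₃ := integrable_mul_conj ((hF.memLp_opWith hσ hμ hv ha hβ).const_mul (-Complex.I))
    (hG.memLp 2)
  obtain ⟨N, φ, g, C, KF, hφ, hg, hKF, hφK, rfl⟩ := hF.exists_rep
  obtain ⟨M, η, k, D, KG, hη, hk, hKG, hηK, rfl⟩ := hG.exists_rep
  have hK := hKF.union hKG
  have hφK' := fun j => (hφK j).mono (subset_union_left (t := KG))
  have hηK' := fun j => (hηK j).mono (subset_union_right (s := KF))
  have hdg := hg.contDiff.differentiable two_ne_zero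
  have hdk := hk.contDiff.differentiable two_ne_zero
  have A₁ := fun j => (hφ j).isAdm (hφK' j) hv₁ ha₁
  have A₂ := fun j => (hφ j).isAdm (hφK' j) hv₂ ha₂
  have A := fun j => (hφ j).isAdm (hφK' j) hv ha
  have B₁ := fun j => (hη j).isAdm (hηK' j) hv₁ ha₁
  have B₂ := fun j => (hη j).isAdm (hηK' j) hv₂ ha₂
  have B := fun j => (hη j).isAdm (hηK' j) hv ha
  have A₁₂ := IsAdm.withDeriv A₁ fun j => (hφ j).isAdm_dirDerivXR hK (hφK' j) hv₁ ha₁ hv₂ ha₂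
  have A₂₁ := IsAdm.withDeriv A₂ fun j => (hφ j).isAdm_dirDerivXR hK (hφK' j) hv₂ ha₂ hv₁ ha₁
  have B₁₂ := IsAdm.withDeriv B₁ fun j => (hη j).isAdm_dirDerivXR hK (hηK' j) hv₁ ha₁ hv₂ ha₂
  have B₂₁ := IsAdm.withDeriv B₂ fun j => (hη j).isAdm_dirDerivXR hK (hηK' j) hv₂ ha₂ hv₁ ha₁
  refine integral_sub_eq_of_forall j₁ j₂ j₃
    (hβ₁.integral_mul_conj hσ hμ hmax hv₁ ha₁ hK A₁₂ B₁ hg.isLin_derivFun hk)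
    (hβ₂.integral_mul_conj hσ hμ hmax hv₂ ha₂ hK B₂₁ A₂ hk.isLin_derivFun hg)
    (hβ₂.integral_mul_conj hσ hμ hmax hv₂ ha₂ hK A₂₁ B₂ hg.isLin_derivFun hk)
    (hβ₁.integral_mul_conj hσ hμ hmax hv₁ ha₁ hK B₁₂ A₁ hk.isLin_derivFun hg)
    (hβ.integral_mul_conj hσ hμ hmax hv ha hK A B hg.isLin hk) fun γ => ?_
  have cF := cylDeriv_commutator hg.contDiff (fun j => (hφ j).smooth.of_le two_le_infty) hKF hφK
    hv₁ ha₁ hv₂ ha₂ γ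
  have cG := congrArg conj (cylDeriv_commutator hk.contDiff (fun j => (hη j).smooth.of_le two_le_infty) hKG hηK
    hv₁ ha₁ hv₂ ha₂ γ)
  simp only [opWith_eq, dirDeriv_cylVal hv₁ ha₁ hdg hKF (fun j => (hφ j).smooth_one) hφK,
    dirDeriv_cylVal hv₂ ha₂ hdg hKF (fun j => (hφ j).smooth_one) hφK,
    dirDeriv_cylVal hv ha hdg hKF (fun j => (hφ j).smooth_one) hφK,
    dirDeriv_cylVal hv₁ ha₁ hdk hKG (fun j => (hη j).smooth_one) hηK,
    dirDeriv_cylVal hv₂ ha₂ hdk hKG (fun j => (hη j).smooth_one) hηK,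
    cylVal_derivFun, ← cF, map_add, map_sub, map_mul, map_neg, Complex.conj_I, Complex.conj_ofReal,
    Complex.conj_conj, map_div₀, map_one, map_ofNat] at cG ⊢
  generalize cylDeriv v₁ a₁ (derivFun g) (withDeriv v₂ a₂ φ) γ = g₁₂ at *
  generalize cylDeriv v₂ a₂ (derivFun g) (withDeriv v₁ a₁ φ) γ = g₂₁ at *
  generalize cylVal g φ γ = g₀ at *
  generalize cylDeriv v₁ a₁ g φ γ = g₁ at *
  generalize cylDeriv v₂ a₂ g φ γ = g₂ at *
  generalize conj (cylVal k η γ) = k₀ at *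
  generalize conj (cylDeriv v₁ a₁ k η γ) = k₁ at *
  generalize conj (cylDeriv v₂ a₂ k η γ) = k₂ at *
  generalize (pairing β₁ γ : ℂ) = b₁ at *
  generalize (pairing β₂ γ : ℂ) = b₂ at *
  generalize (pairing β γ : ℂ) = b at *
  -- `Complex.I_sq` accounts for the two factors -i, and `cG` is the commutator identity for G,
  -- multiplied by half of F; that for F was already substituted.
  linear_combination (-((g₂ + 1 / 2 * (b₂ * g₀)) * (k₁ + 1 / 2 * (b₁ * k₀)) -
    (g₁ + 1 / 2 * (b₁ * g₀)) * (k₂ + 1 / 2 * (b₂ * k₀)) +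
    (g₁₂ - g₂₁ + 1 / 2 * (b * g₀)) * k₀)) * Complex.I_sq + 1 / 2 * g₀ * cG

end Commutator

/-! ### Well-definedness, linearity, and products as functions -/

section Representation

variable {n : ℕ} {X : Type*} [TopologicalSpace X] [ChartedSpace (EuclideanSpace ℝ (Fin n)) X]
  [IsManifold (𝓡 n) ∞ X] [T2Space X] [SecondCountableTopology X] [LocallyCompactSpace X]
  [MeasurableSpace X] [BorelSpace X]
  [Bundle.RiemannianBundle (fun x : X => TangentSpace (𝓡 n) x)]
  [IsContMDiffRiemannianBundle (𝓡 n) ∞ (EuclideanSpace ℝ (Fin n))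
      (fun x : X => TangentSpace (𝓡 n) x)]
  {v v₁ v₂ : (x : X) → TangentSpace (𝓡 n) x} {a a₁ a₂ : X → ℝ}
  {F G : Config X → ℂ} {σ : Measure (X × ℝ)} {μ : Measure (Config X)}
  {β β₁ β₂ : X × ℝ → ℝ}

/-- An operator that is symmetric on cylinder functions is well defined on their classes. -/
theorem IsWeakLogDeriv.opWith_ae_eq (hβ : IsWeakLogDeriv σ v a β)
    (hσ : IsLevy σ) (hμ : IsMarkedPoisson σ μ)
    (hmax : ∀ K : Set X, IsCompact K →
      Integrable ((K ×ˢ univ).indicator fun p : X × ℝ => max 1 p.2) σ)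
    (hv : IsField v) (ha : IsFun n a) (hF : IsCylinder n F) (hG : IsCylinder n G)
    (h : F =ᵐ[μ] G) : opWith β v a F =ᵐ[μ] opWith β v a G := by
  have := hμ.isProbability
  have mF := hF.memLp_opWith hσ hμ hv ha hβ
  have mG := hG.memLp_opWith hσ hμ hv ha hβ
  have key := ae_eq_zero_of_forall_integral_cylinder (n := n) (W := opWith β v a F - opWith β v a G)
    ((mF.sub mG).integrable one_le_two) fun H hH => ?_
  · filter_upwards [key] with γ hγ
    exact sub_eq_zero.1 hγ
  · have iF := integrable_mul_conj mF (hH.memLp 2)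
    have iG := integrable_mul_conj mG (hH.memLp 2)
    simp only [Pi.sub_apply, sub_mul]
    rw [integral_sub iF iG, hβ.integral_opWith_mul_conj hσ hμ hmax hv ha hF hH,
      hβ.integral_opWith_mul_conj hσ hμ hmax hv ha hG hH, sub_eq_zero]
    exact integral_congr_ae (by filter_upwards [h] with γ hγ; rw [hγ])

/-- By the form identity, U - V minus the right-hand side integrates to zero against every cylinder
function, and these separate integrable functions. -/
theorem IsWeakLogDeriv.commutatorEq (hβ₁ : IsWeakLogDeriv σ v₁ a₁ β₁)
    (hβ₂ : IsWeakLogDeriv σ v₂ a₂ β₂)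
    (hβ : IsWeakLogDeriv σ (VectorField.mlieBracket (𝓡 n) v₁ v₂)
      (fun x => along v₁ a₂ x - along v₂ a₁ x) β)
    (hσ : IsLevy σ) (hμ : IsMarkedPoisson σ μ)
    (hmax : ∀ K : Set X, IsCompact K →
      Integrable ((K ×ˢ univ).indicator fun p : X × ℝ => max 1 p.2) σ)
    (hv₁ : IsField v₁) (ha₁ : IsFun n a₁) (hv₂ : IsField v₂) (ha₂ : IsFun n a₂) :
    CommutatorEq μ (IsCylinder n) (opWith β₁ v₁ a₁) (opWith β₂ v₂ a₂)
      (fun F γ => -Complex.I * opWith β (VectorField.mlieBracket (𝓡 n) v₁ v₂)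
        (fun x => along v₁ a₂ x - along v₂ a₁ x) F γ) := by
  have := hμ.isProbability
  have comm := fun F G hF hG => hβ₁.integral_opWith_commutator (F := F) (G := G) hβ₂ hβ hσ hμ hmax
    hv₁ ha₁ hv₂ ha₂ hF hG
  refine fun F hF => ⟨fun G hG => comm F G hF hG, fun U V hU hV hUG hVG => ?_⟩
  have mC := (hF.memLp_opWith hσ hμ (hv₁.mlieBracket hv₂) (IsFun.along_sub_along hv₁ ha₁ hv₂ ha₂)
    hβ).const_mul (-Complex.I)
  have key := ae_eq_zero_of_forall_integral_cylinder (n := n) ((hU.sub hV).sub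
    (mC.integrable one_le_two)) fun G hG => ?_
  · filter_upwards [key] with γ hγ
    exact sub_eq_zero.1 hγ
  · obtain ⟨D, hD⟩ := hG.exists_norm_le
    have mG : AEStronglyMeasurable (fun γ => conj (G γ)) μ :=
      Complex.continuous_conj.comp_aestronglyMeasurable (hG.memLp (μ := μ) 2).1
    have bG : ∀ᵐ γ ∂μ, ‖conj (G γ)‖ ≤ D :=
      Eventually.of_forall fun γ => (RCLike.norm_conj (G γ)).le.trans (hD γ)
    have iU := hU.mul_bdd mG bG
    have iV := hV.mul_bdd mG bG
    have iC := integrable_mul_conj mC (hG.memLp 2)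
    simp only [Pi.sub_apply, sub_mul]
    rw [integral_sub (f := fun γ => U γ * conj (G γ) - V γ * conj (G γ)) (iU.sub iV) iC,
      integral_sub iU iV, hUG G hG, hVG G hG, comm F G hF hG, sub_self]

theorem IsCylinder.dirDeriv_smul_add_smul (hF : IsCylinder n F) (hv₁ : IsField v₁)
    (ha₁ : IsFun n a₁) (hv₂ : IsField v₂) (ha₂ : IsFun n a₂) (c₁ c₂ : ℝ) (γ : Config X) :
    dirDeriv (fun x => c₁ • v₁ x + c₂ • v₂ x) (fun x => c₁ * a₁ x + c₂ * a₂ x) F γ =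
      c₁ * dirDeriv v₁ a₁ F γ + c₂ * dirDeriv v₂ a₂ F γ := by
  obtain ⟨N, φ, g, C, K, hφ, hg, hK, hφK, rfl⟩ := hF.exists_rep
  have hd := hg.contDiff.differentiable two_ne_zero
  have hs := fun j => (hφ j).smooth_one
  rw [dirDeriv_cylVal (hv₁.smul_add_smul hv₂ c₁ c₂) (ha₁.mul_add_mul ha₂ c₁ c₂) hd hK hs hφK,
    dirDeriv_cylVal hv₁ ha₁ hd hK hs hφK, dirDeriv_cylVal hv₂ ha₂ hd hK hs hφK]
  have e : (fun j => pairing (dirDerivXR (fun x => c₁ • v₁ x + c₂ • v₂ x)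
      (fun x => c₁ * a₁ x + c₂ * a₂ x) (φ j)) γ) =
      c₁ • (fun j => pairing (dirDerivXR v₁ a₁ (φ j)) γ) +
        c₂ • fun j => pairing (dirDerivXR v₂ a₂ (φ j)) γ := by
    ext j
    have s₁ := (hφK j).dirDerivXR hK v₁ a₁
    have s₂ := (hφK j).dirDerivXR hK v₂ a₂
    simp only [Pi.add_apply, Pi.smul_apply, smul_eq_mul]
    rw [← pairing_const_mul hK s₁, ← pairing_const_mul hK s₂,
      ← pairing_add hK (fun x hx s h => by rw [s₁ x hx s h, mul_zero])
        (fun x hx s h => by rw [s₂ x hx s h, mul_zero])]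
    exact congrArg (fun f => pairing f γ)
      (funext fun p => dirDerivXR_smul_add_smul c₁ c₂ v₁ v₂ a₁ a₂ (φ j) p)
  simp only [cylDeriv, e, map_add, map_smul, Complex.real_smul]

theorem IsWeakLogDeriv.opWith_smul_add_smul {c₁ c₂ : ℝ}
    (hβ : IsWeakLogDeriv σ (fun x => c₁ • v₁ x + c₂ • v₂ x) (fun x => c₁ * a₁ x + c₂ * a₂ x) β)
    (hβ₁ : IsWeakLogDeriv σ v₁ a₁ β₁) (hβ₂ : IsWeakLogDeriv σ v₂ a₂ β₂)
    (hσ : IsLevy σ) (hμ : IsMarkedPoisson σ μ)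
    (hv₁ : IsField v₁) (ha₁ : IsFun n a₁) (hv₂ : IsField v₂) (ha₂ : IsFun n a₂)
    (hF : IsCylinder n F) :
    opWith β (fun x => c₁ • v₁ x + c₂ • v₂ x) (fun x => c₁ * a₁ x + c₂ * a₂ x) F =ᵐ[μ]
      fun γ => c₁ * opWith β₁ v₁ a₁ F γ + c₂ * opWith β₂ v₂ a₂ F γ := by
  have h := hσ.pairing_ae_eq hμ (hβ.ae_eq_smul_add_smul hβ₁ hβ₂ hσ hv₁ ha₁ hv₂ ha₂)
  filter_upwards [h] with γ hγ
  have hK := (isCompact_fieldSupport hv₁ ha₁).union (isCompact_fieldSupport hv₂ ha₂)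
  have s₁ := hβ₁.supp.mono (subset_union_left (t := fieldSupport v₂ a₂))
  have s₂ := hβ₂.supp.mono (subset_union_right (s := fieldSupport v₁ a₁))
  rw [pairing_add hK (fun x hx s h => by rw [s₁ x hx s h, mul_zero])
    (fun x hx s h => by rw [s₂ x hx s h, mul_zero]), pairing_const_mul hK s₁,
    pairing_const_mul hK s₂] at hγ
  rw [opWith_eq, opWith_eq, opWith_eq, hF.dirDeriv_smul_add_smul hv₁ ha₁ hv₂ ha₂, ← hγ]
  push_cast
  ring

/-- For C¹ functions b the image of a cylinder function is the cylinder function of its derivatives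
plus half a pairing times the original; each part is a finite sum or a smooth function of finite
sums along the curve. -/
theorem hasDerivAt_opWith_curve {ι : Type*} [Fintype ι] {K L : Set X} {φ : ι → X × ℝ → ℝ}
    {g : (ι → ℝ) → ℂ} {C : ℝ} {b : X × ℝ → ℝ} (hg : IsBdd g C) (hφ : ∀ j, IsTest n (φ j))
    (hK : IsCompact K) (hφK : ∀ j, SuppIn K (φ j)) (hL : IsCompact L) (hbL : SuppIn L b)
    (hb : Smooth n 1 b)
    (hv₁ : IsField v₁) (ha₁ : IsFun n a₁) (hv₂ : IsField v₂) (ha₂ : IsFun n a₂) (γ : Config X) :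
    HasDerivAt (fun t => opWith b v₂ a₂ (cylVal g φ) (curve v₁ a₁ γ t))
      (-Complex.I * (cylDeriv v₁ a₁ (derivFun g) (withDeriv v₂ a₂ φ) γ + 1 / 2 *
        ((pairing (dirDerivXR v₁ a₁ b) γ : ℂ) * cylVal g φ γ +
          (pairing b γ : ℂ) * cylDeriv v₁ a₁ g φ γ))) 0 := by
  have hd := hg.contDiff.differentiable two_ne_zero
  have hs := fun j => (hφ j).smooth_one
  have A := IsAdm.withDeriv (fun j => (hφ j).isAdm (hφK j) hv₁ ha₁)
    fun j => (hφ j).isAdm_dirDerivXR hK (hφK j) hv₁ ha₁ hv₂ ha₂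
  have d₁ := hasDerivAt_cylVal hv₁ ha₁.1 (hg.isLin_derivFun.contDiff.differentiable one_ne_zero) hK
    (fun j => (A j).smooth) (fun j => (A j).supp) γ
  have d₂ := hasDerivAt_cylVal hv₁ ha₁.1 hd hK hs hφK γ
  have d₃ := (hv₁.hasDerivAt_pairing_curve ha₁.1 hb hL hbL γ).ofReal_comp
  have d₄ := (d₁.add ((d₃.mul d₂).const_mul (1 / 2))).const_mul (-Complex.I)
  rw [hv₁.pairing_curve_zero a₁ hL hbL, cylVal_curve_zero hv₁ g hK hφK] at d₄
  refine d₄.congr_of_eventuallyEq (Eventually.of_forall fun t => ?_)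
  change opWith b v₂ a₂ (cylVal g φ) (curve v₁ a₁ γ t) = _
  rw [opWith_eq, dirDeriv_cylVal hv₂ ha₂ hd hK hs hφK, ← cylVal_derivFun]
  rfl

theorem IsCylinder.differentiableAt_opWith_curve (hF : IsCylinder n F) {L : Set X}
    {b : X × ℝ → ℝ} (hL : IsCompact L) (hbL : SuppIn L b) (hb : Smooth n 1 b)
    (hv₁ : IsField v₁) (ha₁ : IsFun n a₁) (hv₂ : IsField v₂) (ha₂ : IsFun n a₂) (γ : Config X) :
    DifferentiableAt ℝ (fun t => opWith b v₂ a₂ F (curve v₁ a₁ γ t)) 0 := by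
  obtain ⟨N, φ, g, C, K, hφ, hg, hK, hφK, rfl⟩ := hF.exists_rep
  exact (hasDerivAt_opWith_curve hg hφ hK hφK hL hbL hb hv₁ ha₁ hv₂ ha₂ γ).differentiableAt

/-- The commutation relation for logarithmic derivatives of class `C¹`. -/
theorem IsWeakLogDeriv.opWith_opWith_sub (hβ₁ : IsWeakLogDeriv σ v₁ a₁ β₁)
    (hβ₂ : IsWeakLogDeriv σ v₂ a₂ β₂)
    (hβ : IsWeakLogDeriv σ (VectorField.mlieBracket (𝓡 n) v₁ v₂)
      (fun x => along v₁ a₂ x - along v₂ a₁ x) β)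
    (hσ : IsLevy σ) (hμ : IsMarkedPoisson σ μ)
    (hv₁ : IsField v₁) (ha₁ : IsFun n a₁) (hv₂ : IsField v₂) (ha₂ : IsFun n a₂)
    {b₁ b₂ : X × ℝ → ℝ} (h₁ : b₁ =ᵐ[σ] β₁) (h₂ : b₂ =ᵐ[σ] β₂) (hb₁ : Smooth n 1 b₁)
    (hb₂ : Smooth n 1 b₂) (s₁ : SuppIn (fieldSupport v₁ a₁) b₁)
    (s₂ : SuppIn (fieldSupport v₂ a₂) b₂) (hF : IsCylinder n F) :
    ∀ᵐ γ ∂μ, opWith b₁ v₁ a₁ (opWith b₂ v₂ a₂ F) γ - opWith b₂ v₂ a₂ (opWith b₁ v₁ a₁ F) γ =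
      -Complex.I * opWith β (VectorField.mlieBracket (𝓡 n) v₁ v₂)
        (fun x => along v₁ a₂ x - along v₂ a₁ x) F γ := by
  have h := hσ.pairing_ae_eq hμ
    (hβ₁.commutator_ae_eq hβ₂ hβ hσ hv₁ ha₁ hv₂ ha₂ h₁ h₂ hb₁ hb₂)
  have hL₁ := isCompact_fieldSupport hv₁ ha₁
  have hL₂ := isCompact_fieldSupport hv₂ ha₂
  have hL := hL₁.union hL₂
  obtain ⟨N, φ, g, C, K, hφ, hg, hK, hφK, rfl⟩ := hF.exists_rep
  filter_upwards [h] with γ hγ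
  rw [pairing_sub hL ((s₂.mono subset_union_right).dirDerivXR hL v₁ a₁)
    ((s₁.mono subset_union_left).dirDerivXR hL v₂ a₂)] at hγ
  have e₁ : dirDeriv v₁ a₁ (opWith b₂ v₂ a₂ (cylVal g φ)) γ = _ :=
    (hasDerivAt_opWith_curve hg hφ hK hφK hL₂ s₂ hb₂ hv₁ ha₁ hv₂ ha₂ γ).deriv
  have e₂ : dirDeriv v₂ a₂ (opWith b₁ v₁ a₁ (cylVal g φ)) γ = _ :=
    (hasDerivAt_opWith_curve hg hφ hK hφK hL₁ s₁ hb₁ hv₂ ha₂ hv₁ ha₁ γ).deriv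
  have cF := cylDeriv_commutator hg.contDiff (fun j => (hφ j).smooth.of_le two_le_infty) hK hφK
    hv₁ ha₁ hv₂ ha₂ γ
  have hd := hg.contDiff.differentiable two_ne_zero
  have hs := fun j => (hφ j).smooth_one
  rw [opWith_eq b₁ v₁ a₁ (opWith b₂ v₂ a₂ (cylVal g φ)),
    opWith_eq b₂ v₂ a₂ (opWith b₁ v₁ a₁ (cylVal g φ)), e₁, e₂]
  simp only [opWith_eq, dirDeriv_cylVal hv₁ ha₁ hd hK hs hφK,
    dirDeriv_cylVal hv₂ ha₂ hd hK hs hφK, dirDeriv_cylVal (hv₁.mlieBracket hv₂)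
    (IsFun.along_sub_along hv₁ ha₁ hv₂ ha₂) hd hK hs hφK, ← cF, ← hγ]
  -- With R_j = -i (∇_j + B_j / 2), the cross terms and the B₁ B₂ terms cancel, leaving -([∇₁, ∇₂] +
  -- (∇₁B₂ - ∇₂B₁) / 2), and `hγ` identifies ∇₁B₂ - ∇₂B₁ with B of the bracket.
  push_cast
  ring

end Representation

/-! ### Positivity of the base measure on open sets -/

section Support

variable {n : ℕ} {X : Type*} [TopologicalSpace X] [ChartedSpace (EuclideanSpace ℝ (Fin n)) X]
  [IsManifold (𝓡 n) ∞ X]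
  [T2Space X] [SecondCountableTopology X] [LocallyCompactSpace X]
  [MeasurableSpace X] [BorelSpace X]
  [Bundle.RiemannianBundle (fun x : X => TangentSpace (𝓡 n) x)]
  [IsContMDiffRiemannianBundle (𝓡 n) ∞ (EuclideanSpace ℝ (Fin n))
      (fun x : X => TangentSpace (𝓡 n) x)] {m : Measure X}

theorem IsRiemannianVolume.eq_empty_of_isOpen (hm : IsRiemannianVolume n m) {U : Set (X × ℝ)}
    (hU : IsOpen U) (hUs : U ⊆ univ ×ˢ Ioi (0 : ℝ)) (h0 : baseMeasure m U = 0) : U = ∅ := by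
  have := hm.isOpenPosMeasure
  have := hm.isLocallyFiniteMeasure
  have e : baseMeasure m = (m.prod volume).restrict (univ ×ˢ Ioi (0 : ℝ)) := by
    rw [baseMeasure, ← Measure.prod_restrict, Measure.restrict_univ]
  rw [e, Measure.restrict_apply hU.measurableSet, inter_eq_self_of_subset_left hUs] at h0
  exact hU.measure_eq_zero_iff (m.prod volume) |>.1 h0

end Support

end MarkedPoisson

end

/-! ### Assembly of the proposition -/

theorem proposition3p4 {n : ℕ} {X : Type*}
    [TopologicalSpace X] [T2Space X] [SecondCountableTopology X] [ConnectedSpace X]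
    [NoncompactSpace X] [ChartedSpace (EuclideanSpace ℝ (Fin n)) X] [IsManifold (𝓡 n) ∞ X]
    [Bundle.RiemannianBundle (fun x : X => TangentSpace (𝓡 n) x)]
    [IsContMDiffRiemannianBundle (𝓡 n) ∞ (EuclideanSpace ℝ (Fin n))
      (fun x : X => TangentSpace (𝓡 n) x)]
    [MeasurableSpace X] [BorelSpace X]
    (m : Measure X) (hm : MarkedPoisson.IsRiemannianVolume n m)
    (q : X × ℝ → ℝ) (hq : Measurable q)
    (hqpos : ∀ᵐ p ∂MarkedPoisson.baseMeasure m, 0 < q p)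
    (hqinf : MarkedPoisson.levyMeasure m q univ = ⊤)
    (hqint : ∀ K : Set X, IsCompact K →
      ∫⁻ p in K ×ˢ univ, ENNReal.ofReal (max 1 p.2 * q p) ∂MarkedPoisson.baseMeasure m < ⊤)
    (hqsob : MarkedPoisson.IsLocSobolev n m (fun p => √(q p)))
    (μ : Measure (MarkedPoisson.Config X))
    (hμ : MarkedPoisson.IsMarkedPoisson (MarkedPoisson.levyMeasure m q) μ) :
    -- the operators `R(v, a)` act from the smooth cylinder functions to `L²(μ)`
    (∀ F, MarkedPoisson.IsCylinder n F → MemLp F 2 μ) ∧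
    (∀ (v : (x : X) → TangentSpace (𝓡 n) x) (a : X → ℝ),
      MarkedPoisson.IsField v → MarkedPoisson.IsFun n a →
      (∀ F, MarkedPoisson.IsCylinder n F →
        (∀ γ, DifferentiableAt ℝ (fun t : ℝ => F (MarkedPoisson.curve v a γ t)) 0) ∧
        MemLp (MarkedPoisson.opR m q v a F) 2 μ) ∧
      (∀ F G, MarkedPoisson.IsCylinder n F → MarkedPoisson.IsCylinder n G → F =ᵐ[μ] G →
        MarkedPoisson.opR m q v a F =ᵐ[μ] MarkedPoisson.opR m q v a G) ∧
      ∀ F G, MarkedPoisson.IsCylinder n F → MarkedPoisson.IsCylinder n G →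
        ∫ γ, MarkedPoisson.opR m q v a F γ * conj (G γ) ∂μ =
          ∫ γ, F γ * conj (MarkedPoisson.opR m q v a G γ) ∂μ) ∧
    -- `R` is a representation of the Lie algebra `V₀(X) × C₀^∞(X)`
    (∀ (v₁ v₂ : (x : X) → TangentSpace (𝓡 n) x) (a₁ a₂ : X → ℝ),
      MarkedPoisson.IsField v₁ → MarkedPoisson.IsFun n a₁ →
      MarkedPoisson.IsField v₂ → MarkedPoisson.IsFun n a₂ →
      (∀ (c₁ c₂ : ℝ) (F), MarkedPoisson.IsCylinder n F →
        MarkedPoisson.opR m q (fun x => c₁ • v₁ x + c₂ • v₂ x) (fun x => c₁ * a₁ x + c₂ * a₂ x) F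
          =ᵐ[μ] fun γ => (c₁ : ℂ) * MarkedPoisson.opR m q v₁ a₁ F γ +
            (c₂ : ℂ) * MarkedPoisson.opR m q v₂ a₂ F γ) ∧
      MarkedPoisson.IsField (VectorField.mlieBracket (𝓡 n) v₁ v₂) ∧
      MarkedPoisson.IsFun n
        (fun x => MarkedPoisson.along v₁ a₂ x - MarkedPoisson.along v₂ a₁ x) ∧
      MarkedPoisson.CommutatorEq μ (MarkedPoisson.IsCylinder n)
        (MarkedPoisson.opR m q v₁ a₁) (MarkedPoisson.opR m q v₂ a₂)
        (fun F γ => -Complex.I *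
          MarkedPoisson.opR m q (VectorField.mlieBracket (𝓡 n) v₁ v₂)
            (fun x => MarkedPoisson.along v₁ a₂ x - MarkedPoisson.along v₂ a₁ x) F γ) ∧
      -- if the logarithmic derivatives are continuously differentiable, the products may be
      -- computed literally
      ∀ b₁ b₂ : X × ℝ → ℝ,
        b₁ =ᵐ[MarkedPoisson.levyMeasure m q] MarkedPoisson.logDeriv m q v₁ a₁ →
        b₂ =ᵐ[MarkedPoisson.levyMeasure m q] MarkedPoisson.logDeriv m q v₂ a₂ →
        ContMDiffOn ((𝓡 n).prod 𝓘(ℝ, ℝ)) 𝓘(ℝ, ℝ) 1 b₁ (univ ×ˢ Ioi (0 : ℝ)) →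
        ContMDiffOn ((𝓡 n).prod 𝓘(ℝ, ℝ)) 𝓘(ℝ, ℝ) 1 b₂ (univ ×ˢ Ioi (0 : ℝ)) →
        ∀ F, MarkedPoisson.IsCylinder n F →
          (∀ γ, DifferentiableAt ℝ (fun t : ℝ =>
            MarkedPoisson.opWith b₂ v₂ a₂ F (MarkedPoisson.curve v₁ a₁ γ t)) 0) ∧
          (∀ γ, DifferentiableAt ℝ (fun t : ℝ =>
            MarkedPoisson.opWith b₁ v₁ a₁ F (MarkedPoisson.curve v₂ a₂ γ t)) 0) ∧
          ∀ᵐ γ ∂μ,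
            MarkedPoisson.opWith b₁ v₁ a₁ (MarkedPoisson.opWith b₂ v₂ a₂ F) γ -
              MarkedPoisson.opWith b₂ v₂ a₂ (MarkedPoisson.opWith b₁ v₁ a₁ F) γ =
            -Complex.I * MarkedPoisson.opR m q (VectorField.mlieBracket (𝓡 n) v₁ v₂)
              (fun x => MarkedPoisson.along v₁ a₂ x - MarkedPoisson.along v₂ a₁ x) F γ) ∧
    -- the particular cases
    (∀ v₁ v₂ : (x : X) → TangentSpace (𝓡 n) x,
      MarkedPoisson.IsField v₁ → MarkedPoisson.IsField v₂ →
      MarkedPoisson.CommutatorEq μ (MarkedPoisson.IsCylinder n)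
        (MarkedPoisson.opJ m q v₁) (MarkedPoisson.opJ m q v₂)
        (fun F γ => -Complex.I *
          MarkedPoisson.opJ m q (VectorField.mlieBracket (𝓡 n) v₁ v₂) F γ)) ∧
    (∀ a₁ a₂ : X → ℝ, MarkedPoisson.IsFun n a₁ → MarkedPoisson.IsFun n a₂ →
      MarkedPoisson.CommutatorEq μ (MarkedPoisson.IsCylinder n)
        (MarkedPoisson.opI n m q a₁) (MarkedPoisson.opI n m q a₂) (fun _ _ => 0)) ∧
    (∀ (v : (x : X) → TangentSpace (𝓡 n) x) (a : X → ℝ),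
      MarkedPoisson.IsField v → MarkedPoisson.IsFun n a →
      MarkedPoisson.CommutatorEq μ (MarkedPoisson.IsCylinder n)
        (MarkedPoisson.opJ m q v) (MarkedPoisson.opI n m q a)
        (fun F γ => -Complex.I * MarkedPoisson.opI n m q (MarkedPoisson.along v a) F γ)) := by
  have hlc : LocallyCompactSpace X := Manifold.locallyCompact_of_finiteDimensional (𝓡 n)
  have hlf := hm.isLocallyFiniteMeasure
  have hw : MarkedPoisson.IsWeight m q := ⟨hq, hqpos, hqint⟩
  have hσ := hw.isLevy hm.measure_singleton
  have hmax := fun (K : Set X) hK => hw.integrable_indicator_max (K := K) hK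
  have hprob := hμ.isProbability
  -- Open sets of positive marks are not σ-null, because q is positive almost everywhere and the
  -- base measure charges open sets; this makes C¹ versions of β vanish off the supports.
  have hop : ∀ U : Set (X × ℝ), IsOpen U → U ⊆ univ ×ˢ Ioi (0 : ℝ) →
      MarkedPoisson.levyMeasure m q U = 0 → U = ∅ := fun U hU hUs h0 =>
    hm.eq_empty_of_isOpen hU hUs (hw.baseMeasure_ac h0)
  have hex := fun (v : (x : X) → TangentSpace (𝓡 n) x) (a : X → ℝ) (hv : MarkedPoisson.IsField v)
    (ha : MarkedPoisson.IsFun n a) => MarkedPoisson.exists_isWeakLogDeriv hm hv ha hw hqsob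
  -- All statements are proved for the well-behaved versions of β and transferred to the chosen
  -- `logDeriv`, since pairings of σ-equivalent functions agree almost surely.
  have hR : ∀ {β : X × ℝ → ℝ} {v : (x : X) → TangentSpace (𝓡 n) x} {a : X → ℝ},
      β =ᵐ[MarkedPoisson.levyMeasure m q] MarkedPoisson.logDeriv m q v a →
      ∀ F : MarkedPoisson.Config X → ℂ,
        MarkedPoisson.opWith β v a F =ᵐ[μ] MarkedPoisson.opR m q v a F :=
    fun h F => hσ.opWith_ae_eq hμ h _ _ F
  have hcomm : ∀ (v₁ v₂ : (x : X) → TangentSpace (𝓡 n) x) (a₁ a₂ : X → ℝ),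
      MarkedPoisson.IsField v₁ → MarkedPoisson.IsFun n a₁ →
      MarkedPoisson.IsField v₂ → MarkedPoisson.IsFun n a₂ →
      MarkedPoisson.CommutatorEq μ (MarkedPoisson.IsCylinder n)
        (MarkedPoisson.opR m q v₁ a₁) (MarkedPoisson.opR m q v₂ a₂)
        (fun F γ => -Complex.I *
          MarkedPoisson.opR m q (VectorField.mlieBracket (𝓡 n) v₁ v₂)
            (fun x => MarkedPoisson.along v₁ a₂ x - MarkedPoisson.along v₂ a₁ x) F γ) := by
    intro v₁ v₂ a₁ a₂ hv₁ ha₁ hv₂ ha₂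
    obtain ⟨β₁, hβ₁, e₁⟩ := hex v₁ a₁ hv₁ ha₁
    obtain ⟨β₂, hβ₂, e₂⟩ := hex v₂ a₂ hv₂ ha₂
    obtain ⟨β, hβ, e⟩ := hex _ _ (hv₁.mlieBracket hv₂)
      (MarkedPoisson.IsFun.along_sub_along hv₁ ha₁ hv₂ ha₂)
    exact (hβ₁.commutatorEq hβ₂ hβ hσ hμ hmax hv₁ ha₁ hv₂ ha₂).congr (fun F _ => hR e₁ F)
      (fun F _ => hR e₂ F) fun F _ => (hR e F).fun_comp (fun z => -Complex.I * z)
  have hlin : ∀ (v₁ v₂ : (x : X) → TangentSpace (𝓡 n) x) (a₁ a₂ : X → ℝ),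
      MarkedPoisson.IsField v₁ → MarkedPoisson.IsFun n a₁ →
      MarkedPoisson.IsField v₂ → MarkedPoisson.IsFun n a₂ →
      ∀ (c₁ c₂ : ℝ) (F), MarkedPoisson.IsCylinder n F →
        MarkedPoisson.opR m q (fun x => c₁ • v₁ x + c₂ • v₂ x) (fun x => c₁ * a₁ x + c₂ * a₂ x) F
          =ᵐ[μ] fun γ => (c₁ : ℂ) * MarkedPoisson.opR m q v₁ a₁ F γ +
            (c₂ : ℂ) * MarkedPoisson.opR m q v₂ a₂ F γ := by
    intro v₁ v₂ a₁ a₂ hv₁ ha₁ hv₂ ha₂ c₁ c₂ F hF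
    obtain ⟨β₁, hβ₁, e₁⟩ := hex v₁ a₁ hv₁ ha₁
    obtain ⟨β₂, hβ₂, e₂⟩ := hex v₂ a₂ hv₂ ha₂
    obtain ⟨β, hβ, e⟩ := hex _ _ (hv₁.smul_add_smul hv₂ c₁ c₂) (ha₁.mul_add_mul ha₂ c₁ c₂)
    have h := hβ.opWith_smul_add_smul hβ₁ hβ₂ hσ hμ hv₁ ha₁ hv₂ ha₂ hF
    filter_upwards [h, hR e₁ F, hR e₂ F, hR e F] with γ h h₁ h₂ h₃
    rw [← h₁, ← h₂, ← h₃, h]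
  have hv0 : MarkedPoisson.IsField (0 : (x : X) → TangentSpace (𝓡 n) x) :=
    MarkedPoisson.isField_zero
  have ha0 : MarkedPoisson.IsFun n (0 : X → ℝ) := ⟨contMDiff_const, HasCompactSupport.zero⟩
  refine ⟨fun F hF => hF.memLp 2, fun v a hv ha => ?_, fun v₁ v₂ a₁ a₂ hv₁ ha₁ hv₂ ha₂ =>
    ⟨hlin v₁ v₂ a₁ a₂ hv₁ ha₁ hv₂ ha₂, hv₁.mlieBracket hv₂,
      MarkedPoisson.IsFun.along_sub_along hv₁ ha₁ hv₂ ha₂,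
      hcomm v₁ v₂ a₁ a₂ hv₁ ha₁ hv₂ ha₂, fun b₁ b₂ hb₁ hb₂ sb₁ sb₂ F hF => ?_⟩,
    fun v₁ v₂ hv₁ hv₂ => ?_, fun a₁ a₂ ha₁ ha₂ => ?_, fun v a hv ha => ?_⟩
  · obtain ⟨β, hβ, e⟩ := hex v a hv ha
    refine ⟨fun F hF => ⟨fun γ => hF.differentiableAt hv ha γ,
      (memLp_congr_ae (hR e F)).1 (hF.memLp_opWith hσ hμ hv ha hβ)⟩, fun F G hF hG hFG =>
      (hR e F).symm.trans ((hβ.opWith_ae_eq hσ hμ hmax hv ha hF hG hFG).trans (hR e G)),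
      fun F G hF hG => ?_⟩
    refine Eq.trans (integral_congr_ae ?_)
      ((hβ.integral_opWith_mul_conj hσ hμ hmax hv ha hF hG).trans (integral_congr_ae ?_))
    · filter_upwards [hR e F] with γ hγ
      rw [hγ]
    · filter_upwards [hR e G] with γ hγ
      rw [hγ]
  · obtain ⟨β₁, hβ₁, e₁⟩ := hex v₁ a₁ hv₁ ha₁
    obtain ⟨β₂, hβ₂, e₂⟩ := hex v₂ a₂ hv₂ ha₂
    obtain ⟨β, hβ, e⟩ := hex _ _ (hv₁.mlieBracket hv₂)
      (MarkedPoisson.IsFun.along_sub_along hv₁ ha₁ hv₂ ha₂)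
    have h₁ := hb₁.trans e₁.symm
    have h₂ := hb₂.trans e₂.symm
    have s₁ := hβ₁.suppIn_of_continuousOn sb₁.continuousOn h₁ hop
    have s₂ := hβ₂.suppIn_of_continuousOn sb₂.continuousOn h₂ hop
    have hL₁ := MarkedPoisson.isCompact_fieldSupport hv₁ ha₁
    have hL₂ := MarkedPoisson.isCompact_fieldSupport hv₂ ha₂
    refine ⟨fun γ => hF.differentiableAt_opWith_curve hL₂ s₂ sb₂ hv₁ ha₁ hv₂ ha₂ γ,
      fun γ => hF.differentiableAt_opWith_curve hL₁ s₁ sb₁ hv₂ ha₂ hv₁ ha₁ γ, ?_⟩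
    filter_upwards [hβ₁.opWith_opWith_sub hβ₂ hβ hσ hμ hv₁ ha₁ hv₂ ha₂ h₁ h₂ sb₁ sb₂ s₁ s₂ hF,
      hR e F] with γ h h'
    rw [h, h']
  · have h := hcomm v₁ v₂ 0 0 hv₁ ha0 hv₂ ha0
    simp only [MarkedPoisson.along_zero, Pi.zero_apply, sub_zero] at h
    exact h
  · have h := hcomm 0 0 a₁ a₂ hv0 ha₁ hv0 ha₂
    refine h.congr (fun F _ => ae_eq_refl _) (fun F _ => ae_eq_refl _) fun F hF => ?_
    -- R(0, 0) F = 0 is obtained from linearity with zero coefficients, as the chosen version of the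
    -- logarithmic derivative along zero is known to vanish only almost everywhere.
    have hz := hlin 0 0 0 0 hv0 ha0 hv0 ha0 0 0 F hF
    simp only [MarkedPoisson.zero_along, VectorField.mlieBracket_zero_left, Pi.zero_apply, sub_zero,
      smul_zero, add_zero, mul_zero, Complex.ofReal_zero, zero_mul] at hz ⊢
    filter_upwards [hz] with γ hγ
    exact (congrArg (fun z => -Complex.I * z) hγ).trans (mul_zero _)
  · have h := hcomm v 0 0 a hv ha0 hv0 ha
    simp only [MarkedPoisson.zero_along, VectorField.mlieBracket_zero_right, Pi.zero_apply,
      sub_zero] at h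
    exact h
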